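/- **Setting.** All complexes are $\mathbb Z$-graded chain complexes of abelian groups, and (co)algebras are not required to be (co)associative or (co)unital. For a graded group $M$, $M^*$ denotes its graded dual $\bigoplus_n \mathrm{Hom}(M_n,\mathbb Z)$. A coproduct $\psi$ on a complex dualizes to the product $(f\cup g)(x)=\sum f(x')g(x'')$, $\psi x=\sum x'\otimes x''$, of cochains. Let $K$ be a simplicial complex on $[m]=\{1,\dots,m\}$ (ghost vertices and the void complex are allowed). For $k=1,\dots,m$ let $\vartheta_k\colon (C_k,d)\to (D_k,d)$ be a *split inclusion*: $C_k$ is a subcomplex of the free complex $D_k$ with $D_k/C_k$ free, and for the induced map $\theta_k\colon U_k=H_*(C_k)\to V_k=H_*(D_k)$ the groups $\ker\theta_k$, $\mathrm{coker}\,\theta_k$, $\mathrm{im}\,\theta_k$ are free. Let $\vartheta_k$ also be a coalgebra map $(C_k,\psi_{C_k})\to(D_k,\psi_{D_k})$, the coproducts being chain maps of degree $0$. *Indices.* $\mathscr X=\{(\{1\},\emptyset),(\emptyset,\{1\}),(\emptyset,\emptyset)\}$ and $\mathscr R=\mathscr X\setminus\{(\{1\},\emptyset)\}$. Let $\mathscr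 S=\mathscr X$, or $\mathscr S=\mathscr R$ if all $\theta_k$ are onto. $\mathscr S_m=\mathscr S^m$ is identified with a set of pairs $(\sigma,\omega)$ of disjoint subsets of $[m]$. For groups indexed by $\mathscr S_m$, $A\,\widehat\otimes\,B=\bigoplus_{s\in\mathscr S_m}A^s\otimes B^s$; a product on $A\otimes B$ (or a coproduct) gives one on $A\,\widehat\otimes\,B$ by projecting to the diagonal summands. *Character complex.* $C_*^{\mathscr S}(\theta_k)=\alpha\oplus\beta\oplus\gamma\oplus\eta$ with $\alpha=\mathrm{coker}\,\theta_k$ (absent for $\mathscr R$), $\beta=\Sigma\ker\theta_k$, $\gamma=\ker\theta_k$, $\eta=\mathrm{im}\,\theta_k$; $d\colon\beta\to\gamma$ is the desuspension, written $\bar z\mapsto z$, and $d=0$ elsewhere. $H_*^{\mathscr S}(\theta_k)=\mathrm{coker}\,\theta_k\oplus\ker\theta_k\oplus\mathrm{im}\,\theta_k$ (without the cokernel for $\mathscr R$), the three summands having index $(\{1\},\emptyset)$, $(\emptyset,\{1\})$, $(\emptyset,\emptyset)$. *Character data for $\vartheta=\vartheta_k$* consist of: a retraction $\kappa\colon U\to\ker\theta$,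 giving an inclusion $\vartheta'=(\kappa,\theta)\colon U\to\gamma\oplus\eta\subset C_*^{\mathscr S}(\theta)$; chain maps $q'\colon C\to U$ and $q\colon D\to C_*^{\mathscr S}(\theta)$ with $q\vartheta=\vartheta'q'$, such that $q'$ maps a cycle to its homology class and the $\alpha$-component of $q$ maps a cycle to its class in $\mathrm{coker}\,\theta$ (so $q,q'$ are chain homotopy equivalences); and a *character coproduct* $\widehat\psi$, a chain map $C_*^{\mathscr S}(\theta)\to C_*^{\mathscr S}(\theta)\otimes C_*^{\mathscr S}(\theta)$ of degree $0$ with $\widehat\psi\vartheta'=(\vartheta'\otimes\vartheta')\psi_U$ for a map $\psi_U\colon U\to U\otimes U$, such that $(q\otimes q)\psi_D\simeq\widehat\psi q$ and $(q'\otimes q')\psi_C\simeq\psi_Uq'$ by a homotopy of pairs (a homotopy $D\to C_*^{\mathscr S}(\theta)\otimes C_*^{\mathscr S}(\theta)$ that restricts to a homotopy $C\to U\otimes U$), and such that $\widehat\psi(\eta)\subset\eta\eta\oplus\gamma\eta\oplus\eta\gamma\oplus\gamma\gamma$, $\widehat\psi(\gamma)\subset\gamma\gamma\oplus\gamma\eta\oplus\eta\gamma$,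 $\widehat\psi(\beta)\subset\beta\gamma\oplus\beta\eta\oplus\eta\beta\oplus\alpha\alpha\oplus\alpha\eta\oplus\eta\alpha\oplus\eta\eta$, $\widehat\psi(\alpha)\subset\alpha\alpha\oplus\alpha\eta\oplus\eta\alpha\oplus\eta\eta$ (here $xy$ means $x\otimes y$). Given such data: - The *character coalgebra* $(H_*^{\mathscr S}(\theta),\psi(\vartheta))$: $\psi(\vartheta)=\widehat\psi$ on $\mathrm{coker}\,\theta$ and $\mathrm{im}\,\theta$, and $\psi(\vartheta)(z)=\widehat\psi(z)+\zeta$ for $z\in\ker\theta$, where $\zeta$ is the component of $\widehat\psi(\bar z)$ in $(\alpha\oplus\eta)\otimes(\alpha\oplus\eta)$. - The *index coalgebra complex* $(T_*^{\mathscr S},\widehat\psi_\vartheta)$: the free group on generators $\alpha,\beta,\gamma,\eta$ (no $\alpha$ for $\mathscr R$) of degrees $0,1,0,0$ and of index $(\{1\},\emptyset),(\emptyset,\{1\}),(\emptyset,\{1\}),(\emptyset,\emptyset)$, $d\beta=\gamma$, where $\widehat\psi_\vartheta(x)$ is the sum of those $x'\otimes x''$ for which the component of $\widehat\psi$ from the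 summand $x$ to the summand $x'\otimes x''$ is non-zero. *Complexes attached to $K$.* For inclusions $L_k\subset M_k$ let $P_K(M,L)=\sum_{\tau\in K}Y_1^\tau\otimes\cdots\otimes Y_m^\tau\subset M_1\otimes\cdots\otimes M_m$, $Y_k^\tau=M_k$ if $k\in\tau$ and $Y_k^\tau=L_k$ if $k\notin\tau$. Put $C_*(K;\underline\vartheta)=P_K(D,C)$, $C_*^{\mathscr S_m}(K;\underline\theta)=P_K(C_*^{\mathscr S}(\theta),\vartheta'U)$, $T_*^{\mathscr S_m}(K)=P_K(T_*^{\mathscr S},\mathbb Z(\gamma,\eta))$, with the coproducts restricted from the tensor products of $\psi_{D_k}$, of $\widehat\psi_k$, and of $\widehat\psi_{\vartheta_k}$, and put $H_*^{\mathscr S_m}(\underline\theta)=\bigotimes_kH_*^{\mathscr S}(\theta_k)$ with the coproduct $\psi(\underline\vartheta)=\bigotimes_k\psi(\vartheta_k)$. Signs: factors are shuffled with the Koszul sign. A component of $\widehat\psi_{\vartheta_i}$ or $\psi(\vartheta_j)$ may shift the degree by some $\varepsilon_i$, $\varepsilon_j$; in $\bigotimes_k\psi(\vartheta_k)$ this gives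 the extra sign $(-1)^{\sum_{i<j}|x_i|\varepsilon_j}$, and in $\bigotimes_k\widehat\psi_{\vartheta_k}$ the extra sign $(-1)^{\sum_{i<j}\varepsilon_i(|x_j'|+|x_j''|)}$. The *total cohomology algebra* $H^*_{\mathscr S_m}(K)$ is the cohomology of $T_*^{\mathscr S_m}(K)^*$, with product $\cup_{(K;\underline\vartheta^\circ)}$, and the *character algebra* $(H^*_{\mathscr S_m}(\underline\theta^\circ),\pi(\underline\vartheta^\circ))$ is the graded dual algebra of $(H_*^{\mathscr S_m}(\underline\theta),\psi(\underline\vartheta))$. The product of $A\otimes B$ is $(a\otimes b)(a'\otimes b')=(-1)^{|b||a'|}aa'\otimes bb'$. **Theorem 4.7.** Character data exist for each $\vartheta_k$. For every choice of character data for $\vartheta_1,\dots,\vartheta_m$, the coproducts above induce well-defined cohomology products, and the chain maps $$\varphi_{(K;\underline\vartheta)}=q_1\otimes\cdots\otimes q_m\colon C_*(K;\underline\vartheta)\to C_*^{\mathscr S_m}(K;\underline\theta),\qquad \phi_{(K;\underline\theta)}\colon C_*^{\mathscr S_m}(K;\underline\theta)\to T_*^{\mathscr S_m}(K)\,\widehat\otimes\,H_*^{\mathscr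 S_m}(\underline\theta)$$ induce isomorphisms of cohomology algebras, where $\phi_{(K;\underline\theta)}$ is induced by $x\mapsto\alpha\otimes x,\ \beta\otimes dx,\ \gamma\otimes x,\ \eta\otimes x$ on the summands $\alpha,\beta,\gamma,\eta$ of each factor. Consequently there is an isomorphism of algebras $$\big(H^*_{\mathscr S_m}(K)\,\widehat\otimes\,H^*_{\mathscr S_m}(\underline\theta^\circ),\ \cup_{(K;\underline\vartheta^\circ)}\,\widehat\otimes\,\pi(\underline\vartheta^\circ)\big)\;\cong\;\big(H^*(C^*(K;\underline\vartheta^\circ)),\ \cup_{(K;\underline\vartheta^\circ)}\big),$$ which maps the diagonal part of $[a]\otimes b$ to $(\phi_{(K;\underline\theta)}\varphi_{(K;\underline\vartheta)})^*[a\otimes b]$. -/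

import Mathlib

open scoped DirectSum TensorProduct

universe u v w

-- Module structures over `ℤ` are always found through the construction of the group at hand.
attribute [-instance] AddCommGroup.toIntModule AddCommMonoid.toNatModule

noncomputable section

/-! ### Graded abelian groups, tensor products and signs

All groups are `ℤ`-modules.  Every graded group used below is a direct sum of homogeneous pieces
(`GrData.ofSum`) or a tensor product of such groups (`GrData.prod`, `GrData.pi`). -/

/-- The homogeneous parts `gr n` of a graded group `M`, and its projections `par 0`, `par 1` onto
the even and onto the odd part. -/
structure GrData (M : Type u) [AddCommGroup M] [Module ℤ M] where
  gr : ℤ → Submodule ℤ M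
  par : ZMod 2 → M →ₗ[ℤ] M

open Classical in
/-- The projection of `⨁ i, X i` onto the summands `X i` with `P i`. -/
def projOn {I : Type v} [DecidableEq I] (X : I → Type u) [∀ i, AddCommGroup (X i)]
    [∀ i, Module ℤ (X i)] (P : I → Prop) : (⨁ i, X i) →ₗ[ℤ] ⨁ i, X i :=
  DirectSum.toModule ℤ I (⨁ i, X i) (fun i => if P i then DirectSum.lof ℤ I X i else 0)

namespace GrData

/-- The involution `x ↦ (-1)^|x| x`. -/
def sgn {M : Type u} [AddCommGroup M] [Module ℤ M] (G : GrData M) : M →ₗ[ℤ] M :=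
  G.par 0 - G.par 1

/-- The direct sum `⨁ i, X i`, where `X i` is placed in degree `deg i`. -/
def ofSum {I : Type v} [DecidableEq I] (X : I → Type u) [∀ i, AddCommGroup (X i)]
    [∀ i, Module ℤ (X i)] (deg : I → ℤ) : GrData (⨁ i, X i) where
  gr n := Submodule.span ℤ {y | ∃ i, deg i = n ∧ ∃ x : X i, y = DirectSum.lof ℤ I X i x}
  par e := projOn X (fun i => (deg i : ZMod 2) = e)

/-- The grading of `M ⊗ N`. -/
def prod {M : Type u} {N : Type v} [AddCommGroup M] [Module ℤ M] [AddCommGroup N] [Module ℤ N]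
    (G : GrData M) (H : GrData N) : GrData (M ⊗[ℤ] N) where
  gr n := Submodule.span ℤ
    {z | ∃ a b : ℤ, a + b = n ∧ ∃ x ∈ G.gr a, ∃ y ∈ H.gr b, z = x ⊗ₜ[ℤ] y}
  par e := ∑ a : ZMod 2, TensorProduct.map (G.par a) (H.par (e - a))

/-- The grading of `M_1 ⊗ ⋯ ⊗ M_m`. -/
def pi {m : ℕ} {M : Fin m → Type u} [∀ k, AddCommGroup (M k)] [∀ k, Module ℤ (M k)]
    (G : ∀ k, GrData (M k)) : GrData (⨂[ℤ] k, M k) where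
  gr n := Submodule.span ℤ
    {z | ∃ a : Fin m → ℤ, ∑ k, a k = n ∧
      ∃ x : ∀ k, M k, (∀ k, x k ∈ (G k).gr (a k)) ∧ z = PiTensorProduct.tprod ℤ x}
  par e := ∑ a ∈ Finset.univ.filter (fun a : Fin m → ZMod 2 => ∑ k, a k = e),
    PiTensorProduct.map (fun k => (G k).par (a k))

end GrData

/-- `(-1)^e`. -/
def sg (e : ZMod 2) : ℤ := if e = 0 then 1 else -1

/-- The exponent `∑_{i<j} a_i b_j`. -/
def pairSum {m : ℕ} (a b : Fin m → ZMod 2) : ZMod 2 :=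
  ∑ p ∈ Finset.univ.filter (fun p : Fin m × Fin m => p.1 < p.2), a p.1 * b p.2

section Tensor

variable {m : ℕ}

/-- The differential `d ⊗ 1 + (±1) ⊗ d'` of `M ⊗ N`. -/
def tensorD {M : Type u} {N : Type v} [AddCommGroup M] [Module ℤ M] [AddCommGroup N] [Module ℤ N]
    (G : GrData M) (d : M →ₗ[ℤ] M) (d' : N →ₗ[ℤ] N) : M ⊗[ℤ] N →ₗ[ℤ] M ⊗[ℤ] N :=
  TensorProduct.map d LinearMap.id + TensorProduct.map G.sgn d'

/-- The differential of `M_1 ⊗ ⋯ ⊗ M_m`: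
`d (x_1 ⊗ ⋯ ⊗ x_m) = ∑_k (-1)^{|x_1| + ⋯ + |x_{k-1}|} x_1 ⊗ ⋯ ⊗ d x_k ⊗ ⋯ ⊗ x_m`. -/
def piD {M : Fin m → Type u} [∀ k, AddCommGroup (M k)] [∀ k, Module ℤ (M k)]
    (G : ∀ k, GrData (M k)) (d : ∀ k, M k →ₗ[ℤ] M k) :
    (⨂[ℤ] k, M k) →ₗ[ℤ] ⨂[ℤ] k, M k :=
  ∑ k : Fin m, PiTensorProduct.map
    (fun i => if i < k then (G i).sgn else if i = k then d i else LinearMap.id)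

/-- `a ↦ (a_2 ⊗ ⋯ ⊗ a_{n+1} ↦ a ⊗ a_2 ⊗ ⋯ ⊗ a_{n+1})`. -/
def consTensor {n : ℕ} (A : Fin (n + 1) → Type u) [∀ k, AddCommGroup (A k)]
    [∀ k, Module ℤ (A k)] :
    A 0 →ₗ[ℤ] (⨂[ℤ] k : Fin n, A k.succ) →ₗ[ℤ] ⨂[ℤ] k, A k :=
  (PiTensorProduct.lift (R := ℤ) (s := fun k : Fin n => A k.succ)
    (E := ⨂[ℤ] k, A k)).toLinearMap ∘ₗ (PiTensorProduct.tprod ℤ (s := A)).curryLeft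

/-- The shuffle without signs, `⨂ (A_k ⊗ B_k) → (⨂ A_k) ⊗ (⨂ B_k)`; see `shuffle₀_tprod`. -/
def shuffle₀ : (n : ℕ) → (A : Fin n → Type u) → (B : Fin n → Type v) →
    [∀ k, AddCommGroup (A k)] → [∀ k, Module ℤ (A k)] →
    [∀ k, AddCommGroup (B k)] → [∀ k, Module ℤ (B k)] →
    (⨂[ℤ] k, (A k ⊗[ℤ] B k)) →ₗ[ℤ] (⨂[ℤ] k, A k) ⊗[ℤ] (⨂[ℤ] k, B k)
  | 0, A, B, _, _, _, _ =>
      PiTensorProduct.lift (MultilinearMap.constOfIsEmpty ℤ _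
        (PiTensorProduct.tprod ℤ (fun k : Fin 0 => (k.elim0 : A k)) ⊗ₜ[ℤ]
          PiTensorProduct.tprod ℤ (fun k : Fin 0 => (k.elim0 : B k))))
  | n + 1, A, B, _, _, _, _ =>
      PiTensorProduct.lift (LinearMap.uncurryLeft
        ((PiTensorProduct.lift (R := ℤ)
            (s := fun k : Fin n => A k.succ ⊗[ℤ] B k.succ)
            (E := (⨂[ℤ] k, A k) ⊗[ℤ] (⨂[ℤ] k, B k))).symm.toLinearMap ∘ₗ
          LinearMap.lcomp ℤ _ (shuffle₀ n (fun k => A k.succ) (fun k => B k.succ)) ∘ₗ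
          TensorProduct.lift
            ((TensorProduct.mapBilinear (RingHom.id ℤ) (⨂[ℤ] k : Fin n, A k.succ)
              (⨂[ℤ] k : Fin n, B k.succ) (⨂[ℤ] k, A k) (⨂[ℤ] k, B k)).compl₁₂
              (consTensor A) (consTensor B))))

theorem consTensor_tprod {n : ℕ} (A : Fin (n + 1) → Type u) [∀ k, AddCommGroup (A k)]
    [∀ k, Module ℤ (A k)] (a : ∀ k, A k) :
    consTensor A (a 0) (PiTensorProduct.tprod ℤ fun k : Fin n => a k.succ) =
      PiTensorProduct.tprod ℤ a := by
  simp only [consTensor, LinearMap.comp_apply, LinearEquiv.coe_coe, PiTensorProduct.lift.tprod,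
    MultilinearMap.curryLeft_apply]
  congr 1
  exact Fin.cons_self_tail a

theorem shuffle₀_tprod (n : ℕ) (A : Fin n → Type u) (B : Fin n → Type v)
    [∀ k, AddCommGroup (A k)] [∀ k, Module ℤ (A k)]
    [∀ k, AddCommGroup (B k)] [∀ k, Module ℤ (B k)] (a : ∀ k, A k) (b : ∀ k, B k) :
    shuffle₀ n A B (PiTensorProduct.tprod ℤ fun k => a k ⊗ₜ[ℤ] b k) =
      PiTensorProduct.tprod ℤ a ⊗ₜ[ℤ] PiTensorProduct.tprod ℤ b := by
  induction n with
  | zero =>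
    rw [shuffle₀, PiTensorProduct.lift.tprod, MultilinearMap.constOfIsEmpty_apply,
      Subsingleton.elim a fun k => k.elim0, Subsingleton.elim b fun k => k.elim0]
    rfl
  | succ n ih =>
    rw [shuffle₀, PiTensorProduct.lift.tprod, LinearMap.uncurryLeft_apply]
    simp only [LinearMap.comp_apply, LinearEquiv.coe_coe, PiTensorProduct.lift_symm,
      LinearMap.compMultilinearMap_apply, LinearMap.lcomp_apply, TensorProduct.lift.tmul,
      LinearMap.compl₁₂_apply]
    have h := ih (fun k => A k.succ) (fun k => B k.succ) (fun k => a k.succ) (fun k => b k.succ)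
    have h' : (Fin.tail fun k => a k ⊗ₜ[ℤ] b k) =
        fun k : Fin n => a k.succ ⊗ₜ[ℤ] b k.succ := rfl
    rw [h', h, TensorProduct.mapBilinear_apply, TensorProduct.map_tmul, consTensor_tprod,
      consTensor_tprod]

/-- The shuffle `⨂ (A_k ⊗ B_k) → (⨂ A_k) ⊗ (⨂ B_k)`,
`⨂ (a_k ⊗ b_k) ↦ (-1)^{∑_{i<j} |b_i| |a_j|} (⨂ a_k) ⊗ (⨂ b_k)`. -/
def shuffle {A : Fin m → Type u} {B : Fin m → Type v}
    [∀ k, AddCommGroup (A k)] [∀ k, Module ℤ (A k)]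
    [∀ k, AddCommGroup (B k)] [∀ k, Module ℤ (B k)]
    (G : ∀ k, GrData (A k)) (H : ∀ k, GrData (B k)) :
    (⨂[ℤ] k, (A k ⊗[ℤ] B k)) →ₗ[ℤ] (⨂[ℤ] k, A k) ⊗[ℤ] (⨂[ℤ] k, B k) :=
  ∑ e : Fin m → ZMod 2, ∑ e' : Fin m → ZMod 2, sg (pairSum e' e) •
    (shuffle₀ m A B ∘ₗ
      PiTensorProduct.map (fun k => TensorProduct.map ((G k).par (e k)) ((H k).par (e' k))))

/-- The tensor product `f_1 ⊗ ⋯ ⊗ f_m` of linear maps that need not preserve degrees.  A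
component of `f_j` that shifts degrees by `ε_j` passes `x_1, …, x_{j-1}`, which gives the sign
`(-1)^{∑_{i<j} |x_i| ε_j}`.  For maps of degree 0 this is `PiTensorProduct.map`. -/
def koszulL {A : Fin m → Type u} {B : Fin m → Type v}
    [∀ k, AddCommGroup (A k)] [∀ k, Module ℤ (A k)]
    [∀ k, AddCommGroup (B k)] [∀ k, Module ℤ (B k)]
    (G : ∀ k, GrData (A k)) (H : ∀ k, GrData (B k)) (f : ∀ k, A k →ₗ[ℤ] B k) :
    (⨂[ℤ] k, A k) →ₗ[ℤ] ⨂[ℤ] k, B k :=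
  ∑ e : Fin m → ZMod 2, ∑ e' : Fin m → ZMod 2, sg (pairSum e (e + e')) •
    PiTensorProduct.map (fun k => (H k).par (e' k) ∘ₗ f k ∘ₗ (G k).par (e k))

/-- The same tensor product with the mirror convention: a component of `f_i` that shifts degrees
by `ε_i` passes `f_{i+1} (x_{i+1}), …, f_m (x_m)`, which gives the sign
`(-1)^{∑_{i<j} ε_i |f_j (x_j)|}`. For maps of degree 0 this is `PiTensorProduct.map`. -/
def koszulR {A : Fin m → Type u} {B : Fin m → Type v}
    [∀ k, AddCommGroup (A k)] [∀ k, Module ℤ (A k)]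
    [∀ k, AddCommGroup (B k)] [∀ k, Module ℤ (B k)]
    (G : ∀ k, GrData (A k)) (H : ∀ k, GrData (B k)) (f : ∀ k, A k →ₗ[ℤ] B k) :
    (⨂[ℤ] k, A k) →ₗ[ℤ] ⨂[ℤ] k, B k :=
  ∑ e : Fin m → ZMod 2, ∑ e' : Fin m → ZMod 2, sg (pairSum (e + e') e') •
    PiTensorProduct.map (fun k => (H k).par (e' k) ∘ₗ f k ∘ₗ (G k).par (e k))

/-- The sum over `τ ∈ K` of the tensor products `Y_1 ⊗ ⋯ ⊗ Y_m ⊆ M_1 ⊗ ⋯ ⊗ M_m` with `Y_k = M_k`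
for `k ∈ τ` and `Y_k = L_k` for `k ∉ τ`.  A simplicial complex on `{1, …, m}` (ghost vertices and
the void complex are allowed) is a lower set of finite sets. -/
def poly {M : Fin m → Type u} [∀ k, AddCommGroup (M k)] [∀ k, Module ℤ (M k)]
    (K : LowerSet (Finset (Fin m))) (L : ∀ k, Submodule ℤ (M k)) :
    Submodule ℤ (⨂[ℤ] k, M k) :=
  ⨆ τ ∈ K, Submodule.span ℤ
    {z | ∃ x : ∀ k, M k, (∀ k, k ∉ τ → x k ∈ L k) ∧ z = PiTensorProduct.tprod ℤ x}

end Tensor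

/-- `ψ : M → M ⊗ M` is a coproduct of the complex `(M, d)`: it preserves degrees and is a chain
map.  Neither coassociativity nor a counit is required. -/
structure IsCoproduct {M : Type u} [AddCommGroup M] [Module ℤ M] (G : GrData M)
    (d : M →ₗ[ℤ] M) (ψ : M →ₗ[ℤ] M ⊗[ℤ] M) : Prop where
  deg : ∀ n, ∀ x ∈ G.gr n, ψ x ∈ (G.prod G).gr n
  chain : ∀ x, ψ (d x) = tensorD G d d (ψ x)

/-! ### Cohomology algebras -/

/-- A subcomplex `N` of a graded group `M` with differential `d`, together with a map
`Ψ : M → M ⊗ M` that restricts to the coproduct of `N`. -/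
structure CoalgData where
  M : Type u
  [grp : AddCommGroup M]
  [mod : Module ℤ M]
  G : GrData M
  d : M →ₗ[ℤ] M
  Ψ : M →ₗ[ℤ] M ⊗[ℤ] M
  N : Submodule ℤ M

namespace CoalgData

attribute [instance] CoalgData.grp CoalgData.mod

/-- The graded dual of `M`: functionals that vanish in all but finitely many degrees. -/
def gdual (X : CoalgData.{u}) : Set (Module.Dual ℤ X.M) :=
  {f | ∃ F : Finset ℤ, ∀ n, n ∉ F → ∀ x ∈ X.G.gr n, f x = 0}

theorem gdual_zero (X : CoalgData.{u}) : 0 ∈ X.gdual := ⟨∅, by simp⟩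

theorem gdual_add (X : CoalgData.{u}) {f g : Module.Dual ℤ X.M} (hf : f ∈ X.gdual)
    (hg : g ∈ X.gdual) : f + g ∈ X.gdual := by
  obtain ⟨F, hF⟩ := hf
  obtain ⟨F', hF'⟩ := hg
  classical
  refine ⟨F ∪ F', fun n hn x hx => ?_⟩
  rw [Finset.notMem_union] at hn
  simp [hF n hn.1 x hx, hF' n hn.2 x hx]

theorem gdual_smul (X : CoalgData.{u}) (c : ℤ) {f : Module.Dual ℤ X.M} (hf : f ∈ X.gdual) :
    c • f ∈ X.gdual := by
  obtain ⟨F, hF⟩ := hf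
  exact ⟨F, fun n hn x hx => by simp [hF n hn x hx]⟩

/-- Cochains on `M` that restrict to cocycles on `N`. -/
def cocycles (X : CoalgData.{u}) : Submodule ℤ (Module.Dual ℤ X.M) where
  carrier := {f | f ∈ X.gdual ∧ ∀ x ∈ X.N, f (X.d x) = 0}
  zero_mem' := ⟨X.gdual_zero, by simp⟩
  add_mem' := fun hf hg =>
    ⟨X.gdual_add hf.1 hg.1, fun x hx => by simp [hf.2 x hx, hg.2 x hx]⟩
  smul_mem' := fun c _ hf => ⟨X.gdual_smul c hf.1, fun x hx => by simp [hf.2 x hx]⟩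

/-- Cochains on `M` that restrict to coboundaries on `N`. -/
def coboundaries (X : CoalgData.{u}) : Submodule ℤ (Module.Dual ℤ X.M) where
  carrier := {f | f ∈ X.gdual ∧ ∃ g ∈ X.gdual, ∀ x ∈ X.N, f x = g (X.d x)}
  zero_mem' := ⟨X.gdual_zero, 0, X.gdual_zero, by simp⟩
  add_mem' := by
    rintro f f' ⟨hf, g, hg, h⟩ ⟨hf', g', hg', h'⟩
    exact ⟨X.gdual_add hf hf', g + g', X.gdual_add hg hg', fun x hx => by
      simp [h x hx, h' x hx]⟩
  smul_mem' := by
    rintro c f ⟨hf, g, hg, h⟩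
    exact ⟨X.gdual_smul c hf, c • g, X.gdual_smul c hg, fun x hx => by simp [h x hx]⟩

/-- The cohomology of the dual cochain complex of `N`.  The latter is the quotient of the dual of
`M` by the cochains that vanish on `N`; those are coboundaries in the above sense. -/
def Coh (X : CoalgData.{u}) : Type u :=
  X.cocycles ⧸ X.coboundaries.submoduleOf X.cocycles

instance (X : CoalgData.{u}) : AddCommGroup X.Coh :=
  inferInstanceAs (AddCommGroup (X.cocycles ⧸ X.coboundaries.submoduleOf X.cocycles))

instance (X : CoalgData.{u}) : Module ℤ X.Coh :=
  inferInstanceAs (Module ℤ (X.cocycles ⧸ X.coboundaries.submoduleOf X.cocycles))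

/-- The cohomology class of a cocycle. -/
def cls (X : CoalgData.{u}) : X.cocycles →ₗ[ℤ] X.Coh :=
  (X.coboundaries.submoduleOf X.cocycles).mkQ

/-- The product of cochains dual to `Ψ`: `(f ∪ g)(x) = ∑ f(x') g(x'')` for `Ψ x = ∑ x' ⊗ x''`. -/
def cup (X : CoalgData.{u}) :
    Module.Dual ℤ X.M →ₗ[ℤ] Module.Dual ℤ X.M →ₗ[ℤ] Module.Dual ℤ X.M :=
  TensorProduct.curry (LinearMap.lcomp ℤ ℤ X.Ψ ∘ₗ TensorProduct.dualDistrib ℤ X.M X.M)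

/-- The product of cochains induces a product of cohomology classes. -/
structure MulOK (X : CoalgData.{u}) : Prop where
  mul_mem : ∀ f ∈ X.cocycles, ∀ g ∈ X.cocycles, X.cup f g ∈ X.cocycles
  mul_left : ∀ f ∈ X.cocycles, f ∈ X.coboundaries → ∀ g ∈ X.cocycles,
    X.cup f g ∈ X.coboundaries
  mul_right : ∀ f ∈ X.cocycles, ∀ g ∈ X.cocycles, g ∈ X.coboundaries →
    X.cup f g ∈ X.coboundaries

/-- The product of the cohomology algebra, `[f] [g] = [f ∪ g]`. -/
def mul (X : CoalgData.{u}) (h : X.MulOK) : X.Coh →ₗ[ℤ] X.Coh →ₗ[ℤ] X.Coh :=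
  let b : X.cocycles →ₗ[ℤ] X.cocycles →ₗ[ℤ] X.Coh := LinearMap.mk₂ ℤ
    (fun f g => X.cls ⟨X.cup f.1 g.1, h.mul_mem _ f.2 _ g.2⟩)
    (fun f f' g => by rw [← map_add]; congr 1; ext1; simp)
    (fun c f g => by rw [← map_smul]; congr 1; ext1; simp)
    (fun f g g' => by rw [← map_add]; congr 1; ext1; simp)
    (fun c f g => by rw [← map_smul]; congr 1; ext1; simp)
  let b₁ : X.Coh →ₗ[ℤ] X.cocycles →ₗ[ℤ] X.Coh := Submodule.liftQ _ b (fun f hf => by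
    rw [LinearMap.mem_ker]
    ext1 g
    exact (Submodule.Quotient.mk_eq_zero _).2 (h.mul_left _ f.2 hf _ g.2))
  (Submodule.liftQ _ b₁.flip (fun g hg => by
    rw [LinearMap.mem_ker]
    refine LinearMap.ext fun f => ?_
    obtain ⟨f, rfl⟩ := Submodule.mkQ_surjective _ f
    exact (Submodule.Quotient.mk_eq_zero _).2 (h.mul_right _ f.2 _ g.2 hg))).flip

theorem mul_cls (X : CoalgData.{u}) (h : X.MulOK) (f g : X.cocycles) :
    X.mul h (X.cls f) (X.cls g) = X.cls ⟨X.cup f.1 g.1, h.mul_mem _ f.2 _ g.2⟩ := rfl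

/-- Precomposition with `p : M → M'` induces a map of cohomology groups. -/
structure PullOK (X : CoalgData.{u}) (Y : CoalgData.{v}) (p : X.M →ₗ[ℤ] Y.M) : Prop where
  cocycle : ∀ f ∈ Y.cocycles, f ∘ₗ p ∈ X.cocycles
  coboundary : ∀ f ∈ Y.coboundaries, f ∘ₗ p ∈ X.coboundaries

/-- The induced map of cohomology groups, `[f] ↦ [f ∘ p]`. -/
def pull {X : CoalgData.{u}} {Y : CoalgData.{v}} {p : X.M →ₗ[ℤ] Y.M} (h : PullOK X Y p) :
    Y.Coh →ₗ[ℤ] X.Coh :=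
  Submodule.mapQ _ _
    (LinearMap.restrict (LinearMap.lcomp ℤ ℤ p : Module.Dual ℤ Y.M →ₗ[ℤ] Module.Dual ℤ X.M)
      h.cocycle)
    (fun f hf => h.coboundary f.1 hf)

/-- `p` restricts to a chain map `N → N'` of degree 0. -/
structure IsChainMap (X : CoalgData.{u}) (Y : CoalgData.{v}) (p : X.M →ₗ[ℤ] Y.M) : Prop where
  deg : ∀ n, ∀ x ∈ X.G.gr n, p x ∈ Y.G.gr n
  sub : ∀ x ∈ X.N, p x ∈ Y.N
  comm : ∀ x ∈ X.N, p (X.d x) = Y.d (p x)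

theorem IsChainMap.pullOK {X : CoalgData.{u}} {Y : CoalgData.{v}} {p : X.M →ₗ[ℤ] Y.M}
    (h : IsChainMap X Y p) : PullOK X Y p := by
  have key : ∀ f ∈ Y.gdual, f ∘ₗ p ∈ X.gdual := by
    rintro f ⟨F, hF⟩
    exact ⟨F, fun n hn x hx => hF n hn _ (h.deg n x hx)⟩
  refine ⟨fun f hf => ⟨key f hf.1, fun x hx => ?_⟩, ?_⟩
  · rw [LinearMap.comp_apply, h.comm x hx]
    exact hf.2 _ (h.sub x hx)
  · rintro f ⟨hf, g, hg, hfg⟩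
    refine ⟨key f hf, g ∘ₗ p, key g hg, fun x hx => ?_⟩
    rw [LinearMap.comp_apply, LinearMap.comp_apply, h.comm x hx]
    exact hfg _ (h.sub x hx)

/-- A chain map induces an isomorphism of cohomology algebras. -/
def InducesAlgIso {X : CoalgData.{u}} {Y : CoalgData.{v}} {p : X.M →ₗ[ℤ] Y.M}
    (h : IsChainMap X Y p) (hX : X.MulOK) (hY : Y.MulOK) : Prop :=
  Function.Bijective (pull h.pullOK) ∧
    ∀ a b : Y.Coh, pull h.pullOK (Y.mul hY a b) =
      X.mul hX (pull h.pullOK a) (pull h.pullOK b)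

/-! ### Diagonal tensor products

`S` is a finite index set, and `π s`, `ρ s` are the projections of `X.M`, `Y.M` onto their parts
of index `s`. -/

section Diag

variable {S : Type w} [Fintype S]

/-- `∑_s π_s ⊗ ρ_s`, the projection of `M ⊗ M'` onto the diagonal tensor product. -/
def diagProj₀ (X : CoalgData.{u}) (Y : CoalgData.{v}) (π : S → X.M →ₗ[ℤ] X.M)
    (ρ : S → Y.M →ₗ[ℤ] Y.M) : X.M ⊗[ℤ] Y.M →ₗ[ℤ] X.M ⊗[ℤ] Y.M :=
  ∑ s, TensorProduct.map (π s) (ρ s)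

/-- `(x' ⊗ x'') ⊗ (y' ⊗ y'') ↦ (-1)^{|x''| |y'|} (x' ⊗ y') ⊗ (x'' ⊗ y'')`. -/
def shuffle₂ (X : CoalgData.{u}) (Y : CoalgData.{v}) :
    (X.M ⊗[ℤ] X.M) ⊗[ℤ] (Y.M ⊗[ℤ] Y.M) →ₗ[ℤ] (X.M ⊗[ℤ] Y.M) ⊗[ℤ] (X.M ⊗[ℤ] Y.M) :=
  ∑ e : ZMod 2, ∑ e' : ZMod 2, sg (e * e') •
    ((TensorProduct.tensorTensorTensorComm ℤ X.M X.M Y.M Y.M).toLinearMap ∘ₗ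
      TensorProduct.map (TensorProduct.map LinearMap.id (X.G.par e))
        (TensorProduct.map (Y.G.par e') LinearMap.id))

/-- The diagonal tensor product `⨁_s N_s ⊗ N'_s` of two complexes with coproducts, inside
`M ⊗ M'`. -/
def diag (X : CoalgData.{u}) (Y : CoalgData.{v}) (π : S → X.M →ₗ[ℤ] X.M)
    (ρ : S → Y.M →ₗ[ℤ] Y.M) : CoalgData where
  M := X.M ⊗[ℤ] Y.M
  G := X.G.prod Y.G
  d := tensorD X.G X.d Y.d
  Ψ := TensorProduct.map (diagProj₀ X Y π ρ) (diagProj₀ X Y π ρ) ∘ₗ shuffle₂ X Y ∘ₗ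
    TensorProduct.map X.Ψ Y.Ψ
  N := Submodule.span ℤ
    {z | ∃ s, ∃ x ∈ X.N, ∃ y ∈ Y.N, π s x = x ∧ ρ s y = y ∧ z = x ⊗ₜ[ℤ] y}

/-- The cohomology of `N` is an algebra, it is graded by parity, and it is indexed by `S`. -/
structure IndexedOK (X : CoalgData.{u}) (π : S → X.M →ₗ[ℤ] X.M) : Prop where
  mul : X.MulOK
  par : ∀ e, PullOK X X (X.G.par e)
  idx : ∀ s, PullOK X X (π s)

variable {X : CoalgData.{u}} {Y : CoalgData.{v}} {π : S → X.M →ₗ[ℤ] X.M}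
  {ρ : S → Y.M →ₗ[ℤ] Y.M}

/-- The product `(a ⊗ b)(a' ⊗ b') = (-1)^{|b| |a'|} a a' ⊗ b b'` of the tensor product of two
cohomology algebras. -/
def tensorMul (hX : IndexedOK X π) (hY : IndexedOK Y ρ) :
    X.Coh ⊗[ℤ] Y.Coh →ₗ[ℤ] X.Coh ⊗[ℤ] Y.Coh →ₗ[ℤ] X.Coh ⊗[ℤ] Y.Coh :=
  ∑ e : ZMod 2, ∑ e' : ZMod 2, sg (e * e') •
    TensorProduct.map₂ ((X.mul hX.mul).compl₂ (pull (hX.par e')))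
      ((Y.mul hY.mul) ∘ₗ (pull (hY.par e)))

/-- The projection of the tensor product of two indexed cohomology groups onto
`⨁_s H_s ⊗ H'_s`. -/
def diagProj (hX : IndexedOK X π) (hY : IndexedOK Y ρ) :
    X.Coh ⊗[ℤ] Y.Coh →ₗ[ℤ] X.Coh ⊗[ℤ] Y.Coh :=
  ∑ s, TensorProduct.map (pull (hX.idx s)) (pull (hY.idx s))

/-- The diagonal tensor product `⨁_s H_s ⊗ H'_s` of two indexed cohomology groups. -/
abbrev DiagTensor (hX : IndexedOK X π) (hY : IndexedOK Y ρ) : Submodule ℤ (X.Coh ⊗[ℤ] Y.Coh) :=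
  LinearMap.range (diagProj hX hY)

/-- The product of the diagonal tensor product: the product of the tensor product followed by the
projection onto the diagonal. -/
def diagMul (hX : IndexedOK X π) (hY : IndexedOK Y ρ) (a b : DiagTensor hX hY) :
    DiagTensor hX hY :=
  (diagProj hX hY).rangeRestrict (tensorMul hX hY a.1 b.1)

end Diag

end CoalgData

/-! ### Split inclusions -/

/-- A chain complex of abelian groups `X n`, `n : ℤ`, with total differential `d` on `⨁ n, X n`. -/
structure ChainCx (X : ℤ → Type u) [∀ n, AddCommGroup (X n)] [∀ n, Module ℤ (X n)] where
  d : (⨁ n, X n) →ₗ[ℤ] ⨁ n, X n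
  d_deg : ∀ n (x : X n), ∃ y : X (n - 1),
    d (DirectSum.lof ℤ ℤ X n x) = DirectSum.lof ℤ ℤ X (n - 1) y
  d_d : ∀ x, d (d x) = 0

namespace ChainCx

variable {X : ℤ → Type u} [∀ n, AddCommGroup (X n)] [∀ n, Module ℤ (X n)] (c : ChainCx X)

def cycles (n : ℤ) : Submodule ℤ (X n) := LinearMap.ker (c.d ∘ₗ DirectSum.lof ℤ ℤ X n)

def boundaries (n : ℤ) : Submodule ℤ (X n) :=
  (LinearMap.range c.d).comap (DirectSum.lof ℤ ℤ X n)

/-- `H_n`, cycles modulo boundaries. -/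
def Homology (n : ℤ) : Type u := c.cycles n ⧸ (c.boundaries n).submoduleOf (c.cycles n)

instance (n : ℤ) : AddCommGroup (c.Homology n) :=
  inferInstanceAs (AddCommGroup (c.cycles n ⧸ (c.boundaries n).submoduleOf (c.cycles n)))

instance (n : ℤ) : Module ℤ (c.Homology n) :=
  inferInstanceAs (Module ℤ (c.cycles n ⧸ (c.boundaries n).submoduleOf (c.cycles n)))

/-- The homology class of a cycle. -/
def hcls (n : ℤ) : c.cycles n →ₗ[ℤ] c.Homology n :=
  ((c.boundaries n).submoduleOf (c.cycles n)).mkQ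

end ChainCx

/-- An injective chain map `ϑ : C → D`. -/
structure ChainInclusion where
  C : ℤ → Type u
  D : ℤ → Type u
  [grpC : ∀ n, AddCommGroup (C n)]
  [modC : ∀ n, Module ℤ (C n)]
  [grpD : ∀ n, AddCommGroup (D n)]
  [modD : ∀ n, Module ℤ (D n)]
  cxC : ChainCx C
  cxD : ChainCx D
  incl : ∀ n, C n →ₗ[ℤ] D n
  incl_injective : ∀ n, Function.Injective (incl n)
  incl_comm : ∀ x, DirectSum.lmap incl (cxC.d x) = cxD.d (DirectSum.lmap incl x)

namespace ChainInclusion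

attribute [instance] ChainInclusion.grpC ChainInclusion.modC ChainInclusion.grpD
  ChainInclusion.modD

variable (E : ChainInclusion.{u})

/-- `⨁ n, C n` -/
abbrev TotC : Type u := ⨁ n, E.C n

/-- `⨁ n, D n` -/
abbrev TotD : Type u := ⨁ n, E.D n

/-- `ϑ : ⨁ n, C n → ⨁ n, D n` -/
def tot : E.TotC →ₗ[ℤ] E.TotD := DirectSum.lmap E.incl

def GC : GrData E.TotC := GrData.ofSum E.C (fun n => n)

def GD : GrData E.TotD := GrData.ofSum E.D (fun n => n)

/-- `U_n = H_n(C)` -/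
abbrev U (n : ℤ) : Type u := E.cxC.Homology n

/-- `V_n = H_n(D)` -/
abbrev V (n : ℤ) : Type u := E.cxD.Homology n

theorem incl_cycles (n : ℤ) (x : E.C n) (hx : x ∈ E.cxC.cycles n) :
    E.incl n x ∈ E.cxD.cycles n := by
  have h := E.incl_comm (DirectSum.lof ℤ ℤ E.C n x)
  have hx' : E.cxC.d (DirectSum.lof ℤ ℤ E.C n x) = 0 := hx
  rw [hx', map_zero, DirectSum.lmap_lof] at h
  exact h.symm

/-- The induced homomorphism `θ_n : H_n(C) → H_n(D)`. -/
def θ (n : ℤ) : E.U n →ₗ[ℤ] E.V n :=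
  Submodule.mapQ _ _ (LinearMap.restrict (E.incl n) (E.incl_cycles n)) (by
    rintro x ⟨y, hy⟩
    refine ⟨E.tot y, ?_⟩
    have h := E.incl_comm y
    rw [hy] at h
    exact (h.symm.trans (DirectSum.lmap_lof E.incl n (x : E.C n))))

end ChainInclusion

/-- A split inclusion: `C` is a subcomplex of the free complex `D` with free quotient, and the
kernel, the cokernel and the image of `θ : H(C) → H(D)` are free. -/
structure SplitInclusion extends ChainInclusion.{u} where
  free_D : ∀ n, Module.Free ℤ (D n)
  free_quot : ∀ n, Module.Free ℤ (D n ⧸ LinearMap.range (incl n))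
  free_ker : ∀ n, Module.Free ℤ (LinearMap.ker (toChainInclusion.θ n))
  free_coker : ∀ n, Module.Free ℤ
    (toChainInclusion.V n ⧸ LinearMap.range (toChainInclusion.θ n))
  free_im : ∀ n, Module.Free ℤ (LinearMap.range (toChainInclusion.θ n))

/-- A split inclusion that is a homomorphism of coalgebras `(C, ψ_C) → (D, ψ_D)`. -/
structure SplitCoalgInclusion extends SplitInclusion.{u} where
  ψC : toChainInclusion.TotC →ₗ[ℤ] toChainInclusion.TotC ⊗[ℤ] toChainInclusion.TotC
  ψD : toChainInclusion.TotD →ₗ[ℤ] toChainInclusion.TotD ⊗[ℤ] toChainInclusion.TotD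
  isCoproduct_C : IsCoproduct toChainInclusion.GC cxC.d ψC
  isCoproduct_D : IsCoproduct toChainInclusion.GD cxD.d ψD
  hom : ∀ x, ψD (toChainInclusion.tot x) =
    TensorProduct.map toChainInclusion.tot toChainInclusion.tot (ψC x)

/-! ### Character groups and character complexes -/

/-- The two versions: `X`, and the right version `R`. -/
inductive Kind
  | X
  | R

/-- The index set: `sig = ({1}, ∅)` (absent in the right version), `omg = (∅, {1})` and
`emp = (∅, ∅)`.  A function `s : Fin m → Idx S` is the pair `(σ, ω)` of disjoint subsets of
`{1, …, m}` with `σ = {k | s_k = sig}` and `ω = {k | s_k = omg}`. -/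
inductive Idx (S : Kind) : Type
  | sig (h : S = Kind.X)
  | omg
  | emp

/-- The generators `α, β, γ, η`; `α` is absent in the right version. -/
inductive Letter (S : Kind) : Type
  | α (h : S = Kind.X)
  | β
  | γ
  | η

namespace Idx

variable {S : Kind}

def code : Idx S → Fin 3
  | sig _ => 0
  | omg => 1
  | emp => 2

theorem code_injective : Function.Injective (code (S := S)) := by
  intro a b h
  cases a <;> cases b <;> first | rfl | (simp [code] at h)

instance : DecidableEq (Idx S) := code_injective.decidableEq

instance : Fintype (Idx S) := Fintype.ofInjective code code_injective

end Idx

namespace Letter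

variable {S : Kind}

def code : Letter S → Fin 4
  | α _ => 0
  | β => 1
  | γ => 2
  | η => 3

theorem code_injective : Function.Injective (code (S := S)) := by
  intro a b h
  cases a <;> cases b <;> first | rfl | (simp [code] at h)

instance : DecidableEq (Letter S) := code_injective.decidableEq

instance : Fintype (Letter S) := Fintype.ofInjective code code_injective

/-- The index of a generator. -/
def idx : Letter S → Idx S
  | α h => Idx.sig h
  | β => Idx.omg
  | γ => Idx.omg
  | η => Idx.emp

/-- The degree of a generator. -/
def deg : Letter S → ℤ
  | β => 1
  | _ => 0

/-- The summands `l' ⊗ l''` that may occur in the character coproduct of the summand `l`. -/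
def Allowed : Letter S → Letter S → Letter S → Prop
  | η, η, η => True
  | η, γ, η => True
  | η, η, γ => True
  | η, γ, γ => True
  | γ, γ, γ => True
  | γ, γ, η => True
  | γ, η, γ => True
  | β, β, γ => True
  | β, β, η => True
  | β, η, β => True
  | β, α _, α _ => True
  | β, α _, η => True
  | β, η, α _ => True
  | β, η, η => True
  | α _, α _, α _ => True
  | α _, α _, η => True
  | α _, η, α _ => True
  | α _, η, η => True
  | _, _, _ => False

end Letter

section Character

/-- The degree `n` part of the summand of index `s` of the character group of `θ`: the cokernel,
the kernel and the image of `θ_n`. -/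
def CharGrp (E : ChainInclusion.{u}) {S : Kind} : Idx S → ℤ → Type u
  | Idx.sig _, n => E.V n ⧸ LinearMap.range (E.θ n)
  | Idx.omg, n => LinearMap.ker (E.θ n)
  | Idx.emp, n => LinearMap.range (E.θ n)

instance (E : ChainInclusion.{u}) {S : Kind} : ∀ (s : Idx S) (n : ℤ), AddCommGroup (CharGrp E s n)
  | Idx.sig _, n => inferInstanceAs (AddCommGroup (E.V n ⧸ LinearMap.range (E.θ n)))
  | Idx.omg, n => inferInstanceAs (AddCommGroup (LinearMap.ker (E.θ n)))
  | Idx.emp, n => inferInstanceAs (AddCommGroup (LinearMap.range (E.θ n)))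

instance (E : ChainInclusion.{u}) {S : Kind} : ∀ (s : Idx S) (n : ℤ), Module ℤ (CharGrp E s n)
  | Idx.sig _, n => inferInstanceAs (Module ℤ (E.V n ⧸ LinearMap.range (E.θ n)))
  | Idx.omg, n => inferInstanceAs (Module ℤ (LinearMap.ker (E.θ n)))
  | Idx.emp, n => inferInstanceAs (Module ℤ (LinearMap.range (E.θ n)))

variable (E : ChainInclusion.{u}) (S : Kind)

/-- The homogeneous pieces of the character group. -/
abbrev HPiece (p : Idx S × ℤ) : Type u := CharGrp E p.1 p.2

/-- The character group `H(θ) = coker θ ⊕ ker θ ⊕ im θ` (without `coker θ` in the right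
version). -/
abbrev CharH : Type u := ⨁ p : Idx S × ℤ, HPiece E S p

def GH : GrData (CharH E S) := GrData.ofSum (HPiece E S) (fun p => p.2)

/-- The pieces of the character complex: the piece `(l, n)` is the cokernel of `θ_n` for `l = α`,
its kernel for `l = β, γ`, and its image for `l = η`. -/
abbrev CPiece (p : Letter S × ℤ) : Type u := CharGrp E p.1.idx p.2

/-- The character complex `coker θ ⊕ Σ ker θ ⊕ ker θ ⊕ im θ`. -/
abbrev CharC : Type u := ⨁ p : Letter S × ℤ, CPiece E S p

def GCh : GrData (CharC E S) := GrData.ofSum (CPiece E S) (fun p => p.2 + p.1.deg)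

/-- The inclusion of the piece `(l, n)`. -/
def inC (l : Letter S) (n : ℤ) : CharGrp E l.idx n →ₗ[ℤ] CharC E S :=
  DirectSum.lof ℤ (Letter S × ℤ) (CPiece E S) (l, n)

/-- The inclusion of the piece `(s, n)`. -/
def inH (s : Idx S) (n : ℤ) : CharGrp E s n →ₗ[ℤ] CharH E S :=
  DirectSum.lof ℤ (Idx S × ℤ) (HPiece E S) (s, n)

/-- The differential of the character complex: the desuspension `Σ ker θ → ker θ`. -/
def dChar : CharC E S →ₗ[ℤ] CharC E S :=
  DirectSum.toModule ℤ (Letter S × ℤ) (CharC E S) (fun p => match p with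
    | (Letter.β, n) => inC E S Letter.γ n
    | _ => 0)

/-- `coker θ ⊕ Σ ker θ ⊕ ker θ ⊕ im θ → coker θ ⊕ ker θ ⊕ im θ`, zero on `Σ ker θ`. -/
def forgetC : CharC E S →ₗ[ℤ] CharH E S :=
  DirectSum.toModule ℤ (Letter S × ℤ) (CharH E S) (fun p => match p with
    | (Letter.β, _) => 0
    | (l, n) => inH E S l.idx n)

/-- The inclusion of the piece `(l, n)` for `l = β, γ`. -/
def inKer (l : Letter S) (h : l.idx = Idx.omg) (n : ℤ) :
    CharGrp E (Idx.omg : Idx S) n →ₗ[ℤ] CharC E S :=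
  h ▸ inC E S l n

/-- `x ↦ x` on `coker θ` and `im θ`, and `z ↦ z + z̄` on `ker θ`, where `z̄ ∈ Σ ker θ` is the
element with `d z̄ = z`. -/
def liftH : CharH E S →ₗ[ℤ] CharC E S :=
  DirectSum.toModule ℤ (Idx S × ℤ) (CharC E S) (fun p => match p with
    | (Idx.sig h, n) => inC E S (Letter.α h) n
    | (Idx.omg, n) => inKer E S Letter.γ rfl n + inKer E S Letter.β rfl n
    | (Idx.emp, n) => inC E S Letter.η n)

/-- The projection of the character complex onto the summand `l`. -/
def prC (l : Letter S) : CharC E S →ₗ[ℤ] CharC E S := projOn (CPiece E S) (fun p => p.1 = l)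

/-- The projection of the character group onto the summand of index `s`. -/
def prH (s : Idx S) : CharH E S →ₗ[ℤ] CharH E S := projOn (HPiece E S) (fun p => p.1 = s)

/-- The component of a coproduct of the character complex from the summand `l` to the summand
`l' ⊗ l''`. -/
def comp (ψ : CharC E S →ₗ[ℤ] CharC E S ⊗[ℤ] CharC E S) (l l' l'' : Letter S) :
    CharC E S →ₗ[ℤ] CharC E S ⊗[ℤ] CharC E S :=
  TensorProduct.map (prC E S l') (prC E S l'') ∘ₗ ψ ∘ₗ prC E S l

/-- `H(C) = U`, with zero differential. -/
abbrev TotU : Type u := ⨁ n, E.U n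

/-- The inclusion `ϑ' : U → ker θ ⊕ im θ ⊆ CharC`, for a retraction `κ : U → ker θ`. -/
def θ' (κ : ∀ n, E.U n →ₗ[ℤ] LinearMap.ker (E.θ n)) : TotU E →ₗ[ℤ] CharC E S :=
  DirectSum.toModule ℤ ℤ (CharC E S) (fun n =>
    inC E S Letter.γ n ∘ₗ κ n + inC E S Letter.η n ∘ₗ (E.θ n).rangeRestrict)

end Character

/-- The total map `⨁ n, C n → ⨁ n, U n` of a family `q'`. -/
def totq' (E : ChainInclusion.{u}) (q' : ∀ n, E.C n →ₗ[ℤ] E.U n) : E.TotC →ₗ[ℤ] TotU E :=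
  DirectSum.lmap q'

/-- The data that make the character complex of `ϑ : C → D` a character coalgebra complex:
a splitting `U = ker θ ⊕ im θ` given by `κ`, the quotient maps `q'`, `q`, the coproduct `ψU` and the
character coproduct `ψ̂`, such that in the cube with the vertical arrows `ϑ`, `ϑ ⊗ ϑ`, `ϑ'`,
`ϑ' ⊗ ϑ'` the front, back and side faces commute, and the top and the bottom face commute up to
a homotopy of pairs.  (The first condition on `q'` makes it a chain map `C → U`; the homotopy of
the top face makes `ψU` the coproduct induced on `U = H(C)` by `ψ_C`.) -/
structure CharData (E : SplitCoalgInclusion.{u}) (S : Kind) where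
  κ : ∀ n, E.U n →ₗ[ℤ] LinearMap.ker (E.θ n)
  κ_ker : ∀ n (z : LinearMap.ker (E.θ n)), κ n z = z
  q' : ∀ n, E.C n →ₗ[ℤ] E.U n
  q'_cycle : ∀ n (z : E.cxC.cycles n), q' n z = E.cxC.hcls n z
  q : E.TotD →ₗ[ℤ] CharC E.toChainInclusion S
  q_deg : ∀ n, ∀ x ∈ E.GD.gr n, q x ∈ (GCh E.toChainInclusion S).gr n
  q_chain : ∀ x, q (E.cxD.d x) = dChar E.toChainInclusion S (q x)
  q_tot : ∀ x, q (E.tot x) = θ' E.toChainInclusion S κ (totq' E.toChainInclusion q' x)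
  q_coker : ∀ n (z : E.cxD.cycles n) (h : S = Kind.X),
    q (DirectSum.lof ℤ ℤ E.D n z) (Letter.α h, n) =
      (LinearMap.range (E.θ n)).mkQ (E.cxD.hcls n z)
  ψ : CharC E.toChainInclusion S →ₗ[ℤ]
    CharC E.toChainInclusion S ⊗[ℤ] CharC E.toChainInclusion S
  ψ_coproduct : IsCoproduct (GCh E.toChainInclusion S) (dChar E.toChainInclusion S) ψ
  ψ_allowed : ∀ l l' l'', ¬ Letter.Allowed l l' l'' → comp E.toChainInclusion S ψ l l' l'' = 0
  ψU : TotU E.toChainInclusion →ₗ[ℤ] TotU E.toChainInclusion ⊗[ℤ] TotU E.toChainInclusion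
  ψ_θ' : ∀ x, ψ (θ' E.toChainInclusion S κ x) =
    TensorProduct.map (θ' E.toChainInclusion S κ) (θ' E.toChainInclusion S κ) (ψU x)
  hC : E.TotC →ₗ[ℤ] TotU E.toChainInclusion ⊗[ℤ] TotU E.toChainInclusion
  hD : E.TotD →ₗ[ℤ] CharC E.toChainInclusion S ⊗[ℤ] CharC E.toChainInclusion S
  hD_deg : ∀ n, ∀ x ∈ E.GD.gr n,
    hD x ∈ ((GCh E.toChainInclusion S).prod (GCh E.toChainInclusion S)).gr (n + 1)
  hD_tot : ∀ x, hD (E.tot x) =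
    TensorProduct.map (θ' E.toChainInclusion S κ) (θ' E.toChainInclusion S κ) (hC x)
  top_face : ∀ x,
    TensorProduct.map (totq' E.toChainInclusion q') (totq' E.toChainInclusion q') (E.ψC x) -
      ψU (totq' E.toChainInclusion q' x) = hC (E.cxC.d x)
  bottom_face : ∀ x, TensorProduct.map q q (E.ψD x) - ψ (q x) =
    tensorD (GCh E.toChainInclusion S) (dChar E.toChainInclusion S) (dChar E.toChainInclusion S)
      (hD x) + hD (E.cxD.d x)

/-! ### The index coalgebra complex -/

section IndexComplex

variable (S : Kind)

/-- `T = ℤ(α, β, γ, η)` -/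
abbrev TCx : Type := ⨁ _l : Letter S, ℤ

/-- The generator `l` of `T`. -/
def gen (l : Letter S) : TCx S := DirectSum.lof ℤ (Letter S) (fun _ => ℤ) l 1

def GT : GrData (TCx S) := GrData.ofSum (fun _ : Letter S => ℤ) Letter.deg

/-- The linear map out of `T` with given values on the generators. -/
def TCx.lift {M : Type u} [AddCommGroup M] [Module ℤ M] (f : Letter S → M) : TCx S →ₗ[ℤ] M :=
  DirectSum.toModule ℤ (Letter S) M (fun l => LinearMap.toSpanSingleton ℤ M (f l))

/-- `d β = γ`, and `d` vanishes on the other generators. -/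
def dT : TCx S →ₗ[ℤ] TCx S := TCx.lift S (fun l => match l with
  | Letter.β => gen S Letter.γ
  | _ => 0)

/-- The subgroup `ℤ(γ, η)` of `T`. -/
def lowT : Submodule ℤ (TCx S) := Submodule.span ℤ {gen S Letter.γ, gen S Letter.η}

/-- The projection of `T` onto the part of index `s`. -/
def prT (s : Idx S) : TCx S →ₗ[ℤ] TCx S :=
  projOn (fun _ : Letter S => ℤ) (fun l => l.idx = s)

end IndexComplex

namespace CharData

variable {E : SplitCoalgInclusion.{u}} {S : Kind} (χ : CharData E S)

/-- The coproduct `ψ(ϑ)` of the character coalgebra: `ψ(ϑ)(x)` is `ψ̂(x)` for `x` in `coker θ` or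
`im θ`, and it is `ψ̂(z) + ζ` for `x = z` in `ker θ`, where `ζ` is the component of `ψ̂(z̄)` in
`(coker θ ⊕ im θ) ⊗ (coker θ ⊕ im θ)`. All other components of `ψ̂(z̄)` involve `Σ ker θ`. -/
def ψH : CharH E.toChainInclusion S →ₗ[ℤ]
    CharH E.toChainInclusion S ⊗[ℤ] CharH E.toChainInclusion S :=
  TensorProduct.map (forgetC E.toChainInclusion S) (forgetC E.toChainInclusion S) ∘ₗ χ.ψ ∘ₗ
    liftH E.toChainInclusion S

open Classical in
/-- The coproduct of the index coalgebra complex: `l` is mapped to the sum of those `l' ⊗ l''` for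
which the component of `ψ̂` from the summand `l` to the summand `l' ⊗ l''` is not zero. -/
def ψT : TCx S →ₗ[ℤ] TCx S ⊗[ℤ] TCx S := TCx.lift S (fun l =>
  ∑ l' : Letter S, ∑ l'' : Letter S,
    if comp E.toChainInclusion S χ.ψ l l' l'' = 0 then 0 else gen S l' ⊗ₜ[ℤ] gen S l'')

end CharData

/-- The isomorphism from the character complex to the diagonal tensor product of `T` and `H(θ)`:
`x ↦ α ⊗ x`, `β ⊗ d x`, `γ ⊗ x`, `η ⊗ x` on the four summands. -/
def φ₁ (E : ChainInclusion.{u}) (S : Kind) :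
    CharC E S →ₗ[ℤ] TCx S ⊗[ℤ] CharH E S :=
  DirectSum.toModule ℤ (Letter S × ℤ) _ (fun p =>
    TensorProduct.mk ℤ (TCx S) (CharH E S) (gen S p.1) ∘ₗ inH E S p.1.idx p.2)

/-! ### The complexes attached to a simplicial complex -/

section Polyhedral

variable {m : ℕ} (K : LowerSet (Finset (Fin m))) {E : Fin m → SplitCoalgInclusion.{u}} {S : Kind}

/-- The polyhedral product inclusion complex `C(K; ϑ)` in `D_1 ⊗ ⋯ ⊗ D_m`. -/
def inclCx (E : Fin m → SplitCoalgInclusion.{u}) : CoalgData.{u} where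
  M := ⨂[ℤ] k, (E k).TotD
  G := GrData.pi (fun k => (E k).GD)
  d := piD (fun k => (E k).GD) (fun k => (E k).cxD.d)
  Ψ := shuffle (fun k => (E k).GD) (fun k => (E k).GD) ∘ₗ
    PiTensorProduct.map (fun k => (E k).ψD)
  N := poly K (fun k => LinearMap.range (E k).tot)

/-- The polyhedral product character complex `C(K; θ)` in the tensor product of the character
complexes. -/
def charCx (χ : ∀ k, CharData (E k) S) : CoalgData.{u} where
  M := ⨂[ℤ] k, CharC (E k).toChainInclusion S
  G := GrData.pi (fun k => GCh (E k).toChainInclusion S)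
  d := piD (fun k => GCh (E k).toChainInclusion S) (fun k => dChar (E k).toChainInclusion S)
  Ψ := shuffle (fun k => GCh (E k).toChainInclusion S) (fun k => GCh (E k).toChainInclusion S) ∘ₗ
    PiTensorProduct.map (fun k => (χ k).ψ)
  N := poly K (fun k => LinearMap.range (θ' (E k).toChainInclusion S (χ k).κ))

/-- The total coalgebra complex `T(K)` in `T ⊗ ⋯ ⊗ T`. -/
def totalCx (χ : ∀ k, CharData (E k) S) : CoalgData.{0} where
  M := ⨂[ℤ] _k : Fin m, TCx S
  G := GrData.pi (fun _ => GT S)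
  d := piD (fun _ => GT S) (fun _ => dT S)
  Ψ := shuffle (fun _ => GT S) (fun _ => GT S) ∘ₗ
    koszulR (fun _ => GT S) (fun _ => (GT S).prod (GT S)) (fun k => (χ k).ψT)
  N := poly K (fun _ => lowT S)

/-- The character coalgebra `H(θ_1) ⊗ ⋯ ⊗ H(θ_m)`, with zero differential.  Its cohomology algebra
is its graded dual algebra. -/
def charCoalg (χ : ∀ k, CharData (E k) S) : CoalgData.{u} where
  M := ⨂[ℤ] k, CharH (E k).toChainInclusion S
  G := GrData.pi (fun k => GH (E k).toChainInclusion S)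
  d := 0
  Ψ := shuffle (fun k => GH (E k).toChainInclusion S) (fun k => GH (E k).toChainInclusion S) ∘ₗ
    koszulL (fun k => GH (E k).toChainInclusion S)
      (fun k => (GH (E k).toChainInclusion S).prod (GH (E k).toChainInclusion S))
      (fun k => (χ k).ψH)
  N := ⊤

/-- The projection of `T ⊗ ⋯ ⊗ T` onto the part of index `s = (σ, ω)`. -/
def totalIdx (χ : ∀ k, CharData (E k) S) (s : Fin m → Idx S) :
    (totalCx K χ).M →ₗ[ℤ] (totalCx K χ).M :=
  PiTensorProduct.map (fun k => prT S (s k))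

/-- The projection of `H(θ_1) ⊗ ⋯ ⊗ H(θ_m)` onto the part of index `s = (σ, ω)`. -/
def charIdx (χ : ∀ k, CharData (E k) S) (s : Fin m → Idx S) :
    (charCoalg χ).M →ₗ[ℤ] (charCoalg χ).M :=
  PiTensorProduct.map (fun k => prH (E k).toChainInclusion S (s k))

/-- The diagonal tensor product of `T(K)` and `H(θ_1) ⊗ ⋯ ⊗ H(θ_m)`. -/
def diagCx (χ : ∀ k, CharData (E k) S) : CoalgData.{u} :=
  CoalgData.diag (totalCx K χ) (charCoalg χ) (totalIdx K χ) (charIdx χ)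

/-- `φ_{(K;ϑ)} = q_1 ⊗ ⋯ ⊗ q_m : C(K; ϑ) → C(K; θ)` -/
def φincl (χ : ∀ k, CharData (E k) S) : (inclCx K E).M →ₗ[ℤ] (charCx K χ).M :=
  PiTensorProduct.map (fun k => (χ k).q)

/-- `φ_{(K;θ)}`, from `C(K; θ)` to the diagonal tensor product of `T(K)` and
`H(θ_1) ⊗ ⋯ ⊗ H(θ_m)`. -/
def φchar (χ : ∀ k, CharData (E k) S) : (charCx K χ).M →ₗ[ℤ] (diagCx K χ).M :=
  shuffle (fun _ => GT S) (fun k => GH (E k).toChainInclusion S) ∘ₗ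
    PiTensorProduct.map (fun k => φ₁ (E k).toChainInclusion S)

end Polyhedral

end

noncomputable section

-- Integer scalars are to act through the `Module ℤ` structure carried by each group; the generic
-- actions are removed so that no second one is found.
attribute [-instance] ZSMul.toSMul Ring.toIntAlgebra instMulActionIntOfSubtractionMonoid
  AddSubgroupClass.instZSMul

/-! ### Free modules over principal ideal domains -/

section Hereditary

variable {R : Type*} [CommRing R] {A : Type*} {M : Type*} {X : Type*} {Y : Type*}
  [AddCommGroup A] [Module R A] [AddCommGroup M] [Module R M] [AddCommGroup X] [Module R X]
  [AddCommGroup Y] [Module R Y]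

/-! The work is done for one pair `C ⊆ D` at a time, with maps and homotopies that respect the
subcomplex. Tensoring such data over the factors automatically respects every polyhedral product,
whatever the simplicial complex.

One factor. The character complex is a small model of the pair. Freeness of all groups involved
makes the relevant kernels direct summands, so maps prescribed on cycles by homology classes extend;
this yields the quotient maps `q'` and `q` (`QuotData.nonempty`). Conversely `q` has a chain section
`QuotData.r` that sends `U` into `C`. Cycles in the kernel of `q` bound inside that kernel, and in
`C` if they lie in `C`; choosing the primitives linearly gives a homotopy of pairs from `r q` to the
identity (`QuotData.exists_homotopy`). The coproduct transferred along `q` and `r` is correct up to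
homotopy but may have forbidden components. The suspension `γ → β` contracts the tensor square of
the character complex onto `(α ⊕ η) ⊗ (α ⊕ η)`, and correcting by this contraction gives a character
coproduct, homotopic to the transferred one relative to `U` (`QuotData.ψ`, `QuotData.H_spec`,
`QuotData.ψ_allowed`). Hence character data exist.

The first map. For arbitrary character data, `r` and the homotopy are rebuilt from `q`. Tensor
products of homotopies (`piHomotopy_spec`) show that `q_1 ⊗ ⋯ ⊗ q_m` is a homotopy equivalence of
polyhedral products, and, applied to the homotopies of pairs contained in the data, that it
preserves coproducts up to homotopy. By `CoalgData.pull_bijective` and `CoalgData.pull_mul` this is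
enough in cohomology.

The second map. Each summand of the character complex is a generator of `T` tensored with a summand
of the character group, so the second map is an isomorphism onto the diagonal tensor product. It
preserves coproducts strictly (`diagMap_comult`). The delicate point is that `β` and `γ` share an
index, while `ψ(ϑ)` has only one value on `ker θ`. The chain map condition identifies the components
of `β` that contain a factor `β` with the components of `γ` (`CharData.comp_γγ`, `CharData.comp_γη`,
`CharData.comp_ηγ`), so a single value serves both (`CharData.map_prH_ψH_eq`). What remains is a
sign identity, `diagMap_sign`.

The cohomology of the diagonal. The character group has zero differential and `T ⊗ ⋯ ⊗ T` is free of
finite rank, so a Künneth argument makes the cross product an isomorphism of algebras from the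
diagonal tensor product of cohomology groups (`CoalgData.CrossOK.crossEquiv`,
`CoalgData.CrossOK.crossEquiv_diagMul`). The three isomorphisms compose to the asserted one. -/

theorem Submodule.exists_extension (L : Submodule R A) [Module.Free R (A ⧸ L)] (f : L →ₗ[R] X) :
    ∃ g : A →ₗ[R] X, ∀ x : L, g x = f x := by
  obtain ⟨s, hs⟩ := Module.projective_lifting_property L.mkQ LinearMap.id L.mkQ_surjective
  have hm : ∀ x : A, x - s (L.mkQ x) ∈ L := fun x => by
    rw [← Submodule.Quotient.mk_eq_zero, ← Submodule.mkQ_apply, map_sub]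
    exact sub_eq_zero.2 (LinearMap.congr_fun hs (L.mkQ x)).symm
  refine ⟨f ∘ₗ LinearMap.codRestrict L (LinearMap.id - s ∘ₗ L.mkQ) hm, fun x => ?_⟩
  rw [LinearMap.comp_apply]
  congr 1
  ext1
  have : L.mkQ (x : A) = 0 := (Submodule.Quotient.mk_eq_zero _).2 x.2
  simp only [LinearMap.codRestrict_apply, LinearMap.sub_apply, LinearMap.id_apply,
    LinearMap.comp_apply, this, map_zero, sub_zero]

/-- A retraction onto `L` and the quotient map together split `A` as the product of `L` and `A ⧸ L`.
-/
theorem Module.Free.of_submodule_of_quotient (L : Submodule R A) [Module.Free R L]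
    [Module.Free R (A ⧸ L)] : Module.Free R A := by
  obtain ⟨g, hg⟩ := L.exists_extension (LinearMap.id : L →ₗ[R] L)
  refine Module.Free.of_equiv (LinearEquiv.ofBijective (g.prod L.mkQ) ⟨?_, ?_⟩).symm
  · rw [← LinearMap.ker_eq_bot, LinearMap.ker_eq_bot']
    intro x hx
    obtain ⟨h1, h2⟩ := Prod.ext_iff.1 hx
    have hx : x ∈ L := (Submodule.Quotient.mk_eq_zero _).1 h2
    have := hg ⟨x, hx⟩
    simpa [this] using h1
  · rintro ⟨l, y⟩
    obtain ⟨y, rfl⟩ := L.mkQ_surjective y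
    refine ⟨y - g y + l, Prod.ext ?_ ?_⟩
    · have h1 := hg (g y)
      have h2 := hg l
      simp only [LinearMap.id_apply] at h1 h2
      simp [h1, h2]
    · have h1 : L.mkQ (g y : A) = 0 := (Submodule.Quotient.mk_eq_zero _).2 (g y).2
      have h2 : L.mkQ (l : A) = 0 := (Submodule.Quotient.mk_eq_zero _).2 l.2
      change L.mkQ (y - g y + l) = L.mkQ y
      rw [map_add, map_sub, h1, h2, sub_zero, add_zero]

/-- Projectivity of `A`, applied to the restriction of `g` to `Y'`. The prescribed `Y'` is the means
by which degrees, kernels and cycle conditions are imposed on sections. -/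
theorem LinearMap.exists_lift [Module.Free R A] (j : A →ₗ[R] X) (g : Y →ₗ[R] X)
    (Y' : Submodule R Y) (h : ∀ a, ∃ y ∈ Y', g y = j a) :
    ∃ s : A →ₗ[R] Y, (∀ a, g (s a) = j a) ∧ ∀ a, s a ∈ Y' := by
  let P := LinearMap.range (g ∘ₗ Y'.subtype)
  have hP : ∀ a, j a ∈ P := fun a => by
    obtain ⟨y, hy, e⟩ := h a
    exact ⟨⟨y, hy⟩, e⟩
  obtain ⟨s, hs⟩ := Module.projective_lifting_property (g ∘ₗ Y'.subtype).rangeRestrict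
    (j.codRestrict P hP) (LinearMap.surjective_rangeRestrict _)
  refine ⟨Y'.subtype ∘ₗ s, fun a => ?_, fun a => (s a).2⟩
  exact congrArg Subtype.val (LinearMap.congr_fun hs a)

/-- Lifting for pairs of modules. -/
theorem LinearMap.exists_lift_pair (A' : Submodule R A) [Module.Free R A']
    [Module.Free R (A ⧸ A')] (j : A →ₗ[R] X) (g : Y →ₗ[R] X) (Y₀ Y' : Submodule R Y)
    (h : ∀ a, ∃ y ∈ Y₀, g y = j a) (h' : ∀ a ∈ A', ∃ y ∈ Y', g y = j a) (hle : Y' ≤ Y₀) :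
    ∃ s : A →ₗ[R] Y, (∀ a, g (s a) = j a) ∧ (∀ a, s a ∈ Y₀) ∧ ∀ a ∈ A', s a ∈ Y' := by
  obtain ⟨s', hs', hm'⟩ := LinearMap.exists_lift (j ∘ₗ A'.subtype) g Y' (fun a => h' a a.2)
  obtain ⟨p, hp⟩ := A'.exists_extension (LinearMap.id : A' →ₗ[R] A')
  obtain ⟨t, ht⟩ := Module.projective_lifting_property A'.mkQ LinearMap.id A'.mkQ_surjective
  -- With `p` a retraction onto `A'` and `t` a section of the quotient map, the second lift is aimed
  -- at the error `j (t - p t)`, so that `s' p + s''` lifts `j`.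
  obtain ⟨s'', hs'', hm''⟩ := LinearMap.exists_lift (j ∘ₗ t - j ∘ₗ A'.subtype ∘ₗ p ∘ₗ t) g Y₀
    (fun a => by
      obtain ⟨y, hy, e⟩ := h (t a - p (t a))
      exact ⟨y, hy, by rw [e]; simp⟩)
  refine ⟨s' ∘ₗ p + s'' ∘ₗ A'.mkQ, fun a => ?_, fun a => ?_, fun a ha => ?_⟩
  · have hm : a - t (A'.mkQ a) ∈ A' := by
      rw [← Submodule.Quotient.mk_eq_zero, ← Submodule.mkQ_apply, map_sub]
      exact sub_eq_zero.2 (LinearMap.congr_fun ht (A'.mkQ a)).symm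
    have e := congrArg Subtype.val (hp ⟨_, hm⟩)
    simp only [LinearMap.id_apply, map_sub, Submodule.coe_sub] at e
    simp only [LinearMap.add_apply, LinearMap.comp_apply, map_add, hs', hs'', LinearMap.sub_apply,
      Submodule.subtype_apply]
    rw [← map_sub, ← map_add]
    congr 1
    rw [add_comm, sub_add, ← neg_sub (p a : A), sub_neg_eq_add, e, add_sub_cancel]
  · exact Y₀.add_mem (hle (hm' _)) (hm'' _)
  · have : A'.mkQ a = 0 := (Submodule.Quotient.mk_eq_zero _).2 ha
    simp only [LinearMap.add_apply, LinearMap.comp_apply, this, map_zero, add_zero]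
    exact hm' _

variable [IsDomain R] [IsPrincipalIdealRing R]

/-- A submodule of a free module over a principal ideal domain is free: coordinates. -/
theorem Finsupp.free_submodule {ι : Type*} (N : Submodule R (ι →₀ R)) : Module.Free R N := by
  classical
  let _ : LinearOrder ι := linearOrderOfSTO (WellOrderingRel (α := ι))
  have wf : WellFounded ((· < ·) : ι → ι → Prop) := WellOrderingRel.isWellOrder.wf
  -- `N` is filtered by the largest index allowed in the support. `I i` is the ideal of leading
  -- coefficients at `i`, `c i` its generator, and `u i` an element attaining it; the basis will
  -- consist of the `u i` with `c i ≠ 0`.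
  let F : ι → Submodule R (ι →₀ R) := fun i => N ⊓ Finsupp.supported R R (Set.Iic i)
  let I : ι → Ideal R := fun i => (F i).map (Finsupp.lapply i)
  let c : ι → R := fun i => Submodule.IsPrincipal.generator (I i)
  have hc : ∀ i, ∃ x ∈ F i, x i = c i := fun i => Submodule.IsPrincipal.generator_mem (I i)
  choose u hu huc using hc
  have hu0 : ∀ i j, i < j → u i j = 0 := fun i j hij => by
    by_contra h
    exact absurd ((hu i).2 (Finsupp.mem_support_iff.2 h)) (not_le.2 hij)
  let J := {i : ι // c i ≠ 0}
  let b : J → N := fun i => ⟨u i, (hu i).1⟩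
  have hspan : ∀ i, ∀ x (hx : x ∈ F i), (⟨x, hx.1⟩ : N) ∈ Submodule.span R (Set.range b) := by
    intro i
    induction i using wf.induction with
    | _ i ih =>
      intro x hx
      obtain ⟨a, ha⟩ := (Submodule.IsPrincipal.mem_iff_eq_smul_generator (I i)).1
        (Submodule.mem_map_of_mem (f := Finsupp.lapply i) hx : x i ∈ I i)
      have ha' : x i = a * c i := ha
      -- A multiple of `u i` cancels the coordinate `i`; the remainder has a smaller leading index,
      -- so well-founded induction applies.
      have key : ∃ y ∈ F i,
          (∃ h : y ∈ N, (Subtype.mk y h : N) ∈ Submodule.span R (Set.range b)) ∧ y i = x i := by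
        by_cases h0 : c i = 0
        · refine ⟨0, (F i).zero_mem, ⟨N.zero_mem, Submodule.zero_mem _⟩, ?_⟩
          rw [ha', h0, mul_zero, Finsupp.zero_apply]
        · refine ⟨a • u i, (F i).smul_mem a (hu i), ⟨N.smul_mem a (hu i).1, ?_⟩, ?_⟩
          · exact Submodule.smul_mem _ a (Submodule.subset_span (Set.mem_range_self (⟨i, h0⟩ : J)))
          · rw [ha', Finsupp.smul_apply, huc, smul_eq_mul]
      obtain ⟨y, hyF, ⟨hyN, hy⟩, hyi⟩ := key
      have hz : x - y ∈ F i := (F i).sub_mem hx hyF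
      suffices h : (⟨x - y, hz.1⟩ : N) ∈ Submodule.span R (Set.range b) by
        have := Submodule.add_mem _ h hy
        convert this using 1
        ext1; simp
      by_cases hne : (x - y).support.Nonempty
      · let j := (x - y).support.max' hne
        have hj : j ∈ (x - y).support := Finset.max'_mem _ _
        have hji : j < i := lt_of_le_of_ne (hz.2 hj) (by
          rintro h
          rw [Finsupp.mem_support_iff, h, Finsupp.sub_apply, hyi, sub_self] at hj
          exact hj rfl)
        exact ih j hji _ ⟨hz.1, fun k hk => Finset.le_max' _ _ hk⟩
      · have : x - y = 0 := Finsupp.support_eq_empty.1 (Finset.not_nonempty_iff_eq_empty.1 hne)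
        simp only [this]
        exact Submodule.zero_mem _
  have hli : LinearIndependent R b := by
    refine (injective_iff_map_eq_zero (Finsupp.linearCombination R b)).2 fun g hg => ?_
    by_contra hne
    have hs : g.support.Nonempty := Finsupp.support_nonempty_iff.2 hne
    -- At the largest index of a relation only one term survives, because `u j` vanishes above `j`.
    let i := g.support.max' hs
    have hi : i ∈ g.support := Finset.max'_mem _ _
    have h := congrArg (fun n : N => (n : ι →₀ R) i) hg
    simp only [Finsupp.linearCombination_apply, Finsupp.sum, Submodule.coe_sum, Submodule.coe_smul,
      Finsupp.finsetSum_apply, Finsupp.smul_apply, smul_eq_mul] at h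
    rw [Finset.sum_eq_single i] at h
    · change g i * u i i = 0 at h
      rw [huc] at h
      exact (mul_ne_zero (Finsupp.mem_support_iff.1 hi) i.2) h
    · intro j hj hji
      change g j * u j i = 0
      rw [hu0 _ _ (lt_of_le_of_ne (Finset.le_max' _ _ hj) fun h => hji (Subtype.ext h)), mul_zero]
    · exact fun h' => absurd hi h'
  refine Module.Free.of_basis (Module.Basis.mk hli ?_)
  rintro ⟨x, hx⟩ -
  by_cases hne : x.support.Nonempty
  · exact hspan (x.support.max' hne) x ⟨hx, fun k hk => Finset.le_max' _ _ hk⟩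
  · have : x = 0 := Finsupp.support_eq_empty.1 (Finset.not_nonempty_iff_eq_empty.1 hne)
    simp only [this]
    exact Submodule.zero_mem _

theorem Module.Free.of_injective_pid [Module.Free R M] (f : A →ₗ[R] M)
    (hf : Function.Injective f) : Module.Free R A := by
  let e := (Module.Free.chooseBasis R M).repr
  let g : A →ₗ[R] _ := e.toLinearMap ∘ₗ f
  have hg : Function.Injective g := e.injective.comp hf
  have := Finsupp.free_submodule (LinearMap.range g)
  exact Module.Free.of_equiv (LinearEquiv.ofInjective g hg).symm

theorem Module.Free.submodule_pid [Module.Free R M] (N : Submodule R M) : Module.Free R N :=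
  Module.Free.of_injective_pid N.subtype N.injective_subtype

/-- The range of `f` lies in a free module over a principal ideal domain, hence is free, and the
kernel is a direct summand. Maps given on cycles, or on similar kernels, are extended in this way.
-/
theorem LinearMap.exists_extension_ker [Module.Free R M] (f : A →ₗ[R] M)
    (g : LinearMap.ker f →ₗ[R] X) : ∃ g' : A →ₗ[R] X, ∀ x : LinearMap.ker f, g' x = g x := by
  have := Module.Free.submodule_pid (LinearMap.range f)
  have := Module.Free.of_equiv f.quotKerEquivRange.symm
  exact (LinearMap.ker f).exists_extension g

end Hereditary

/-! ### Multilinear maps on spanning sets -/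

section Multilinear

variable {ι : Type*} [Fintype ι] {R : Type*} [CommRing R] {M : ι → Type*}
  [∀ i, AddCommGroup (M i)] [∀ i, Module R (M i)] {N : Type*} [AddCommGroup N] [Module R N]

/-- Induction on the finite set of slots whose entry is only known to lie in the span; the other
entries are generators. -/
theorem MultilinearMap.mem_of_span (f : MultilinearMap R M N) (S : ∀ i, Set (M i))
    (Q : Submodule R N) (h : ∀ x, (∀ i, x i ∈ S i) → f x ∈ Q) (x : ∀ i, M i)
    (hx : ∀ i, x i ∈ Submodule.span R (S i)) : f x ∈ Q := by
  classical
  have key : ∀ s : Finset ι, ∀ x : ∀ i, M i, (∀ i ∈ s, x i ∈ Submodule.span R (S i)) →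
      (∀ i ∉ s, x i ∈ S i) → f x ∈ Q := by
    intro s
    induction s using Finset.induction_on with
    | empty => exact fun x _ hx => h x fun i => hx i (Finset.notMem_empty i)
    | insert i s hi ih =>
      intro x hx hx'
      have hmain : ∀ y ∈ Submodule.span R (S i), f (Function.update x i y) ∈ Q := by
        intro y hy
        induction hy using Submodule.span_induction with
        | mem y hy =>
          refine ih _ (fun j hj => ?_) (fun j hj => ?_)
          · rw [Function.update_of_ne (by rintro rfl; exact hi hj)]
            exact hx j (Finset.mem_insert_of_mem hj)
          · by_cases hji : j = i
            · subst hji; rwa [Function.update_self]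
            · rw [Function.update_of_ne hji]
              exact hx' j (by simp [hji, hj])
        | zero => rw [f.map_update_zero]; exact Q.zero_mem
        | add y z _ _ hy hz => rw [f.map_update_add]; exact Q.add_mem hy hz
        | smul c y _ hy => rw [f.map_update_smul]; exact Q.smul_mem c hy
      have := hmain (x i) (hx i (Finset.mem_insert_self i s))
      rwa [Function.update_eq_self] at this
  exact key Finset.univ x (fun i _ => hx i) (fun i hi => absurd (Finset.mem_univ i) hi)

theorem MultilinearMap.eq_of_span (f g : MultilinearMap R M N) (S : ∀ i, Set (M i))
    (h : ∀ x, (∀ i, x i ∈ S i) → f x = g x) (x : ∀ i, M i)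
    (hx : ∀ i, x i ∈ Submodule.span R (S i)) : f x = g x := by
  have := (f - g).mem_of_span S ⊥ (fun y hy => by simp [h y hy]) x hx
  exact sub_eq_zero.1 (by simpa using this)

theorem PiTensorProduct.tprod_mem_of_span (S : ∀ i, Set (M i))
    (Q : Submodule R (PiTensorProduct R M))
    (h : ∀ x, (∀ i, x i ∈ S i) → PiTensorProduct.tprod R x ∈ Q) (x : ∀ i, M i)
    (hx : ∀ i, x i ∈ Submodule.span R (S i)) : PiTensorProduct.tprod R x ∈ Q :=
  MultilinearMap.mem_of_span _ S Q h x hx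

theorem PiTensorProduct.ext_span {f g : PiTensorProduct R M →ₗ[R] N} (S : ∀ i, Set (M i))
    (hS : ∀ i, Submodule.span R (S i) = ⊤)
    (h : ∀ x, (∀ i, x i ∈ S i) → f (PiTensorProduct.tprod R x) = g (PiTensorProduct.tprod R x)) :
    f = g := by
  refine PiTensorProduct.ext (MultilinearMap.ext fun x => ?_)
  exact MultilinearMap.eq_of_span _ _ S h x (fun i => by rw [hS]; trivial)

end Multilinear

/-! ### Gradings -/

@[simp] theorem projOn_lof {I : Type v} [DecidableEq I] (X : I → Type u) [∀ i, AddCommGroup (X i)]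
    [∀ i, Module ℤ (X i)] (P : I → Prop) (i : I) [Decidable (P i)] (x : X i) :
    projOn X P (DirectSum.lof ℤ I X i x) = if P i then DirectSum.lof ℤ I X i x else 0 := by
  rw [projOn, DirectSum.toModule_lof]
  split_ifs <;> rfl

theorem DirectSum.span_lof_eq_top {I : Type v} [DecidableEq I] (X : I → Type u)
    [∀ i, AddCommGroup (X i)] [∀ i, Module ℤ (X i)] :
    Submodule.span ℤ {y | ∃ i, ∃ x : X i, y = DirectSum.lof ℤ I X i x} = ⊤ := by
  refine top_unique fun y _ => ?_
  induction y using DirectSum.induction_on with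
  | zero => exact Submodule.zero_mem _
  | of i x => exact Submodule.subset_span ⟨i, x, rfl⟩
  | add x y hx hy => exact Submodule.add_mem _ (hx trivial) (hy trivial)

namespace GrData

variable {M : Type u} {N : Type v} {P : Type w} [AddCommGroup M] [Module ℤ M] [AddCommGroup N]
  [Module ℤ N] [AddCommGroup P] [Module ℤ P]

/-- The parts `gr n` span, and `par` consists of the projections that they determine. -/
structure Lawful (G : GrData M) : Prop where
  span : Submodule.span ℤ {x | ∃ n, x ∈ G.gr n} = ⊤
  par_gr : ∀ n e, ∀ x ∈ G.gr n, G.par e x = if (n : ZMod 2) = e then x else 0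

/-- `f` shifts degrees by `k`. -/
def IsDeg (G : GrData M) (H : GrData N) (f : M →ₗ[ℤ] N) (k : ℤ) : Prop :=
  ∀ n, ∀ x ∈ G.gr n, f x ∈ H.gr (n + k)

/-- `f` shifts degrees by finitely many amounts. -/
def IsBdd (G : GrData M) (H : GrData N) (f : M →ₗ[ℤ] N) : Prop :=
  ∃ F : Finset ℤ, ∀ n, ∀ x ∈ G.gr n, f x ∈ ⨆ j ∈ F, H.gr (n + j)

/-- `f` shifts parities by `ε`. -/
def IsPar (G : GrData M) (H : GrData N) (f : M →ₗ[ℤ] N) (ε : ZMod 2) : Prop :=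
  ∀ e x, H.par (e + ε) (f x) = f (G.par e x)

/-- The functional `f` vanishes in all but finitely many degrees. -/
def IsFin (G : GrData M) (f : Module.Dual ℤ M) : Prop :=
  ∃ F : Finset ℤ, ∀ n, n ∉ F → ∀ x ∈ G.gr n, f x = 0

variable {G : GrData M} {H : GrData N} {L : GrData P}

section deg

theorem IsDeg.comp {f : M →ₗ[ℤ] N} {g : N →ₗ[ℤ] P} {k l : ℤ} (hg : IsDeg H L g l)
    (hf : IsDeg G H f k) : IsDeg G L (g ∘ₗ f) (k + l) := fun n x hx => by
  rw [← add_assoc]; exact hg _ _ (hf n x hx)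

theorem IsDeg.comp' {f : M →ₗ[ℤ] N} {g : N →ₗ[ℤ] P} {k l j : ℤ} (hg : IsDeg H L g l)
    (hf : IsDeg G H f k) (h : k + l = j) : IsDeg G L (g ∘ₗ f) j := h ▸ hg.comp hf

theorem IsDeg.id : IsDeg G G LinearMap.id 0 := fun n x hx => by rwa [add_zero]

theorem IsDeg.of_zero {f : M →ₗ[ℤ] N} (h : ∀ n, ∀ x ∈ G.gr n, f x ∈ H.gr n) : IsDeg G H f 0 :=
  fun n x hx => by rw [add_zero]; exact h n x hx

theorem IsDeg.zero_mem {f : M →ₗ[ℤ] N} (h : IsDeg G H f 0) {n : ℤ} {x : M} (hx : x ∈ G.gr n) :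
    f x ∈ H.gr n := by simpa using h n x hx

theorem IsDeg.add {f g : M →ₗ[ℤ] N} {k : ℤ} (hf : IsDeg G H f k) (hg : IsDeg G H g k) :
    IsDeg G H (f + g) k := fun n x hx => Submodule.add_mem _ (hf n x hx) (hg n x hx)

theorem IsDeg.sub {f g : M →ₗ[ℤ] N} {k : ℤ} (hf : IsDeg G H f k) (hg : IsDeg G H g k) :
    IsDeg G H (f - g) k := fun n x hx => Submodule.sub_mem _ (hf n x hx) (hg n x hx)

theorem IsDeg.zero {k : ℤ} : IsDeg G H 0 k := fun _ _ _ => Submodule.zero_mem _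

theorem IsDeg.smul {f : M →ₗ[ℤ] N} {k : ℤ} (c : ℤ) (hf : IsDeg G H f k) :
    IsDeg G H (c • f) k := fun n x hx => Submodule.smul_mem _ c (hf n x hx)

theorem IsDeg.sum {ι : Type*} {s : Finset ι} {f : ι → M →ₗ[ℤ] N} {k : ℤ}
    (hf : ∀ i ∈ s, IsDeg G H (f i) k) : IsDeg G H (∑ i ∈ s, f i) k := fun n x hx => by
  rw [LinearMap.sum_apply]; exact Submodule.sum_mem _ fun i hi => hf i hi n x hx

theorem IsDeg.bdd {f : M →ₗ[ℤ] N} {k : ℤ} (hf : IsDeg G H f k) : IsBdd G H f :=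
  ⟨{k}, fun n x hx => by simpa using hf n x hx⟩

theorem IsBdd.sum {ι : Type*} {s : Finset ι} {f : ι → M →ₗ[ℤ] N}
    (hf : ∀ i ∈ s, IsBdd G H (f i)) : IsBdd G H (∑ i ∈ s, f i) := by
  classical
  choose! F hF using hf
  refine ⟨s.biUnion F, fun n x hx => ?_⟩
  rw [LinearMap.sum_apply]
  refine Submodule.sum_mem _ fun i hi => ?_
  refine (iSup₂_le fun j hj => ?_ : ⨆ j ∈ F i, H.gr (n + j) ≤ _) (hF i hi n x hx)
  exact le_iSup₂_of_le j (Finset.mem_biUnion.2 ⟨i, hi, hj⟩) le_rfl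

theorem IsBdd.smul {f : M →ₗ[ℤ] N} (c : ℤ) (hf : IsBdd G H f) : IsBdd G H (c • f) := by
  obtain ⟨F, hF⟩ := hf
  exact ⟨F, fun n x hx => Submodule.smul_mem _ c (hF n x hx)⟩

theorem IsBdd.comp {f : M →ₗ[ℤ] N} {g : N →ₗ[ℤ] P} (hg : IsBdd H L g) (hf : IsBdd G H f) :
    IsBdd G L (g ∘ₗ f) := by
  classical
  obtain ⟨F, hF⟩ := hf
  obtain ⟨F', hF'⟩ := hg
  refine ⟨(F ×ˢ F').image fun p => p.1 + p.2, fun n x hx => ?_⟩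
  have h : ⨆ j ∈ F, H.gr (n + j) ≤
      (⨆ j ∈ (F ×ˢ F').image fun p => p.1 + p.2, L.gr (n + j)).comap g := by
    refine iSup₂_le fun j hj y hy => ?_
    rw [Submodule.mem_comap]
    refine (iSup₂_le fun i hi => ?_ : ⨆ i ∈ F', L.gr (n + j + i) ≤ _) (hF' _ y hy)
    rw [add_assoc]
    exact le_iSup₂_of_le (j + i) (Finset.mem_image.2 ⟨(j, i), Finset.mk_mem_product hj hi, rfl⟩)
      le_rfl
  exact h (hF n x hx)

/-- From degree `n` only the degrees `n + j` with `j` in a finite set are reached, so only finitely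
many `n` meet the support of `g`. Bounded shifts have to be allowed because the coproducts of `T`
and of the character group need not preserve degrees. -/
theorem IsFin.comp {f : M →ₗ[ℤ] N} {g : Module.Dual ℤ N} (hg : H.IsFin g) (hf : IsBdd G H f) :
    G.IsFin (g ∘ₗ f) := by
  classical
  obtain ⟨F, hF⟩ := hf
  obtain ⟨F', hF'⟩ := hg
  refine ⟨(F ×ˢ F').image fun p => p.2 - p.1, fun n hn x hx => ?_⟩
  have h : ⨆ j ∈ F, H.gr (n + j) ≤ LinearMap.ker g := by
    refine iSup₂_le fun j hj y hy => hF' (n + j) (fun h => hn ?_) y hy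
    exact Finset.mem_image.2 ⟨(j, n + j), Finset.mk_mem_product hj h, by simp⟩
  exact h (hF n x hx)

end deg

namespace Lawful

theorem ext_gr (hG : G.Lawful) {f g : M →ₗ[ℤ] N} (h : ∀ n, ∀ x ∈ G.gr n, f x = g x) : f = g :=
  LinearMap.ext_on hG.span fun x ⟨n, hx⟩ => h n x hx

theorem par_par (hG : G.Lawful) (e e' : ZMod 2) :
    G.par e ∘ₗ G.par e' = if e = e' then G.par e else 0 := by
  refine hG.ext_gr fun n x hx => ?_
  rw [LinearMap.comp_apply, hG.par_gr n e' x hx]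
  split_ifs with h1 h2 h2
  · rfl
  · subst h1; simp [hG.par_gr n e x hx, Ne.symm h2]
  · subst h2; simp [hG.par_gr n e x hx, h1]
  · simp

theorem par_par_self (hG : G.Lawful) (e : ZMod 2) (x : M) : G.par e (G.par e x) = G.par e x := by
  have := LinearMap.congr_fun (hG.par_par e e) x
  simpa using this

theorem par_par_ne (hG : G.Lawful) {e e' : ZMod 2} (h : e ≠ e') (x : M) :
    G.par e (G.par e' x) = 0 := by
  have := LinearMap.congr_fun (hG.par_par e e') x
  simpa [h] using this

theorem par_hom (hG : G.Lawful) {e e' : ZMod 2} {x : M} (h : G.par e' x = x) :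
    G.par e x = if e' = e then x else 0 := by
  rw [← h]
  split_ifs with h'
  · subst h'; exact hG.par_par_self _ _
  · exact hG.par_par_ne (Ne.symm h') x

theorem sum_par (hG : G.Lawful) : ∑ e, G.par e = LinearMap.id := by
  refine hG.ext_gr fun n x hx => ?_
  simp [LinearMap.sum_apply, hG.par_gr n _ x hx]

theorem sum_par_apply (hG : G.Lawful) (x : M) : ∑ e, G.par e x = x := by
  simpa [LinearMap.sum_apply] using LinearMap.congr_fun hG.sum_par x

theorem span_par (hG : G.Lawful) : Submodule.span ℤ {x | ∃ e, G.par e x = x} = ⊤ := by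
  refine top_unique (hG.span ▸ Submodule.span_mono ?_)
  rintro x ⟨n, hx⟩
  exact ⟨n, by simp [hG.par_gr n _ x hx]⟩

theorem sgn_hom (hG : G.Lawful) {e : ZMod 2} {x : M} (h : G.par e x = x) :
    G.sgn x = sg e • x := by
  rw [sgn, LinearMap.sub_apply, hG.par_hom h, hG.par_hom h]
  obtain rfl | rfl := (by decide : ∀ e : ZMod 2, e = 0 ∨ e = 1) e
  · simp [sg]
  · simp [sg]

theorem sgn_sgn (hG : G.Lawful) : G.sgn ∘ₗ G.sgn = LinearMap.id := by
  refine LinearMap.ext_on hG.span_par fun x ⟨e, h⟩ => ?_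
  rw [LinearMap.comp_apply, hG.sgn_hom h, map_smul, hG.sgn_hom h, smul_smul]
  have : sg e * sg e = 1 := (by decide : ∀ e : ZMod 2, sg e * sg e = 1) e
  simp [this]

theorem par_deg (hG : G.Lawful) (e : ZMod 2) : IsDeg G G (G.par e) 0 := fun n x hx => by
  rw [hG.par_gr n e x hx, add_zero]
  split_ifs
  exacts [hx, Submodule.zero_mem _]

theorem sgn_deg (hG : G.Lawful) : IsDeg G G G.sgn 0 := (hG.par_deg 0).sub (hG.par_deg 1)

end Lawful

theorem IsDeg.par {f : M →ₗ[ℤ] N} {k : ℤ} (hf : IsDeg G H f k) (hG : G.Lawful) (hH : H.Lawful) :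
    IsPar G H f k := by
  intro e
  refine LinearMap.congr_fun (f := H.par (e + k) ∘ₗ f) (g := f ∘ₗ G.par e) ?_
  refine hG.ext_gr fun n x hx => ?_
  simp only [LinearMap.comp_apply, hH.par_gr _ _ _ (hf n x hx), hG.par_gr n e x hx, Int.cast_add,
    add_left_inj]
  split_ifs <;> simp

theorem IsPar.hom {f : M →ₗ[ℤ] N} {ε e : ZMod 2} (hf : IsPar G H f ε) {x : M}
    (hx : G.par e x = x) : H.par (e + ε) (f x) = f x := by rw [hf, hx]

theorem IsPar.sgn_even {f : M →ₗ[ℤ] N} (hf : IsPar G H f 0) : H.sgn ∘ₗ f = f ∘ₗ G.sgn := by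
  ext x
  have h0 := hf 0 x
  have h1 := hf 1 x
  simp only [add_zero] at h0 h1
  simp [sgn, h0, h1]

theorem IsPar.sgn_odd {f : M →ₗ[ℤ] N} (hf : IsPar G H f 1) : H.sgn ∘ₗ f = -(f ∘ₗ G.sgn) := by
  ext x
  have h0 := hf 0 x
  have h1 := hf 1 x
  rw [zero_add] at h0
  rw [show (1 + 1 : ZMod 2) = 0 from rfl] at h1
  simp [sgn, h0, h1]

/-! #### Direct sums -/

theorem ofSum_lawful {I : Type v} [DecidableEq I] (X : I → Type u) [∀ i, AddCommGroup (X i)]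
    [∀ i, Module ℤ (X i)] (deg : I → ℤ) : (ofSum X deg).Lawful where
  span := by
    refine top_unique (DirectSum.span_lof_eq_top X ▸ Submodule.span_mono ?_)
    rintro _ ⟨i, x, rfl⟩
    exact ⟨deg i, Submodule.subset_span ⟨i, rfl, x, rfl⟩⟩
  par_gr := by
    intro n e x hx
    classical
    induction hx using Submodule.span_induction with
    | mem x hx =>
      obtain ⟨i, rfl, x, rfl⟩ := hx
      exact projOn_lof X _ i x
    | zero => simp
    | add x y _ _ hx hy => rw [map_add, hx, hy]; split_ifs <;> simp
    | smul c x _ hx => rw [map_smul, hx]; split_ifs <;> simp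

theorem lof_mem_ofSum {I : Type v} [DecidableEq I] {X : I → Type u} [∀ i, AddCommGroup (X i)]
    [∀ i, Module ℤ (X i)] {deg : I → ℤ} (i : I) (x : X i) :
    DirectSum.lof ℤ I X i x ∈ (ofSum X deg).gr (deg i) :=
  Submodule.subset_span ⟨i, rfl, x, rfl⟩

theorem isDeg_ofSum {I : Type*} [DecidableEq I] {X : I → Type u} [∀ i, AddCommGroup (X i)]
    [∀ i, Module ℤ (X i)] {deg : I → ℤ} {f : (⨁ i, X i) →ₗ[ℤ] N} {k : ℤ}
    (h : ∀ i (x : X i), f (DirectSum.lof ℤ I X i x) ∈ H.gr (deg i + k)) :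
    IsDeg (ofSum X deg) H f k := by
  intro n x hx
  induction hx using Submodule.span_induction with
  | mem x hx => obtain ⟨i, rfl, x, rfl⟩ := hx; exact h i x
  | zero => rw [map_zero]; exact Submodule.zero_mem _
  | add x y _ _ hx hy => rw [map_add]; exact Submodule.add_mem _ hx hy
  | smul c x _ hx => rw [map_smul]; exact Submodule.smul_mem _ c hx

/-! #### Tensor products -/

theorem tmul_mem_prod {a b n : ℤ} {x : M} {y : N} (hx : x ∈ G.gr a) (hy : y ∈ H.gr b)
    (h : a + b = n) : x ⊗ₜ[ℤ] y ∈ (G.prod H).gr n :=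
  Submodule.subset_span ⟨a, b, h, x, hx, y, hy, rfl⟩

theorem prod_gr_le {n : ℤ} {Q : Submodule ℤ (M ⊗[ℤ] N)}
    (h : ∀ a b, a + b = n → ∀ x ∈ G.gr a, ∀ y ∈ H.gr b, x ⊗ₜ[ℤ] y ∈ Q) :
    (G.prod H).gr n ≤ Q := by
  refine Submodule.span_le.2 ?_
  rintro _ ⟨a, b, hab, x, hx, y, hy, rfl⟩
  exact h a b hab x hx y hy

theorem prod_par_tmul (hG : G.Lawful) (hH : H.Lawful) {a b : ZMod 2} (e : ZMod 2) {x : M} {y : N}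
    (hx : G.par a x = x) (hy : H.par b y = y) :
    (G.prod H).par e (x ⊗ₜ y) = if a + b = e then x ⊗ₜ y else 0 := by
  simp only [prod, LinearMap.sum_apply, TensorProduct.map_tmul]
  rw [Finset.sum_eq_single a]
  · rw [hx, hH.par_hom hy]
    by_cases h : a + b = e
    · rw [if_pos h, if_pos (by rw [← h]; ring)]
    · rw [if_neg h, if_neg (fun h' => h (by rw [h']; ring)), TensorProduct.tmul_zero]
  · intro c _ hc
    rw [hG.par_hom hx, if_neg (Ne.symm hc), TensorProduct.zero_tmul]
  · simp

theorem prod_hom (hG : G.Lawful) (hH : H.Lawful) {a b : ZMod 2} {x : M} {y : N}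
    (hx : G.par a x = x) (hy : H.par b y = y) :
    (G.prod H).par (a + b) (x ⊗ₜ y) = x ⊗ₜ y := by
  rw [prod_par_tmul hG hH _ hx hy, if_pos rfl]

theorem Lawful.prod (hG : G.Lawful) (hH : H.Lawful) : (G.prod H).Lawful where
  span := by
    refine top_unique ?_
    rw [← LinearMap.range_id, LinearMap.range_eq_map, ← TensorProduct.span_tmul_eq_top,
      Submodule.map_id]
    refine Submodule.span_le.2 ?_
    rintro _ ⟨x, y, rfl⟩
    have hx : x ∈ Submodule.span ℤ {x | ∃ n, x ∈ G.gr n} := by rw [hG.span]; trivial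
    have hy : y ∈ Submodule.span ℤ {x | ∃ n, x ∈ H.gr n} := by rw [hH.span]; trivial
    have := Submodule.apply_mem_map₂ (TensorProduct.mk ℤ M N) hx hy
    rw [Submodule.map₂_span_span] at this
    refine Submodule.span_mono ?_ this
    rintro _ ⟨x, ⟨a, hx⟩, y, ⟨b, hy⟩, rfl⟩
    exact ⟨a + b, tmul_mem_prod hx hy rfl⟩
  par_gr := by
    intro n e z hz
    refine prod_gr_le (Q := LinearMap.eqLocus ((G.prod H).par e)
      (if (n : ZMod 2) = e then LinearMap.id else 0)) ?_ hz |>.trans ?_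
    · intro a b hab x hx y hy
      have h1 : G.par a x = x := by simp [hG.par_gr a _ x hx]
      have h2 : H.par b y = y := by simp [hH.par_gr b _ y hy]
      rw [LinearMap.mem_eqLocus, prod_par_tmul hG hH e h1 h2, ← hab]
      push_cast
      split_ifs <;> rfl
    · split_ifs <;> rfl

theorem IsDeg.tmap {M' : Type*} {N' : Type*} [AddCommGroup M'] [Module ℤ M'] [AddCommGroup N']
    [Module ℤ N'] {G' : GrData M'} {H' : GrData N'} {f : M →ₗ[ℤ] M'} {g : N →ₗ[ℤ] N'} {k l : ℤ}
    (hf : IsDeg G G' f k) (hg : IsDeg H H' g l) :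
    IsDeg (G.prod H) (G'.prod H') (TensorProduct.map f g) (k + l) := fun n z hz =>
  prod_gr_le (Q := ((G'.prod H').gr (n + (k + l))).comap (TensorProduct.map f g))
    (fun a b hab x hx y hy => by
      refine tmul_mem_prod (hf a x hx) (hg b y hy) ?_
      rw [← hab]; ring) hz

theorem IsBdd.tmap {M' : Type*} {N' : Type*} [AddCommGroup M'] [Module ℤ M'] [AddCommGroup N']
    [Module ℤ N'] {G' : GrData M'} {H' : GrData N'} {f : M →ₗ[ℤ] M'} {g : N →ₗ[ℤ] N'}
    (hf : IsBdd G G' f) (hg : IsBdd H H' g) :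
    IsBdd (G.prod H) (G'.prod H') (TensorProduct.map f g) := by
  classical
  obtain ⟨F, hF⟩ := hf
  obtain ⟨F', hF'⟩ := hg
  refine ⟨(F ×ˢ F').image fun p => p.1 + p.2, fun n z hz => ?_⟩
  refine prod_gr_le (Q := (⨆ j ∈ (F ×ˢ F').image fun p => p.1 + p.2,
    (G'.prod H').gr (n + j)).comap (TensorProduct.map f g)) (fun a b hab x hx y hy => ?_) hz
  have := Submodule.apply_mem_map₂ (TensorProduct.mk ℤ M' N') (hF a x hx) (hF' b y hy)
  rw [Submodule.mem_comap, TensorProduct.map_tmul]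
  refine (Submodule.map₂_le.2 ?_ : Submodule.map₂ (TensorProduct.mk ℤ M' N') _ _ ≤ _) this
  intro x hx y hy
  suffices hT : ⨆ j ∈ F, G'.gr (a + j) ≤ Submodule.comap ((TensorProduct.mk ℤ M' N').flip y)
      (⨆ j ∈ (F ×ˢ F').image fun p => p.1 + p.2, (G'.prod H').gr (n + j)) from hT hx
  refine iSup₂_le fun i hi x hx => ?_
  rw [Submodule.mem_comap, LinearMap.flip_apply, ← Submodule.mem_comap]
  refine (iSup₂_le fun j hj y hy => ?_ : ⨆ j ∈ F', H'.gr (b + j) ≤ _) hy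
  exact (le_iSup₂_of_le (i + j)
    (Finset.mem_image.2 ⟨(i, j), Finset.mk_mem_product hi hj, rfl⟩) le_rfl :
    (G'.prod H').gr (n + (i + j)) ≤ _) (tmul_mem_prod hx hy (by rw [← hab]; ring))

theorem IsFin.tmul {f : Module.Dual ℤ M} {g : Module.Dual ℤ N} (hf : G.IsFin f) (hg : H.IsFin g) :
    (G.prod H).IsFin (TensorProduct.dualDistrib ℤ M N (f ⊗ₜ g)) := by
  classical
  obtain ⟨F, hF⟩ := hf
  obtain ⟨F', hF'⟩ := hg
  refine ⟨(F ×ˢ F').image fun p => p.1 + p.2, fun n hn z hz => ?_⟩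
  refine prod_gr_le (Q := LinearMap.ker (TensorProduct.dualDistrib ℤ M N (f ⊗ₜ g)))
    (fun a b hab x hx y hy => ?_) hz
  rw [LinearMap.mem_ker, TensorProduct.dualDistrib_apply]
  by_cases ha : a ∈ F
  · by_cases hb : b ∈ F'
    · exact absurd (Finset.mem_image.2 ⟨(a, b), Finset.mk_mem_product ha hb, hab⟩) hn
    · rw [hF' b hb y hy, mul_zero]
  · rw [hF a ha x hx, zero_mul]

/-! #### Tensor products of families -/

section pi

variable {m : ℕ} {A : Fin m → Type u} [∀ k, AddCommGroup (A k)] [∀ k, Module ℤ (A k)]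
  {B : Fin m → Type v} [∀ k, AddCommGroup (B k)] [∀ k, Module ℤ (B k)]
  {GA : ∀ k, GrData (A k)} {GB : ∀ k, GrData (B k)}

theorem tprod_mem_pi {a : Fin m → ℤ} {n : ℤ} {x : ∀ k, A k} (hx : ∀ k, x k ∈ (GA k).gr (a k))
    (h : ∑ k, a k = n) : PiTensorProduct.tprod ℤ x ∈ (pi GA).gr n :=
  Submodule.subset_span ⟨a, h, x, hx, rfl⟩

theorem pi_gr_le {n : ℤ} {Q : Submodule ℤ (⨂[ℤ] k, A k)}
    (h : ∀ a : Fin m → ℤ, ∑ k, a k = n → ∀ x : ∀ k, A k, (∀ k, x k ∈ (GA k).gr (a k)) →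
      PiTensorProduct.tprod ℤ x ∈ Q) : (pi GA).gr n ≤ Q := by
  refine Submodule.span_le.2 ?_
  rintro _ ⟨a, ha, x, hx, rfl⟩
  exact h a ha x hx

theorem pi_par_tprod (hG : ∀ k, (GA k).Lawful) {a : Fin m → ZMod 2} (e : ZMod 2) {x : ∀ k, A k}
    (hx : ∀ k, (GA k).par (a k) (x k) = x k) :
    (pi GA).par e (PiTensorProduct.tprod ℤ x) =
      if ∑ k, a k = e then PiTensorProduct.tprod ℤ x else 0 := by
  have key : ∀ b : Fin m → ZMod 2, PiTensorProduct.map (fun k => (GA k).par (b k))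
      (PiTensorProduct.tprod ℤ x) = if a = b then PiTensorProduct.tprod ℤ x else 0 := by
    intro b
    rw [PiTensorProduct.map_tprod]
    split_ifs with h
    · subst h; simp only [hx]
    · obtain ⟨k, hk⟩ := Function.ne_iff.1 h
      refine MultilinearMap.map_coord_zero _ k ?_
      rw [(hG k).par_hom (hx k), if_neg hk]
  simp only [pi, LinearMap.sum_apply, key]
  rw [Finset.sum_ite_eq]
  simp

theorem pi_hom (hG : ∀ k, (GA k).Lawful) {a : Fin m → ZMod 2} {x : ∀ k, A k}
    (hx : ∀ k, (GA k).par (a k) (x k) = x k) :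
    (pi GA).par (∑ k, a k) (PiTensorProduct.tprod ℤ x) = PiTensorProduct.tprod ℤ x := by
  rw [pi_par_tprod hG _ hx, if_pos rfl]

theorem Lawful.pi (hG : ∀ k, (GA k).Lawful) : (pi GA).Lawful where
  span := by
    refine top_unique ?_
    rw [← PiTensorProduct.span_tprod_eq_top]
    refine Submodule.span_le.2 ?_
    rintro _ ⟨x, rfl⟩
    refine PiTensorProduct.tprod_mem_of_span (fun k => {x | ∃ n, x ∈ (GA k).gr n}) _
      (fun x hx => ?_) x (fun k => by rw [(hG k).span]; trivial)
    choose a ha using hx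
    exact Submodule.subset_span ⟨_, tprod_mem_pi ha rfl⟩
  par_gr := by
    intro n e z hz
    refine pi_gr_le (Q := LinearMap.eqLocus ((GrData.pi GA).par e)
      (if (n : ZMod 2) = e then LinearMap.id else 0)) ?_ hz |>.trans ?_
    · intro a ha x hx
      have h1 : ∀ k, (GA k).par (a k) (x k) = x k := fun k => by
        simp [(hG k).par_gr _ _ _ (hx k)]
      rw [LinearMap.mem_eqLocus, pi_par_tprod hG e h1, ← ha]
      push_cast
      split_ifs <;> rfl
    · split_ifs <;> rfl

theorem IsDeg.piMap {f : ∀ k, A k →ₗ[ℤ] B k} {d : Fin m → ℤ}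
    (hf : ∀ k, IsDeg (GA k) (GB k) (f k) (d k)) :
    IsDeg (pi GA) (pi GB) (PiTensorProduct.map f) (∑ k, d k) := fun n z hz =>
  pi_gr_le (Q := ((pi GB).gr (n + ∑ k, d k)).comap (PiTensorProduct.map f))
    (fun a ha x hx => by
      rw [Submodule.mem_comap, PiTensorProduct.map_tprod]
      refine tprod_mem_pi (fun k => hf k _ _ (hx k)) ?_
      rw [Finset.sum_add_distrib, ha]) hz

theorem IsDeg.piMap_zero {f : ∀ k, A k →ₗ[ℤ] B k} (hf : ∀ k, IsDeg (GA k) (GB k) (f k) 0) :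
    IsDeg (pi GA) (pi GB) (PiTensorProduct.map f) 0 := by
  simpa using IsDeg.piMap hf

theorem IsBdd.piMap {f : ∀ k, A k →ₗ[ℤ] B k} (hf : ∀ k, IsBdd (GA k) (GB k) (f k)) :
    IsBdd (pi GA) (pi GB) (PiTensorProduct.map f) := by
  classical
  choose F hF using hf
  refine ⟨(Fintype.piFinset F).image fun d => ∑ k, d k, fun n z hz => ?_⟩
  refine pi_gr_le (Q := (⨆ j ∈ (Fintype.piFinset F).image fun d => ∑ k, d k,
    (pi GB).gr (n + j)).comap (PiTensorProduct.map f)) (fun a ha x hx => ?_) hz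
  rw [Submodule.mem_comap, PiTensorProduct.map_tprod]
  refine PiTensorProduct.tprod_mem_of_span
    (fun k => {y | ∃ j ∈ F k, y ∈ (GB k).gr (a k + j)}) _ (fun y hy => ?_) _ (fun k => ?_)
  · choose d hd hy using hy
    exact (le_iSup₂_of_le (∑ k, d k)
      (Finset.mem_image.2 ⟨d, Fintype.mem_piFinset.2 hd, rfl⟩) le_rfl :
      (pi GB).gr (n + ∑ k, d k) ≤ _)
      (tprod_mem_pi hy (by rw [Finset.sum_add_distrib, ha]))
  · refine (iSup₂_le fun j hj => ?_ : ⨆ j ∈ F k, (GB k).gr (a k + j) ≤ _) (hF k _ _ (hx k))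
    exact fun y hy => Submodule.subset_span ⟨j, hj, hy⟩

end pi

end GrData

/-! ### Cohomology algebras of complexes with coproducts -/

/-- The image of `N ⊗ N'` in `M ⊗ M'`. -/
abbrev tensorSub {M : Type u} {M' : Type v} [AddCommGroup M] [Module ℤ M] [AddCommGroup M']
    [Module ℤ M'] (N : Submodule ℤ M) (N' : Submodule ℤ M') : Submodule ℤ (M ⊗[ℤ] M') :=
  Submodule.map₂ (TensorProduct.mk ℤ M M') N N'

theorem tensorSub_eqOn {M : Type u} {M' : Type v} {P : Type w} [AddCommGroup M] [Module ℤ M]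
    [AddCommGroup M'] [Module ℤ M'] [AddCommGroup P] [Module ℤ P] {N : Submodule ℤ M}
    {N' : Submodule ℤ M'} (f g : M ⊗[ℤ] M' →ₗ[ℤ] P)
    (h : ∀ x ∈ N, ∀ y ∈ N', f (x ⊗ₜ y) = g (x ⊗ₜ y)) {z : M ⊗[ℤ] M'} (hz : z ∈ tensorSub N N') :
    f z = g z := by
  have : tensorSub N N' ≤ LinearMap.eqLocus f g := Submodule.map₂_le.2 h
  exact this hz

theorem tensorSub_map {M : Type*} {M' : Type*} {P : Type*} {P' : Type*} [AddCommGroup M]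
    [Module ℤ M] [AddCommGroup M'] [Module ℤ M'] [AddCommGroup P] [Module ℤ P] [AddCommGroup P']
    [Module ℤ P'] {N : Submodule ℤ M} {N' : Submodule ℤ M'} {Q : Submodule ℤ P}
    {Q' : Submodule ℤ P'} {f : M →ₗ[ℤ] P} {g : M' →ₗ[ℤ] P'} (hf : ∀ x ∈ N, f x ∈ Q)
    (hg : ∀ x ∈ N', g x ∈ Q') {z : M ⊗[ℤ] M'} (hz : z ∈ tensorSub N N') :
    TensorProduct.map f g z ∈ tensorSub Q Q' := by
  have : tensorSub N N' ≤ (tensorSub Q Q').comap (TensorProduct.map f g) :=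
    Submodule.map₂_le.2 fun x hx y hy => Submodule.apply_mem_map₂ _ (hf x hx) (hg y hy)
  exact this hz

namespace CoalgData

/-- `N` is a subcomplex, closed under the projections to the even and the odd part, and `Ψ`
restricts to a chain map `N → N ⊗ N` that shifts degrees by finitely many amounts. -/
structure IsDGC (X : CoalgData.{u}) : Prop where
  lawful : X.G.Lawful
  d_deg : GrData.IsDeg X.G X.G X.d (-1)
  d_mem : ∀ x ∈ X.N, X.d x ∈ X.N
  par_mem : ∀ e, ∀ x ∈ X.N, X.G.par e x ∈ X.N
  Ψ_bdd : GrData.IsBdd X.G (X.G.prod X.G) X.Ψ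
  Ψ_mem : ∀ x ∈ X.N, X.Ψ x ∈ tensorSub X.N X.N
  Ψ_d : ∀ x ∈ X.N, X.Ψ (X.d x) = tensorD X.G X.d X.d (X.Ψ x)

variable {X : CoalgData.{u}} {Y : CoalgData.{v}}

theorem cup_apply (f g : Module.Dual ℤ X.M) (x : X.M) :
    X.cup f g x = TensorProduct.dualDistrib ℤ X.M X.M (f ⊗ₜ g) (X.Ψ x) := rfl

theorem cls_surjective (X : CoalgData.{u}) : Function.Surjective X.cls :=
  Submodule.mkQ_surjective _

theorem cls_eq_zero {f : X.cocycles} : X.cls f = 0 ↔ f.1 ∈ X.coboundaries :=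
  Submodule.Quotient.mk_eq_zero _

theorem cls_eq {f g : X.cocycles} : X.cls f = X.cls g ↔ f.1 - g.1 ∈ X.coboundaries := by
  rw [← sub_eq_zero, ← map_sub, cls_eq_zero]; rfl

theorem pull_cls {p : X.M →ₗ[ℤ] Y.M} (h : PullOK X Y p) (f : Y.cocycles) :
    pull h (Y.cls f) = X.cls ⟨f.1 ∘ₗ p, h.cocycle _ f.2⟩ := rfl

theorem dual_tensorD_eq_zero {f : Module.Dual ℤ X.M} {g : Module.Dual ℤ Y.M}
    (hX : ∀ x ∈ X.N, f (X.d x) = 0) (hY : ∀ y ∈ Y.N, g (Y.d y) = 0) {z : X.M ⊗[ℤ] Y.M}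
    (hz : z ∈ tensorSub X.N Y.N) :
    TensorProduct.dualDistrib ℤ X.M Y.M (f ⊗ₜ g) (tensorD X.G X.d Y.d z) = 0 := by
  refine tensorSub_eqOn (TensorProduct.dualDistrib ℤ X.M Y.M (f ⊗ₜ g) ∘ₗ tensorD X.G X.d Y.d) 0
    (fun x hx y hy => ?_) hz
  simp [tensorD, hX x hx, hY y hy]

theorem IsDGC.sgn_d (hX : X.IsDGC) (x : X.M) : X.G.sgn (X.d x) = -X.d (X.G.sgn x) := by
  have h := (hX.d_deg.par hX.lawful hX.lawful)
  exact LinearMap.congr_fun (GrData.IsPar.sgn_odd (show GrData.IsPar X.G X.G X.d 1 from h)) x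

theorem IsDGC.sgn_mem (hX : X.IsDGC) {x : X.M} (hx : x ∈ X.N) : X.G.sgn x ∈ X.N :=
  X.N.sub_mem (hX.par_mem 0 x hx) (hX.par_mem 1 x hx)

/-- The Leibniz rule, for cochains on `M` whose properties hold on `N` only; `Ψ_mem` confines the
coproduct of `N` to `N ⊗ N`, where these properties can be used. -/
theorem IsDGC.mulOK (hX : X.IsDGC) : X.MulOK where
  mul_mem f hf g hg := by
    refine ⟨(GrData.IsFin.tmul hf.1 hg.1).comp hX.Ψ_bdd, fun x hx => ?_⟩
    rw [cup_apply, hX.Ψ_d x hx]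
    exact dual_tensorD_eq_zero hf.2 hg.2 (hX.Ψ_mem x hx)
  mul_left f _ hf g hg := by
    obtain ⟨hf, f₀, hf₀, e⟩ := hf
    refine ⟨(GrData.IsFin.tmul hf hg.1).comp hX.Ψ_bdd, X.cup f₀ g,
      (GrData.IsFin.tmul hf₀ hg.1).comp hX.Ψ_bdd, fun x hx => ?_⟩
    rw [cup_apply, cup_apply, hX.Ψ_d x hx, ← LinearMap.comp_apply (g := tensorD _ _ _)]
    refine tensorSub_eqOn _ _ (fun a ha b hb => ?_) (hX.Ψ_mem x hx)
    simp [tensorD, e a ha, hg.2 b hb]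
  mul_right f hf g _ hg := by
    obtain ⟨hg, g₀, hg₀, e⟩ := hg
    -- A cochain `f` need not be homogeneous, so the sign `(-1)^|f|` of the Leibniz rule becomes
    -- precomposition with the sign involution.
    have hf' : X.G.IsFin (f ∘ₗ X.G.sgn) := GrData.IsFin.comp hf.1 hX.lawful.sgn_deg.bdd
    refine ⟨(GrData.IsFin.tmul hf.1 hg).comp hX.Ψ_bdd, X.cup (f ∘ₗ X.G.sgn) g₀,
      (GrData.IsFin.tmul hf' hg₀).comp hX.Ψ_bdd, fun x hx => ?_⟩
    rw [cup_apply, cup_apply, hX.Ψ_d x hx, ← LinearMap.comp_apply (g := tensorD _ _ _)]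
    refine tensorSub_eqOn _ _ (fun a ha b hb => ?_) (hX.Ψ_mem x hx)
    have h1 : X.G.sgn (X.G.sgn a) = a := LinearMap.congr_fun hX.lawful.sgn_sgn a
    simp [tensorD, e b hb, h1, hX.sgn_d, hf.2 _ (hX.sgn_mem ha)]

theorem IsDGC.pullOK_par (hX : X.IsDGC) (e : ZMod 2) : PullOK X X (X.G.par e) := by
  have hd : GrData.IsPar X.G X.G X.d 1 := hX.d_deg.par hX.lawful hX.lawful
  have h2 : e + 1 + 1 = e := (by decide : ∀ e : ZMod 2, e + 1 + 1 = e) e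
  have hb : GrData.IsBdd X.G X.G (X.G.par e) := (hX.lawful.par_deg e).bdd
  refine ⟨fun f hf => ⟨GrData.IsFin.comp hf.1 hb, fun x hx => ?_⟩, ?_⟩
  · have := hd (e + 1) x
    rw [h2] at this
    rw [LinearMap.comp_apply, this]
    exact hf.2 _ (hX.par_mem _ x hx)
  · rintro f ⟨hf, g, hg, h⟩
    refine ⟨GrData.IsFin.comp hf hb, g ∘ₗ X.G.par (e + 1),
      GrData.IsFin.comp hg (hX.lawful.par_deg (e + 1)).bdd, fun x hx => ?_⟩
    rw [LinearMap.comp_apply, LinearMap.comp_apply, h _ (hX.par_mem e x hx), hd]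

/-- The criterion of a homotopy equivalence, required only on the subcomplexes. Injectivity follows
from `p r = id`. For surjectivity `[f ∘ r]` is the preimage of `[f]`, and `-(f ∘ s)` has the
difference as its coboundary. -/
theorem pull_bijective {p : X.M →ₗ[ℤ] Y.M} (h : IsChainMap X Y p) (r : Y.M →ₗ[ℤ] X.M)
    (s : X.M →ₗ[ℤ] X.M) (r_bdd : GrData.IsBdd Y.G X.G r) (s_bdd : GrData.IsBdd X.G X.G s)
    (r_mem : ∀ y ∈ Y.N, r y ∈ X.N) (r_d : ∀ y ∈ Y.N, r (Y.d y) = X.d (r y))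
    (s_mem : ∀ x ∈ X.N, s x ∈ X.N)
    (hs : ∀ x ∈ X.N, x - r (p x) = X.d (s x) + s (X.d x)) (hr : ∀ y ∈ Y.N, p (r y) = y) :
    Function.Bijective (pull h.pullOK) := by
  constructor
  · rw [injective_iff_map_eq_zero]
    intro a ha
    obtain ⟨f, rfl⟩ := Y.cls_surjective a
    rw [pull_cls, cls_eq_zero] at ha
    obtain ⟨-, g, hg, e⟩ := ha
    rw [cls_eq_zero]
    refine ⟨f.2.1, g ∘ₗ r, GrData.IsFin.comp hg r_bdd, fun y hy => ?_⟩
    rw [LinearMap.comp_apply, r_d y hy, ← e _ (r_mem y hy), LinearMap.comp_apply, hr y hy]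
  · intro a
    obtain ⟨f, rfl⟩ := X.cls_surjective a
    have hf : f.1 ∘ₗ r ∈ Y.cocycles := ⟨GrData.IsFin.comp f.2.1 r_bdd, fun y hy => by
      rw [LinearMap.comp_apply, r_d y hy]
      exact f.2.2 _ (r_mem y hy)⟩
    refine ⟨Y.cls ⟨_, hf⟩, ?_⟩
    rw [pull_cls, cls_eq]
    refine ⟨(X.cocycles.sub_mem (h.pullOK.cocycle _ hf) f.2).1, -(f.1 ∘ₗ s),
      by simpa using X.gdual_smul (-1) (GrData.IsFin.comp f.2.1 s_bdd), fun x hx => ?_⟩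
    have e := congrArg f.1 (hs x hx)
    rw [map_sub, map_add, f.2.2 _ (s_mem x hx), zero_add] at e
    simp only [LinearMap.sub_apply, LinearMap.comp_apply, LinearMap.neg_apply, ← e, neg_sub]

/-- The coproducts need to agree only up to a homotopy `T`. Evaluating `f ⊗ g`, which kills
boundaries of `N' ⊗ N'`, on the homotopy formula exhibits the difference of the two products as the
coboundary of `-(f ⊗ g) ∘ T`. -/
theorem pull_mul {p : X.M →ₗ[ℤ] Y.M} (h : IsChainMap X Y p) (hX : X.MulOK) (hY : Y.MulOK)
    (T : X.M →ₗ[ℤ] Y.M ⊗[ℤ] Y.M) (T_bdd : GrData.IsBdd X.G (Y.G.prod Y.G) T)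
    (T_mem : ∀ x ∈ X.N, T x ∈ tensorSub Y.N Y.N)
    (hT : ∀ x ∈ X.N, TensorProduct.map p p (X.Ψ x) - Y.Ψ (p x) =
      tensorD Y.G Y.d Y.d (T x) + T (X.d x)) (a b : Y.Coh) :
    pull h.pullOK (Y.mul hY a b) = X.mul hX (pull h.pullOK a) (pull h.pullOK b) := by
  obtain ⟨f, rfl⟩ := Y.cls_surjective a
  obtain ⟨g, rfl⟩ := Y.cls_surjective b
  rw [mul_cls, pull_cls, pull_cls, pull_cls, mul_cls, cls_eq]
  refine ⟨(X.cocycles.sub_mem (h.pullOK.cocycle _ (hY.mul_mem _ f.2 _ g.2))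
      (hX.mul_mem _ (h.pullOK.cocycle _ f.2) _ (h.pullOK.cocycle _ g.2))).1,
    -(TensorProduct.dualDistrib ℤ Y.M Y.M (f.1 ⊗ₜ g.1) ∘ₗ T),
    by simpa using X.gdual_smul (-1) ((GrData.IsFin.tmul f.2.1 g.2.1).comp T_bdd),
    fun x hx => ?_⟩
  have e := congrArg (TensorProduct.dualDistrib ℤ Y.M Y.M (f.1 ⊗ₜ g.1)) (hT x hx)
  rw [map_sub, map_add, dual_tensorD_eq_zero f.2.2 g.2.2 (T_mem x hx), zero_add] at e
  have e' : TensorProduct.dualDistrib ℤ X.M X.M ((f.1 ∘ₗ p) ⊗ₜ (g.1 ∘ₗ p)) =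
      TensorProduct.dualDistrib ℤ Y.M Y.M (f.1 ⊗ₜ g.1) ∘ₗ TensorProduct.map p p := by
    ext; simp
  simp only [LinearMap.sub_apply, LinearMap.comp_apply, LinearMap.neg_apply, ← e, neg_sub,
    cup_apply, e']

end CoalgData

/-! ### Signs -/

theorem sg_add (a b : ZMod 2) : sg (a + b) = sg a * sg b := by revert a b; decide

theorem sg_mul_self (a : ZMod 2) : sg a * sg a = 1 := by revert a; decide

theorem sg_zero : sg 0 = 1 := rfl

theorem zmod_two_add_self (a : ZMod 2) : a + a = 0 := by revert a; decide

section PairSum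

variable {m : ℕ}

theorem pairSum_add_left (a a' b : Fin m → ZMod 2) :
    pairSum (a + a') b = pairSum a b + pairSum a' b := by
  simp only [pairSum, Pi.add_apply, add_mul, Finset.sum_add_distrib]

theorem pairSum_add_right (a b b' : Fin m → ZMod 2) :
    pairSum a (b + b') = pairSum a b + pairSum a b' := by
  simp only [pairSum, Pi.add_apply, mul_add, Finset.sum_add_distrib]

theorem pairSum_eq (a b : Fin m → ZMod 2) :
    pairSum a b = ∑ i, ∑ j, if i < j then a i * b j else 0 := by
  rw [pairSum, Finset.sum_filter, ← Finset.univ_product_univ, Finset.sum_product]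

/-- The sum over the indices before `k`. -/
def sumBefore (a : Fin m → ZMod 2) (k : Fin m) : ZMod 2 := ∑ i, if i < k then a i else 0

theorem sumBefore_add (a b : Fin m → ZMod 2) (k : Fin m) :
    sumBefore (a + b) k = sumBefore a k + sumBefore b k := by
  simp only [sumBefore, Pi.add_apply, ← Finset.sum_add_distrib]
  refine Finset.sum_congr rfl fun i _ => ?_
  split_ifs <;> simp

theorem pairSum_single_right (a : Fin m → ZMod 2) (k : Fin m) :
    pairSum a (Pi.single k 1) = sumBefore a k := by
  rw [pairSum_eq, sumBefore]
  refine Finset.sum_congr rfl fun i _ => ?_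
  rw [Finset.sum_eq_single k]
  · simp
  · intro j _ hj; simp [Pi.single_eq_of_ne hj]
  · simp

/-- The left side is the sum over the indices after `k`, that is, the total sum minus the part up to
and including `k`; signs do not matter modulo 2. -/
theorem pairSum_single_left (a : Fin m → ZMod 2) (k : Fin m) :
    pairSum (Pi.single k 1) a = ∑ i, a i + a k + sumBefore a k := by
  have h : pairSum (Pi.single k 1) a = ∑ j, if k < j then a j else 0 := by
    rw [pairSum_eq, Finset.sum_eq_single k]
    · simp
    · intro i _ hi; simp [Pi.single_eq_of_ne hi]
    · simp
  have h' : a k = ∑ i, if i = k then a i else 0 := by simp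
  rw [h, sumBefore, h', ← Finset.sum_add_distrib, ← Finset.sum_add_distrib]
  refine Finset.sum_congr rfl fun i _ => ?_
  rcases lt_trichotomy i k with hik | rfl | hik
  · simp [hik, hik.ne, hik.not_gt, zmod_two_add_self]
  · simp [zmod_two_add_self]
  · simp [hik, hik.ne', hik.not_gt]

end PairSum

theorem LinearMap.sum_comp_eq {R M N P ι : Type*} [CommRing R] [AddCommGroup M] [Module R M]
    [AddCommGroup N] [Module R N] [AddCommGroup P] [Module R P] (s : Finset ι)
    (f : ι → N →ₗ[R] P) (g : M →ₗ[R] N) : (∑ i ∈ s, f i) ∘ₗ g = ∑ i ∈ s, f i ∘ₗ g := by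
  ext; simp [LinearMap.sum_apply]

theorem LinearMap.comp_sum_eq {R M N P ι : Type*} [CommRing R] [AddCommGroup M] [Module R M]
    [AddCommGroup N] [Module R N] [AddCommGroup P] [Module R P] (s : Finset ι)
    (f : N →ₗ[R] P) (g : ι → M →ₗ[R] N) : f ∘ₗ (∑ i ∈ s, g i) = ∑ i ∈ s, f ∘ₗ g i := by
  ext; simp [LinearMap.sum_apply]

/-! ### Tensor products of complexes -/

section PiTensor

variable {m : ℕ} {A : Fin m → Type u} [∀ k, AddCommGroup (A k)] [∀ k, Module ℤ (A k)]
  {B : Fin m → Type v} [∀ k, AddCommGroup (B k)] [∀ k, Module ℤ (B k)]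
  {GA : ∀ k, GrData (A k)} {GB : ∀ k, GrData (B k)}

/-! ### Polyhedral subcomplexes of a tensor product. -/

section poly

variable {K : LowerSet (Finset (Fin m))} {L : ∀ k, Submodule ℤ (A k)}
  {L' : ∀ k, Submodule ℤ (B k)}

theorem tprod_mem_poly {τ : Finset (Fin m)} (hτ : τ ∈ K) {x : ∀ k, A k}
    (hx : ∀ k, k ∉ τ → x k ∈ L k) : PiTensorProduct.tprod ℤ x ∈ poly K L :=
  (le_iSup₂_of_le τ hτ le_rfl : Submodule.span ℤ _ ≤ poly K L)
    (Submodule.subset_span ⟨x, hx, rfl⟩)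

theorem poly_le {Q : Submodule ℤ (⨂[ℤ] k, A k)}
    (h : ∀ τ ∈ K, ∀ x : ∀ k, A k, (∀ k, k ∉ τ → x k ∈ L k) → PiTensorProduct.tprod ℤ x ∈ Q) :
    poly K L ≤ Q := by
  refine iSup₂_le fun τ hτ => Submodule.span_le.2 ?_
  rintro _ ⟨x, hx, rfl⟩
  exact h τ hτ x hx

theorem map_mem_poly {f : ∀ k, A k →ₗ[ℤ] B k} (hf : ∀ k, ∀ x ∈ L k, f k x ∈ L' k)
    {x : ⨂[ℤ] k, A k} (hx : x ∈ poly K L) : PiTensorProduct.map f x ∈ poly K L' := by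
  have : poly K L ≤ (poly K L').comap (PiTensorProduct.map f) := poly_le fun τ hτ x hx => by
    rw [Submodule.mem_comap, PiTensorProduct.map_tprod]
    exact tprod_mem_poly hτ fun k hk => hf k _ (hx k hk)
  exact this hx

theorem sgn_mem_of_par {M : Type*} [AddCommGroup M] [Module ℤ M] {G : GrData M}
    {N : Submodule ℤ M} (h : ∀ e, ∀ x ∈ N, G.par e x ∈ N) {x : M} (hx : x ∈ N) : G.sgn x ∈ N :=
  N.sub_mem (h 0 x hx) (h 1 x hx)

theorem piD_mem_poly {d : ∀ k, A k →ₗ[ℤ] A k} (hd : ∀ k, ∀ x ∈ L k, d k x ∈ L k)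
    (hs : ∀ k e, ∀ x ∈ L k, (GA k).par e x ∈ L k) {x : ⨂[ℤ] k, A k} (hx : x ∈ poly K L) :
    piD GA d x ∈ poly K L := by
  rw [piD, LinearMap.sum_apply]
  refine Submodule.sum_mem _ fun k _ => map_mem_poly (fun i y hy => ?_) hx
  split_ifs
  · exact sgn_mem_of_par (hs i) hy
  · exact hd i y hy
  · exact hy

theorem pi_par_mem_poly (hs : ∀ k e, ∀ x ∈ L k, (GA k).par e x ∈ L k) (e : ZMod 2)
    {x : ⨂[ℤ] k, A k} (hx : x ∈ poly K L) : (GrData.pi GA).par e x ∈ poly K L := by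
  rw [GrData.pi, LinearMap.sum_apply]
  exact Submodule.sum_mem _ fun a _ => map_mem_poly (fun i y hy => hs i _ y hy) hx

end poly

theorem piD_deg {d : ∀ k, A k →ₗ[ℤ] A k} (hG : ∀ k, (GA k).Lawful)
    (hd : ∀ k, GrData.IsDeg (GA k) (GA k) (d k) (-1)) :
    GrData.IsDeg (GrData.pi GA) (GrData.pi GA) (piD GA d) (-1) := by
  refine GrData.IsDeg.sum fun k _ => ?_
  have : ∑ i : Fin m, (if i = k then (-1 : ℤ) else 0) = -1 := by simp
  rw [← this]
  refine GrData.IsDeg.piMap fun i => ?_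
  split_ifs with h1 h2 h2
  · exact absurd h2 h1.ne
  · exact (hG i).sgn_deg
  · exact hd i
  · exact GrData.IsDeg.id

theorem piD_comm {d : ∀ k, A k →ₗ[ℤ] A k} {d' : ∀ k, B k →ₗ[ℤ] B k} {f : ∀ k, A k →ₗ[ℤ] B k}
    (hs : ∀ k, (GB k).sgn ∘ₗ f k = f k ∘ₗ (GA k).sgn) (hd : ∀ k, d' k ∘ₗ f k = f k ∘ₗ d k) :
    piD GB d' ∘ₗ PiTensorProduct.map f = PiTensorProduct.map f ∘ₗ piD GA d := by
  rw [piD, piD, LinearMap.sum_comp_eq, LinearMap.comp_sum_eq]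
  refine Finset.sum_congr rfl fun k _ => ?_
  rw [← PiTensorProduct.map_comp, ← PiTensorProduct.map_comp]
  congr 1
  funext i
  split_ifs
  · exact hs i
  · exact hd i
  · rfl

theorem PiTensorProduct.map_eq_neg {f g : ∀ k, A k →ₗ[ℤ] B k} (k : Fin m) (hk : g k = -f k)
    (h : ∀ i, i ≠ k → g i = f i) : PiTensorProduct.map g = -PiTensorProduct.map f := by
  have hg : g = Function.update f k ((-1 : ℤ) • f k) := by
    funext i
    by_cases hi : i = k
    · subst hi; simp [hk]
    · rw [Function.update_of_ne hi, h i hi]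
  rw [hg, PiTensorProduct.map_update_smul, Function.update_eq_self]
  ext; simp

theorem PiTensorProduct.map_eq_add {f g h : ∀ k, A k →ₗ[ℤ] B k} (k : Fin m)
    (hk : h k = f k + g k) (hf : ∀ i, i ≠ k → h i = f i) (hg : ∀ i, i ≠ k → h i = g i) :
    PiTensorProduct.map h = PiTensorProduct.map f + PiTensorProduct.map g := by
  have e : h = Function.update h k (f k + g k) := by rw [← hk, Function.update_eq_self]
  have e1 : Function.update h k (f k) = f := by
    funext i
    by_cases hi : i = k
    · subst hi; simp
    · rw [Function.update_of_ne hi, hf i hi]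
  have e2 : Function.update h k (g k) = g := by
    funext i
    by_cases hi : i = k
    · subst hi; simp
    · rw [Function.update_of_ne hi, hg i hi]
  rw [e, PiTensorProduct.map_update_add, e1, e2]

/-- The homotopy between `f_1 ⊗ ⋯ ⊗ f_m` and `g_1 ⊗ ⋯ ⊗ g_m` given by homotopies `h_k` between
`f_k` and `g_k`. -/
def piHomotopy (GA : ∀ k, GrData (A k)) (f g h : ∀ k, A k →ₗ[ℤ] B k) :
    (⨂[ℤ] k, A k) →ₗ[ℤ] ⨂[ℤ] k, B k :=
  ∑ k : Fin m, PiTensorProduct.map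
    (fun i => if i < k then f i ∘ₗ (GA i).sgn else if i = k then h i else g i)

/-- The factors are changed from `g` to `f` one position at a time, from the left. -/
theorem map_sub_map_telescope (f g : ∀ k, A k →ₗ[ℤ] B k) :
    PiTensorProduct.map f - PiTensorProduct.map g = ∑ k : Fin m, PiTensorProduct.map
      (fun i => if i < k then f i else if i = k then f i - g i else g i) := by
  let F : ℕ → (⨂[ℤ] k, A k) →ₗ[ℤ] ⨂[ℤ] k, B k := fun n =>
    PiTensorProduct.map (fun i : Fin m => if (i : ℕ) < n then f i else g i)
  have h : ∀ k : Fin m, PiTensorProduct.map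
      (fun i => if i < k then f i else if i = k then f i - g i else g i) =
        F ((k : ℕ) + 1) - F k := by
    intro k
    rw [eq_sub_iff_add_eq]
    refine (PiTensorProduct.map_eq_add k ?_ ?_ ?_).symm
    · simp
    · intro i hi
      have : (i : ℕ) ≠ k := fun h => hi (Fin.ext h)
      have h2 : (i : ℕ) < k + 1 ↔ i < k := by rw [Fin.lt_def]; omega
      simp [h2, hi]
    · intro i hi
      have : (i : ℕ) ≠ k := fun h => hi (Fin.ext h)
      have h2 : (i : ℕ) < k + 1 ↔ (i : ℕ) < k := by omega
      simp [h2]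
  rw [Finset.sum_congr rfl fun k _ => h k,
    Fin.sum_univ_eq_sum_range (fun k => F (k + 1) - F k) m, Finset.sum_range_sub]
  simp [F]

/-- The terms in which differential and homotopy act on the same factor give the telescoping sum.
Terms on two different factors cancel in pairs, since exchanging two odd maps changes the sign. -/
theorem piHomotopy_spec {d : ∀ k, A k →ₗ[ℤ] A k} {d' : ∀ k, B k →ₗ[ℤ] B k}
    {f g h : ∀ k, A k →ₗ[ℤ] B k} (hA : ∀ k, (GA k).sgn ∘ₗ (GA k).sgn = LinearMap.id)
    (hfs : ∀ k, (GB k).sgn ∘ₗ f k = f k ∘ₗ (GA k).sgn)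
    (hgs : ∀ k, (GB k).sgn ∘ₗ g k = g k ∘ₗ (GA k).sgn)
    (hhs : ∀ k, (GB k).sgn ∘ₗ h k = -(h k ∘ₗ (GA k).sgn))
    (hds : ∀ k, (GA k).sgn ∘ₗ d k = -(d k ∘ₗ (GA k).sgn))
    (hfd : ∀ k, d' k ∘ₗ f k = f k ∘ₗ d k) (hgd : ∀ k, d' k ∘ₗ g k = g k ∘ₗ d k)
    (hh : ∀ k, f k - g k = d' k ∘ₗ h k + h k ∘ₗ d k) :
    PiTensorProduct.map f - PiTensorProduct.map g =
      piD GB d' ∘ₗ piHomotopy GA f g h + piHomotopy GA f g h ∘ₗ piD GA d := by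
  rw [map_sub_map_telescope, piHomotopy, piD, piD, LinearMap.sum_comp_eq, LinearMap.sum_comp_eq]
  simp only [LinearMap.comp_sum_eq]
  rw [Finset.sum_comm (γ := Fin m) (s := Finset.univ) (t := Finset.univ), ← Finset.sum_add_distrib]
  refine Finset.sum_congr rfl fun k _ => ?_
  rw [← Finset.sum_add_distrib, Finset.sum_eq_single k]
  · rw [← PiTensorProduct.map_comp, ← PiTensorProduct.map_comp]
    refine PiTensorProduct.map_eq_add k ?_ ?_ ?_
    · simp [hh]
    · intro i hi
      by_cases hik : i < k
      · simp only [if_pos hik]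
        rw [← LinearMap.comp_assoc, hfs, LinearMap.comp_assoc, hA, LinearMap.comp_id]
      · simp [if_neg hik, if_neg hi]
    · intro i hi
      by_cases hik : i < k
      · simp only [if_pos hik]
        rw [LinearMap.comp_assoc, hA, LinearMap.comp_id]
      · simp [if_neg hik, if_neg hi]
  · intro j _ hj
    rw [← PiTensorProduct.map_comp, ← PiTensorProduct.map_comp]
    -- The differential sits at `j`, the homotopy at `k`. If `j` comes first, the sign arises at
    -- `j`, where the sign involution belonging to the homotopy meets the differential; otherwise it
    -- arises at `k`, where the one belonging to the differential meets `h`.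
    rcases lt_or_gt_of_ne hj with hjk | hkj
    · rw [PiTensorProduct.map_eq_neg (g := fun i => (if i < j then (GB i).sgn else
          if i = j then d' i else LinearMap.id) ∘ₗ _) j ?_ fun i hi => ?_, neg_add_cancel]
      · simp only [lt_irrefl, if_false, if_true, if_pos hjk]
        rw [← LinearMap.comp_assoc, hfd, LinearMap.comp_assoc, LinearMap.comp_assoc, hds,
          LinearMap.comp_neg, neg_neg]
      · rcases lt_or_gt_of_ne hi with h1 | h1
        · simp only [if_pos h1, if_pos (h1.trans hjk)]
          rw [← LinearMap.comp_assoc, hfs]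
        · simp only [if_neg h1.not_gt, if_neg h1.ne']
          rfl
    · rw [PiTensorProduct.map_eq_neg (g := fun i => (if i < j then (GB i).sgn else
          if i = j then d' i else LinearMap.id) ∘ₗ _) k ?_ fun i hi => ?_, neg_add_cancel]
      · simp only [lt_irrefl, if_false, if_true, if_pos hkj]
        rw [hhs]
      · rcases lt_or_gt_of_ne hi with h1 | h1
        · simp only [if_pos h1, if_pos (h1.trans hkj)]
          rw [← LinearMap.comp_assoc, hfs]
        · simp only [if_neg h1.not_gt, if_neg h1.ne']
          split_ifs
          · exact hgs i
          · exact hgd i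
          · rfl
  · simp

theorem piHomotopy_deg {f g h : ∀ k, A k →ₗ[ℤ] B k} (hG : ∀ k, (GA k).Lawful)
    (hf : ∀ k, GrData.IsDeg (GA k) (GB k) (f k) 0) (hg : ∀ k, GrData.IsDeg (GA k) (GB k) (g k) 0)
    (hh : ∀ k, GrData.IsDeg (GA k) (GB k) (h k) 1) :
    GrData.IsDeg (GrData.pi GA) (GrData.pi GB) (piHomotopy GA f g h) 1 := by
  refine GrData.IsDeg.sum fun k _ => ?_
  have : ∑ i : Fin m, (if i = k then (1 : ℤ) else 0) = 1 := by simp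
  rw [← this]
  refine GrData.IsDeg.piMap fun i => ?_
  split_ifs with h1 h2 h2
  · exact absurd h2 h1.ne
  · exact (hf i).comp' (hG i).sgn_deg (add_zero 0)
  · exact hh i
  · exact hg i

theorem piHomotopy_mem_poly {K : LowerSet (Finset (Fin m))} {L : ∀ k, Submodule ℤ (A k)}
    {L' : ∀ k, Submodule ℤ (B k)} {f g h : ∀ k, A k →ₗ[ℤ] B k}
    (hs : ∀ k e, ∀ x ∈ L k, (GA k).par e x ∈ L k)
    (hf : ∀ k, ∀ x ∈ L k, f k x ∈ L' k) (hg : ∀ k, ∀ x ∈ L k, g k x ∈ L' k)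
    (hh : ∀ k, ∀ x ∈ L k, h k x ∈ L' k) {x : ⨂[ℤ] k, A k} (hx : x ∈ poly K L) :
    piHomotopy GA f g h x ∈ poly K L' := by
  rw [piHomotopy, LinearMap.sum_apply]
  refine Submodule.sum_mem _ fun k _ => map_mem_poly (fun i y hy => ?_) hx
  split_ifs
  · exact hf i _ (sgn_mem_of_par (hs i) hy)
  · exact hh i y hy
  · exact hg i y hy

theorem piD_tprod {d : ∀ k, A k →ₗ[ℤ] A k} (hG : ∀ k, (GA k).Lawful) {e : Fin m → ZMod 2}
    {x : ∀ k, A k} (hx : ∀ k, (GA k).par (e k) (x k) = x k) :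
    piD GA d (PiTensorProduct.tprod ℤ x) =
      ∑ k, sg (sumBefore e k) • PiTensorProduct.tprod ℤ (Function.update x k (d k (x k))) := by
  rw [piD, LinearMap.sum_apply]
  refine Finset.sum_congr rfl fun k _ => ?_
  rw [PiTensorProduct.map_tprod]
  have h : (fun i => (if i < k then (GA i).sgn else if i = k then d i else LinearMap.id) (x i)) =
      fun i => (if i < k then sg (e i) else 1) • Function.update x k (d k (x k)) i := by
    funext i
    rcases lt_trichotomy i k with h | rfl | h
    · simp [h, h.ne, (hG i).sgn_hom (hx i)]
    · simp
    · simp [h.not_gt, h.ne']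
  have h2 : ∏ i, (if i < k then sg (e i) else 1) = sg (sumBefore e k) := by
    rw [sumBefore]
    induction (Finset.univ : Finset (Fin m)) using Finset.induction_on with
    | empty => rfl
    | insert i s hi ih =>
      rw [Finset.prod_insert hi, Finset.sum_insert hi, sg_add, ih]
      split_ifs <;> simp [sg_zero]
  rw [h, MultilinearMap.map_smul_univ, h2]

/-! ### The shuffle -/

theorem homogeneous_span (hA : ∀ k, (GA k).Lawful) (hB : ∀ k, (GB k).Lawful) (k : Fin m) :
    Submodule.span ℤ {z : A k ⊗[ℤ] B k | ∃ e e' a b, (GA k).par e a = a ∧ (GB k).par e' b = b ∧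
      z = a ⊗ₜ b} = ⊤ := by
  refine top_unique fun z _ => ?_
  induction z with
  | zero => exact Submodule.zero_mem _
  | tmul a b =>
    rw [← (hA k).sum_par_apply a, ← (hB k).sum_par_apply b, TensorProduct.sum_tmul]
    refine Submodule.sum_mem _ fun e _ => ?_
    rw [TensorProduct.tmul_sum]
    refine Submodule.sum_mem _ fun e' _ => Submodule.subset_span ⟨e, e', _, _, ?_, ?_, rfl⟩
    · exact (hA k).par_par_self _ _
    · exact (hB k).par_par_self _ _
  | add x y hx hy => exact Submodule.add_mem _ (hx trivial) (hy trivial)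

theorem par_map_tprod (hA : ∀ k, (GA k).Lawful) {e : Fin m → ZMod 2} {x : ∀ k, A k}
    (hx : ∀ k, (GA k).par (e k) (x k) = x k) (e' : Fin m → ZMod 2) :
    PiTensorProduct.tprod ℤ (fun k => (GA k).par (e' k) (x k)) =
      if e = e' then PiTensorProduct.tprod ℤ x else 0 := by
  split_ifs with h
  · subst h; simp only [hx]
  · obtain ⟨k, hk⟩ := Function.ne_iff.1 h
    refine MultilinearMap.map_coord_zero _ k ?_
    rw [(hA k).par_hom (hx k), if_neg hk]

/-- For homogeneous entries a single pair of parity vectors survives in the defining sum. -/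
theorem shuffle_tprod (hA : ∀ k, (GA k).Lawful) (hB : ∀ k, (GB k).Lawful)
    {e e' : Fin m → ZMod 2} {a : ∀ k, A k} {b : ∀ k, B k}
    (ha : ∀ k, (GA k).par (e k) (a k) = a k) (hb : ∀ k, (GB k).par (e' k) (b k) = b k) :
    shuffle GA GB (PiTensorProduct.tprod ℤ fun k => a k ⊗ₜ b k) =
      sg (pairSum e' e) • (PiTensorProduct.tprod ℤ a ⊗ₜ[ℤ] PiTensorProduct.tprod ℤ b) := by
  simp only [shuffle, LinearMap.sum_apply]
  rw [Finset.sum_eq_single e, Finset.sum_eq_single e']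
  · rw [LinearMap.smul_apply, LinearMap.comp_apply, PiTensorProduct.map_tprod]
    simp only [TensorProduct.map_tmul, ha, hb]
    rw [shuffle₀_tprod]
  · intro c _ hc
    rw [LinearMap.smul_apply, LinearMap.comp_apply, PiTensorProduct.map_tprod]
    simp only [TensorProduct.map_tmul]
    rw [shuffle₀_tprod, par_map_tprod hB hb, if_neg (Ne.symm hc), TensorProduct.tmul_zero,
      smul_zero]
  · simp
  · intro c _ hc
    refine Finset.sum_eq_zero fun c' _ => ?_
    rw [LinearMap.smul_apply, LinearMap.comp_apply, PiTensorProduct.map_tprod]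
    simp only [TensorProduct.map_tmul]
    rw [shuffle₀_tprod, par_map_tprod hA ha, if_neg (Ne.symm hc), TensorProduct.zero_tmul,
      smul_zero]
  · simp

theorem shuffle_ext {N : Type*} [AddCommGroup N] [Module ℤ N] (hA : ∀ k, (GA k).Lawful)
    (hB : ∀ k, (GB k).Lawful) {f g : (⨂[ℤ] k, (A k ⊗[ℤ] B k)) →ₗ[ℤ] N}
    (h : ∀ (e e' : Fin m → ZMod 2) (a : ∀ k, A k) (b : ∀ k, B k),
      (∀ k, (GA k).par (e k) (a k) = a k) → (∀ k, (GB k).par (e' k) (b k) = b k) →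
      f (PiTensorProduct.tprod ℤ fun k => a k ⊗ₜ b k) =
        g (PiTensorProduct.tprod ℤ fun k => a k ⊗ₜ b k)) : f = g := by
  refine PiTensorProduct.ext_span _ (homogeneous_span hA hB) fun x hx => ?_
  choose e e' a b ha hb hx using hx
  obtain rfl : x = _ := funext hx
  exact h e e' a b ha hb

theorem shuffle_deg (hA : ∀ k, (GA k).Lawful) (hB : ∀ k, (GB k).Lawful) :
    GrData.IsDeg (GrData.pi fun k => (GA k).prod (GB k)) ((GrData.pi GA).prod (GrData.pi GB))
      (shuffle GA GB) 0 := by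
  refine GrData.IsDeg.of_zero fun n z hz => ?_
  refine GrData.pi_gr_le (Q := (((GrData.pi GA).prod (GrData.pi GB)).gr n).comap
    (shuffle GA GB)) (fun c hc x hx => ?_) hz
  refine PiTensorProduct.tprod_mem_of_span _ _ (fun x hx => ?_) x hx
  choose p q hpq a ha b hb hx using hx
  obtain rfl : x = _ := funext hx
  rw [Submodule.mem_comap, shuffle_tprod hA hB (e := fun k => (p k : ZMod 2))
    (e' := fun k => (q k : ZMod 2)) (fun k => by simp [(hA k).par_gr _ _ _ (ha k)])
    (fun k => by simp [(hB k).par_gr _ _ _ (hb k)])]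
  refine Submodule.smul_mem _ _ (GrData.tmul_mem_prod (GrData.tprod_mem_pi ha rfl)
    (GrData.tprod_mem_pi hb rfl) ?_)
  rw [← Finset.sum_add_distrib, ← hc]
  exact Finset.sum_congr rfl fun k _ => hpq k

theorem shuffle_map {A' : Fin m → Type*} [∀ k, AddCommGroup (A' k)] [∀ k, Module ℤ (A' k)]
    {B' : Fin m → Type*} [∀ k, AddCommGroup (B' k)] [∀ k, Module ℤ (B' k)]
    {GA' : ∀ k, GrData (A' k)} {GB' : ∀ k, GrData (B' k)}
    (hA : ∀ k, (GA k).Lawful) (hB : ∀ k, (GB k).Lawful)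
    (hA' : ∀ k, (GA' k).Lawful) (hB' : ∀ k, (GB' k).Lawful)
    {f : ∀ k, A k →ₗ[ℤ] A' k} {g : ∀ k, B k →ₗ[ℤ] B' k}
    (hf : ∀ k, GrData.IsPar (GA k) (GA' k) (f k) 0) (hg : ∀ k, GrData.IsPar (GB k) (GB' k) (g k) 0) :
    shuffle GA' GB' ∘ₗ PiTensorProduct.map (fun k => TensorProduct.map (f k) (g k)) =
      TensorProduct.map (PiTensorProduct.map f) (PiTensorProduct.map g) ∘ₗ shuffle GA GB := by
  refine shuffle_ext hA hB fun e e' a b ha hb => ?_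
  rw [LinearMap.comp_apply, LinearMap.comp_apply, shuffle_tprod hA hB ha hb, map_smul,
    PiTensorProduct.map_tprod]
  simp only [TensorProduct.map_tmul]
  rw [shuffle_tprod hA' hB' (e := e) (e' := e') (fun k => by simpa using (hf k).hom (ha k))
    (fun k => by simpa using (hg k).hom (hb k)), PiTensorProduct.map_tprod,
    PiTensorProduct.map_tprod]

/-- The homogeneous parts of elements of `L` and `L'` stay there, so outside a simplex the spanning
tensors can be taken homogeneous with both entries in the subgroups. -/
theorem shuffle_mem_poly {K : LowerSet (Finset (Fin m))} {L : ∀ k, Submodule ℤ (A k)}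
    {L' : ∀ k, Submodule ℤ (B k)} (hA : ∀ k, (GA k).Lawful) (hB : ∀ k, (GB k).Lawful)
    (hL : ∀ k e, ∀ x ∈ L k, (GA k).par e x ∈ L k)
    (hL' : ∀ k e, ∀ x ∈ L' k, (GB k).par e x ∈ L' k) {z : ⨂[ℤ] k, (A k ⊗[ℤ] B k)}
    (hz : z ∈ poly K fun k => tensorSub (L k) (L' k)) :
    shuffle GA GB z ∈ tensorSub (poly K L) (poly K L') := by
  suffices h : poly K (fun k => tensorSub (L k) (L' k)) ≤
      (tensorSub (poly K L) (poly K L')).comap (shuffle GA GB) from h hz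
  refine poly_le fun τ hτ x hx => ?_
  refine PiTensorProduct.tprod_mem_of_span (fun k => {z : A k ⊗[ℤ] B k | ∃ e e' a b,
    (GA k).par e a = a ∧ (GB k).par e' b = b ∧ z = a ⊗ₜ b ∧ (k ∉ τ → a ∈ L k ∧ b ∈ L' k)})
    _ (fun x hx => ?_) x (fun k => ?_)
  · choose e e' a b ha hb hx hab using hx
    obtain rfl : x = _ := funext hx
    rw [Submodule.mem_comap, shuffle_tprod hA hB ha hb]
    exact Submodule.smul_mem _ _ (Submodule.apply_mem_map₂ _
      (tprod_mem_poly hτ fun k hk => (hab k hk).1) (tprod_mem_poly hτ fun k hk => (hab k hk).2))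
  · by_cases hk : k ∈ τ
    · have : x k ∈ (⊤ : Submodule ℤ _) := trivial
      rw [← homogeneous_span hA hB k] at this
      refine Submodule.span_mono ?_ this
      rintro _ ⟨e, e', a, b, ha, hb, rfl⟩
      exact ⟨e, e', a, b, ha, hb, rfl, fun h => absurd hk h⟩
    · refine (Submodule.map₂_le.2 fun a ha b hb => ?_ : tensorSub (L k) (L' k) ≤ _) (hx k hk)
      rw [TensorProduct.mk_apply, ← (hA k).sum_par_apply a, ← (hB k).sum_par_apply b,
        TensorProduct.sum_tmul]
      refine Submodule.sum_mem _ fun e _ => ?_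
      rw [TensorProduct.tmul_sum]
      exact Submodule.sum_mem _ fun e' _ => Submodule.subset_span ⟨e, e', _, _,
        (hA k).par_par_self _ _, (hB k).par_par_self _ _, rfl,
        fun _ => ⟨hL k e a ha, hL' k e' b hb⟩⟩

theorem update_hom {G : ∀ k, GrData (A k)} {d : ∀ k, A k →ₗ[ℤ] A k}
    (hd : ∀ k, GrData.IsPar (G k) (G k) (d k) 1) {e : Fin m → ZMod 2} {a : ∀ k, A k}
    (ha : ∀ k, (G k).par (e k) (a k) = a k) (k i : Fin m) :
    (G i).par ((e + Pi.single k 1 : Fin m → ZMod 2) i) (Function.update a k (d k (a k)) i) =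
      Function.update a k (d k (a k)) i := by
  by_cases h : i = k
  · subst h
    simpa using (hd i).hom (ha i)
  · simp [h, ha]

/-- Both sides are sums over the factor `k` that is differentiated. A differential raises one parity
at `k`, and bilinearity of `pairSum` compares the shuffle signs before and after. -/
theorem shuffle_piD {d : ∀ k, A k →ₗ[ℤ] A k} {d' : ∀ k, B k →ₗ[ℤ] B k}
    (hA : ∀ k, (GA k).Lawful) (hB : ∀ k, (GB k).Lawful)
    (hd : ∀ k, GrData.IsPar (GA k) (GA k) (d k) 1)
    (hd' : ∀ k, GrData.IsPar (GB k) (GB k) (d' k) 1) :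
    shuffle GA GB ∘ₗ piD (fun k => (GA k).prod (GB k)) (fun k => tensorD (GA k) (d k) (d' k)) =
      tensorD (GrData.pi GA) (piD GA d) (piD GB d') ∘ₗ shuffle GA GB := by
  refine shuffle_ext hA hB fun e e' a b ha hb => ?_
  rw [LinearMap.comp_apply, LinearMap.comp_apply, shuffle_tprod hA hB ha hb,
    piD_tprod (fun k => (hA k).prod (hB k)) (e := e + e')
      (fun k => GrData.prod_hom (hA k) (hB k) (ha k) (hb k)), map_sum]
  have hs : (GrData.pi GA).sgn (PiTensorProduct.tprod ℤ a) =
      sg (∑ k, e k) • PiTensorProduct.tprod ℤ a :=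
    (GrData.Lawful.pi hA).sgn_hom (GrData.pi_hom hA ha)
  have h1 : ∀ k, (Function.update (fun i => a i ⊗ₜ[ℤ] b i) k (d k (a k) ⊗ₜ[ℤ] b k)) =
      fun i => Function.update a k (d k (a k)) i ⊗ₜ[ℤ] b i := fun k => by
    funext i
    by_cases h : i = k
    · subst h; simp
    · simp [h]
  have h2 : ∀ k, (Function.update (fun i => a i ⊗ₜ[ℤ] b i) k (a k ⊗ₜ[ℤ] d' k (b k))) =
      fun i => a i ⊗ₜ[ℤ] Function.update b k (d' k (b k)) i := fun k => by
    funext i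
    by_cases h : i = k
    · subst h; simp
    · simp [h]
  rw [map_smul, tensorD, LinearMap.add_apply, TensorProduct.map_tmul, TensorProduct.map_tmul,
    piD_tprod hA ha, piD_tprod hB hb, hs, LinearMap.id_apply, TensorProduct.sum_tmul,
    TensorProduct.tmul_sum, ← Finset.sum_add_distrib, Finset.smul_sum]
  refine Finset.sum_congr rfl fun k _ => ?_
  have h3 : tensorD (GA k) (d k) (d' k) (a k ⊗ₜ[ℤ] b k) =
      d k (a k) ⊗ₜ b k + sg (e k) • (a k ⊗ₜ d' k (b k)) := by
    rw [tensorD, LinearMap.add_apply, TensorProduct.map_tmul, TensorProduct.map_tmul,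
      (hA k).sgn_hom (ha k), TensorProduct.smul_tmul', LinearMap.id_apply]
  rw [h3, MultilinearMap.map_update_add, MultilinearMap.map_update_smul, h1, h2, map_smul, map_add,
    map_smul, shuffle_tprod hA hB (update_hom hd ha k) hb,
    shuffle_tprod hA hB ha (update_hom hd' hb k), pairSum_add_left, pairSum_add_right,
    pairSum_single_left, pairSum_single_right, sumBefore_add, smul_add, smul_add]
  simp only [TensorProduct.smul_tmul', TensorProduct.tmul_smul, smul_smul, ← sg_add]
  -- In the two remaining exponents every surplus term occurs twice.
  have c2 := zmod_two_add_self
  congr 3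
  · congr 1
    linear_combination c2 (sumBefore e' k)
  · congr 1
    linear_combination c2 (e k) + c2 (sumBefore e k)

/-- The inverse of the shuffle, `(⨂ a_k) ⊗ (⨂ b_k) ↦ (-1)^{∑_{i<j} |b_i| |a_j|} ⨂ (a_k ⊗ b_k)`. -/
def unshuffle (GA : ∀ k, GrData (A k)) (GB : ∀ k, GrData (B k)) :
    (⨂[ℤ] k, A k) ⊗[ℤ] (⨂[ℤ] k, B k) →ₗ[ℤ] ⨂[ℤ] k, (A k ⊗[ℤ] B k) :=
  ∑ e : Fin m → ZMod 2, ∑ e' : Fin m → ZMod 2, sg (pairSum e' e) •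
    (TensorProduct.lift (PiTensorProduct.map₂ fun k => TensorProduct.mk ℤ (A k) (B k)) ∘ₗ
      TensorProduct.map (PiTensorProduct.map fun k => (GA k).par (e k))
        (PiTensorProduct.map fun k => (GB k).par (e' k)))

theorem unshuffle_tmul (hA : ∀ k, (GA k).Lawful) (hB : ∀ k, (GB k).Lawful)
    {e e' : Fin m → ZMod 2} {a : ∀ k, A k} {b : ∀ k, B k}
    (ha : ∀ k, (GA k).par (e k) (a k) = a k) (hb : ∀ k, (GB k).par (e' k) (b k) = b k) :
    unshuffle GA GB (PiTensorProduct.tprod ℤ a ⊗ₜ[ℤ] PiTensorProduct.tprod ℤ b) =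
      sg (pairSum e' e) • (PiTensorProduct.tprod ℤ fun k => a k ⊗ₜ[ℤ] b k) := by
  simp only [unshuffle, LinearMap.sum_apply, LinearMap.smul_apply, LinearMap.comp_apply,
    TensorProduct.map_tmul, PiTensorProduct.map_tprod, par_map_tprod hA ha, par_map_tprod hB hb]
  rw [Finset.sum_eq_single e, Finset.sum_eq_single e']
  · simp [PiTensorProduct.map₂_tprod_tprod]
  · intro c _ hc; simp [Ne.symm hc]
  · simp
  · intro c _ hc; simp [Ne.symm hc]
  · simp

theorem unshuffle_shuffle (hA : ∀ k, (GA k).Lawful) (hB : ∀ k, (GB k).Lawful) :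
    unshuffle GA GB ∘ₗ shuffle GA GB = LinearMap.id := by
  refine shuffle_ext hA hB fun e e' a b ha hb => ?_
  rw [LinearMap.comp_apply, shuffle_tprod hA hB ha hb, map_smul, unshuffle_tmul hA hB ha hb,
    smul_smul, sg_mul_self, one_smul, LinearMap.id_apply]

theorem unshuffle_deg (hA : ∀ k, (GA k).Lawful) (hB : ∀ k, (GB k).Lawful) :
    GrData.IsDeg ((GrData.pi GA).prod (GrData.pi GB)) (GrData.pi fun k => (GA k).prod (GB k))
      (unshuffle GA GB) 0 := by
  refine GrData.IsDeg.of_zero fun n z hz => ?_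
  refine GrData.prod_gr_le (Q := ((GrData.pi fun k => (GA k).prod (GB k)).gr n).comap
    (unshuffle GA GB)) (fun p q hpq x hx y hy => ?_) hz
  change x ∈ ((GrData.pi fun k => (GA k).prod (GB k)).gr n).comap
    (unshuffle GA GB ∘ₗ (TensorProduct.mk ℤ _ _).flip y)
  refine GrData.pi_gr_le (fun a ha x hx => ?_) hx
  change y ∈ ((GrData.pi fun k => (GA k).prod (GB k)).gr n).comap
    (unshuffle GA GB ∘ₗ TensorProduct.mk ℤ _ _ (PiTensorProduct.tprod ℤ x))
  refine GrData.pi_gr_le (fun b hb y hy => ?_) hy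
  rw [Submodule.mem_comap, LinearMap.comp_apply, TensorProduct.mk_apply,
    unshuffle_tmul hA hB (e := fun k => (a k : ZMod 2))
    (e' := fun k => (b k : ZMod 2)) (fun k => by simp [(hA k).par_gr _ _ _ (hx k)])
    (fun k => by simp [(hB k).par_gr _ _ _ (hy k)])]
  refine Submodule.smul_mem _ _ (GrData.tprod_mem_pi
    (fun k => GrData.tmul_mem_prod (hx k) (hy k) rfl) ?_)
  rw [Finset.sum_add_distrib, ha, hb, hpq]

end PiTensor

/-! ### Graded maps between direct sums -/

section Homogeneous

variable {X : ℤ → Type u} [∀ n, AddCommGroup (X n)] [∀ n, Module ℤ (X n)]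
  {Y : ℤ → Type v} [∀ n, AddCommGroup (Y n)] [∀ n, Module ℤ (Y n)]

theorem mem_ofSum_id {n : ℤ} {x : ⨁ n, X n} :
    x ∈ (GrData.ofSum X fun n => n).gr n ↔ ∃ y : X n, x = DirectSum.lof ℤ ℤ X n y := by
  constructor
  · intro hx
    induction hx using Submodule.span_induction with
    | mem x hx => obtain ⟨i, rfl, y, rfl⟩ := hx; exact ⟨y, rfl⟩
    | zero => exact ⟨0, by simp⟩
    | add x y _ _ hx hy =>
      obtain ⟨x, rfl⟩ := hx
      obtain ⟨y, rfl⟩ := hy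
      exact ⟨x + y, by simp⟩
    | smul c x _ hx => obtain ⟨x, rfl⟩ := hx; exact ⟨c • x, by simp⟩
  · rintro ⟨y, rfl⟩
    exact GrData.lof_mem_ofSum (X := X) (deg := fun n => n) n y

theorem lof_mem_gr (n : ℤ) (x : X n) :
    DirectSum.lof ℤ ℤ X n x ∈ (GrData.ofSum X fun n => n).gr n := mem_ofSum_id.2 ⟨x, rfl⟩

theorem DirectSum.lof_inj {I : Type*} [DecidableEq I] {X : I → Type*} [∀ i, AddCommGroup (X i)]
    [∀ i, Module ℤ (X i)] {i : I} {x y : X i}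
    (h : DirectSum.lof ℤ I X i x = DirectSum.lof ℤ I X i y) : x = y :=
  DirectSum.of_injective i h

/-- A homogeneous map commutes with the projections to homogeneous parts, up to the shift, so the
right component of any preimage is again a preimage. -/
theorem exists_homogeneous_preimage {f : (⨁ n, X n) →ₗ[ℤ] ⨁ n, Y n} {k : ℤ}
    (hf : GrData.IsDeg (GrData.ofSum X fun n => n) (GrData.ofSum Y fun n => n) f k) {n : ℤ}
    {y : ⨁ n, Y n} (hy : y ∈ (GrData.ofSum Y fun n => n).gr (n + k)) (h : y ∈ LinearMap.range f) :
    ∃ x ∈ (GrData.ofSum X fun n => n).gr n, f x = y := by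
  classical
  obtain ⟨x, rfl⟩ := h
  have e : projOn Y (fun i => i = n + k) ∘ₗ f = f ∘ₗ projOn X (fun i => i = n) := by
    refine DirectSum.linearMap_ext ℤ fun i => LinearMap.ext fun z => ?_
    obtain ⟨w, hw⟩ := mem_ofSum_id.1 (hf i _ (lof_mem_gr i z))
    simp only [LinearMap.comp_apply]
    rw [hw, projOn_lof, projOn_lof]
    by_cases hi : i = n
    · subst hi; simp [hw]
    · simp [hi]
  obtain ⟨w, hw⟩ := mem_ofSum_id.1 hy
  refine ⟨projOn X (fun i => i = n) x, ?_, ?_⟩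
  · clear hy e hw w
    induction x using DirectSum.induction_on with
    | zero => rw [map_zero]; exact Submodule.zero_mem _
    | of i z =>
      have := projOn_lof X (fun i => i = n) i z
      rw [DirectSum.lof_eq_of] at this
      rw [this]
      split_ifs with h
      · subst h; exact lof_mem_gr i z
      · exact Submodule.zero_mem _
    | add x y hx hy => rw [map_add]; exact Submodule.add_mem _ hx hy
  · have := LinearMap.congr_fun e x
    rw [LinearMap.comp_apply, LinearMap.comp_apply, hw, projOn_lof, if_pos rfl] at this
    rw [← this, hw]

end Homogeneous

/-! ### Homology of a complex and of an inclusion, in homogeneous terms. -/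

namespace ChainCx

variable {X : ℤ → Type u} [∀ n, AddCommGroup (X n)] [∀ n, Module ℤ (X n)] (c : ChainCx X)

theorem deg_d : GrData.IsDeg (GrData.ofSum X fun n => n) (GrData.ofSum X fun n => n) c.d (-1) :=
  GrData.isDeg_ofSum (X := X) (deg := fun n => n) (f := c.d) fun n x => by
    obtain ⟨y, hy⟩ := c.d_deg n x
    rw [hy]
    exact lof_mem_gr _ y

theorem mem_cycles {n : ℤ} {x : X n} : x ∈ c.cycles n ↔ c.d (DirectSum.lof ℤ ℤ X n x) = 0 :=
  Iff.rfl

theorem hcls_surjective (n : ℤ) : Function.Surjective (c.hcls n) := Submodule.mkQ_surjective _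

/-- Boundaries are defined through the total differential; homogeneity puts a primitive into degree
`n + 1`. -/
theorem hcls_eq_zero {n : ℤ} {z : c.cycles n} :
    c.hcls n z = 0 ↔ ∃ y ∈ (GrData.ofSum X fun n => n).gr (n + 1),
      c.d y = DirectSum.lof ℤ ℤ X n z := by
  refine (Submodule.Quotient.mk_eq_zero _).trans ⟨fun h => ?_, fun ⟨y, _, hy⟩ => ⟨y, hy⟩⟩
  exact exists_homogeneous_preimage (k := -1) c.deg_d
    (by rw [add_neg_cancel_right]; exact lof_mem_gr n _) h

end ChainCx

namespace ChainInclusion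

variable (E : ChainInclusion.{u})

theorem tot_lof (n : ℤ) (x : E.C n) :
    E.tot (DirectSum.lof ℤ ℤ E.C n x) = DirectSum.lof ℤ ℤ E.D n (E.incl n x) :=
  DirectSum.lmap_lof E.incl n x

theorem tot_deg : GrData.IsDeg E.GC E.GD E.tot 0 :=
  GrData.isDeg_ofSum (X := E.C) (deg := fun n => n) (f := E.tot) fun n x => by
    rw [E.tot_lof, add_zero]; exact lof_mem_gr _ _

theorem tot_injective : Function.Injective E.tot := by
  refine (injective_iff_map_eq_zero E.tot).2 fun x hx => ?_
  refine DFinsupp.ext fun n => ?_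
  have h : E.tot x n = 0 := by rw [hx]; rfl
  have h' : E.tot x n = E.incl n (x n) := DirectSum.lmap_apply E.incl x n
  rw [h', ← map_zero (E.incl n)] at h
  exact E.incl_injective n h

theorem tot_d (x : E.TotC) : E.tot (E.cxC.d x) = E.cxD.d (E.tot x) := E.incl_comm x

theorem θ_hcls (n : ℤ) (z : E.cxC.cycles n) :
    E.θ n (E.cxC.hcls n z) = E.cxD.hcls n ⟨E.incl n z, E.incl_cycles n z z.2⟩ := rfl

theorem mem_range_tot {n : ℤ} {x : E.D n} :
    DirectSum.lof ℤ ℤ E.D n x ∈ LinearMap.range E.tot ↔ x ∈ LinearMap.range (E.incl n) := by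
  constructor
  · intro h
    obtain ⟨y, hy, e⟩ := exists_homogeneous_preimage (k := 0) E.tot_deg
      (by rw [add_zero]; exact lof_mem_gr n x) h
    obtain ⟨c, rfl⟩ := mem_ofSum_id.1 hy
    rw [E.tot_lof] at e
    exact ⟨c, DirectSum.lof_inj e⟩
  · rintro ⟨c, rfl⟩
    exact ⟨_, E.tot_lof n c⟩

end ChainInclusion

/-! ### The character complex -/

section CharLemmas

variable {E : ChainInclusion.{u}} {S : Kind}

theorem charC_ext {N : Type*} [AddCommGroup N] [Module ℤ N] {f g : CharC E S →ₗ[ℤ] N}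
    (h : ∀ l n (x : CharGrp E l.idx n), f (inC E S l n x) = g (inC E S l n x)) : f = g :=
  DirectSum.linearMap_ext ℤ fun p => LinearMap.ext fun x => h p.1 p.2 x

theorem toModule_inC {N : Type*} [AddCommGroup N] [Module ℤ N]
    (f : ∀ p : Letter S × ℤ, CPiece E S p →ₗ[ℤ] N) (l : Letter S) (n : ℤ)
    (x : CharGrp E l.idx n) :
    DirectSum.toModule ℤ (Letter S × ℤ) N f (inC E S l n x) = f (l, n) x :=
  DirectSum.toModule_lof ℤ (φ := f) (l, n) x

theorem dChar_β (n : ℤ) (x : CharGrp E (Letter.β (S := S)).idx n) :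
    dChar E S (inC E S Letter.β n x) = inC E S Letter.γ n x :=
  toModule_inC _ Letter.β n x

theorem dChar_α (h : S = Kind.X) (n : ℤ) (x : CharGrp E (Letter.α h).idx n) :
    dChar E S (inC E S (Letter.α h) n x) = 0 :=
  toModule_inC _ (Letter.α h) n x

theorem dChar_γ (n : ℤ) (x : CharGrp E (Letter.γ (S := S)).idx n) : dChar E S (inC E S Letter.γ n x) = 0 :=
  toModule_inC _ Letter.γ n x

theorem dChar_η (n : ℤ) (x : CharGrp E (Letter.η (S := S)).idx n) : dChar E S (inC E S Letter.η n x) = 0 :=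
  toModule_inC _ Letter.η n x

theorem θ'_lof (κ : ∀ n, E.U n →ₗ[ℤ] LinearMap.ker (E.θ n)) (n : ℤ) (u : E.U n) :
    θ' E S κ (DirectSum.lof ℤ ℤ E.U n u) =
      inC E S Letter.γ n (κ n u) + inC E S Letter.η n ((E.θ n).rangeRestrict u) :=
  DirectSum.toModule_lof ℤ n u

theorem inC_mem_gr (l : Letter S) (n : ℤ) (x : CharGrp E l.idx n) :
    inC E S l n x ∈ (GCh E S).gr (n + l.deg) :=
  GrData.lof_mem_ofSum (X := CPiece E S) (deg := fun p => p.2 + p.1.deg) (l, n) x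

theorem GCh_lawful : (GCh E S).Lawful := GrData.ofSum_lawful _ _

theorem isDeg_charC {N : Type*} [AddCommGroup N] [Module ℤ N] {H : GrData N}
    {f : CharC E S →ₗ[ℤ] N} {k : ℤ}
    (h : ∀ l n (x : CharGrp E l.idx n), f (inC E S l n x) ∈ H.gr (n + l.deg + k)) :
    GrData.IsDeg (GCh E S) H f k :=
  GrData.isDeg_ofSum (X := CPiece E S) (deg := fun p => p.2 + p.1.deg) (f := f)
    fun p x => h p.1 p.2 x

theorem dChar_deg : GrData.IsDeg (GCh E S) (GCh E S) (dChar E S) (-1) := by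
  refine isDeg_charC fun l n x => ?_
  cases l with
  | α h => rw [dChar_α]; exact Submodule.zero_mem _
  | β =>
    rw [dChar_β]
    have := inC_mem_gr (E := E) (S := S) Letter.γ n x
    simpa [Letter.deg] using this
  | γ => rw [dChar_γ]; exact Submodule.zero_mem _
  | η => rw [dChar_η]; exact Submodule.zero_mem _

theorem θ'_deg (κ : ∀ n, E.U n →ₗ[ℤ] LinearMap.ker (E.θ n)) :
    GrData.IsDeg (GrData.ofSum E.U fun n => n) (GCh E S) (θ' E S κ) 0 :=
  GrData.isDeg_ofSum (X := E.U) (deg := fun n => n) (f := θ' E S κ) fun n u => by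
    rw [θ'_lof]
    exact Submodule.add_mem _ (inC_mem_gr (S := S) Letter.γ n (κ n u))
      (inC_mem_gr (S := S) Letter.η n ((E.θ n).rangeRestrict u))

theorem dChar_θ' (κ : ∀ n, E.U n →ₗ[ℤ] LinearMap.ker (E.θ n)) (u : TotU E) :
    dChar E S (θ' E S κ u) = 0 := by
  suffices h : dChar E S ∘ₗ θ' E S κ = 0 from LinearMap.congr_fun h u
  refine DirectSum.linearMap_ext ℤ fun n => LinearMap.ext fun u => ?_
  simp only [LinearMap.comp_apply]
  rw [θ'_lof, map_add]
  exact (congrArg₂ (· + ·) (dChar_γ n (κ n u)) (dChar_η n ((E.θ n).rangeRestrict u))).trans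
    (add_zero 0)

/-- The projection of the character complex onto `coker θ`. -/
def prA (E : ChainInclusion.{u}) (S : Kind) : CharC E S →ₗ[ℤ] CharC E S :=
  projOn (CPiece E S) fun p => ∃ h, p.1 = Letter.α h

theorem prC_inC (l l' : Letter S) (n : ℤ) (x : CharGrp E l'.idx n) :
    prC E S l (inC E S l' n x) = if l' = l then inC E S l' n x else 0 :=
  projOn_lof (CPiece E S) (fun p => p.1 = l) (l', n) x

theorem prA_α (h : S = Kind.X) (n : ℤ) (x : CharGrp E (Letter.α h).idx n) :
    prA E S (inC E S (Letter.α h) n x) = inC E S (Letter.α h) n x := by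
  classical
  exact (projOn_lof (CPiece E S) (fun p => ∃ h, p.1 = Letter.α h) (Letter.α h, n) x).trans
    (if_pos ⟨h, rfl⟩)

theorem prA_ne (l : Letter S) (hl : ∀ h, l ≠ Letter.α h) (n : ℤ) (x : CharGrp E l.idx n) :
    prA E S (inC E S l n x) = 0 := by
  classical
  exact (projOn_lof (CPiece E S) (fun p => ∃ h, p.1 = Letter.α h) (l, n) x).trans
    (if_neg fun ⟨h, e⟩ => hl h e)

theorem prA_add (x : CharC E S) :
    prA E S x + prC E S Letter.β x + prC E S Letter.γ x + prC E S Letter.η x = x := by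
  suffices h : prA E S + prC E S Letter.β + prC E S Letter.γ + prC E S Letter.η = LinearMap.id from
    LinearMap.congr_fun h x
  refine charC_ext fun l n x => ?_
  simp only [LinearMap.add_apply, prC_inC]
  cases l with
  | α h => simp [prA_α]
  | β => simp [prA_ne Letter.β (by simp)]
  | γ => simp [prA_ne Letter.γ (by simp)]
  | η => simp [prA_ne Letter.η (by simp)]

/-- The suspension `ker θ → Σ ker θ`. -/
def suspC (E : ChainInclusion.{u}) (S : Kind) : CharC E S →ₗ[ℤ] CharC E S :=
  DirectSum.toModule ℤ (Letter S × ℤ) (CharC E S) (fun p => match p with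
    | (Letter.γ, n) => inC E S Letter.β n
    | _ => 0)

theorem suspC_γ (n : ℤ) (x : CharGrp E (Letter.γ (S := S)).idx n) :
    suspC E S (inC E S Letter.γ n x) = inC E S Letter.β n x :=
  toModule_inC _ Letter.γ n x

theorem suspC_ne (l : Letter S) (hl : l ≠ Letter.γ) (n : ℤ) (x : CharGrp E l.idx n) :
    suspC E S (inC E S l n x) = 0 := by
  refine (toModule_inC _ l n x).trans ?_
  cases l with
  | γ => exact absurd rfl hl
  | α h => rfl
  | β => rfl
  | η => rfl

theorem suspC_dChar (x : CharC E S) : suspC E S (dChar E S x) = prC E S Letter.β x := by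
  suffices h : suspC E S ∘ₗ dChar E S = prC E S Letter.β from LinearMap.congr_fun h x
  refine charC_ext fun l n x => ?_
  rw [LinearMap.comp_apply, prC_inC]
  cases l with
  | α h => rw [dChar_α]; simp
  | β => rw [dChar_β]; exact (suspC_γ n x).trans (if_pos rfl).symm
  | γ => rw [dChar_γ]; simp
  | η => rw [dChar_η]; simp

theorem dChar_suspC (x : CharC E S) : dChar E S (suspC E S x) = prC E S Letter.γ x := by
  suffices h : dChar E S ∘ₗ suspC E S = prC E S Letter.γ from LinearMap.congr_fun h x
  refine charC_ext fun l n x => ?_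
  rw [LinearMap.comp_apply, prC_inC]
  cases l with
  | γ => rw [suspC_γ]; exact (dChar_β n x).trans (if_pos rfl).symm
  | α h => rw [suspC_ne _ (by simp)]; simp
  | β => rw [suspC_ne _ (by simp)]; simp
  | η => rw [suspC_ne _ (by simp)]; simp

theorem suspC_deg : GrData.IsDeg (GCh E S) (GCh E S) (suspC E S) 1 := by
  refine isDeg_charC fun l n x => ?_
  by_cases hl : l = Letter.γ
  · subst hl
    rw [suspC_γ]
    have := inC_mem_gr (E := E) (S := S) Letter.β n x
    simpa [Letter.deg] using this
  · rw [suspC_ne l hl]; exact Submodule.zero_mem _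

/-- The summand `α` is not shifted, so the only piece of type `α` in total degree `n` is the one
with internal degree `n`. -/
theorem prA_eq_of_mem_gr (h : S = Kind.X) {n : ℤ} {x : CharC E S} (hx : x ∈ (GCh E S).gr n) :
    prA E S x = inC E S (Letter.α h) n (x (Letter.α h, n)) := by
  induction hx using Submodule.span_induction with
  | mem x hx =>
    obtain ⟨⟨l, j⟩, hp, x, rfl⟩ := hx
    by_cases hl : l = Letter.α h
    · subst hl
      have hj : j = n := by simpa [Letter.deg] using hp
      subst hj
      rw [DirectSum.lof_apply]
      exact prA_α h j x
    · have e : (DirectSum.lof ℤ (Letter S × ℤ) (CPiece E S) (l, j) x) (Letter.α h, n) = 0 :=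
        DFinsupp.single_eq_of_ne fun e => hl (Prod.ext_iff.1 e).1.symm
      rw [e, map_zero]
      exact prA_ne l (fun _ e => hl e) j x
  | zero => rw [map_zero]; exact (map_zero _).symm
  | add x y _ _ hx hy => rw [map_add, hx, hy, ← map_add]; rfl
  | smul c x _ hx => rw [map_smul, hx, ← map_smul]; rfl

end CharLemmas

instance SplitInclusion.free_charGrp (E : SplitInclusion.{u}) {S : Kind} : ∀ (s : Idx S) (n : ℤ),
    Module.Free ℤ (CharGrp E.toChainInclusion s n)
  | Idx.sig _, n => E.free_coker n
  | Idx.omg, n => E.free_ker n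
  | Idx.emp, n => E.free_im n

/-! ### Quotient maps onto the character complex -/

/-- The quotient maps `q'`, `q` of character data. -/
structure QuotData (E : SplitInclusion.{u}) (S : Kind) where
  onto : S = Kind.R → ∀ n, Function.Surjective (E.θ n)
  κ : ∀ n, E.U n →ₗ[ℤ] LinearMap.ker (E.θ n)
  κ_ker : ∀ n (z : LinearMap.ker (E.θ n)), κ n z = z
  q' : ∀ n, E.C n →ₗ[ℤ] E.U n
  q'_cycle : ∀ n (z : E.cxC.cycles n), q' n z = E.cxC.hcls n z
  q : E.TotD →ₗ[ℤ] CharC E.toChainInclusion S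
  q_deg : ∀ n, ∀ x ∈ E.GD.gr n, q x ∈ (GCh E.toChainInclusion S).gr n
  q_chain : ∀ x, q (E.cxD.d x) = dChar E.toChainInclusion S (q x)
  q_tot : ∀ x, q (E.tot x) = θ' E.toChainInclusion S κ (totq' E.toChainInclusion q' x)
  q_coker : ∀ n (z : E.cxD.cycles n) (h : S = Kind.X),
    q (DirectSum.lof ℤ ℤ E.D n z) (Letter.α h, n) =
      (LinearMap.range (E.θ n)).mkQ (E.cxD.hcls n z)

/-- The grading of `U = H(C)`. -/
def ChainInclusion.GU (E : ChainInclusion.{u}) : GrData (TotU E) := GrData.ofSum E.U fun n => n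

/-! ### Retraction onto `U` and linear choice of cycles. -/

section Retraction

variable {E : SplitInclusion.{u}} {S : Kind} {κ : ∀ n, E.U n →ₗ[ℤ] LinearMap.ker (E.θ n)}

/-- As `im θ` is free, `θ` has a section over its image; subtracting `κ` moves it into `ker κ`, so
`U = ker θ ⊕ ker κ`. The retraction uses this splitting on `γ ⊕ η` and vanishes on `α ⊕ β`. -/
theorem exists_charC_retraction (hκ : ∀ n (z : LinearMap.ker (E.θ n)), κ n z = z) :
    ∃ l : CharC E.toChainInclusion S →ₗ[ℤ] TotU E.toChainInclusion,
      (∀ u, l (θ' E.toChainInclusion S κ u) = u) ∧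
      (∀ x, θ' E.toChainInclusion S κ (l x) =
        prC E.toChainInclusion S Letter.γ x + prC E.toChainInclusion S Letter.η x) ∧
      GrData.IsDeg (GCh E.toChainInclusion S) E.GU l 0 := by
  have hρ : ∀ n, ∃ ρ : LinearMap.range (E.θ n) →ₗ[ℤ] E.U n,
      (∀ y, E.θ n (ρ y) = y) ∧ ∀ y, ρ y ∈ LinearMap.ker (κ n) := fun n => by
    have := E.free_im n
    refine LinearMap.exists_lift (LinearMap.range (E.θ n)).subtype (E.θ n) _ ?_
    rintro ⟨_, u, rfl⟩
    refine ⟨u - κ n u, ?_, ?_⟩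
    · rw [LinearMap.mem_ker, map_sub, hκ, sub_self]
    · have : E.θ n (κ n u) = 0 := (κ n u).2
      rw [map_sub, this, sub_zero]
      rfl
  choose ρ hρ hρκ using hρ
  let l : CharC E.toChainInclusion S →ₗ[ℤ] TotU E.toChainInclusion :=
    DirectSum.toModule ℤ (Letter S × ℤ) _ (fun p => match p with
      | (Letter.γ, n) => DirectSum.lof ℤ ℤ E.U n ∘ₗ (LinearMap.ker (E.θ n)).subtype
      | (Letter.η, n) => DirectSum.lof ℤ ℤ E.U n ∘ₗ ρ n
      | _ => 0)
  have lα : ∀ h n x, l (inC E.toChainInclusion S (Letter.α h) n x) = 0 :=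
    fun h n x => toModule_inC _ (Letter.α h) n x
  have lβ : ∀ n x, l (inC E.toChainInclusion S Letter.β n x) = 0 :=
    fun n x => toModule_inC _ Letter.β n x
  have lγ : ∀ n (x : LinearMap.ker (E.θ n)), l (inC E.toChainInclusion S Letter.γ n x) =
    DirectSum.lof ℤ ℤ E.U n x := fun n x => toModule_inC _ Letter.γ n x
  have lη : ∀ n (x : LinearMap.range (E.θ n)), l (inC E.toChainInclusion S Letter.η n x) =
    DirectSum.lof ℤ ℤ E.U n (ρ n x) := fun n x => toModule_inC _ Letter.η n x
  refine ⟨l, fun u => ?_, fun x => ?_, ?_⟩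
  · suffices h : l ∘ₗ θ' E.toChainInclusion S κ = LinearMap.id from LinearMap.congr_fun h u
    refine DirectSum.linearMap_ext ℤ fun n => LinearMap.ext fun u => ?_
    simp only [LinearMap.comp_apply, LinearMap.id_apply]
    rw [θ'_lof, map_add, lγ, lη, ← map_add]
    congr 1
    have h1 : E.θ n (κ n u + ρ n ((E.θ n).rangeRestrict u) - u) = 0 := by
      have : E.θ n (κ n u) = 0 := (κ n u).2
      rw [map_sub, map_add, this, hρ]
      simp
    have h2 : κ n (κ n u + ρ n ((E.θ n).rangeRestrict u) - u) = 0 := by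
      have : κ n (ρ n ((E.θ n).rangeRestrict u)) = 0 := hρκ n _
      rw [map_sub, map_add, this, hκ]
      simp
    have h3 := hκ n ⟨_, h1⟩
    rw [h2] at h3
    exact sub_eq_zero.1 (congrArg Subtype.val h3).symm
  · suffices h : θ' E.toChainInclusion S κ ∘ₗ l =
        prC E.toChainInclusion S Letter.γ + prC E.toChainInclusion S Letter.η from
      LinearMap.congr_fun h x
    refine charC_ext fun l' n x => ?_
    rw [LinearMap.add_apply, prC_inC, prC_inC, LinearMap.comp_apply]
    cases l' with
    | α h => rw [lα]; simp
    | β => rw [lβ]; simp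
    | γ =>
      have h1 : E.θ n ((show LinearMap.ker (E.θ n) from x) : E.U n) = 0 :=
        (show LinearMap.ker (E.θ n) from x).2
      have h2 : (E.θ n).rangeRestrict ((show LinearMap.ker (E.θ n) from x) : E.U n) = 0 :=
        Subtype.ext h1
      have key : θ' E.toChainInclusion S κ (DirectSum.lof ℤ ℤ E.U n
          ((show LinearMap.ker (E.θ n) from x) : E.U n)) = inC E.toChainInclusion S Letter.γ n x := by
        refine (θ'_lof κ n _).trans ?_
        refine (congrArg₂ (· + ·) (congrArg (inC E.toChainInclusion S Letter.γ n)
          (hκ n (show LinearMap.ker (E.θ n) from x)))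
          ((congrArg (inC E.toChainInclusion S Letter.η n) h2).trans (map_zero _))).trans
          (add_zero _)
      refine (congrArg _ (lγ n x)).trans (key.trans ?_)
      simp
    | η =>
      have h1 : κ n (ρ n x) = 0 := hρκ n x
      have h2 : (E.θ n).rangeRestrict (ρ n x) = x := Subtype.ext (hρ n x)
      refine (congrArg _ (lη n x)).trans ?_
      rw [θ'_lof, h1, h2]
      simp
      exact map_zero _
  · refine isDeg_charC fun l' n x => ?_
    cases l' with
    | α h => rw [lα]; exact Submodule.zero_mem _
    | β => rw [lβ]; exact Submodule.zero_mem _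
    | γ =>
      rw [lγ n x, show n + (Letter.γ (S := S)).deg + 0 = n by simp [Letter.deg]]
      exact lof_mem_gr (X := E.U) n _
    | η =>
      rw [lη n x, show n + (Letter.η (S := S)).deg + 0 = n by simp [Letter.deg]]
      exact lof_mem_gr (X := E.U) n _

theorem θ'_injective (hκ : ∀ n (z : LinearMap.ker (E.θ n)), κ n z = z) :
    Function.Injective (θ' E.toChainInclusion S κ) := by
  obtain ⟨l, hl, -⟩ := exists_charC_retraction (S := S) hκ
  exact Function.LeftInverse.injective hl

theorem SplitInclusion.free_U (E : SplitInclusion.{u}) (n : ℤ) : Module.Free ℤ (E.U n) := by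
  have := E.free_ker n
  have := E.free_im n
  have := Module.Free.of_equiv (E.θ n).quotKerEquivRange.symm
  exact Module.Free.of_submodule_of_quotient (LinearMap.ker (E.θ n))

theorem SplitInclusion.exists_cycle_section (E : SplitInclusion.{u}) (n : ℤ) :
    ∃ s : E.U n →ₗ[ℤ] E.cxC.cycles n, ∀ u, E.cxC.hcls n (s u) = u := by
  have := E.free_U n
  obtain ⟨s, hs, -⟩ := LinearMap.exists_lift (LinearMap.id : E.U n →ₗ[ℤ] E.U n) (E.cxC.hcls n) ⊤
    fun u => by
      obtain ⟨z, hz⟩ := E.cxC.hcls_surjective n u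
      exact ⟨z, trivial, hz⟩
  exact ⟨s, hs⟩

end Retraction

namespace SplitInclusion

variable (E : SplitInclusion.{u})

/-- Representing cycles for the elements of `U = H(C)`. -/
def sec : TotU E.toChainInclusion →ₗ[ℤ] E.TotC :=
  DirectSum.lmap fun n => (E.cxC.cycles n).subtype ∘ₗ (E.exists_cycle_section n).choose

theorem sec_lof (n : ℤ) (u : E.U n) : ∃ z : E.cxC.cycles n, E.cxC.hcls n z = u ∧
    E.sec (DirectSum.lof ℤ ℤ E.U n u) = DirectSum.lof ℤ ℤ E.C n z :=
  ⟨(E.exists_cycle_section n).choose u, (E.exists_cycle_section n).choose_spec u,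
    DirectSum.lmap_lof (fun n => (E.cxC.cycles n).subtype ∘ₗ (E.exists_cycle_section n).choose) n u⟩

theorem d_sec (u : TotU E.toChainInclusion) : E.cxC.d (E.sec u) = 0 := by
  suffices h : E.cxC.d ∘ₗ E.sec = 0 from LinearMap.congr_fun h u
  refine DirectSum.linearMap_ext ℤ fun n => LinearMap.ext fun u => ?_
  obtain ⟨z, hz, e⟩ := E.sec_lof n u
  simp only [LinearMap.comp_apply, LinearMap.zero_apply]
  rw [e]
  exact z.2

theorem sec_deg : GrData.IsDeg E.GU E.GC E.sec 0 :=
  GrData.isDeg_ofSum (X := E.U) (deg := fun n => n) (f := E.sec) fun n u => by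
    obtain ⟨z, -, e⟩ := E.sec_lof n u
    rw [e, add_zero]; exact lof_mem_gr (X := E.C) n _

end SplitInclusion

/-! ### A chain section of the quotient map. -/

namespace QuotData

variable {E : SplitInclusion.{u}} {S : Kind} (Q : QuotData E S)

/-- `ϑ' : U → ker θ ⊕ im θ ⊆ CharC`. -/
abbrev incl : TotU E.toChainInclusion →ₗ[ℤ] CharC E.toChainInclusion S :=
  θ' E.toChainInclusion S Q.κ

/-- The total map of `q'`. -/
abbrev p' : E.TotC →ₗ[ℤ] TotU E.toChainInclusion := totq' E.toChainInclusion Q.q'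

theorem p'_lof (n : ℤ) (c : E.C n) :
    Q.p' (DirectSum.lof ℤ ℤ E.C n c) = DirectSum.lof ℤ ℤ E.U n (Q.q' n c) :=
  DirectSum.lmap_lof Q.q' n c

theorem p'_deg : GrData.IsDeg E.GC E.GU Q.p' 0 :=
  GrData.isDeg_ofSum (X := E.C) (deg := fun n => n) (f := Q.p') fun n c => by
    rw [Q.p'_lof, add_zero]; exact lof_mem_gr (X := E.U) n _

theorem p'_d (x : E.TotC) : Q.p' (E.cxC.d x) = 0 := by
  suffices h : Q.p' ∘ₗ E.cxC.d = 0 from LinearMap.congr_fun h x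
  refine DirectSum.linearMap_ext ℤ fun n => LinearMap.ext fun c => ?_
  obtain ⟨y, hy⟩ := E.cxC.d_deg n c
  have hc : y ∈ E.cxC.cycles (n - 1) := by
    rw [ChainCx.mem_cycles, ← hy, E.cxC.d_d]
  have h0 : E.cxC.hcls (n - 1) ⟨y, hc⟩ = 0 := (Submodule.Quotient.mk_eq_zero _).2 ⟨_, hy⟩
  simp only [LinearMap.comp_apply, LinearMap.zero_apply]
  rw [hy, Q.p'_lof, show Q.q' (n - 1) y = _ from Q.q'_cycle (n - 1) ⟨y, hc⟩, h0, map_zero]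

/-- A retraction of the character complex onto `U`. -/
def lam : CharC E.toChainInclusion S →ₗ[ℤ] TotU E.toChainInclusion :=
  (exists_charC_retraction Q.κ_ker).choose

theorem lam_incl (u : TotU E.toChainInclusion) : Q.lam (Q.incl u) = u :=
  (exists_charC_retraction Q.κ_ker).choose_spec.1 u

theorem incl_lam (x : CharC E.toChainInclusion S) : Q.incl (Q.lam x) =
    prC E.toChainInclusion S Letter.γ x + prC E.toChainInclusion S Letter.η x :=
  (exists_charC_retraction Q.κ_ker).choose_spec.2.1 x

theorem lam_deg : GrData.IsDeg (GCh E.toChainInclusion S) E.GU Q.lam 0 :=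
  (exists_charC_retraction Q.κ_ker).choose_spec.2.2

theorem incl_injective : Function.Injective Q.incl := θ'_injective Q.κ_ker

/-- The differential is injective on `β`, so a cycle has no `β`-component. -/
theorem incl_lam_of_cycle {x : CharC E.toChainInclusion S}
    (hx : dChar E.toChainInclusion S x = 0) : prA E.toChainInclusion S x + Q.incl (Q.lam x) = x := by
  have h := prA_add x
  rw [← suspC_dChar, hx, map_zero, add_zero, add_assoc, ← Q.incl_lam] at h
  exact h

theorem p'_sec (u : TotU E.toChainInclusion) : Q.p' (E.sec u) = u := by
  suffices h : Q.p' ∘ₗ E.sec = LinearMap.id from LinearMap.congr_fun h u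
  refine DirectSum.linearMap_ext ℤ fun n => LinearMap.ext fun u => ?_
  obtain ⟨z, hz, e⟩ := E.sec_lof n u
  simp only [LinearMap.comp_apply, LinearMap.id_apply]
  rw [e, Q.p'_lof, Q.q'_cycle, hz]

theorem incl_lam_γ (n : ℤ) (w : CharGrp E.toChainInclusion (Letter.γ (S := S)).idx n) :
    Q.incl (Q.lam (inC E.toChainInclusion S Letter.γ n w)) =
      inC E.toChainInclusion S Letter.γ n w := by
  rw [Q.incl_lam, prC_inC, prC_inC]
  simp

theorem lam_γ (n : ℤ) (z : LinearMap.ker (E.θ n)) :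
    Q.lam (inC E.toChainInclusion S Letter.γ n z) = DirectSum.lof ℤ ℤ E.U n z := by
  apply Q.incl_injective
  have h2 : (E.θ n).rangeRestrict (z : E.U n) = 0 := Subtype.ext z.2
  refine (Q.incl_lam_γ n z).trans ((θ'_lof Q.κ n _).trans ?_).symm
  exact (congrArg₂ (· + ·) (congrArg (inC E.toChainInclusion S Letter.γ n) (Q.κ_ker n z))
    ((congrArg (inC E.toChainInclusion S Letter.η n) h2).trans (map_zero _))).trans (add_zero _)

/-- The part of the section of `q` on `ker θ ⊕ im θ`. -/
def secU : CharC E.toChainInclusion S →ₗ[ℤ] E.TotD := E.tot ∘ₗ E.sec ∘ₗ Q.lam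

theorem q_secU (x : CharC E.toChainInclusion S) : Q.q (Q.secU x) = Q.incl (Q.lam x) := by
  rw [secU, LinearMap.comp_apply, LinearMap.comp_apply, Q.q_tot, Q.p'_sec]

theorem d_secU (x : CharC E.toChainInclusion S) : E.cxD.d (Q.secU x) = 0 := by
  rw [secU, LinearMap.comp_apply, LinearMap.comp_apply, ← E.tot_d, E.d_sec, map_zero]

theorem secU_deg : GrData.IsDeg (GCh E.toChainInclusion S) E.GD Q.secU 0 :=
  E.tot_deg.comp' (E.sec_deg.comp' Q.lam_deg (add_zero 0)) (add_zero 0)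

/-- A class of the cokernel is represented by a cycle `z`. Then `q z` has the right `α`-component
but perhaps a part in `γ ⊕ η`, which is removed by subtracting the cycle `secU (q z)`. -/
theorem exists_secA (h : S = Kind.X) (n : ℤ) :
    ∃ s : CharGrp E.toChainInclusion (Letter.α h).idx n →ₗ[ℤ] E.TotD,
      (∀ v, Q.q (s v) = inC E.toChainInclusion S (Letter.α h) n v) ∧
      ∀ v, s v ∈ E.GD.gr n ⊓ LinearMap.ker E.cxD.d := by
  refine LinearMap.exists_lift (inC E.toChainInclusion S (Letter.α h) n) Q.q _ fun v => ?_
  obtain ⟨w, hw⟩ := (LinearMap.range (E.θ n)).mkQ_surjective v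
  obtain ⟨z, rfl⟩ := E.cxD.hcls_surjective n w
  have hz : E.cxD.d (DirectSum.lof ℤ ℤ E.D n z) = 0 := z.2
  have hg : DirectSum.lof ℤ ℤ E.D n z ∈ E.GD.gr n := lof_mem_gr n _
  have hd : dChar E.toChainInclusion S (Q.q (DirectSum.lof ℤ ℤ E.D n z)) = 0 := by
    rw [← Q.q_chain, hz, map_zero]
  have hA : prA E.toChainInclusion S (Q.q (DirectSum.lof ℤ ℤ E.D n z)) =
      inC E.toChainInclusion S (Letter.α h) n v := by
    rw [prA_eq_of_mem_gr h (Q.q_deg n _ hg), Q.q_coker n z h]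
    exact congrArg _ hw
  refine ⟨DirectSum.lof ℤ ℤ E.D n z - Q.secU (Q.q (DirectSum.lof ℤ ℤ E.D n z)), ⟨?_, ?_⟩, ?_⟩
  · exact Submodule.sub_mem _ hg (Q.secU_deg.zero_mem (Q.q_deg n _ hg))
  · change E.cxD.d _ = 0
    rw [map_sub, hz, Q.d_secU, sub_zero]
  · rw [map_sub, Q.q_secU, ← hA, sub_eq_iff_eq_add]
    exact (Q.incl_lam_of_cycle hd).symm

/-- The part of the section of `q` on `coker θ`. -/
def secA : CharC E.toChainInclusion S →ₗ[ℤ] E.TotD :=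
  DirectSum.toModule ℤ (Letter S × ℤ) _ (fun p => match p with
    | (Letter.α h, n) => (Q.exists_secA h n).choose
    | _ => 0)

theorem secA_ne (l : Letter S) (hl : ∀ h, l ≠ Letter.α h) (n : ℤ)
    (x : CharGrp E.toChainInclusion l.idx n) : Q.secA (inC E.toChainInclusion S l n x) = 0 := by
  refine (toModule_inC _ l n x).trans ?_
  cases l with
  | α h => exact absurd rfl (hl h)
  | β => rfl
  | γ => rfl
  | η => rfl

theorem secA_α (h : S = Kind.X) (n : ℤ) (x : CharGrp E.toChainInclusion (Letter.α h).idx n) :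
    Q.q (Q.secA (inC E.toChainInclusion S (Letter.α h) n x)) =
      inC E.toChainInclusion S (Letter.α h) n x ∧
    Q.secA (inC E.toChainInclusion S (Letter.α h) n x) ∈ E.GD.gr n ⊓ LinearMap.ker E.cxD.d := by
  have e : Q.secA (inC E.toChainInclusion S (Letter.α h) n x) =
    (Q.exists_secA h n).choose x := toModule_inC _ (Letter.α h) n x
  rw [e]
  exact ⟨(Q.exists_secA h n).choose_spec.1 x, (Q.exists_secA h n).choose_spec.2 x⟩

theorem q_secA (x : CharC E.toChainInclusion S) :
    Q.q (Q.secA x) = prA E.toChainInclusion S x := by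
  suffices h : Q.q ∘ₗ Q.secA = prA E.toChainInclusion S from LinearMap.congr_fun h x
  refine charC_ext fun l n x => ?_
  rw [LinearMap.comp_apply]
  by_cases hl : ∀ h, l ≠ Letter.α h
  · rw [Q.secA_ne l hl, prA_ne l hl, map_zero]
  · push Not at hl
    obtain ⟨h, rfl⟩ := hl
    rw [(Q.secA_α h n x).1, prA_α]

theorem d_secA (x : CharC E.toChainInclusion S) : E.cxD.d (Q.secA x) = 0 := by
  suffices h : E.cxD.d ∘ₗ Q.secA = 0 from LinearMap.congr_fun h x
  refine charC_ext fun l n x => ?_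
  rw [LinearMap.comp_apply]
  by_cases hl : ∀ h, l ≠ Letter.α h
  · rw [Q.secA_ne l hl, map_zero]; rfl
  · push Not at hl
    obtain ⟨h, rfl⟩ := hl
    exact (Q.secA_α h n x).2.2

theorem secA_deg : GrData.IsDeg (GCh E.toChainInclusion S) E.GD Q.secA 0 := by
  refine isDeg_charC fun l n x => ?_
  by_cases hl : ∀ h, l ≠ Letter.α h
  · rw [Q.secA_ne l hl]; exact Submodule.zero_mem _
  · push Not at hl
    obtain ⟨h, rfl⟩ := hl
    simpa [Letter.deg] using (Q.secA_α h n x).2.1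

/-- The cycle in `C` that represents an element of `ker θ` bounds some `y` in `D`. The difference
`e` between `q y` and the desired value is a cycle of the character complex, and is removed with the
sections already available on `α` and on `γ ⊕ η`. Lifting against `q` and `d` together makes the
section compatible with the differential. -/
theorem exists_secB (n : ℤ) :
    ∃ s : CharGrp E.toChainInclusion (Letter.β (S := S)).idx n →ₗ[ℤ] E.TotD,
      (∀ w, Q.q.prod E.cxD.d (s w) = (inC E.toChainInclusion S Letter.β n w,
        Q.secU (inC E.toChainInclusion S Letter.γ n w))) ∧
      ∀ w, s w ∈ E.GD.gr (n + 1) := by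
  refine LinearMap.exists_lift ((inC E.toChainInclusion S Letter.β n).prod
    (Q.secU ∘ₗ inC E.toChainInclusion S Letter.γ n)) (Q.q.prod E.cxD.d) _ fun w => ?_
  have hw : E.θ n ((show LinearMap.ker (E.θ n) from w) : E.U n) = 0 :=
    (show LinearMap.ker (E.θ n) from w).2
  have hlam := Q.lam_γ n w
  obtain ⟨c, hc, e⟩ := E.sec_lof n ((show LinearMap.ker (E.θ n) from w) : E.U n)
  have hU : Q.secU (inC E.toChainInclusion S Letter.γ n w) =
      DirectSum.lof ℤ ℤ E.D n (E.incl n c) := by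
    rw [secU, LinearMap.comp_apply, LinearMap.comp_apply, hlam, e, E.tot_lof]
  have hb : E.cxD.hcls n ⟨E.incl n c, E.incl_cycles n c c.2⟩ = 0 := by
    rw [← E.θ_hcls, hc, hw]
  obtain ⟨y, hy, hdy⟩ := E.cxD.hcls_eq_zero.1 hb
  let e := Q.q y - inC E.toChainInclusion S Letter.β n w
  have hde : dChar E.toChainInclusion S e = 0 := by
    rw [map_sub, ← Q.q_chain, hdy, dChar_β, sub_eq_zero]
    change Q.q (DirectSum.lof ℤ ℤ E.D n (E.incl n c)) = _
    rw [← hU, Q.q_secU]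
    exact Q.incl_lam_γ n w
  have he : e ∈ (GCh E.toChainInclusion S).gr (n + 1) :=
    Submodule.sub_mem _ (Q.q_deg _ _ hy) (inC_mem_gr Letter.β n w)
  refine ⟨y - Q.secA e - Q.secU e, ?_, ?_⟩
  · exact Submodule.sub_mem _ (Submodule.sub_mem _ hy (Q.secA_deg.zero_mem he))
      (Q.secU_deg.zero_mem he)
  · refine Prod.ext ?_ ?_
    · change Q.q (y - Q.secA e - Q.secU e) = inC E.toChainInclusion S Letter.β n w
      rw [map_sub, map_sub, Q.q_secA, Q.q_secU, sub_sub, Q.incl_lam_of_cycle hde, sub_sub_cancel]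
    · change E.cxD.d (y - Q.secA e - Q.secU e) = Q.secU (inC E.toChainInclusion S Letter.γ n w)
      rw [map_sub, map_sub, Q.d_secA, Q.d_secU, sub_zero, sub_zero, hdy, hU]

/-- The part of the section of `q` on `Σ ker θ`. -/
def secB : CharC E.toChainInclusion S →ₗ[ℤ] E.TotD :=
  DirectSum.toModule ℤ (Letter S × ℤ) _ (fun p => match p with
    | (Letter.β, n) => (Q.exists_secB n).choose
    | _ => 0)

theorem secB_ne (l : Letter S) (hl : l ≠ Letter.β) (n : ℤ)
    (x : CharGrp E.toChainInclusion l.idx n) : Q.secB (inC E.toChainInclusion S l n x) = 0 := by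
  refine (toModule_inC _ l n x).trans ?_
  cases l with
  | β => exact absurd rfl hl
  | α h => rfl
  | γ => rfl
  | η => rfl

theorem secB_β (n : ℤ) (x : CharGrp E.toChainInclusion (Letter.β (S := S)).idx n) :
    Q.q (Q.secB (inC E.toChainInclusion S Letter.β n x)) = inC E.toChainInclusion S Letter.β n x ∧
    E.cxD.d (Q.secB (inC E.toChainInclusion S Letter.β n x)) =
      Q.secU (inC E.toChainInclusion S Letter.γ n x) ∧
    Q.secB (inC E.toChainInclusion S Letter.β n x) ∈ E.GD.gr (n + 1) := by
  have e : Q.secB (inC E.toChainInclusion S Letter.β n x) = (Q.exists_secB n).choose x :=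
    toModule_inC _ Letter.β n x
  rw [e]
  have h := (Q.exists_secB n).choose_spec.1 x
  exact ⟨congrArg Prod.fst h, congrArg Prod.snd h, (Q.exists_secB n).choose_spec.2 x⟩

/-- A section of `q`. -/
def r : CharC E.toChainInclusion S →ₗ[ℤ] E.TotD := Q.secA + Q.secU + Q.secB

theorem q_r (x : CharC E.toChainInclusion S) : Q.q (Q.r x) = x := by
  have h : Q.q (Q.secB x) = prC E.toChainInclusion S Letter.β x := by
    suffices h : Q.q ∘ₗ Q.secB = prC E.toChainInclusion S Letter.β from LinearMap.congr_fun h x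
    refine charC_ext fun l n x => ?_
    rw [LinearMap.comp_apply, prC_inC]
    by_cases hl : l = Letter.β
    · subst hl; rw [(Q.secB_β n x).1, if_pos rfl]
    · rw [Q.secB_ne l hl, if_neg hl, map_zero]
  rw [r, LinearMap.add_apply, LinearMap.add_apply, map_add, map_add, Q.q_secA, Q.q_secU, h,
    Q.incl_lam]
  conv_rhs => rw [← prA_add x]
  abel

theorem d_r (x : CharC E.toChainInclusion S) :
    E.cxD.d (Q.r x) = Q.r (dChar E.toChainInclusion S x) := by
  suffices h : E.cxD.d ∘ₗ Q.r = Q.r ∘ₗ dChar E.toChainInclusion S from LinearMap.congr_fun h x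
  refine charC_ext fun l n x => ?_
  simp only [LinearMap.comp_apply, r, LinearMap.add_apply, map_add, Q.d_secA, Q.d_secU, zero_add]
  cases l with
  | β =>
    rw [(Q.secB_β n x).2.1, dChar_β]
    have h1 := Q.secA_ne Letter.γ (by simp) n x
    have h2 := Q.secB_ne Letter.γ (by simp) n x
    exact (by rw [h1, h2, zero_add, add_zero])
  | α h => rw [Q.secB_ne _ (by simp), dChar_α]; simp
  | γ => rw [Q.secB_ne _ (by simp), dChar_γ]; simp
  | η => rw [Q.secB_ne _ (by simp), dChar_η]; simp

theorem r_deg : GrData.IsDeg (GCh E.toChainInclusion S) E.GD Q.r 0 := by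
  refine (Q.secA_deg.add Q.secU_deg).add (isDeg_charC fun l n x => ?_)
  by_cases hl : l = Letter.β
  · subst hl; simpa [Letter.deg] using (Q.secB_β n x).2.2
  · rw [Q.secB_ne l hl]; exact Submodule.zero_mem _

/-- The parts on `α` and `β` vanish on `γ ⊕ η`, and `secU` takes its values in `C`; so `r` is a map
of pairs. -/
theorem r_incl (u : TotU E.toChainInclusion) : Q.r (Q.incl u) = E.tot (E.sec u) := by
  have h : ∀ f : CharC E.toChainInclusion S →ₗ[ℤ] E.TotD,
      (∀ n x, f (inC E.toChainInclusion S Letter.γ n x) = 0) →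
      (∀ n x, f (inC E.toChainInclusion S Letter.η n x) = 0) → f (Q.incl u) = 0 := by
    intro f h1 h2
    suffices h : f ∘ₗ Q.incl = 0 from LinearMap.congr_fun h u
    refine DirectSum.linearMap_ext ℤ fun n => LinearMap.ext fun u => ?_
    simp only [LinearMap.comp_apply, LinearMap.zero_apply]
    rw [θ'_lof, map_add]
    exact (congrArg₂ (· + ·) (h1 n (Q.κ n u)) (h2 n ((E.θ n).rangeRestrict u))).trans (add_zero 0)
  rw [r, LinearMap.add_apply, LinearMap.add_apply,
    h Q.secA (Q.secA_ne _ (by simp)) (Q.secA_ne _ (by simp)),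
    h Q.secB (Q.secB_ne _ (by simp)) (Q.secB_ne _ (by simp)), zero_add, add_zero, secU,
    LinearMap.comp_apply, LinearMap.comp_apply, Q.lam_incl]

end QuotData

/-! ### Contractions of the kernels of the quotient maps -/

namespace QuotData

variable {E : SplitInclusion.{u}} {S : Kind} (Q : QuotData E S)

/-- Boundaries of the character complex have no `η`-component, and the `η`-component of `ϑ' u` is `θ
u`. -/
theorem θ_eq_zero_of_incl {n : ℤ} {u : E.U n} {x : CharC E.toChainInclusion S}
    (h : dChar E.toChainInclusion S x = Q.incl (DirectSum.lof ℤ ℤ E.U n u)) : E.θ n u = 0 := by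
  have h0 : ∀ y, prC E.toChainInclusion S Letter.η (dChar E.toChainInclusion S y) = 0 := by
    intro y
    suffices h : prC E.toChainInclusion S Letter.η ∘ₗ dChar E.toChainInclusion S = 0 from
      LinearMap.congr_fun h y
    refine charC_ext fun l n y => ?_
    rw [LinearMap.comp_apply]
    cases l with
    | α h => rw [dChar_α, map_zero]; rfl
    | β => rw [dChar_β]; exact prC_inC _ Letter.γ n y
    | γ => rw [dChar_γ, map_zero]; rfl
    | η => rw [dChar_η, map_zero]; rfl
  have h1 := h0 x
  rw [h, θ'_lof, map_add] at h1
  have h2 := (congrArg₂ (· + ·) (prC_inC (E := E.toChainInclusion) Letter.η Letter.γ n (Q.κ n u))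
    (prC_inC (E := E.toChainInclusion) (S := S) Letter.η Letter.η n ((E.θ n).rangeRestrict u))).symm.trans h1
  simp only [reduceCtorEq, if_false, if_true, zero_add] at h2
  have h3 : (E.θ n).rangeRestrict u = 0 :=
    DirectSum.lof_inj (X := CPiece E.toChainInclusion S) (i := (Letter.η, n))
      (h2.trans (map_zero _).symm)
  exact congrArg Subtype.val h3

/-- Since the `α`-component of `q x` vanishes, or `θ` is onto, `x` is homologous to a cycle `c` of
`C`. Applying `q` makes `ϑ' [c]` a boundary, which forces `θ [c] = 0`. Hence `x` bounds some `y`,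
and `y - r q y` is a primitive in the kernel of `q`. -/
theorem exists_kernel_primitive {n : ℤ} {x : E.D n}
    (hd : E.cxD.d (DirectSum.lof ℤ ℤ E.D n x) = 0) (hq : Q.q (DirectSum.lof ℤ ℤ E.D n x) = 0) :
    ∃ y ∈ E.GD.gr (n + 1) ⊓ LinearMap.ker Q.q, E.cxD.d y = DirectSum.lof ℤ ℤ E.D n x := by
  let z : E.cxD.cycles n := ⟨x, hd⟩
  have hr : E.cxD.hcls n z ∈ LinearMap.range (E.θ n) := by
    cases hS : S with
    | X =>
      have h := Q.q_coker n z hS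
      rw [hq] at h
      exact (Submodule.Quotient.mk_eq_zero _).1 h.symm
    | R => exact Q.onto hS n _
  obtain ⟨u, hu⟩ := hr
  obtain ⟨c, rfl⟩ := E.cxC.hcls_surjective n u
  have h0 : E.cxD.hcls n (z - ⟨E.incl n c, E.incl_cycles n c c.2⟩) = 0 := by
    rw [map_sub, ← E.θ_hcls, hu, sub_self]
  obtain ⟨y₀, -, hdy⟩ := E.cxD.hcls_eq_zero.1 h0
  have h1 : E.cxD.d y₀ = DirectSum.lof ℤ ℤ E.D n x - E.tot (DirectSum.lof ℤ ℤ E.C n c) := by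
    rw [hdy, E.tot_lof, ← map_sub]; rfl
  have h2 : dChar E.toChainInclusion S (-Q.q y₀) =
      Q.incl (DirectSum.lof ℤ ℤ E.U n (E.cxC.hcls n c)) := by
    rw [map_neg, ← Q.q_chain, h1, map_sub, hq, Q.q_tot, zero_sub, neg_neg, Q.p'_lof, Q.q'_cycle]
  have h3 : E.cxD.hcls n z = 0 := hu.symm.trans (Q.θ_eq_zero_of_incl h2)
  obtain ⟨y, hy, hdy⟩ := E.cxD.hcls_eq_zero.1 h3
  refine ⟨y - Q.r (Q.q y), ⟨?_, ?_⟩, ?_⟩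
  · exact Submodule.sub_mem _ hy (Q.r_deg.zero_mem (Q.q_deg _ _ hy))
  · change Q.q (y - Q.r (Q.q y)) = 0
    rw [map_sub, Q.q_r, sub_self]
  · rw [map_sub, Q.d_r, ← Q.q_chain, hdy, hq, map_zero, sub_zero]

/-- On `C` the vanishing of `q` means that the class in `U` is zero, so the cycle already bounds in
`C`. The correction `r q` restricts to `sec ∘ p'` there and does not leave `C`. -/
theorem exists_kernel_primitive_sub {n : ℤ} {c : E.C n}
    (hd : E.cxD.d (E.tot (DirectSum.lof ℤ ℤ E.C n c)) = 0)
    (hq : Q.q (E.tot (DirectSum.lof ℤ ℤ E.C n c)) = 0) :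
    ∃ y ∈ (E.GD.gr (n + 1) ⊓ LinearMap.ker Q.q) ⊓ LinearMap.range E.tot,
      E.cxD.d y = E.tot (DirectSum.lof ℤ ℤ E.C n c) := by
  have hc : c ∈ E.cxC.cycles n := by
    rw [ChainCx.mem_cycles]
    apply E.tot_injective
    rw [E.tot_d, hd, map_zero]
  rw [Q.q_tot, ← map_zero Q.incl] at hq
  have hp := Q.incl_injective hq
  rw [Q.p'_lof, ← map_zero (DirectSum.lof ℤ ℤ E.U n)] at hp
  have h0 : E.cxC.hcls n ⟨c, hc⟩ = 0 := by
    rw [← Q.q'_cycle]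
    exact DirectSum.lof_inj hp
  obtain ⟨b, hb, hdb⟩ := E.cxC.hcls_eq_zero.1 h0
  refine ⟨E.tot (b - E.sec (Q.p' b)), ⟨⟨?_, ?_⟩, _, rfl⟩, ?_⟩
  · exact E.tot_deg.zero_mem (Submodule.sub_mem _ hb (E.sec_deg.zero_mem (Q.p'_deg.zero_mem hb)))
  · change Q.q _ = 0
    rw [Q.q_tot, map_sub, Q.p'_sec, sub_self, map_zero]
  · rw [← E.tot_d, map_sub, E.d_sec, sub_zero, hdb]

/-- The cycles in the kernel of `q`. -/
def kerCycles (n : ℤ) : Submodule ℤ (E.D n) :=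
  LinearMap.ker ((E.cxD.d ∘ₗ DirectSum.lof ℤ ℤ E.D n).prod (Q.q ∘ₗ DirectSum.lof ℤ ℤ E.D n))

theorem mem_kerCycles {n : ℤ} {x : E.D n} : x ∈ Q.kerCycles n ↔
    E.cxD.d (DirectSum.lof ℤ ℤ E.D n x) = 0 ∧ Q.q (DirectSum.lof ℤ ℤ E.D n x) = 0 :=
  Prod.ext_iff

/-- Linear choice of primitives for the pair formed by the cycles in the kernel of `q` and those
among them that lie in `C`. The subgroup embeds in `D` and the quotient in `D / C`, so both are free
and `LinearMap.exists_lift_pair` applies. The choice extends to `D` because these cycles are the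
kernel of a map into a free group. -/
theorem exists_kernel_section (n : ℤ) : ∃ s : E.D n →ₗ[ℤ] E.TotD, ∀ x ∈ Q.kerCycles n,
    E.cxD.d (s x) = DirectSum.lof ℤ ℤ E.D n x ∧ s x ∈ E.GD.gr (n + 1) ⊓ LinearMap.ker Q.q ∧
      (x ∈ LinearMap.range (E.incl n) → s x ∈ LinearMap.range E.tot) := by
  have := E.free_D n
  have := E.free_quot n
  have hD := fun n => E.free_D n
  let A' := (LinearMap.range (E.incl n)).submoduleOf (Q.kerCycles n)
  have hA' : Module.Free ℤ A' := Module.Free.of_injective_pid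
    ((Q.kerCycles n).subtype ∘ₗ A'.subtype)
    ((Q.kerCycles n).injective_subtype.comp A'.injective_subtype)
  have hQ : Module.Free ℤ (Q.kerCycles n ⧸ A') := by
    refine Module.Free.of_injective_pid (Submodule.mapQ A' (LinearMap.range (E.incl n))
      (Q.kerCycles n).subtype le_rfl) ?_
    rw [← LinearMap.ker_eq_bot]
    refine Submodule.ker_liftQ_eq_bot _ _ _ ?_
    rw [LinearMap.ker_comp, Submodule.ker_mkQ]
    exact le_rfl
  obtain ⟨s, h1, h2, h3⟩ := LinearMap.exists_lift_pair A'
    (DirectSum.lof ℤ ℤ E.D n ∘ₗ (Q.kerCycles n).subtype) E.cxD.d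
    (E.GD.gr (n + 1) ⊓ LinearMap.ker Q.q)
    ((E.GD.gr (n + 1) ⊓ LinearMap.ker Q.q) ⊓ LinearMap.range E.tot)
    (fun a => Q.exists_kernel_primitive (Q.mem_kerCycles.1 a.2).1 (Q.mem_kerCycles.1 a.2).2)
    (by
      rintro ⟨a, ha⟩ ⟨c, rfl⟩
      have h := Q.mem_kerCycles.1 ha
      change E.cxD.d (DirectSum.lof ℤ ℤ E.D n (E.incl n c)) = 0 ∧
        Q.q (DirectSum.lof ℤ ℤ E.D n (E.incl n c)) = 0 at h
      rw [← E.tot_lof] at h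
      obtain ⟨y, hy, e⟩ := Q.exists_kernel_primitive_sub h.1 h.2
      exact ⟨y, hy, e.trans (E.tot_lof n c)⟩)
    inf_le_left
  obtain ⟨g, hg⟩ := LinearMap.exists_extension_ker
    ((E.cxD.d ∘ₗ DirectSum.lof ℤ ℤ E.D n).prod (Q.q ∘ₗ DirectSum.lof ℤ ℤ E.D n)) s
  refine ⟨g, fun x hx => ?_⟩
  rw [show g x = _ from hg ⟨x, hx⟩]
  exact ⟨h1 ⟨x, hx⟩, h2 ⟨x, hx⟩, fun hr => (h3 ⟨x, hx⟩ hr).2⟩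

theorem exists_total_kernel_section : ∃ s : E.TotD →ₗ[ℤ] E.TotD, ∀ n, ∀ x ∈ E.GD.gr n,
    E.cxD.d x = 0 → Q.q x = 0 →
      E.cxD.d (s x) = x ∧ s x ∈ E.GD.gr (n + 1) ∧ Q.q (s x) = 0 ∧
        (x ∈ LinearMap.range E.tot → s x ∈ LinearMap.range E.tot) := by
  choose s hs using Q.exists_kernel_section
  refine ⟨DirectSum.toModule ℤ ℤ _ s, fun n x hx hd hq => ?_⟩
  obtain ⟨x, rfl⟩ := mem_ofSum_id.1 hx
  obtain ⟨h1, h2, h3⟩ := hs n x (Q.mem_kerCycles.2 ⟨hd, hq⟩)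
  rw [DirectSum.toModule_lof]
  exact ⟨h1, h2.1, h2.2, fun h => h3 (E.mem_range_tot.1 h)⟩

/-- A homotopy from `r q` to the identity that preserves the subcomplex `C`. -/
theorem exists_homotopy : ∃ h : E.TotD →ₗ[ℤ] E.TotD, GrData.IsDeg E.GD E.GD h 1 ∧
    (∀ x, x - Q.r (Q.q x) = E.cxD.d (h x) + h (E.cxD.d x)) ∧
    ∀ x ∈ LinearMap.range E.tot, h x ∈ LinearMap.range E.tot := by
  obtain ⟨s, hs⟩ := Q.exists_total_kernel_section
  let p : E.TotD →ₗ[ℤ] E.TotD := LinearMap.id - Q.r ∘ₗ Q.q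
  have hp : ∀ x, p x = x - Q.r (Q.q x) := fun x => rfl
  have pd : ∀ x, p (E.cxD.d x) = E.cxD.d (p x) := fun x => by
    rw [hp, hp, map_sub, Q.d_r, Q.q_chain]
  have qp : ∀ x, Q.q (p x) = 0 := fun x => by rw [hp, map_sub, Q.q_r, sub_self]
  have pg : ∀ n, ∀ x ∈ E.GD.gr n, p x ∈ E.GD.gr n := fun n x hx =>
    Submodule.sub_mem _ hx (Q.r_deg.zero_mem (Q.q_deg _ _ hx))
  have pt : ∀ x, p (E.tot x) ∈ LinearMap.range E.tot := fun x => by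
    rw [hp, Q.q_tot, Q.r_incl, ← map_sub]
    exact ⟨_, rfl⟩
  -- The map `s` gives primitives for cycles in the kernel of `q` only. For arbitrary `x` the
  -- element `p x - s (d (p x))` is such a cycle, because `d s` is the identity on `d (p x)`.
  let h := s ∘ₗ (p - s ∘ₗ E.cxD.d ∘ₗ p)
  have hh : ∀ x, h x = s (p x - s (E.cxD.d (p x))) := fun x => rfl
  have dg : ∀ n, ∀ x ∈ E.GD.gr n, E.cxD.d x ∈ E.GD.gr (n - 1) := fun n x hx =>
    E.cxD.deg_d n x hx
  have key₁ : ∀ n, ∀ x ∈ E.GD.gr n, E.cxD.d (s (E.cxD.d (p x))) = E.cxD.d (p x) ∧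
      s (E.cxD.d (p x)) ∈ E.GD.gr n ∧ Q.q (s (E.cxD.d (p x))) = 0 ∧
        (E.cxD.d (p x) ∈ LinearMap.range E.tot →
          s (E.cxD.d (p x)) ∈ LinearMap.range E.tot) := fun n x hx => by
    have := hs (n - 1) (E.cxD.d (p x)) (dg n _ (pg n x hx)) (E.cxD.d_d _)
      (by rw [Q.q_chain, qp, map_zero])
    rwa [sub_add_cancel] at this
  have key₂ : ∀ n, ∀ x ∈ E.GD.gr n, E.cxD.d (h x) = p x - s (E.cxD.d (p x)) ∧
      h x ∈ E.GD.gr (n + 1) ∧ (p x - s (E.cxD.d (p x)) ∈ LinearMap.range E.tot →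
        h x ∈ LinearMap.range E.tot) := fun n x hx => by
    obtain ⟨h1, h2, h3, -⟩ := key₁ n x hx
    have := hs n (p x - s (E.cxD.d (p x))) (Submodule.sub_mem _ (pg n x hx) h2)
      (by rw [map_sub, h1, sub_self]) (by rw [map_sub, qp, h3, sub_self])
    exact ⟨this.1, this.2.1, this.2.2.2⟩
  have hl : E.GD.Lawful := GrData.ofSum_lawful _ _
  refine ⟨h, fun n x hx => (key₂ n x hx).2.1, fun x => ?_, ?_⟩
  · suffices e : p = E.cxD.d ∘ₗ h + h ∘ₗ E.cxD.d from LinearMap.congr_fun e x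
    refine hl.ext_gr fun n x hx => ?_
    -- On a boundary the inner correction vanishes, so `h (d x) = s (d (p x))`, which is exactly the
    -- term missing from `d (h x)`.
    refine Eq.trans ?_ (congrArg₂ (· + ·) (key₂ n x hx).1.symm (hh (E.cxD.d x)).symm)
    rw [pd, E.cxD.d_d, map_zero, sub_zero, sub_add_cancel]
  · rintro _ ⟨x, rfl⟩
    induction x using DirectSum.induction_on with
    | zero => rw [map_zero, map_zero]; exact Submodule.zero_mem _
    | add x y hx hy => rw [map_add, map_add]; exact Submodule.add_mem _ hx hy
    | of n c =>
      have hg : E.tot (DirectSum.lof ℤ ℤ E.C n c) ∈ E.GD.gr n := by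
        rw [E.tot_lof]; exact lof_mem_gr n _
      obtain ⟨b, hb⟩ := pt (DirectSum.lof ℤ ℤ E.C n c)
      refine (key₂ n _ hg).2.2 (Submodule.sub_mem _ ⟨b, hb⟩ ((key₁ n _ hg).2.2.2 ?_))
      rw [← hb, ← E.tot_d]
      exact ⟨_, rfl⟩

/-- A homotopy from `r q` to the identity that preserves the subcomplex `C`. -/
def h : E.TotD →ₗ[ℤ] E.TotD := Q.exists_homotopy.choose

theorem h_deg : GrData.IsDeg E.GD E.GD Q.h 1 := Q.exists_homotopy.choose_spec.1

theorem h_spec (x : E.TotD) : x - Q.r (Q.q x) = E.cxD.d (Q.h x) + Q.h (E.cxD.d x) :=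
  Q.exists_homotopy.choose_spec.2.1 x

theorem h_mem {x : E.TotD} (hx : x ∈ LinearMap.range E.tot) : Q.h x ∈ LinearMap.range E.tot :=
  Q.exists_homotopy.choose_spec.2.2 x hx

end QuotData

/-! ### Existence of the quotient maps -/

namespace ChainCx

variable {X : ℤ → Type u} [∀ n, AddCommGroup (X n)] [∀ n, Module ℤ (X n)] (c : ChainCx X)

/-- The component `X i → X j` of the differential. -/
def dAt (i j : ℤ) : X i →ₗ[ℤ] X j := DirectSum.component ℤ ℤ X j ∘ₗ c.d ∘ₗ DirectSum.lof ℤ ℤ X i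

theorem lof_dAt {i j : ℤ} (h : j + 1 = i) (x : X i) :
    DirectSum.lof ℤ ℤ X j (c.dAt i j x) = c.d (DirectSum.lof ℤ ℤ X i x) := by
  obtain ⟨y, hy⟩ := c.d_deg i x
  obtain rfl : j = i - 1 := by omega
  rw [dAt, LinearMap.comp_apply, LinearMap.comp_apply, hy, DirectSum.component.lof_self]

theorem dAt_mem_cycles {i j : ℤ} (h : j + 1 = i) (x : X i) : c.dAt i j x ∈ c.cycles j := by
  rw [mem_cycles, c.lof_dAt h, c.d_d]

theorem hcls_dAt {i j : ℤ} (h : j + 1 = i) (x : X i) :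
    c.hcls j ⟨c.dAt i j x, c.dAt_mem_cycles h x⟩ = 0 :=
  (Submodule.Quotient.mk_eq_zero _).2 ⟨_, (c.lof_dAt h x).symm⟩

theorem dAt_eq_zero {i j : ℤ} (x : X i) (hx : x ∈ c.cycles i) : c.dAt i j x = 0 := by
  rw [dAt, LinearMap.comp_apply, LinearMap.comp_apply, c.mem_cycles.1 hx, map_zero]

theorem mem_cycles_of_dAt {i j : ℤ} (h : j + 1 = i) {x : X i} (hx : c.dAt i j x = 0) :
    x ∈ c.cycles i := by
  rw [mem_cycles, ← c.lof_dAt h, hx, map_zero]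

theorem hcls_eq_zero_iff_dAt {n : ℤ} {z : c.cycles n} :
    c.hcls n z = 0 ↔ ∃ y : X (n + 1), c.dAt (n + 1) n y = z := by
  rw [c.hcls_eq_zero]
  constructor
  · rintro ⟨y, hy, e⟩
    obtain ⟨y, rfl⟩ := mem_ofSum_id.1 hy
    exact ⟨y, DirectSum.lof_inj ((c.lof_dAt rfl y).trans e)⟩
  · rintro ⟨y, e⟩
    exact ⟨_, lof_mem_gr (n + 1) y, by rw [← c.lof_dAt rfl, e]⟩

end ChainCx

namespace SplitInclusion

variable (E : SplitInclusion.{u})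

theorem incl_dAt {i j : ℤ} (h : j + 1 = i) (c : E.C i) :
    E.incl j (E.cxC.dAt i j c) = E.cxD.dAt i j (E.incl i c) := by
  apply DirectSum.lof_inj (i := j)
  rw [E.cxD.lof_dAt h, ← E.tot_lof, E.cxC.lof_dAt h, E.tot_d, E.tot_lof]

theorem free_C (n : ℤ) : Module.Free ℤ (E.C n) := by
  have := E.free_D n
  exact Module.Free.of_injective_pid (E.incl n) (E.incl_injective n)

theorem exists_κ (n : ℤ) : ∃ κ : E.U n →ₗ[ℤ] LinearMap.ker (E.θ n),
    ∀ z : LinearMap.ker (E.θ n), κ z = z := by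
  have := E.free_im n
  have := Module.Free.of_equiv (E.θ n).quotKerEquivRange.symm
  exact (LinearMap.ker (E.θ n)).exists_extension LinearMap.id

theorem exists_q' (n : ℤ) : ∃ q' : E.C n →ₗ[ℤ] E.U n,
    ∀ z : E.cxC.cycles n, q' z = E.cxC.hcls n z := by
  have := E.free_C
  exact LinearMap.exists_extension_ker _ (E.cxC.hcls n)

variable {E} {q' : ∀ n, E.C n →ₗ[ℤ] E.U n}

theorem q'_dAt (hq' : ∀ n (z : E.cxC.cycles n), q' n z = E.cxC.hcls n z) {i j : ℤ}
    (h : j + 1 = i) (c : E.C i) : q' j (E.cxC.dAt i j c) = 0 :=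
  (hq' j ⟨_, E.cxC.dAt_mem_cycles h c⟩).trans (E.cxC.hcls_dAt h c)

theorem mem_cycles_of_incl {n : ℤ} {c : E.C n} (h : E.incl n c ∈ E.cxD.cycles n) :
    c ∈ E.cxC.cycles n := by
  rw [ChainCx.mem_cycles] at h ⊢
  rw [← E.tot_lof, ← E.tot_d] at h
  exact E.tot_injective (h.trans (map_zero _).symm)

/-- If `d x` lies in `C`, its class in `U` is killed by `θ`, as `x` is a primitive in `D`. This
prescribes the `β`-component of `q` on the kernel of `d` modulo `C`, a direct summand because `D /
C` is free. -/
theorem exists_qβ (hq' : ∀ n (z : E.cxC.cycles n), q' n z = E.cxC.hcls n z) (i j : ℤ)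
    (h : j + 1 = i) : ∃ f : E.D i →ₗ[ℤ] LinearMap.ker (E.θ j), ∀ x c,
      E.cxD.dAt i j x = E.incl j c → (f x : E.U j) = q' j c := by
  have := E.free_quot j
  let F := (LinearMap.range (E.incl j)).mkQ ∘ₗ E.cxD.dAt i j
  have hF : ∀ x : LinearMap.ker F, E.cxD.dAt i j x ∈ LinearMap.range (E.incl j) := fun x =>
    (Submodule.Quotient.mk_eq_zero _).1 x.2
  let e := LinearEquiv.ofInjective (E.incl j) (E.incl_injective j)
  let g : LinearMap.ker F →ₗ[ℤ] E.C j := e.symm.toLinearMap ∘ₗ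
    (E.cxD.dAt i j ∘ₗ (LinearMap.ker F).subtype).codRestrict _ hF
  have hg : ∀ x, E.incl j (g x) = E.cxD.dAt i j x := fun x =>
    congrArg Subtype.val (e.apply_symm_apply ⟨E.cxD.dAt i j x, hF x⟩)
  have hθ : ∀ x, q' j (g x) ∈ LinearMap.ker (E.θ j) := fun x => by
    have hc : g x ∈ E.cxC.cycles j := mem_cycles_of_incl
      (by rw [hg]; exact E.cxD.dAt_mem_cycles h x)
    rw [LinearMap.mem_ker, show q' j (g x) = _ from hq' j ⟨g x, hc⟩, E.θ_hcls]
    refine Eq.trans ?_ (E.cxD.hcls_dAt h (x : E.D i))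
    congr 1
    exact Subtype.ext (hg x)
  obtain ⟨f, hf⟩ := LinearMap.exists_extension_ker F ((q' j ∘ₗ g).codRestrict _ hθ)
  refine ⟨f, fun x c hx => ?_⟩
  have hx' : x ∈ LinearMap.ker F := (Submodule.Quotient.mk_eq_zero _).2 (by rw [hx]; exact ⟨c, rfl⟩)
  have e1 : (f x : E.U j) = q' j (g ⟨x, hx'⟩) := congrArg Subtype.val (hf ⟨x, hx'⟩)
  rw [e1, show g ⟨x, hx'⟩ = c from E.incl_injective j ((hg _).trans hx)]

variable {qβ : ∀ i j : ℤ, j + 1 = i → (E.D i →ₗ[ℤ] LinearMap.ker (E.θ j))}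

/-- Vanishing of the class of `d x` in `U` means `d x = d b` with `b` in `C`, and then `x - b` is a
cycle. -/
theorem exists_cycle_add_of_qβ (hq' : ∀ n (z : E.cxC.cycles n), q' n z = E.cxC.hcls n z)
    (hβ : ∀ i j h x c, E.cxD.dAt i j x = E.incl j c → (qβ i j h x : E.U j) = q' j c) {i j : ℤ}
    (h : j + 1 = i) {x : E.D i} (hx : E.cxD.dAt i j x ∈ LinearMap.range (E.incl j))
    (hx' : qβ i j h x = 0) : ∃ (z : E.cxD.cycles i) (c : E.C i), z + E.incl i c = x := by
  obtain ⟨c, hc⟩ := hx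
  have hcyc : c ∈ E.cxC.cycles j := mem_cycles_of_incl (by rw [hc]; exact E.cxD.dAt_mem_cycles h x)
  have h0 : E.cxC.hcls j ⟨c, hcyc⟩ = 0 := by
    rw [← hq', ← hβ i j h x c hc.symm, hx']; rfl
  subst h
  obtain ⟨b, hb⟩ := E.cxC.hcls_eq_zero_iff_dAt.1 h0
  refine ⟨⟨x - E.incl _ b, E.cxD.mem_cycles_of_dAt (j := j) rfl ?_⟩, b, sub_add_cancel _ _⟩
  rw [map_sub, ← E.incl_dAt rfl, hb, hc, sub_self]

/-- On the kernel of `d` modulo `C` and of the `β`-component, every `x` is a cycle `z` of `D` plus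
an element of `C`. The class of `z` modulo `im θ` is well defined, since two choices of `z` differ
by a cycle of `C`. -/
theorem exists_qα (hq' : ∀ n (z : E.cxC.cycles n), q' n z = E.cxC.hcls n z)
    (hβ : ∀ i j h x c, E.cxD.dAt i j x = E.incl j c → (qβ i j h x : E.U j) = q' j c) (n : ℤ) :
    ∃ f : E.D n →ₗ[ℤ] E.V n ⧸ LinearMap.range (E.θ n), ∀ (z : E.cxD.cycles n) (c : E.C n),
      f (z + E.incl n c) = (LinearMap.range (E.θ n)).mkQ (E.cxD.hcls n z) := by
  have hn : n - 1 + 1 = n := sub_add_cancel _ _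
  have := E.free_quot (n - 1)
  have := E.free_ker (n - 1)
  have := E.free_D n
  let F := ((LinearMap.range (E.incl (n - 1))).mkQ ∘ₗ E.cxD.dAt n (n - 1)).prod (qβ n (n - 1) hn)
  have := Module.Free.submodule_pid (LinearMap.ker F)
  have hF : ∀ {x}, x ∈ LinearMap.ker F ↔
      E.cxD.dAt n (n - 1) x ∈ LinearMap.range (E.incl (n - 1)) ∧ qβ n (n - 1) hn x = 0 := fun {x} =>
    Prod.ext_iff.trans (and_congr (Submodule.Quotient.mk_eq_zero _) Iff.rfl)
  obtain ⟨s, hs, -⟩ := LinearMap.exists_lift (LinearMap.ker F).subtype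
    ((E.cxD.cycles n).subtype.coprod (E.incl n)) ⊤ fun a => by
      have ha := hF.1 a.2
      obtain ⟨z, c, e⟩ := exists_cycle_add_of_qβ hq' hβ hn ha.1 ha.2
      exact ⟨(z, c), trivial, e⟩
  obtain ⟨f, hf⟩ := LinearMap.exists_extension_ker F
    ((LinearMap.range (E.θ n)).mkQ ∘ₗ E.cxD.hcls n ∘ₗ LinearMap.fst ℤ _ _ ∘ₗ s)
  refine ⟨f, fun z c => ?_⟩
  have hx : (z : E.D n) + E.incl n c ∈ LinearMap.ker F := by
    have e : E.cxD.dAt n (n - 1) ((z : E.D n) + E.incl n c) =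
        E.incl (n - 1) (E.cxC.dAt n (n - 1) c) := by
      rw [map_add, E.cxD.dAt_eq_zero _ z.2, zero_add, E.incl_dAt hn]
    refine hF.2 ⟨⟨_, e.symm⟩, Subtype.ext ?_⟩
    rw [hβ _ _ hn _ _ e, q'_dAt hq' hn]; rfl
  rw [show f (z + E.incl n c) = _ from hf ⟨_, hx⟩]
  rcases hsz : s ⟨_, hx⟩ with ⟨z', c'⟩
  have h1 : (z' : E.D n) + E.incl n c' = z + E.incl n c := by
    have := hs ⟨_, hx⟩
    rwa [hsz] at this
  simp only [LinearMap.comp_apply, hsz, LinearMap.fst_apply]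
  rw [← sub_eq_zero, ← map_sub, ← map_sub]
  have h2 : E.incl n (c - c') = (z' - z : E.cxD.cycles n) := by
    rw [map_sub, Submodule.coe_sub, sub_eq_sub_iff_add_eq_add, add_comm, ← h1, add_comm]
  have hc : c - c' ∈ E.cxC.cycles n := mem_cycles_of_incl (by rw [h2]; exact Subtype.mem _)
  refine (Submodule.Quotient.mk_eq_zero _).2 ⟨E.cxC.hcls n ⟨_, hc⟩, ?_⟩
  rw [E.θ_hcls]
  congr 1
  exact Subtype.ext h2

/-- Where the `α`- and `β`-components and `d` modulo `C` all vanish, an element has the form `d y +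
c`. The chain map condition prescribes the value on `d y`, the compatibility with `q'` the value on
`c`. The prescriptions agree: if `d y = c`, the `β`-component of `y` is `q' c`, an element of `ker
θ`. -/
theorem exists_qγη (hq' : ∀ n (z : E.cxC.cycles n), q' n z = E.cxC.hcls n z)
    (hβ : ∀ i j h x c, E.cxD.dAt i j x = E.incl j c → (qβ i j h x : E.U j) = q' j c)
    {κ : ∀ n, E.U n →ₗ[ℤ] LinearMap.ker (E.θ n)}
    (hκ : ∀ n (z : LinearMap.ker (E.θ n)), κ n z = z) (n : ℤ) :
    ∃ f : E.D n →ₗ[ℤ] LinearMap.ker (E.θ n) × LinearMap.range (E.θ n),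
      ∀ i (h : n + 1 = i) (x : E.D i) (c : E.C n), f (E.cxD.dAt i n x + E.incl n c) =
        (qβ i n h x + κ n (q' n c), (E.θ n).rangeRestrict (q' n c)) := by
  obtain ⟨qα, hα⟩ := exists_qα hq' hβ n
  have hn : n - 1 + 1 = n := sub_add_cancel _ _
  have := E.free_quot (n - 1)
  have := E.free_ker (n - 1)
  have := E.free_coker n
  have := E.free_D n
  let F := (((LinearMap.range (E.incl (n - 1))).mkQ ∘ₗ E.cxD.dAt n (n - 1)).prod
    (qβ n (n - 1) hn)).prod qα
  have := Module.Free.submodule_pid (LinearMap.ker F)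
  have hF : ∀ {x}, x ∈ LinearMap.ker F ↔
      (E.cxD.dAt n (n - 1) x ∈ LinearMap.range (E.incl (n - 1)) ∧ qβ n (n - 1) hn x = 0) ∧
        qα x = 0 := fun {x} =>
    Prod.ext_iff.trans (and_congr (Prod.ext_iff.trans
      (and_congr (Submodule.Quotient.mk_eq_zero _) Iff.rfl)) Iff.rfl)
  obtain ⟨s, hs, -⟩ := LinearMap.exists_lift (LinearMap.ker F).subtype
    ((E.cxD.dAt (n + 1) n).coprod (E.incl n)) ⊤ fun a => by
      have ha := hF.1 a.2
      obtain ⟨z, c, e⟩ := exists_cycle_add_of_qβ hq' hβ hn ha.1.1 ha.1.2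
      have h0 := ha.2
      rw [← e, hα] at h0
      obtain ⟨u, hu⟩ := (Submodule.Quotient.mk_eq_zero _).1 h0
      obtain ⟨b, rfl⟩ := E.cxC.hcls_surjective n u
      have h1 : E.cxD.hcls n (z - ⟨E.incl n b, E.incl_cycles n b b.2⟩) = 0 := by
        rw [map_sub, ← E.θ_hcls, hu, sub_self]
      obtain ⟨y, hy⟩ := E.cxD.hcls_eq_zero_iff_dAt.1 h1
      refine ⟨(y, b + c), trivial, ?_⟩
      rw [LinearMap.coprod_apply, hy, map_add]
      change (z : E.D n) - E.incl n b + (E.incl n b + E.incl n c) = a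
      rw [← e]
      abel
  obtain ⟨f, hf⟩ := LinearMap.exists_extension_ker F
    (((qβ (n + 1) n rfl).comp (LinearMap.fst ℤ _ _) + κ n ∘ₗ q' n ∘ₗ LinearMap.snd ℤ _ _).prod
      ((E.θ n).rangeRestrict ∘ₗ q' n ∘ₗ LinearMap.snd ℤ _ _) ∘ₗ s)
  refine ⟨f, ?_⟩
  rintro i rfl x c
  have hx : E.cxD.dAt (n + 1) n x + E.incl n c ∈ LinearMap.ker F := by
    have e : E.cxD.dAt n (n - 1) (E.cxD.dAt (n + 1) n x + E.incl n c) =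
        E.incl (n - 1) (E.cxC.dAt n (n - 1) c) := by
      rw [map_add, E.cxD.dAt_eq_zero _ (E.cxD.dAt_mem_cycles rfl x), zero_add, E.incl_dAt hn]
    refine hF.2 ⟨⟨⟨_, e.symm⟩, Subtype.ext ?_⟩, ?_⟩
    · rw [hβ _ _ hn _ _ e, q'_dAt hq' hn]; rfl
    · refine (hα ⟨_, E.cxD.dAt_mem_cycles rfl x⟩ c).trans ?_
      rw [E.cxD.hcls_dAt rfl, map_zero]
  rw [hf ⟨_, hx⟩]
  rcases hsz : s ⟨_, hx⟩ with ⟨x', c'⟩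
  have h1 : E.cxD.dAt (n + 1) n x' + E.incl n c' = E.cxD.dAt (n + 1) n x + E.incl n c := by
    have := hs ⟨_, hx⟩
    rwa [hsz] at this
  have h2 : E.cxD.dAt (n + 1) n (x' - x) = E.incl n (c - c') := by
    rw [map_sub, map_sub, sub_eq_sub_iff_add_eq_add, h1, add_comm]
  have h3 := hβ _ _ rfl _ _ h2
  have h4 : κ n (q' n (c - c')) = qβ (n + 1) n rfl (x' - x) := by rw [← h3, hκ]
  have h5 : (E.θ n).rangeRestrict (q' n (c - c')) = 0 := by
    rw [← h3]; exact Subtype.ext (qβ (n + 1) n rfl (x' - x)).2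
  simp only [LinearMap.comp_apply, hsz]
  simp only [map_sub] at h4 h5
  refine Prod.ext ?_ ?_
  · change qβ (n + 1) n rfl x' + κ n (q' n c') = qβ (n + 1) n rfl x + κ n (q' n c)
    rw [add_comm (qβ (n + 1) n rfl x)]
    exact (sub_eq_sub_iff_add_eq_add.1 h4).symm
  · change (E.θ n).rangeRestrict (q' n c') = (E.θ n).rangeRestrict (q' n c)
    exact (sub_eq_zero.1 h5).symm

end SplitInclusion

/-- Quotient maps onto the character complex exist. -/
theorem QuotData.nonempty (E : SplitInclusion.{u}) (S : Kind)
    (onto : S = Kind.R → ∀ n, Function.Surjective (E.θ n)) : Nonempty (QuotData E S) := by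
  classical
  choose κ hκ using E.exists_κ
  choose q' hq' using E.exists_q'
  choose qβ hβ using SplitInclusion.exists_qβ hq'
  choose qα hα using SplitInclusion.exists_qα hq' hβ
  choose qγη hγη using SplitInclusion.exists_qγη hq' hβ hκ
  have hn : ∀ n : ℤ, n - 1 + 1 = n := fun n => sub_add_cancel _ _
  -- In the right version the summand `α` is absent and this component is zero.
  let A : ∀ n, E.D n →ₗ[ℤ] CharC E.toChainInclusion S := fun n =>
    if h : S = Kind.X then inC E.toChainInclusion S (Letter.α h) n ∘ₗ qα n else 0
  let B : ∀ n, E.D n →ₗ[ℤ] CharC E.toChainInclusion S := fun n =>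
    inC E.toChainInclusion S Letter.β (n - 1) ∘ₗ qβ n (n - 1) (hn n)
  let G : ∀ n, LinearMap.ker (E.θ n) →ₗ[ℤ] CharC E.toChainInclusion S := fun n =>
    inC E.toChainInclusion S Letter.γ n
  let H : ∀ n, LinearMap.range (E.θ n) →ₗ[ℤ] CharC E.toChainInclusion S := fun n =>
    inC E.toChainInclusion S Letter.η n
  have hAX : ∀ h n x, A n x = inC E.toChainInclusion S (Letter.α h) n (qα n x) := fun h n x => by
    simp only [A, dif_pos h]
    rfl
  have hA : ∀ n x, qα n x = 0 → A n x = 0 := fun n x hx => by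
    by_cases h : S = Kind.X
    · rw [hAX h, hx]
      exact map_zero (inC E.toChainInclusion S (Letter.α h) n)
    · simp only [A, dif_neg h, LinearMap.zero_apply]
  let q : E.TotD →ₗ[ℤ] CharC E.toChainInclusion S := DirectSum.toModule ℤ ℤ _ fun n =>
    A n + B n + (G n ∘ₗ LinearMap.fst ℤ _ _ ∘ₗ qγη n + H n ∘ₗ LinearMap.snd ℤ _ _ ∘ₗ qγη n)
  have hq : ∀ n x, q (DirectSum.lof ℤ ℤ E.D n x) =
      A n x + B n x + (G n (qγη n x).1 + H n (qγη n x).2) := fun n x =>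
    DirectSum.toModule_lof ℤ n x
  have dA : ∀ n x, dChar E.toChainInclusion S (A n x) = 0 := fun n x => by
    by_cases h : S = Kind.X
    · rw [hAX h]
      exact dChar_α h n _
    · simp only [A, dif_neg h, LinearMap.zero_apply, map_zero]
  have hβ₀ : ∀ i j h x, E.cxD.dAt i j x = 0 → qβ i j h x = 0 := fun i j h x hx =>
    Subtype.ext ((hβ i j h x 0 (by rw [hx, map_zero])).trans (map_zero _))
  refine ⟨onto, κ, hκ, q', hq', q, ?_, fun x => ?_, fun x => ?_, fun n z h => ?_⟩
  · refine fun n x hx => GrData.IsDeg.zero_mem (GrData.isDeg_ofSum (X := E.D) (deg := fun n => n)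
      (f := q) fun n x => ?_) hx
    rw [hq, add_zero]
    refine Submodule.add_mem _ (Submodule.add_mem _ ?_ ?_) (Submodule.add_mem _ ?_ ?_)
    · by_cases h : S = Kind.X
      · rw [hAX h]
        simpa [Letter.deg] using inC_mem_gr (E := E.toChainInclusion) (Letter.α h) n (qα n x)
      · simp only [A, dif_neg h, LinearMap.zero_apply]
        exact Submodule.zero_mem _
    · have := inC_mem_gr (E := E.toChainInclusion) (S := S) Letter.β (n - 1) (qβ n (n - 1) (hn n) x)
      rwa [show n - 1 + (Letter.β (S := S)).deg = n from hn n] at this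
    · have := inC_mem_gr (E := E.toChainInclusion) (S := S) Letter.γ n (qγη n x).1
      rwa [show n + (Letter.γ (S := S)).deg = n from add_zero n] at this
    · have := inC_mem_gr (E := E.toChainInclusion) (S := S) Letter.η n (qγη n x).2
      rwa [show n + (Letter.η (S := S)).deg = n from add_zero n] at this
  · suffices e : q ∘ₗ E.cxD.d = dChar E.toChainInclusion S ∘ₗ q from LinearMap.congr_fun e x
    refine DirectSum.linearMap_ext ℤ fun n => LinearMap.ext fun x => ?_
    simp only [LinearMap.comp_apply]
    have h0 := E.cxD.dAt_eq_zero (j := n - 1 - 1) _ (E.cxD.dAt_mem_cycles (hn n) x)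
    have h1 := hγη (n - 1) n (hn n) x 0
    have h2 := hα (n - 1) ⟨_, E.cxD.dAt_mem_cycles (hn n) x⟩ 0
    rw [E.cxD.hcls_dAt (hn n), map_zero] at h2
    simp only [map_zero, add_zero] at h1 h2
    have h3 : B (n - 1) (E.cxD.dAt n (n - 1) x) = 0 :=
      (congrArg (inC E.toChainInclusion S Letter.β (n - 1 - 1)) (hβ₀ _ _ (hn (n - 1)) _ h0)).trans
        (map_zero _)
    rw [← E.cxD.lof_dAt (hn n), hq, hq, h1, hA _ _ h2, h3]
    simp only [map_add, map_zero, add_zero, zero_add]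
    have h4 : dChar E.toChainInclusion S (B n x) = G (n - 1) (qβ n (n - 1) (hn n) x) :=
      dChar_β (n - 1) _
    have h5 : dChar E.toChainInclusion S (G n (qγη n x).1) = 0 := dChar_γ n _
    have h6 : dChar E.toChainInclusion S (H n (qγη n x).2) = 0 := dChar_η n _
    rw [dA, h4, h5, h6, zero_add, add_zero, add_zero]
  · suffices e : q ∘ₗ E.tot = θ' E.toChainInclusion S κ ∘ₗ totq' E.toChainInclusion q' from
      LinearMap.congr_fun e x
    refine DirectSum.linearMap_ext ℤ fun n => LinearMap.ext fun c => ?_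
    simp only [LinearMap.comp_apply]
    have h1 := hγη n (n + 1) rfl 0 c
    have h2 := hα n 0 c
    simp only [map_zero, zero_add, Submodule.coe_zero] at h1 h2
    have h3 : qβ n (n - 1) (hn n) (E.incl n c) = 0 := Subtype.ext <|
      (hβ _ _ (hn n) _ _ (E.incl_dAt (hn n) c).symm).trans (SplitInclusion.q'_dAt hq' (hn n) c)
    have h4 : B n (E.incl n c) = 0 :=
      (congrArg (inC E.toChainInclusion S Letter.β (n - 1)) h3).trans (map_zero _)
    rw [E.tot_lof, hq, h1, hA _ _ h2, h4, totq', DirectSum.lmap_lof, θ'_lof, zero_add, zero_add]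
    rfl
  · have h2 := hα n z 0
    rw [map_zero, add_zero] at h2
    have hne : ∀ (l : Letter S) (j : ℤ) (x : CharGrp E.toChainInclusion l.idx j),
        l ≠ Letter.α h → inC E.toChainInclusion S l j x (Letter.α h, n) = 0 := fun l j x hl =>
      DFinsupp.single_eq_of_ne fun e => hl (Prod.ext_iff.1 e).1.symm
    rw [hq, ← h2, hAX h, DirectSum.add_apply, DirectSum.add_apply, DirectSum.add_apply]
    refine (congrArg₂ (· + ·) (congrArg₂ (· + ·) (DirectSum.lof_apply ℤ (Letter.α h, n) _)
      (hne Letter.β _ _ (by simp))) (congrArg₂ (· + ·) (hne Letter.γ _ _ (by simp))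
      (hne Letter.η _ _ (by simp)))).trans ?_
    rw [add_zero, add_zero]
    exact add_zero _

/-! ### Existence of character coproducts -/

section CharProj

variable {E : ChainInclusion.{u}} {S : Kind}

/-- The projection of the character complex onto `coker θ ⊕ im θ`. -/
def prAη (E : ChainInclusion.{u}) (S : Kind) : CharC E S →ₗ[ℤ] CharC E S :=
  prA E S + prC E S Letter.η

theorem prA_inC (l : Letter S) (n : ℤ) (x : CharGrp E l.idx n) :
    prA E S (inC E S l n x) = inC E S l n x ∨ prA E S (inC E S l n x) = 0 := by
  cases l with
  | α h => exact Or.inl (prA_α h n x)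
  | β => exact Or.inr (prA_ne _ (by simp) n x)
  | γ => exact Or.inr (prA_ne _ (by simp) n x)
  | η => exact Or.inr (prA_ne _ (by simp) n x)

theorem prA_deg : GrData.IsDeg (GCh E S) (GCh E S) (prA E S) 0 :=
  isDeg_charC fun l n x => by
    rw [add_zero]
    rcases prA_inC l n x with h | h <;> rw [h]
    · exact inC_mem_gr l n x
    · exact Submodule.zero_mem _

theorem prC_deg (l : Letter S) : GrData.IsDeg (GCh E S) (GCh E S) (prC E S l) 0 :=
  isDeg_charC fun l' n x => by
    rw [add_zero, prC_inC]
    split_ifs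
    · exact inC_mem_gr l' n x
    · exact Submodule.zero_mem _

theorem prAη_deg : GrData.IsDeg (GCh E S) (GCh E S) (prAη E S) 0 := prA_deg.add (prC_deg _)

theorem prC_prAη (l : Letter S) (hβ : l = Letter.β ∨ l = Letter.γ) :
    prC E S l ∘ₗ prAη E S = 0 := by
  refine charC_ext fun l' n x => ?_
  rw [LinearMap.comp_apply, prAη, LinearMap.add_apply, prC_inC, map_add]
  cases l' with
  | α h => rw [prA_α]; rcases hβ with rfl | rfl <;> simp [prC_inC]
  | β => rw [prA_ne _ (by simp)]; simp
  | γ => rw [prA_ne _ (by simp)]; simp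
  | η => rw [prA_ne _ (by simp)]; rcases hβ with rfl | rfl <;> simp [prC_inC]

theorem prAη_add (x : CharC E S) :
    prAη E S x + prC E S Letter.β x + prC E S Letter.γ x = x := by
  conv_rhs => rw [← prA_add x]
  rw [prAη, LinearMap.add_apply]
  abel

theorem prC_dChar (l : Letter S) (hl : l ≠ Letter.γ) : prC E S l ∘ₗ dChar E S = 0 := by
  refine charC_ext fun l' n x => ?_
  rw [LinearMap.comp_apply]
  cases l' with
  | α h => rw [dChar_α, map_zero]; rfl
  | β => rw [dChar_β]; exact (prC_inC l Letter.γ n x).trans (if_neg (Ne.symm hl))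
  | γ => rw [dChar_γ, map_zero]; rfl
  | η => rw [dChar_η, map_zero]; rfl

theorem prC_suspC (l : Letter S) (hl : l ≠ Letter.β) : prC E S l ∘ₗ suspC E S = 0 := by
  refine charC_ext fun l' n x => ?_
  rw [LinearMap.comp_apply]
  by_cases h : l' = Letter.γ
  · subst h
    rw [suspC_γ]
    exact (prC_inC l Letter.β n x).trans (if_neg (Ne.symm hl))
  · rw [suspC_ne l' h, map_zero]; rfl

theorem prA_dChar : prA E S ∘ₗ dChar E S = 0 := by
  refine charC_ext fun l' n x => ?_
  rw [LinearMap.comp_apply]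
  cases l' with
  | α h => rw [dChar_α, map_zero]; rfl
  | β => rw [dChar_β]; exact prA_ne Letter.γ (by simp) n x
  | γ => rw [dChar_γ, map_zero]; rfl
  | η => rw [dChar_η, map_zero]; rfl

theorem prA_suspC : prA E S ∘ₗ suspC E S = 0 := by
  refine charC_ext fun l' n x => ?_
  rw [LinearMap.comp_apply]
  by_cases h : l' = Letter.γ
  · subst h
    rw [suspC_γ]
    exact prA_ne Letter.β (by simp) n x
  · rw [suspC_ne l' h, map_zero]; rfl

theorem prAη_dChar : prAη E S ∘ₗ dChar E S = 0 := by
  rw [prAη, LinearMap.add_comp, prA_dChar, prC_dChar _ (by simp), add_zero]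

theorem prAη_suspC : prAη E S ∘ₗ suspC E S = 0 := by
  rw [prAη, LinearMap.add_comp, prA_suspC, prC_suspC _ (by simp), add_zero]

theorem dChar_prAη : dChar E S ∘ₗ prAη E S = 0 := by
  refine charC_ext fun l n x => ?_
  rw [LinearMap.comp_apply, prAη, LinearMap.add_apply, prC_inC, map_add]
  cases l with
  | α h => rw [prA_α, dChar_α]; simp
  | β => rw [prA_ne _ (by simp)]; simp
  | γ => rw [prA_ne _ (by simp)]; simp
  | η => rw [prA_ne _ (by simp)]; simpa using dChar_η n x

theorem dChar_dChar (x : CharC E S) : dChar E S (dChar E S x) = 0 := by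
  suffices h : dChar E S ∘ₗ dChar E S = 0 from LinearMap.congr_fun h x
  refine charC_ext fun l n x => ?_
  rw [LinearMap.comp_apply]
  cases l with
  | α h => rw [dChar_α, map_zero]; rfl
  | β => rw [dChar_β]; exact dChar_γ n x
  | γ => rw [dChar_γ, map_zero]; rfl
  | η => rw [dChar_η, map_zero]; rfl

theorem prC_prC (l l' : Letter S) (x : CharC E S) :
    prC E S l (prC E S l' x) = if l' = l then prC E S l x else 0 := by
  suffices h : prC E S l ∘ₗ prC E S l' = if l' = l then prC E S l else 0 by
    have := LinearMap.congr_fun h x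
    split_ifs at this ⊢ <;> exact this
  refine charC_ext fun l₀ n x => ?_
  rw [LinearMap.comp_apply, prC_inC]
  by_cases h1 : l₀ = l'
  · subst h1
    rw [if_pos rfl, prC_inC]
    split_ifs with h2
    · rw [prC_inC, if_pos h2]
    · rfl
  · rw [if_neg h1, map_zero]
    split_ifs with h2
    · subst h2; rw [prC_inC, if_neg h1]
    · rfl

theorem suspC_suspC_eq : suspC E S ∘ₗ dChar E S + dChar E S ∘ₗ suspC E S + prAη E S =
    LinearMap.id := LinearMap.ext fun x => by
  rw [LinearMap.add_apply, LinearMap.add_apply, LinearMap.comp_apply, LinearMap.comp_apply,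
    suspC_dChar, dChar_suspC, add_comm, ← add_assoc]
  exact prAη_add x

theorem sgn_comm_of_deg_zero {f : CharC E S →ₗ[ℤ] CharC E S}
    (hf : GrData.IsDeg (GCh E S) (GCh E S) f 0) (x : CharC E S) :
    (GCh E S).sgn (f x) = f ((GCh E S).sgn x) :=
  LinearMap.congr_fun (GrData.IsPar.sgn_even
    (show GrData.IsPar _ _ f 0 from by simpa using hf.par GCh_lawful GCh_lawful)) x

theorem sgn_sgn_charC (x : CharC E S) : (GCh E S).sgn ((GCh E S).sgn x) = x :=
  LinearMap.congr_fun GCh_lawful.sgn_sgn x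

theorem sgn_suspC (x : CharC E S) : (GCh E S).sgn (suspC E S x) = -suspC E S ((GCh E S).sgn x) :=
  LinearMap.congr_fun (GrData.IsPar.sgn_odd
    (show GrData.IsPar _ _ (suspC E S) 1 from by
      simpa using (suspC_deg (E := E) (S := S)).par GCh_lawful GCh_lawful)) x

/-- The differential of `CharC ⊗ CharC`. -/
abbrev dChar₂ (E : ChainInclusion.{u}) (S : Kind) :
    CharC E S ⊗[ℤ] CharC E S →ₗ[ℤ] CharC E S ⊗[ℤ] CharC E S :=
  tensorD (GCh E S) (dChar E S) (dChar E S)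

/-- A contraction of `CharC ⊗ CharC` onto `(coker θ ⊕ im θ) ⊗ (coker θ ⊕ im θ)`. -/
def suspC₂ (E : ChainInclusion.{u}) (S : Kind) :
    CharC E S ⊗[ℤ] CharC E S →ₗ[ℤ] CharC E S ⊗[ℤ] CharC E S :=
  TensorProduct.map (suspC E S) LinearMap.id +
    TensorProduct.map ((GCh E S).sgn ∘ₗ prAη E S) (suspC E S)

/-- Suspension contracts `β → γ`: the identity is `s d + d s + p` with `p` the projection to `α ⊕
η`. The formula is the usual contraction `s ⊗ 1 ± p ⊗ s` of a tensor product, with `d p = p d = 0`.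
-/
theorem suspC₂_spec (z : CharC E S ⊗[ℤ] CharC E S) :
    dChar₂ E S (suspC₂ E S z) + suspC₂ E S (dChar₂ E S z) =
      z - TensorProduct.map (prAη E S) (prAη E S) z := by
  suffices h : dChar₂ E S ∘ₗ suspC₂ E S + suspC₂ E S ∘ₗ dChar₂ E S =
      LinearMap.id - TensorProduct.map (prAη E S) (prAη E S) from LinearMap.congr_fun h z
  have hd : ∀ x, dChar E S (prAη E S x) = 0 := LinearMap.congr_fun dChar_prAη
  have hd' : ∀ x, prAη E S (dChar E S x) = 0 := LinearMap.congr_fun prAη_dChar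
  have hk : ∀ x, suspC E S (dChar E S x) + dChar E S (suspC E S x) + prAη E S x = x :=
    LinearMap.congr_fun suspC_suspC_eq
  have hk' : ∀ x, dChar E S (suspC E S x) = x - prAη E S x - suspC E S (dChar E S x) := fun x => by
    rw [eq_sub_iff_add_eq, eq_sub_iff_add_eq]
    refine Eq.trans ?_ (hk x)
    abel
  refine TensorProduct.ext' fun x y => ?_
  simp only [tensorD, suspC₂, LinearMap.add_apply, LinearMap.comp_apply, LinearMap.sub_apply,
    map_add, TensorProduct.map_tmul, LinearMap.id_apply, hd, hd', sgn_suspC,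
    sgn_sgn_charC, sgn_comm_of_deg_zero prAη_deg, hk',
    TensorProduct.zero_tmul, TensorProduct.neg_tmul, TensorProduct.tmul_sub, TensorProduct.sub_tmul,
    map_zero]
  abel

theorem suspC₂_deg : GrData.IsDeg ((GCh E S).prod (GCh E S)) ((GCh E S).prod (GCh E S))
    (suspC₂ E S) 1 := by
  have h1 := suspC_deg.tmap (GrData.IsDeg.id (G := GCh E S)) (f := suspC E S)
  have h2 := (GCh_lawful.sgn_deg.comp' (f := prAη E S) prAη_deg (add_zero 0)).tmap
    (suspC_deg (E := E) (S := S))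
  rw [add_zero] at h1
  rw [zero_add] at h2
  exact h1.add h2

theorem prAη_prAη₂_d (z : CharC E S ⊗[ℤ] CharC E S) :
    TensorProduct.map (prAη E S) (prAη E S) (dChar₂ E S z) = 0 := by
  suffices h : TensorProduct.map (prAη E S) (prAη E S) ∘ₗ dChar₂ E S = 0 from
    LinearMap.congr_fun h z
  rw [dChar₂, tensorD, LinearMap.comp_add, ← TensorProduct.map_comp, ← TensorProduct.map_comp,
    prAη_dChar, TensorProduct.map_zero_left, TensorProduct.map_zero_right, add_zero]

theorem d_prAη_prAη₂ (z : CharC E S ⊗[ℤ] CharC E S) :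
    dChar₂ E S (TensorProduct.map (prAη E S) (prAη E S) z) = 0 := by
  suffices h : dChar₂ E S ∘ₗ TensorProduct.map (prAη E S) (prAη E S) = 0 from
    LinearMap.congr_fun h z
  rw [dChar₂, tensorD, LinearMap.add_comp, ← TensorProduct.map_comp, ← TensorProduct.map_comp,
    dChar_prAη, TensorProduct.map_zero_left, TensorProduct.map_zero_right, add_zero]

theorem prAη_prAη₂_susp (z : CharC E S ⊗[ℤ] CharC E S) :
    TensorProduct.map (prAη E S) (prAη E S) (suspC₂ E S z) = 0 := by
  suffices h : TensorProduct.map (prAη E S) (prAη E S) ∘ₗ suspC₂ E S = 0 from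
    LinearMap.congr_fun h z
  rw [suspC₂, LinearMap.comp_add, ← TensorProduct.map_comp, ← TensorProduct.map_comp,
    prAη_suspC, TensorProduct.map_zero_left, TensorProduct.map_zero_right, add_zero]

end CharProj

theorem QuotData.prC_incl {E : SplitInclusion.{u}} {S : Kind} (Q : QuotData E S) (l : Letter S)
    (h1 : l ≠ Letter.γ) (h2 : l ≠ Letter.η) : prC E.toChainInclusion S l ∘ₗ Q.incl = 0 := by
  refine DirectSum.linearMap_ext ℤ fun n => LinearMap.ext fun u => ?_
  simp only [LinearMap.comp_apply]
  rw [θ'_lof, map_add]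
  exact (congrArg₂ (· + ·) ((prC_inC l Letter.γ n _).trans (if_neg (Ne.symm h1)))
    ((prC_inC l Letter.η n _).trans (if_neg (Ne.symm h2)))).trans (add_zero 0)

theorem QuotData.prA_incl {E : SplitInclusion.{u}} {S : Kind} (Q : QuotData E S) :
    prA E.toChainInclusion S ∘ₗ Q.incl = 0 := by
  refine DirectSum.linearMap_ext ℤ fun n => LinearMap.ext fun u => ?_
  simp only [LinearMap.comp_apply]
  rw [θ'_lof, map_add]
  exact (congrArg₂ (· + ·) (prA_ne Letter.γ (by simp) n _)
    (prA_ne Letter.η (by simp) n _)).trans (add_zero 0)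

/-! ### Transfer of the coproduct and its correction. -/

namespace QuotData

variable {E : SplitCoalgInclusion.{u}} {S : Kind} (Q : QuotData E.toSplitInclusion S)

/-- The coproduct of the character complex transferred along `q`. -/
def ψ' : CharC E.toChainInclusion S →ₗ[ℤ] CharC E.toChainInclusion S ⊗[ℤ] CharC E.toChainInclusion S :=
  TensorProduct.map Q.q Q.q ∘ₗ E.ψD ∘ₗ Q.r

theorem qq_d (z : E.TotD ⊗[ℤ] E.TotD) : TensorProduct.map Q.q Q.q (tensorD E.GD E.cxD.d E.cxD.d z) =
    dChar₂ E.toChainInclusion S (TensorProduct.map Q.q Q.q z) := by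
  suffices h : TensorProduct.map Q.q Q.q ∘ₗ tensorD E.GD E.cxD.d E.cxD.d =
    dChar₂ E.toChainInclusion S ∘ₗ TensorProduct.map Q.q Q.q from LinearMap.congr_fun h z
  have hs : (GCh E.toChainInclusion S).sgn ∘ₗ Q.q = Q.q ∘ₗ E.GD.sgn :=
    GrData.IsPar.sgn_even (show GrData.IsPar _ _ Q.q 0 from by
      simpa using (GrData.IsDeg.of_zero Q.q_deg).par (GrData.ofSum_lawful _ _) GCh_lawful)
  have hd : Q.q ∘ₗ E.cxD.d = dChar E.toChainInclusion S ∘ₗ Q.q := LinearMap.ext Q.q_chain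
  rw [dChar₂, tensorD, tensorD, LinearMap.add_comp, LinearMap.comp_add, ← TensorProduct.map_comp,
    ← TensorProduct.map_comp, ← TensorProduct.map_comp, ← TensorProduct.map_comp, hs, hd]
  rfl

theorem ψ'_d (x : CharC E.toChainInclusion S) :
    Q.ψ' (dChar E.toChainInclusion S x) = dChar₂ E.toChainInclusion S (Q.ψ' x) := by
  simp only [ψ', LinearMap.comp_apply]
  rw [← Q.d_r, E.isCoproduct_D.chain, qq_d]

theorem ψ'_deg : GrData.IsDeg (GCh E.toChainInclusion S)
    ((GCh E.toChainInclusion S).prod (GCh E.toChainInclusion S)) Q.ψ' 0 := by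
  have h1 := (GrData.IsDeg.of_zero Q.q_deg).tmap (GrData.IsDeg.of_zero Q.q_deg)
  rw [add_zero] at h1
  exact h1.comp' ((GrData.IsDeg.of_zero E.isCoproduct_D.deg).comp' Q.r_deg (add_zero 0)) (add_zero 0)

/-- The coproduct induced on `U = H(C)`. -/
def ψU : TotU E.toChainInclusion →ₗ[ℤ] TotU E.toChainInclusion ⊗[ℤ] TotU E.toChainInclusion :=
  TensorProduct.map Q.p' Q.p' ∘ₗ E.ψC ∘ₗ E.sec

theorem qq_tot (z : E.TotC ⊗[ℤ] E.TotC) :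
    TensorProduct.map Q.q Q.q (TensorProduct.map E.tot E.tot z) =
      TensorProduct.map Q.incl Q.incl (TensorProduct.map Q.p' Q.p' z) := by
  have h : Q.q ∘ₗ E.tot = Q.incl ∘ₗ Q.p' := LinearMap.ext Q.q_tot
  rw [← LinearMap.comp_apply, ← LinearMap.comp_apply, ← TensorProduct.map_comp,
    ← TensorProduct.map_comp, h]

/-- The section `r` maps `U` into `C`, and `ψ_D` restricts to `ψ_C`, so the transferred coproduct
respects `U` before any correction. -/
theorem ψ'_incl (u : TotU E.toChainInclusion) :
    Q.ψ' (Q.incl u) = TensorProduct.map Q.incl Q.incl (Q.ψU u) := by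
  simp only [ψ', ψU, LinearMap.comp_apply]
  rw [Q.r_incl, E.hom, qq_tot]

/-- The character coproduct. -/
def ψ : CharC E.toChainInclusion S →ₗ[ℤ] CharC E.toChainInclusion S ⊗[ℤ] CharC E.toChainInclusion S :=
  -- On `γ ⊕ η` the transferred coproduct is kept. On `α ⊕ β` only its part in `(α ⊕ η) ⊗ (α ⊕ η)`
  -- is kept; the last summand gives the elements of `β` primitives for the coproduct of their
  -- boundaries.
  Q.ψ' ∘ₗ (prC E.toChainInclusion S Letter.γ + prC E.toChainInclusion S Letter.η) +
  TensorProduct.map (prAη E.toChainInclusion S) (prAη E.toChainInclusion S) ∘ₗ Q.ψ' ∘ₗ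
    (prA E.toChainInclusion S + prC E.toChainInclusion S Letter.β) +
  suspC₂ E.toChainInclusion S ∘ₗ Q.ψ' ∘ₗ dChar E.toChainInclusion S

theorem ψ_apply (x : CharC E.toChainInclusion S) : Q.ψ x =
    Q.ψ' (prC E.toChainInclusion S Letter.γ x + prC E.toChainInclusion S Letter.η x) +
    TensorProduct.map (prAη E.toChainInclusion S) (prAη E.toChainInclusion S)
      (Q.ψ' (prA E.toChainInclusion S x + prC E.toChainInclusion S Letter.β x)) +
    suspC₂ E.toChainInclusion S (Q.ψ' (dChar E.toChainInclusion S x)) := rfl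

theorem ψ_deg : GrData.IsDeg (GCh E.toChainInclusion S)
    ((GCh E.toChainInclusion S).prod (GCh E.toChainInclusion S)) Q.ψ 0 := by
  have h1 := (prAη_deg (E := E.toChainInclusion) (S := S)).tmap
    (prAη_deg (E := E.toChainInclusion) (S := S))
  rw [add_zero] at h1
  refine GrData.IsDeg.add (GrData.IsDeg.add ?_ ?_) ?_
  · exact Q.ψ'_deg.comp' ((prC_deg _).add (prC_deg _)) (add_zero 0)
  · exact h1.comp' (Q.ψ'_deg.comp' (prA_deg.add (prC_deg _)) (add_zero 0)) (add_zero 0)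
  · exact suspC₂_deg.comp' (Q.ψ'_deg.comp' dChar_deg (add_zero _)) (neg_add_cancel 1)

/-- The contraction formula, applied to the cycle `ψ' (d x)`, gives back `ψ' (d x)` up to its part
in `(α ⊕ η) ⊗ (α ⊕ η)`, which is zero because `ψ' (d x)` is a boundary. -/
theorem ψ_d (x : CharC E.toChainInclusion S) :
    Q.ψ (dChar E.toChainInclusion S x) = dChar₂ E.toChainInclusion S (Q.ψ x) := by
  have h1 := prA_add (dChar E.toChainInclusion S x)
  have hA : prA E.toChainInclusion S (dChar E.toChainInclusion S x) = 0 :=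
    LinearMap.congr_fun prA_dChar x
  have hβ : prC E.toChainInclusion S Letter.β (dChar E.toChainInclusion S x) = 0 :=
    LinearMap.congr_fun (prC_dChar Letter.β (by simp)) x
  rw [hA, hβ, zero_add, zero_add] at h1
  have h2 : dChar E.toChainInclusion S (prC E.toChainInclusion S Letter.γ x +
      prC E.toChainInclusion S Letter.η x) = 0 := by
    rw [← Q.incl_lam, dChar_θ']
  have h3 := suspC₂_spec (Q.ψ' (dChar E.toChainInclusion S x))
  rw [← Q.ψ'_d, dChar_dChar, map_zero, map_zero, add_zero] at h3
  rw [ψ_apply, ψ_apply, h1, hA, hβ, dChar_dChar]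
  simp only [map_add (dChar₂ _ _), ← Q.ψ'_d, h2, h3, d_prAη_prAη₂]
  rw [Q.ψ'_d x, prAη_prAη₂_d]
  simp

theorem ψ_incl (u : TotU E.toChainInclusion) : Q.ψ (Q.incl u) = Q.ψ' (Q.incl u) := by
  have h1 := prA_add (Q.incl u)
  have hA : prA E.toChainInclusion S (Q.incl u) = 0 := LinearMap.congr_fun Q.prA_incl u
  have hβ : prC E.toChainInclusion S Letter.β (Q.incl u) = 0 :=
    LinearMap.congr_fun (Q.prC_incl Letter.β (by simp) (by simp)) u
  rw [hA, hβ, zero_add, zero_add] at h1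
  rw [ψ_apply, h1, hA, hβ, dChar_θ']
  simp

/-- A homotopy from the character coproduct to the transferred coproduct. -/
def H : CharC E.toChainInclusion S →ₗ[ℤ] CharC E.toChainInclusion S ⊗[ℤ] CharC E.toChainInclusion S :=
  suspC₂ E.toChainInclusion S ∘ₗ (Q.ψ' - Q.ψ)

/-- Both coproducts have the same part in `(α ⊕ η) ⊗ (α ⊕ η)`, so the contraction applies to their
difference without remainder. -/
theorem H_spec (x : CharC E.toChainInclusion S) : Q.ψ' x - Q.ψ x =
    dChar₂ E.toChainInclusion S (Q.H x) + Q.H (dChar E.toChainInclusion S x) := by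
  have h := suspC₂_spec (Q.ψ' x - Q.ψ x)
  have h0 : TensorProduct.map (prAη E.toChainInclusion S) (prAη E.toChainInclusion S)
      (Q.ψ' x - Q.ψ x) = 0 := by
    have hp : ∀ z, TensorProduct.map (prAη E.toChainInclusion S) (prAη E.toChainInclusion S)
        (TensorProduct.map (prAη E.toChainInclusion S) (prAη E.toChainInclusion S) z) =
        TensorProduct.map (prAη E.toChainInclusion S) (prAη E.toChainInclusion S) z := fun z => by
      have := congrArg (TensorProduct.map (prAη E.toChainInclusion S) (prAη E.toChainInclusion S))
        (suspC₂_spec z)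
      rw [map_add, prAη_prAη₂_d, prAη_prAη₂_susp, map_sub, add_zero] at this
      exact (sub_eq_zero.1 this.symm).symm
    rw [map_sub, ψ_apply, map_add, map_add, hp, prAη_prAη₂_susp, add_zero, ← map_add, ← map_add,
      sub_eq_zero]
    congr 2
    conv_lhs => rw [← prA_add x]
    abel
  rw [h0, sub_zero] at h
  rw [← h, map_sub (dChar₂ _ _), ← ψ'_d, ← ψ_d]
  rfl

theorem H_deg : GrData.IsDeg (GCh E.toChainInclusion S)
    ((GCh E.toChainInclusion S).prod (GCh E.toChainInclusion S)) Q.H 1 :=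
  suspC₂_deg.comp' (Q.ψ'_deg.sub Q.ψ_deg) (zero_add 1)

/-- The two coproducts agree on `U`; the homotopy is relative to `U`, as needed for a homotopy of
pairs. -/
theorem H_incl (u : TotU E.toChainInclusion) : Q.H (Q.incl u) = 0 := by
  rw [H, LinearMap.comp_apply, LinearMap.sub_apply, ψ_incl, sub_self, map_zero]

theorem prC_suspC_incl_left (l : Letter S) (hl : l ≠ Letter.β) :
    prC E.toChainInclusion S l ∘ₗ suspC E.toChainInclusion S ∘ₗ Q.incl = 0 := by
  rw [← LinearMap.comp_assoc, prC_suspC l hl, LinearMap.zero_comp]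

theorem prC_sgn_incl (l : Letter S) (hl : l ≠ Letter.η) :
    prC E.toChainInclusion S l ∘ₗ ((GCh E.toChainInclusion S).sgn ∘ₗ prAη E.toChainInclusion S) ∘ₗ
      Q.incl = 0 := by
  have h : prAη E.toChainInclusion S ∘ₗ Q.incl = prC E.toChainInclusion S Letter.η ∘ₗ Q.incl := by
    rw [prAη, LinearMap.add_comp, Q.prA_incl, zero_add]
  rw [LinearMap.comp_assoc, h]
  refine LinearMap.ext fun u => ?_
  simp only [LinearMap.comp_apply, LinearMap.zero_apply]
  rw [← sgn_comm_of_deg_zero (prC_deg l), prC_prC, if_neg (Ne.symm hl), map_zero]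

theorem exists_ψ'_eq_incl {x : CharC E.toChainInclusion S}
    (hx : prC E.toChainInclusion S Letter.γ x + prC E.toChainInclusion S Letter.η x = x) :
    ∃ w, Q.ψ' x = TensorProduct.map Q.incl Q.incl w := by
  refine ⟨Q.ψU (Q.lam x), ?_⟩
  rw [← ψ'_incl, Q.incl_lam, hx]

/-- On `γ ⊕ η` the coproduct comes from `U ⊗ U`, so only `γ` and `η` occur. On `α` it is projected
to `(α ⊕ η) ⊗ (α ⊕ η)`. On `β` the contraction of elements of `U ⊗ U` adds terms in `β ⊗ (γ ⊕ η)`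
and `η ⊗ β`. -/
theorem ψ_allowed (l l' l'' : Letter S) (h : ¬ Letter.Allowed l l' l'') :
    comp E.toChainInclusion S Q.ψ l l' l'' = 0 := by
  have map₂ : ∀ {M M' : Type u} [AddCommGroup M] [Module ℤ M] [AddCommGroup M'] [Module ℤ M']
      (f : M →ₗ[ℤ] CharC E.toChainInclusion S) (g : M' →ₗ[ℤ] CharC E.toChainInclusion S)
      (w : M ⊗[ℤ] M'),
      (prC E.toChainInclusion S l' ∘ₗ f = 0 ∨ prC E.toChainInclusion S l'' ∘ₗ g = 0) →
      TensorProduct.map (prC E.toChainInclusion S l') (prC E.toChainInclusion S l'')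
        (TensorProduct.map f g w) = 0 := by
    intro M M' _ _ _ _ f g w hfg
    rw [← LinearMap.comp_apply, ← TensorProduct.map_comp]
    rcases hfg with e | e <;> rw [e]
    · rw [TensorProduct.map_zero_left]; rfl
    · rw [TensorProduct.map_zero_right]; rfl
  have hI := fun l => Q.prC_incl l
  have hAη := fun l => prC_prAη (E := E.toChainInclusion) (S := S) l
  have hs := fun l => Q.prC_suspC_incl_left l
  have hη := fun l => Q.prC_sgn_incl l
  refine LinearMap.ext fun x => ?_
  simp only [comp, LinearMap.comp_apply, LinearMap.zero_apply]
  cases l with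
  | α hα =>
    have e : Q.ψ (prC E.toChainInclusion S (Letter.α hα) x) =
        TensorProduct.map (prAη E.toChainInclusion S) (prAη E.toChainInclusion S)
          (Q.ψ' (prA E.toChainInclusion S (prC E.toChainInclusion S (Letter.α hα) x))) := by
      have hd : dChar E.toChainInclusion S (prC E.toChainInclusion S (Letter.α hα) x) = 0 := by
        suffices h : dChar E.toChainInclusion S ∘ₗ prC E.toChainInclusion S (Letter.α hα) = 0 from
          LinearMap.congr_fun h x
        refine charC_ext fun l n x => ?_
        rw [LinearMap.comp_apply, prC_inC]
        split_ifs with h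
        · subst h; exact dChar_α hα n x
        · exact map_zero _
      rw [ψ_apply, hd]
      simp [prC_prC]
    rw [e]
    refine map₂ _ _ _ ?_
    cases l' <;> cases l'' <;> first
      | exact absurd trivial h
      | exact Or.inl (hAη _ (Or.inl rfl))
      | exact Or.inl (hAη _ (Or.inr rfl))
      | exact Or.inr (hAη _ (Or.inl rfl))
      | exact Or.inr (hAη _ (Or.inr rfl))
  | β =>
    have hd : dChar E.toChainInclusion S (prC E.toChainInclusion S Letter.β x) =
        dChar E.toChainInclusion S x := by
      rw [← suspC_dChar, dChar_suspC]
      have h1 := prA_add (dChar E.toChainInclusion S x)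
      have hA : prA E.toChainInclusion S (dChar E.toChainInclusion S x) = 0 :=
        LinearMap.congr_fun prA_dChar x
      have hβ : prC E.toChainInclusion S Letter.β (dChar E.toChainInclusion S x) = 0 :=
        LinearMap.congr_fun (prC_dChar Letter.β (by simp)) x
      have hη : prC E.toChainInclusion S Letter.η (dChar E.toChainInclusion S x) = 0 :=
        LinearMap.congr_fun (prC_dChar Letter.η (by simp)) x
      rwa [hA, hβ, hη, zero_add, zero_add, add_zero] at h1
    have hA : prA E.toChainInclusion S (prC E.toChainInclusion S Letter.β x) = 0 := by
      rw [← suspC_dChar]; exact LinearMap.congr_fun prA_suspC _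
    obtain ⟨w, hw⟩ := Q.exists_ψ'_eq_incl (x := dChar E.toChainInclusion S x) (by
      have h1 := Q.incl_lam_of_cycle (dChar_dChar x)
      rwa [show prA _ _ (dChar _ _ x) = 0 from LinearMap.congr_fun prA_dChar x, zero_add,
        Q.incl_lam] at h1)
    rw [ψ_apply, hd, hw, hA]
    simp only [prC_prC, reduceCtorEq, if_false, map_zero, zero_add, if_true, map_add]
    have e1 : suspC₂ E.toChainInclusion S (TensorProduct.map Q.incl Q.incl w) =
        TensorProduct.map (suspC E.toChainInclusion S ∘ₗ Q.incl) Q.incl w +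
        TensorProduct.map (((GCh E.toChainInclusion S).sgn ∘ₗ prAη E.toChainInclusion S) ∘ₗ Q.incl)
          (suspC E.toChainInclusion S ∘ₗ Q.incl) w := by
      have e2 := TensorProduct.map_comp (suspC E.toChainInclusion S) LinearMap.id Q.incl Q.incl
      rw [LinearMap.id_comp] at e2
      rw [TensorProduct.map_comp _ _ Q.incl Q.incl, e2]
      rfl
    rw [e1, map_add, map₂, map₂, map₂]
    · simp
    all_goals cases l' <;> cases l'' <;> first
      | exact absurd trivial h
      | exact Or.inl (hAη _ (Or.inl rfl))
      | exact Or.inl (hAη _ (Or.inr rfl))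
      | exact Or.inr (hAη _ (Or.inl rfl))
      | exact Or.inr (hAη _ (Or.inr rfl))
      | (left; apply hη; intro e; cases e; done)
      | (left; apply hs; intro e; cases e; done)
      | (right; apply hs; intro e; cases e; done)
      | (right; apply hI <;> (intro e; cases e; done))
  | γ =>
    have e := dChar_suspC x
    have h2 : prC E.toChainInclusion S Letter.γ (prC E.toChainInclusion S Letter.γ x) +
        prC E.toChainInclusion S Letter.η (prC E.toChainInclusion S Letter.γ x) =
        prC E.toChainInclusion S Letter.γ x := by simp [prC_prC]
    obtain ⟨w, hw⟩ := Q.exists_ψ'_eq_incl h2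
    have h3 : Q.ψ (prC E.toChainInclusion S Letter.γ x) =
        Q.ψ' (prC E.toChainInclusion S Letter.γ x) := by
      rw [← h2, ← Q.incl_lam, ψ_incl]
    -- Elements of `γ` are boundaries, and a boundary of the tensor square has no component in `η ⊗
    -- η`.
    by_cases hηη : l' = Letter.η ∧ l'' = Letter.η
    · obtain ⟨rfl, rfl⟩ := hηη
      rw [← e, ψ_d, dChar₂, tensorD, LinearMap.add_apply, map_add,
        map₂ _ _ _ (Or.inl (prC_dChar _ (by simp))), map₂ _ _ _ (Or.inr (prC_dChar _ (by simp))),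
        add_zero]
    · rw [h3, hw]
      refine map₂ _ _ _ ?_
      cases l' <;> cases l'' <;> first
        | exact absurd trivial h
        | exact absurd ⟨rfl, rfl⟩ hηη
        | (left; apply hI <;> (intro e; cases e; done))
        | (right; apply hI <;> (intro e; cases e; done))
  | η =>
    have h2 : prC E.toChainInclusion S Letter.γ (prC E.toChainInclusion S Letter.η x) +
        prC E.toChainInclusion S Letter.η (prC E.toChainInclusion S Letter.η x) =
        prC E.toChainInclusion S Letter.η x := by simp [prC_prC]
    obtain ⟨w, hw⟩ := Q.exists_ψ'_eq_incl h2
    have h3 : Q.ψ (prC E.toChainInclusion S Letter.η x) =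
        Q.ψ' (prC E.toChainInclusion S Letter.η x) := by
      rw [← h2, ← Q.incl_lam, ψ_incl]
    rw [h3, hw]
    refine map₂ _ _ _ ?_
    cases l' <;> cases l'' <;> first
      | exact absurd trivial h
      | (left; apply hI <;> (intro e; cases e; done))
      | (right; apply hI <;> (intro e; cases e; done))

theorem exists_homotopy_sub : ∃ hC : E.TotC →ₗ[ℤ] E.TotC, ∀ x, Q.h (E.tot x) = E.tot (hC x) := by
  let e := LinearEquiv.ofInjective E.tot E.tot_injective
  refine ⟨e.symm.toLinearMap ∘ₗ (Q.h ∘ₗ E.tot).codRestrict (LinearMap.range E.tot)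
    fun x => Q.h_mem ⟨x, rfl⟩, fun x => ?_⟩
  exact (congrArg Subtype.val (e.apply_symm_apply ⟨Q.h (E.tot x), Q.h_mem ⟨x, rfl⟩⟩)).symm

/-- The homotopy from `r q` to the identity accounts for `(q ⊗ q) ψ_D ≃ ψ' q`, and `H` for `ψ' ≃ ψ`.
Their sum is the homotopy on `D`; on `C` the second summand vanishes. -/
theorem nonempty_charData (Q : QuotData E.toSplitInclusion S) : Nonempty (CharData E S) := by
  obtain ⟨hC, hhC⟩ := Q.exists_homotopy_sub
  have h1 := (GrData.IsDeg.of_zero Q.q_deg).tmap (GrData.IsDeg.of_zero Q.q_deg)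
  rw [add_zero] at h1
  have hD_deg : GrData.IsDeg E.GD ((GCh E.toChainInclusion S).prod (GCh E.toChainInclusion S))
      (TensorProduct.map Q.q Q.q ∘ₗ E.ψD ∘ₗ Q.h + Q.H ∘ₗ Q.q) 1 :=
    (h1.comp' ((GrData.IsDeg.of_zero E.isCoproduct_D.deg).comp' Q.h_deg (add_zero 1))
      (add_zero 1)).add (Q.H_deg.comp' (GrData.IsDeg.of_zero Q.q_deg) (zero_add 1))
  refine ⟨{ κ := Q.κ, κ_ker := Q.κ_ker, q' := Q.q', q'_cycle := Q.q'_cycle, q := Q.q,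
            q_deg := Q.q_deg, q_chain := Q.q_chain, q_tot := Q.q_tot, q_coker := Q.q_coker,
            ψ := Q.ψ, ψ_coproduct := ⟨fun n x hx => Q.ψ_deg.zero_mem hx, Q.ψ_d⟩,
            ψ_allowed := Q.ψ_allowed, ψU := Q.ψU,
            ψ_θ' := fun x => (Q.ψ_incl x).trans (Q.ψ'_incl x),
            hC := TensorProduct.map Q.p' Q.p' ∘ₗ E.ψC ∘ₗ hC,
            hD := TensorProduct.map Q.q Q.q ∘ₗ E.ψD ∘ₗ Q.h + Q.H ∘ₗ Q.q,
            hD_deg := hD_deg, hD_tot := fun x => ?_, top_face := fun x => ?_,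
            bottom_face := fun x => ?_ }⟩
  · rw [LinearMap.add_apply, LinearMap.comp_apply Q.H, Q.q_tot]
    have h2 : Q.H (Q.incl (Q.p' x)) = 0 := Q.H_incl _
    simp only [LinearMap.comp_apply]
    rw [hhC, E.hom, qq_tot]
    refine (congrArg _ h2).trans (add_zero _)
  -- `U ⊗ U` has zero differential, so `(q' ⊗ q') ψ_C` kills boundaries and one half of the homotopy
  -- formula drops out.
  · have h2 : x - E.sec (Q.p' x) = E.cxC.d (hC x) + hC (E.cxC.d x) := by
      apply E.tot_injective
      rw [map_sub, ← Q.r_incl, map_add, ← hhC, E.tot_d, E.tot_d, ← hhC, ← Q.h_spec, Q.q_tot]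
    have h3 : ∀ y, TensorProduct.map Q.p' Q.p' (E.ψC (E.cxC.d y)) = 0 := fun y => by
      have hp : Q.p' ∘ₗ E.cxC.d = 0 := LinearMap.ext Q.p'_d
      rw [E.isCoproduct_C.chain, tensorD, LinearMap.add_apply, map_add, ← LinearMap.comp_apply,
        ← TensorProduct.map_comp, ← LinearMap.comp_apply (TensorProduct.map Q.p' Q.p'),
        ← TensorProduct.map_comp, hp, TensorProduct.map_zero_left, TensorProduct.map_zero_right]
      exact add_zero _
    have h4 := congrArg (fun y => TensorProduct.map Q.p' Q.p' (E.ψC y)) h2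
    simp only [map_sub, map_add, h3, zero_add] at h4
    exact h4
  · have h2 := congrArg (fun y => TensorProduct.map Q.q Q.q (E.ψD y)) (Q.h_spec x)
    have h3 := Q.H_spec (Q.q x)
    simp only [map_sub, map_add] at h2
    rw [E.isCoproduct_D.chain, qq_d] at h2
    simp only [LinearMap.add_apply, LinearMap.comp_apply, map_add, Q.q_chain]
    have h4 : TensorProduct.map Q.q Q.q (E.ψD (Q.r (Q.q x))) = Q.ψ' (Q.q x) := rfl
    rw [h4] at h2
    rw [← sub_add_sub_cancel _ (Q.ψ' (Q.q x)), h2, h3]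
    abel

end QuotData

/-- Character data exist. -/
theorem CharData.nonempty (E : SplitCoalgInclusion.{u}) (S : Kind)
    (onto : S = Kind.R → ∀ n, Function.Surjective (E.θ n)) : Nonempty (CharData E S) := by
  obtain ⟨Q⟩ := QuotData.nonempty E.toSplitInclusion S onto
  exact Q.nonempty_charData

/-! ### Polyhedral products of complexes with coproducts -/

theorem map_mem_tensorSub {M M' P P' : Type*} [AddCommGroup M] [Module ℤ M] [AddCommGroup M']
    [Module ℤ M'] [AddCommGroup P] [Module ℤ P] [AddCommGroup P'] [Module ℤ P'] (f : M →ₗ[ℤ] P)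
    (g : M' →ₗ[ℤ] P') (z : M ⊗[ℤ] M') :
    TensorProduct.map f g z ∈ tensorSub (LinearMap.range f) (LinearMap.range g) := by
  induction z using TensorProduct.induction_on with
  | zero => rw [map_zero]; exact Submodule.zero_mem _
  | tmul x y => exact Submodule.apply_mem_map₂ _ ⟨x, rfl⟩ ⟨y, rfl⟩
  | add x y hx hy => rw [map_add]; exact Submodule.add_mem _ hx hy

theorem GrData.IsDeg.sgn_comm {M N : Type*} [AddCommGroup M] [Module ℤ M] [AddCommGroup N]
    [Module ℤ N] {G : GrData M} {H : GrData N} {f : M →ₗ[ℤ] N} (hf : IsDeg G H f 0)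
    (hG : G.Lawful) (hH : H.Lawful) : H.sgn ∘ₗ f = f ∘ₗ G.sgn :=
  IsPar.sgn_even (by simpa using hf.par hG hH)

theorem GrData.IsDeg.sgn_anticomm {M N : Type*} [AddCommGroup M] [Module ℤ M] [AddCommGroup N]
    [Module ℤ N] {G : GrData M} {H : GrData N} {f : M →ₗ[ℤ] N} {k : ℤ} (hf : IsDeg G H f k)
    (hG : G.Lawful) (hH : H.Lawful) (hk : (k : ZMod 2) = 1) : H.sgn ∘ₗ f = -(f ∘ₗ G.sgn) :=
  IsPar.sgn_odd (by simpa [hk] using hf.par hG hH)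

theorem GrData.IsDeg.par_mem_range {M N : Type*} [AddCommGroup M] [Module ℤ M] [AddCommGroup N]
    [Module ℤ N] {G : GrData M} {H : GrData N} {f : M →ₗ[ℤ] N} (hf : IsDeg G H f 0)
    (hG : G.Lawful) (hH : H.Lawful) (e : ZMod 2) {x : N} (hx : x ∈ LinearMap.range f) :
    H.par e x ∈ LinearMap.range f := by
  obtain ⟨x, rfl⟩ := hx
  have h : IsPar G H f 0 := by simpa using hf.par hG hH
  exact ⟨G.par e x, by rw [← h, add_zero]⟩

theorem tensorD_deg {M : Type*} [AddCommGroup M] [Module ℤ M] {G : GrData M} {d : M →ₗ[ℤ] M}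
    (hG : G.Lawful) (hd : GrData.IsDeg G G d (-1)) :
    GrData.IsDeg (G.prod G) (G.prod G) (tensorD G d d) (-1) := by
  have h1 := hd.tmap (GrData.IsDeg.id (G := G))
  have h2 := hG.sgn_deg.tmap hd
  rw [add_zero] at h1
  rw [zero_add] at h2
  exact h1.add h2

section Poly

variable {m : ℕ} {A : Fin m → Type u} [∀ k, AddCommGroup (A k)] [∀ k, Module ℤ (A k)]
  {G : ∀ k, GrData (A k)} {d : ∀ k, A k →ₗ[ℤ] A k} {ψ : ∀ k, A k →ₗ[ℤ] A k ⊗[ℤ] A k}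
  {L : ∀ k, Submodule ℤ (A k)}

/-- Outside a simplex the entries of a tensor lie in `L k`, so each condition on the polyhedral
subcomplex reduces to the same condition on every `L k`. -/
theorem CoalgData.isDGC_poly (K : LowerSet (Finset (Fin m))) (hG : ∀ k, (G k).Lawful)
    (hd : ∀ k, GrData.IsDeg (G k) (G k) (d k) (-1)) (hψ : ∀ k, IsCoproduct (G k) (d k) (ψ k))
    (d_mem : ∀ k, ∀ x ∈ L k, d k x ∈ L k) (par_mem : ∀ k e, ∀ x ∈ L k, (G k).par e x ∈ L k)
    (ψ_mem : ∀ k, ∀ x ∈ L k, ψ k x ∈ tensorSub (L k) (L k)) :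
    CoalgData.IsDGC ⟨⨂[ℤ] k, A k, GrData.pi G, piD G d, shuffle G G ∘ₗ PiTensorProduct.map ψ,
      poly K L⟩ where
  lawful := GrData.Lawful.pi hG
  d_deg := piD_deg hG hd
  d_mem x hx := piD_mem_poly d_mem par_mem hx
  par_mem e x hx := pi_par_mem_poly par_mem e hx
  Ψ_bdd := ((shuffle_deg hG hG).comp' (GrData.IsDeg.piMap_zero fun k =>
    GrData.IsDeg.of_zero (hψ k).deg) (add_zero 0)).bdd
  Ψ_mem x hx := shuffle_mem_poly hG hG par_mem par_mem (map_mem_poly ψ_mem hx)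
  Ψ_d x _ := by
    have hd' : ∀ k, GrData.IsPar (G k) (G k) (d k) 1 := fun k => by
      simpa using (hd k).par (hG k) (hG k)
    have h1 := piD_comm (GA := G) (GB := fun k => (G k).prod (G k)) (d := d) (f := ψ)
      (d' := fun k => tensorD (G k) (d k) (d k))
      (fun k => (GrData.IsDeg.of_zero (hψ k).deg).sgn_comm (hG k) ((hG k).prod (hG k)))
      (fun k => LinearMap.ext fun x => ((hψ k).chain x).symm)
    have h2 := shuffle_piD hG hG hd' hd'
    exact (congrArg (shuffle G G) (LinearMap.congr_fun h1 x).symm).trans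
      (LinearMap.congr_fun h2 (PiTensorProduct.map ψ x))

end Poly

/-! ### The quotient map of polyhedral products. -/

section Incl

variable {m : ℕ} (K : LowerSet (Finset (Fin m))) (E : Fin m → SplitCoalgInclusion.{u}) {S : Kind}

theorem GD_lawful (E : ChainInclusion.{u}) : E.GD.Lawful := GrData.ofSum_lawful _ _

theorem GC_lawful (E : ChainInclusion.{u}) : E.GC.Lawful := GrData.ofSum_lawful _ _

theorem GU_lawful (E : ChainInclusion.{u}) : E.GU.Lawful := GrData.ofSum_lawful _ _

theorem inclCx_isDGC : (inclCx K E).IsDGC :=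
  CoalgData.isDGC_poly K (fun k => GD_lawful _) (fun k => (E k).cxD.deg_d)
    (fun k => (E k).isCoproduct_D)
    (by
      rintro k _ ⟨x, rfl⟩
      exact ⟨_, (E k).tot_d x⟩)
    (fun k e x hx => (E k).tot_deg.par_mem_range (GC_lawful _) (GD_lawful _) e hx)
    (by
      rintro k _ ⟨x, rfl⟩
      rw [(E k).hom]
      exact map_mem_tensorSub _ _ _)

variable {E} (χ : ∀ k, CharData (E k) S)

theorem charCx_isDGC : (charCx K χ).IsDGC :=
  CoalgData.isDGC_poly K (fun k => GCh_lawful) (fun k => dChar_deg)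
    (fun k => (χ k).ψ_coproduct)
    (by
      rintro k _ ⟨x, rfl⟩
      rw [dChar_θ']
      exact Submodule.zero_mem _)
    (fun k e x hx => (θ'_deg _).par_mem_range (GU_lawful _) GCh_lawful e hx)
    (by
      rintro k _ ⟨x, rfl⟩
      rw [(χ k).ψ_θ']
      exact map_mem_tensorSub _ _ _)

theorem CharData.q_mem {E : SplitCoalgInclusion.{u}} (χ : CharData E S) {x : E.TotD}
    (hx : x ∈ LinearMap.range E.tot) :
    χ.q x ∈ LinearMap.range (θ' E.toChainInclusion S χ.κ) := by
  obtain ⟨x, rfl⟩ := hx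
  exact ⟨_, (χ.q_tot x).symm⟩

theorem CharData.q_sgn {E : SplitCoalgInclusion.{u}} (χ : CharData E S) :
    (GCh E.toChainInclusion S).sgn ∘ₗ χ.q = χ.q ∘ₗ E.GD.sgn :=
  (GrData.IsDeg.of_zero χ.q_deg).sgn_comm (GD_lawful _) GCh_lawful

theorem φincl_isChainMap : CoalgData.IsChainMap (inclCx K E) (charCx K χ) (φincl K χ) where
  deg _ _ hx := (GrData.IsDeg.piMap_zero fun k => GrData.IsDeg.of_zero (χ k).q_deg).zero_mem hx
  sub _ hx := map_mem_poly (fun k _ => (χ k).q_mem) hx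
  comm x _ := (LinearMap.congr_fun (piD_comm (fun k => (χ k).q_sgn)
    (fun k => LinearMap.ext fun x => ((χ k).q_chain x).symm)) x).symm

/-- The quotient maps of character data. -/
def CharData.quot {E : SplitCoalgInclusion.{u}} (χ : CharData E S)
    (onto : S = Kind.R → ∀ n, Function.Surjective (E.θ n)) : QuotData E.toSplitInclusion S where
  onto := onto
  κ := χ.κ
  κ_ker := χ.κ_ker
  q' := χ.q'
  q'_cycle := χ.q'_cycle
  q := χ.q
  q_deg := χ.q_deg
  q_chain := χ.q_chain
  q_tot := χ.q_tot
  q_coker := χ.q_coker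

/-- `r_1 ⊗ ⋯ ⊗ r_m` inverts `q_1 ⊗ ⋯ ⊗ q_m` up to the tensor homotopy, and both respect the
polyhedral subcomplexes because every factor does. Sections and homotopies are constructed from the
quotient maps alone, so every choice of character data is covered. -/
theorem φincl_bijective (onto : S = Kind.R → ∀ k n, Function.Surjective ((E k).θ n)) :
    Function.Bijective (CoalgData.pull (φincl_isChainMap K χ).pullOK) := by
  let Q := fun k => (χ k).quot fun h => onto h k
  have hD : ∀ k, (E k).GD.Lawful := fun k => GD_lawful _
  have hrq : ∀ k, GrData.IsDeg (E k).GD (E k).GD ((Q k).r ∘ₗ (Q k).q) 0 := fun k =>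
    (Q k).r_deg.comp' (GrData.IsDeg.of_zero (Q k).q_deg) (add_zero 0)
  have r_mem : ∀ k, ∀ x ∈ LinearMap.range (Q k).incl, (Q k).r x ∈ LinearMap.range (E k).tot := by
    rintro k _ ⟨u, rfl⟩
    exact ⟨_, ((Q k).r_incl u).symm⟩
  refine CoalgData.pull_bijective (φincl_isChainMap K χ) (PiTensorProduct.map fun k => (Q k).r)
    (piHomotopy (fun k => (E k).GD) (fun k => LinearMap.id) (fun k => (Q k).r ∘ₗ (Q k).q)
      fun k => (Q k).h) (GrData.IsDeg.piMap_zero fun k => (Q k).r_deg).bdd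
    (piHomotopy_deg hD (fun k => GrData.IsDeg.id) hrq fun k => (Q k).h_deg).bdd
    (fun y hy => map_mem_poly r_mem hy) (fun y _ => ?_) (fun x hx => ?_) (fun x _ => ?_)
    (fun y _ => ?_)
  · exact (LinearMap.congr_fun (piD_comm
      (fun k => (Q k).r_deg.sgn_comm GCh_lawful (hD k))
      (fun k => LinearMap.ext fun x => (Q k).d_r x)) y).symm
  · exact piHomotopy_mem_poly
      (fun k e x hx => (E k).tot_deg.par_mem_range (GC_lawful _) (GD_lawful _) e hx)
      (fun k x hx => hx) (fun k x hx => r_mem k _ ((χ k).q_mem hx)) (fun k x hx => (Q k).h_mem hx) hx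
  · have h := piHomotopy_spec (fun k => (hD k).sgn_sgn)
      (fun k => (GrData.IsDeg.id (G := (E k).GD)).sgn_comm (hD k) (hD k))
      (fun k => (hrq k).sgn_comm (hD k) (hD k))
      (fun k => (Q k).h_deg.sgn_anticomm (hD k) (hD k) (by simp))
      (fun k => (E k).cxD.deg_d.sgn_anticomm (hD k) (hD k) (by simp))
      (fun k => by rw [LinearMap.comp_id, LinearMap.id_comp])
      (fun k => LinearMap.ext fun x => by
        simp only [LinearMap.comp_apply]
        rw [(Q k).d_r, (Q k).q_chain])
      (fun k => LinearMap.ext (Q k).h_spec)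
    rw [PiTensorProduct.map_id, PiTensorProduct.map_comp] at h
    exact LinearMap.congr_fun h x
  · have h : PiTensorProduct.map (fun k => (Q k).q) ∘ₗ PiTensorProduct.map (fun k => (Q k).r) =
        LinearMap.id := by
      rw [← PiTensorProduct.map_comp, ← PiTensorProduct.map_id]
      congr 1
      exact funext fun k => LinearMap.ext (Q k).q_r
    exact LinearMap.congr_fun h y

/-- The bottom faces give homotopies of pairs between `(q_k ⊗ q_k) ψ_{D_k}` and `ψ̂_k q_k`. Their
tensor homotopy followed by the shuffle is the one required by `CoalgData.pull_mul`. -/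
theorem φincl_mul (a b : (charCx K χ).Coh) :
    CoalgData.pull (φincl_isChainMap K χ).pullOK ((charCx K χ).mul (charCx_isDGC K χ).mulOK a b) =
      (inclCx K E).mul (inclCx_isDGC K E).mulOK (CoalgData.pull (φincl_isChainMap K χ).pullOK a)
        (CoalgData.pull (φincl_isChainMap K χ).pullOK b) := by
  have hD : ∀ k, (E k).GD.Lawful := fun k => GD_lawful _
  have hC : ∀ k, (GCh (E k).toChainInclusion S).Lawful := fun k => GCh_lawful
  have hC₂ := fun k => (hC k).prod (hC k)
  have hq : ∀ k, GrData.IsDeg (E k).GD (GCh (E k).toChainInclusion S) (χ k).q 0 := fun k =>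
    GrData.IsDeg.of_zero (χ k).q_deg
  have hqq := fun k => (hq k).tmap (hq k)
  simp only [add_zero] at hqq
  let f := fun k => TensorProduct.map (χ k).q (χ k).q ∘ₗ (E k).ψD
  let g := fun k => (χ k).ψ ∘ₗ (χ k).q
  have hf : ∀ k, GrData.IsDeg (E k).GD _ (f k) 0 := fun k =>
    (hqq k).comp' (GrData.IsDeg.of_zero (E k).isCoproduct_D.deg) (add_zero 0)
  have hg : ∀ k, GrData.IsDeg (E k).GD _ (g k) 0 := fun k =>
    (GrData.IsDeg.of_zero (χ k).ψ_coproduct.deg).comp' (hq k) (add_zero 0)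
  have hd : ∀ k, GrData.IsPar _ _ (dChar (E k).toChainInclusion S) 1 := fun k => by
    simpa using (dChar_deg (E := (E k).toChainInclusion) (S := S)).par GCh_lawful GCh_lawful
  have hq_par : ∀ k, GrData.IsPar (E k).GD (GCh (E k).toChainInclusion S) (χ k).q 0 := fun k => by
    simpa using (hq k).par (hD k) (hC k)
  have hpar : ∀ k e, ∀ x ∈ LinearMap.range (θ' (E k).toChainInclusion S (χ k).κ),
      (GCh (E k).toChainInclusion S).par e x ∈ LinearMap.range (θ' (E k).toChainInclusion S (χ k).κ) :=
    fun k e x hx => (θ'_deg _).par_mem_range (GU_lawful _) GCh_lawful e hx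
  let T := shuffle (fun k => GCh (E k).toChainInclusion S) (fun k => GCh (E k).toChainInclusion S) ∘ₗ
    piHomotopy (fun k => (E k).GD) f g fun k => (χ k).hD
  have hfd : ∀ k, tensorD (GCh (E k).toChainInclusion S) (dChar (E k).toChainInclusion S)
      (dChar (E k).toChainInclusion S) ∘ₗ f k = f k ∘ₗ (E k).cxD.d := fun k => by
    refine LinearMap.ext fun x => ?_
    simp only [f, LinearMap.comp_apply]
    rw [(E k).isCoproduct_D.chain, tensorD, tensorD]
    simp only [LinearMap.add_apply, map_add]
    simp only [← LinearMap.comp_apply, ← LinearMap.comp_assoc, ← TensorProduct.map_comp]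
    rw [(χ k).q_sgn, show (χ k).q ∘ₗ (E k).cxD.d = dChar (E k).toChainInclusion S ∘ₗ (χ k).q from
      LinearMap.ext (χ k).q_chain]
    rfl
  have hgd : ∀ k, tensorD (GCh (E k).toChainInclusion S) (dChar (E k).toChainInclusion S)
      (dChar (E k).toChainInclusion S) ∘ₗ g k = g k ∘ₗ (E k).cxD.d := fun k => by
    refine LinearMap.ext fun x => ?_
    simp only [g, LinearMap.comp_apply]
    rw [(χ k).q_chain, (χ k).ψ_coproduct.chain]
  have hspec := piHomotopy_spec (fun k => (hD k).sgn_sgn) (fun k => (hf k).sgn_comm (hD k) (hC₂ k))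
    (fun k => (hg k).sgn_comm (hD k) (hC₂ k))
    (fun k => GrData.IsDeg.sgn_anticomm (k := 1) (χ k).hD_deg (hD k) (hC₂ k) (by simp))
    (fun k => (E k).cxD.deg_d.sgn_anticomm (hD k) (hD k) (by simp)) hfd hgd
    (fun k => LinearMap.ext (χ k).bottom_face)
  have hsh := shuffle_map hD hD hC hC hq_par hq_par
  have hshd := shuffle_piD hC hC hd hd
  refine CoalgData.pull_mul (φincl_isChainMap K χ) _ _ T ?_ (fun x hx => ?_) (fun x _ => ?_) a b
  · exact ((shuffle_deg hC hC).comp' (piHomotopy_deg hD hf hg fun k => (χ k).hD_deg) rfl).bdd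
  · refine shuffle_mem_poly hC hC hpar hpar (piHomotopy_mem_poly
      (L := fun k => LinearMap.range (E k).tot)
      (fun k e x hx => (E k).tot_deg.par_mem_range (GC_lawful _) (GD_lawful _) e hx) ?_ ?_ ?_ hx)
    · rintro k _ ⟨x, rfl⟩
      simp only [f, LinearMap.comp_apply]
      rw [(E k).hom]
      exact tensorSub_map (fun x => (χ k).q_mem) (fun x => (χ k).q_mem) (map_mem_tensorSub _ _ _)
    · rintro k _ ⟨x, rfl⟩
      simp only [g, LinearMap.comp_apply]
      rw [(χ k).q_tot, (χ k).ψ_θ']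
      exact map_mem_tensorSub _ _ _
    · rintro k _ ⟨x, rfl⟩
      rw [(χ k).hD_tot]
      exact map_mem_tensorSub _ _ _
  · have h1 : ∀ x : ⨂[ℤ] k, (E k).TotD, _ := fun x =>
      congrArg (shuffle (fun k => GCh (E k).toChainInclusion S)
        (fun k => GCh (E k).toChainInclusion S)) (LinearMap.congr_fun hspec x)
    simp only [LinearMap.sub_apply, LinearMap.add_apply, map_sub, map_add] at h1
    have h2 : PiTensorProduct.map f = PiTensorProduct.map
        (fun k => TensorProduct.map (χ k).q (χ k).q) ∘ₗ PiTensorProduct.map fun k => (E k).ψD :=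
      PiTensorProduct.map_comp _ _
    have h3 : PiTensorProduct.map g = PiTensorProduct.map (fun k => (χ k).ψ) ∘ₗ
      PiTensorProduct.map fun k => (χ k).q := PiTensorProduct.map_comp _ _
    rw [h2, h3] at h1
    refine Eq.trans ?_ ((h1 x).trans (congrArg₂ (· + ·) (LinearMap.congr_fun hshd _) rfl))
    exact congrArg₂ (· - ·) (LinearMap.congr_fun hsh _).symm rfl

end Incl

/-! ### Components of the character coproduct -/

section Components

variable {E : ChainInclusion.{u}} {S : Kind}

theorem toModule_inH {N : Type*} [AddCommGroup N] [Module ℤ N]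
    (f : ∀ p : Idx S × ℤ, HPiece E S p →ₗ[ℤ] N) (s : Idx S) (n : ℤ) (x : CharGrp E s n) :
    DirectSum.toModule ℤ (Idx S × ℤ) N f (inH E S s n x) = f (s, n) x :=
  DirectSum.toModule_lof ℤ (φ := f) (s, n) x

theorem GH_lawful : (GH E S).Lawful := GrData.ofSum_lawful _ _

theorem inH_mem_gr (s : Idx S) (n : ℤ) (x : CharGrp E s n) : inH E S s n x ∈ (GH E S).gr n :=
  GrData.lof_mem_ofSum (X := HPiece E S) (deg := fun p => p.2) (s, n) x

theorem isDeg_charH {N : Type*} [AddCommGroup N] [Module ℤ N] {H : GrData N}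
    {f : CharH E S →ₗ[ℤ] N} {k : ℤ}
    (h : ∀ s n (x : CharGrp E s n), f (inH E S s n x) ∈ H.gr (n + k)) :
    GrData.IsDeg (GH E S) H f k :=
  GrData.isDeg_ofSum (X := HPiece E S) (deg := fun p => p.2) (f := f) fun p x => h p.1 p.2 x

theorem prH_inH (s s' : Idx S) (n : ℤ) (x : CharGrp E s' n) :
    prH E S s (inH E S s' n x) = if s' = s then inH E S s' n x else 0 :=
  projOn_lof (HPiece E S) (fun p => p.1 = s) (s', n) x

theorem prH_deg (s : Idx S) : GrData.IsDeg (GH E S) (GH E S) (prH E S s) 0 :=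
  isDeg_charH fun s' n x => by
    rw [add_zero, prH_inH]
    split_ifs
    · exact inH_mem_gr s' n x
    · exact Submodule.zero_mem _

/-- `coker θ ⊕ Σ ker θ ⊕ ker θ ⊕ im θ → coker θ ⊕ ker θ ⊕ im θ`, the identity on every summand. -/
def toH (E : ChainInclusion.{u}) (S : Kind) : CharC E S →ₗ[ℤ] CharH E S :=
  DirectSum.toModule ℤ (Letter S × ℤ) (CharH E S) fun p => inH E S p.1.idx p.2

theorem toH_inC (l : Letter S) (n : ℤ) (x : CharGrp E l.idx n) :
    toH E S (inC E S l n x) = inH E S l.idx n x := toModule_inC _ l n x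

theorem φ₁_inC (l : Letter S) (n : ℤ) (x : CharGrp E l.idx n) :
    φ₁ E S (inC E S l n x) = gen S l ⊗ₜ[ℤ] inH E S l.idx n x := toModule_inC _ l n x

/-- The generator of given index other than `β`. -/
def Idx.letter : Idx S → Letter S
  | Idx.sig h => Letter.α h
  | Idx.omg => Letter.γ
  | Idx.emp => Letter.η

/-- `forgetC` kills `β`, so the part of given index sees only one summand of the character complex.
-/
theorem prH_forgetC (s : Idx S) :
    prH E S s ∘ₗ forgetC E S = toH E S ∘ₗ prC E S s.letter := by
  refine charC_ext fun l n x => ?_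
  rw [LinearMap.comp_apply, LinearMap.comp_apply, prC_inC]
  have h : forgetC E S (inC E S l n x) = if l = Letter.β then 0 else inH E S l.idx n x := by
    refine (toModule_inC _ l n x).trans ?_
    cases l <;> rfl
  rw [h]
  have h2 : l ≠ Letter.β → (l.idx = s ↔ l = s.letter) := fun hl => by
    cases l <;> cases s <;> simp [Letter.idx, Idx.letter] at hl ⊢
  by_cases hl : l = Letter.β
  · have h3 : ¬ l = s.letter := by subst hl; cases s <;> nofun
    rw [if_pos hl, if_neg h3, map_zero, map_zero]
  · rw [if_neg hl, prH_inH]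
    split_ifs with h4 h5 h5
    · exact (toH_inC l n x).symm
    · exact absurd ((h2 hl).1 h4) h5
    · exact absurd ((h2 hl).2 h5) h4
    · exact (map_zero _).symm

theorem liftH_sig (h : S = Kind.X) (n : ℤ) (x : CharGrp E (Letter.α h).idx n) :
    liftH E S (inH E S (Letter.α h).idx n x) = inC E S (Letter.α h) n x :=
  toModule_inH _ (Idx.sig h) n x

theorem liftH_omg (n : ℤ) (x : CharGrp E (Idx.omg (S := S)) n) :
    liftH E S (inH E S Idx.omg n x) = inC E S Letter.γ n x + inC E S Letter.β n x :=
  toModule_inH _ Idx.omg n x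

theorem liftH_emp (n : ℤ) (x : CharGrp E (Letter.η (S := S)).idx n) :
    liftH E S (inH E S Letter.η.idx n x) = inC E S Letter.η n x :=
  toModule_inH _ Idx.emp n x

theorem exists_prC_eq (l : Letter S) {n : ℤ} {x : CharC E S} (hx : x ∈ (GCh E S).gr n) :
    ∃ y : CharGrp E l.idx (n - l.deg), prC E S l x = inC E S l (n - l.deg) y := by
  induction hx using Submodule.span_induction with
  | mem x hx =>
    obtain ⟨⟨l', j⟩, hp, x, rfl⟩ := hx
    by_cases hl : l' = l
    · subst hl
      obtain rfl : j = n - l'.deg := eq_sub_of_add_eq hp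
      exact ⟨x, (prC_inC l' l' _ x).trans (if_pos rfl)⟩
    · exact ⟨0, ((prC_inC l l' j x).trans (if_neg hl)).trans (map_zero _).symm⟩
  | zero => exact ⟨0, by rw [map_zero, map_zero]⟩
  | add x y _ _ hx hy =>
    obtain ⟨a, ha⟩ := hx
    obtain ⟨b, hb⟩ := hy
    exact ⟨a + b, by rw [map_add, map_add, ha, hb]⟩
  | smul c x _ hx =>
    obtain ⟨a, ha⟩ := hx
    exact ⟨c • a, by rw [map_smul, map_smul, ha]⟩

theorem prC_dChar_γ : prC E S Letter.γ ∘ₗ dChar E S = dChar E S ∘ₗ prC E S Letter.β := by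
  refine charC_ext fun l n x => ?_
  rw [LinearMap.comp_apply, LinearMap.comp_apply, prC_inC]
  cases l with
  | α h => rw [dChar_α]; simp
  | β =>
    rw [dChar_β]
    refine (prC_inC Letter.γ Letter.γ n x).trans ?_
    rw [if_pos rfl, if_pos rfl, dChar_β]
  | γ => rw [dChar_γ]; simp
  | η => rw [dChar_η]; simp

/-- An element of `β` and its desuspension in `γ` are the same element of `ker θ`. -/
theorem toH_dChar : toH E S ∘ₗ dChar E S = toH E S ∘ₗ prC E S Letter.β := by
  refine charC_ext fun l n x => ?_
  rw [LinearMap.comp_apply, LinearMap.comp_apply, prC_inC]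
  cases l with
  | α h => rw [dChar_α]; simp
  | β =>
    rw [dChar_β, if_pos rfl, toH_inC]
    exact toH_inC Letter.γ n x
  | γ => rw [dChar_γ]; simp
  | η => rw [dChar_η]; simp

theorem toH_sgn_η : toH E S ∘ₗ (GCh E S).sgn ∘ₗ prC E S Letter.η =
    (GH E S).sgn ∘ₗ toH E S ∘ₗ prC E S Letter.η := by
  refine charC_ext fun l n x => ?_
  simp only [LinearMap.comp_apply]
  rw [prC_inC]
  split_ifs with h
  · subst h
    have h1 : (GCh E S).par n (inC E S Letter.η n x) = inC E S Letter.η n x := by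
      rw [GCh_lawful.par_gr _ _ _ (inC_mem_gr Letter.η n x)]
      simp [Letter.deg]
    have h2 : (GH E S).par n (inH E S Letter.η.idx n x) = inH E S Letter.η.idx n x := by
      rw [GH_lawful.par_gr _ _ _ (inH_mem_gr _ n x), if_pos rfl]
    rw [GCh_lawful.sgn_hom h1, map_smul, toH_inC, GH_lawful.sgn_hom h2]
  · simp

end Components

/-! ### Components from `β` against components from `γ`. -/

namespace CharData

variable {E : SplitCoalgInclusion.{u}} {S : Kind} (χ : CharData E S)

theorem comp_apply_eq (l l' l'' : Letter S) (x : CharC E.toChainInclusion S) :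
    comp E.toChainInclusion S χ.ψ l l' l'' x = TensorProduct.map (prC E.toChainInclusion S l')
      (prC E.toChainInclusion S l'') (χ.ψ (prC E.toChainInclusion S l x)) := rfl

theorem comp_inC (l l' l'' : Letter S) (n : ℤ) (x : CharGrp E.toChainInclusion l.idx n) :
    comp E.toChainInclusion S χ.ψ l l' l'' (inC E.toChainInclusion S l n x) =
      TensorProduct.map (prC E.toChainInclusion S l') (prC E.toChainInclusion S l'')
        (χ.ψ (inC E.toChainInclusion S l n x)) := by
  rw [comp_apply_eq, prC_inC, if_pos rfl]

/-- The chain map condition on `β`, read in one component of the tensor square; the two terms are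
those of the Leibniz rule. -/
theorem comp_d (l' l'' : Letter S) (x : CharC E.toChainInclusion S) :
    comp E.toChainInclusion S χ.ψ Letter.γ l' l'' (dChar E.toChainInclusion S x) =
      TensorProduct.map (prC E.toChainInclusion S l' ∘ₗ dChar E.toChainInclusion S)
          (prC E.toChainInclusion S l'') (χ.ψ (prC E.toChainInclusion S Letter.β x)) +
        TensorProduct.map ((GCh E.toChainInclusion S).sgn ∘ₗ prC E.toChainInclusion S l')
          (prC E.toChainInclusion S l'' ∘ₗ dChar E.toChainInclusion S)
          (χ.ψ (prC E.toChainInclusion S Letter.β x)) := by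
  rw [comp_apply_eq, ← LinearMap.comp_apply (prC _ _ _), prC_dChar_γ, LinearMap.comp_apply,
    χ.ψ_coproduct.chain, tensorD, LinearMap.add_apply, map_add]
  congr 1
  · rw [← LinearMap.comp_apply, ← TensorProduct.map_comp, LinearMap.comp_id]
  · rw [← LinearMap.comp_apply, ← TensorProduct.map_comp]
    congr 2
    exact LinearMap.ext fun y => (sgn_comm_of_deg_zero (prC_deg l') y).symm

/-- The second term of the Leibniz rule would come from `β → γ ⊗ β`, which is not allowed. So `β → β
⊗ γ` alone determines `γ → γ ⊗ γ`. -/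
theorem comp_γγ (x : CharC E.toChainInclusion S) :
    comp E.toChainInclusion S χ.ψ Letter.γ Letter.γ Letter.γ (dChar E.toChainInclusion S x) =
      TensorProduct.map (dChar E.toChainInclusion S) LinearMap.id
        (comp E.toChainInclusion S χ.ψ Letter.β Letter.β Letter.γ x) := by
  have h := LinearMap.congr_fun (χ.ψ_allowed Letter.β Letter.γ Letter.β fun h => h) x
  rw [comp_apply_eq, LinearMap.zero_apply] at h
  have e : TensorProduct.map ((GCh E.toChainInclusion S).sgn ∘ₗ prC E.toChainInclusion S Letter.γ)
      (prC E.toChainInclusion S Letter.γ ∘ₗ dChar E.toChainInclusion S)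
      (χ.ψ (prC E.toChainInclusion S Letter.β x)) = 0 := by
    rw [prC_dChar_γ, TensorProduct.map_comp, LinearMap.comp_apply, h, map_zero]
  rw [comp_d, e, add_zero, comp_apply_eq, prC_dChar_γ, ← LinearMap.comp_apply
    (TensorProduct.map (dChar _ _) _), ← TensorProduct.map_comp, LinearMap.id_comp]

theorem comp_γη (x : CharC E.toChainInclusion S) :
    comp E.toChainInclusion S χ.ψ Letter.γ Letter.γ Letter.η (dChar E.toChainInclusion S x) =
      TensorProduct.map (dChar E.toChainInclusion S) LinearMap.id
        (comp E.toChainInclusion S χ.ψ Letter.β Letter.β Letter.η x) := by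
  rw [comp_d, prC_dChar Letter.η (by simp), TensorProduct.map_zero_right, LinearMap.zero_apply,
    add_zero, comp_apply_eq, prC_dChar_γ, ← LinearMap.comp_apply
    (TensorProduct.map (dChar _ _) _), ← TensorProduct.map_comp, LinearMap.id_comp]

theorem comp_ηγ (x : CharC E.toChainInclusion S) :
    comp E.toChainInclusion S χ.ψ Letter.γ Letter.η Letter.γ (dChar E.toChainInclusion S x) =
      TensorProduct.map (GCh E.toChainInclusion S).sgn (dChar E.toChainInclusion S)
        (comp E.toChainInclusion S χ.ψ Letter.β Letter.η Letter.β x) := by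
  rw [comp_d, prC_dChar Letter.η (by simp), TensorProduct.map_zero_left, LinearMap.zero_apply,
    zero_add, comp_apply_eq, prC_dChar_γ, ← LinearMap.comp_apply
    (TensorProduct.map (GCh _ _).sgn _), ← TensorProduct.map_comp]

theorem comp_eq_zero_of_d {l' l'' : Letter S} {f : CharC E.toChainInclusion S ⊗[ℤ]
    CharC E.toChainInclusion S →ₗ[ℤ] CharC E.toChainInclusion S ⊗[ℤ] CharC E.toChainInclusion S}
    {k' k'' : Letter S} (h : ∀ x, comp E.toChainInclusion S χ.ψ Letter.γ l' l''
      (dChar E.toChainInclusion S x) = f (comp E.toChainInclusion S χ.ψ Letter.β k' k'' x))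
    (h0 : comp E.toChainInclusion S χ.ψ Letter.β k' k'' = 0) :
    comp E.toChainInclusion S χ.ψ Letter.γ l' l'' = 0 := by
  refine LinearMap.ext fun x => ?_
  have h1 := h (suspC E.toChainInclusion S x)
  rw [dChar_suspC, h0, LinearMap.zero_apply, map_zero, comp_apply_eq, prC_prC, if_pos rfl] at h1
  exact h1

theorem suspC_dChar_prC : (suspC E.toChainInclusion S ∘ₗ dChar E.toChainInclusion S) ∘ₗ
    prC E.toChainInclusion S Letter.β = prC E.toChainInclusion S Letter.β :=
  LinearMap.ext fun y => by
    simp only [LinearMap.comp_apply]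
    rw [suspC_dChar, prC_prC, if_pos rfl]

theorem tensor_suspC_comp (l : Letter S) (x : CharC E.toChainInclusion S) :
    TensorProduct.map (suspC E.toChainInclusion S) LinearMap.id
      (TensorProduct.map (dChar E.toChainInclusion S) LinearMap.id
        (comp E.toChainInclusion S χ.ψ Letter.β Letter.β l x)) =
      comp E.toChainInclusion S χ.ψ Letter.β Letter.β l x := by
  rw [comp_apply_eq, TensorProduct.map_map, TensorProduct.map_map, suspC_dChar_prC,
    LinearMap.id_comp, LinearMap.id_comp]

/-- The differential is an isomorphism from `β` to `γ`, so the two components vanish together. The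
coproduct of `T` records only which components vanish, and such equivalences are what makes it a
chain map. -/
theorem comp_γγ_eq_zero_iff :
    comp E.toChainInclusion S χ.ψ Letter.γ Letter.γ Letter.γ = 0 ↔
      comp E.toChainInclusion S χ.ψ Letter.β Letter.β Letter.γ = 0 := by
  refine ⟨fun h => LinearMap.ext fun x => ?_, χ.comp_eq_zero_of_d χ.comp_γγ⟩
  rw [← tensor_suspC_comp, ← comp_γγ, h, LinearMap.zero_apply, map_zero, LinearMap.zero_apply]

theorem comp_γη_eq_zero_iff :
    comp E.toChainInclusion S χ.ψ Letter.γ Letter.γ Letter.η = 0 ↔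
      comp E.toChainInclusion S χ.ψ Letter.β Letter.β Letter.η = 0 := by
  refine ⟨fun h => LinearMap.ext fun x => ?_, χ.comp_eq_zero_of_d χ.comp_γη⟩
  rw [← tensor_suspC_comp, ← comp_γη, h, LinearMap.zero_apply, map_zero, LinearMap.zero_apply]

theorem comp_ηγ_eq_zero_iff :
    comp E.toChainInclusion S χ.ψ Letter.γ Letter.η Letter.γ = 0 ↔
      comp E.toChainInclusion S χ.ψ Letter.β Letter.η Letter.β = 0 := by
  refine ⟨fun h => LinearMap.ext fun x => ?_, χ.comp_eq_zero_of_d χ.comp_ηγ⟩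
  have h1 : TensorProduct.map (GCh E.toChainInclusion S).sgn (suspC E.toChainInclusion S)
      (TensorProduct.map (GCh E.toChainInclusion S).sgn (dChar E.toChainInclusion S)
        (comp E.toChainInclusion S χ.ψ Letter.β Letter.η Letter.β x)) =
      comp E.toChainInclusion S χ.ψ Letter.β Letter.η Letter.β x := by
    rw [comp_apply_eq, TensorProduct.map_map, TensorProduct.map_map, suspC_dChar_prC,
      GCh_lawful.sgn_sgn, LinearMap.id_comp]
  rw [← h1, ← comp_ηγ, h, LinearMap.zero_apply, map_zero, LinearMap.zero_apply]

theorem map_prC_ψ_eq_zero {l l' l'' : Letter S} (h : ¬ Letter.Allowed l l' l'') (n : ℤ)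
    (x : CharGrp E.toChainInclusion l.idx n) :
    TensorProduct.map (prC E.toChainInclusion S l') (prC E.toChainInclusion S l'')
      (χ.ψ (inC E.toChainInclusion S l n x)) = 0 := by
  rw [← comp_inC, χ.ψ_allowed l l' l'' h, LinearMap.zero_apply]

/-- The map from the summand `l' ⊗ l''` of `CharC ⊗ CharC` to `CharH ⊗ CharH`, with the sign of
moving `l''` past the first factor. -/
def toH₂ (E : ChainInclusion.{u}) (l'' : Letter S) :
    CharC E S ⊗[ℤ] CharC E S →ₗ[ℤ] CharH E S ⊗[ℤ] CharH E S :=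
  TensorProduct.map ((if l'' = Letter.β then (GH E S).sgn else LinearMap.id) ∘ₗ toH E S) (toH E S)

theorem toH₂_of_ne {l : Letter S} (hl : l ≠ Letter.β) :
    toH₂ E.toChainInclusion l = TensorProduct.map (toH E.toChainInclusion S)
      (toH E.toChainInclusion S) := by
  rw [toH₂, if_neg hl, LinearMap.id_comp]

theorem map_prH_ψH (s s' : Idx S) (x : CharH E.toChainInclusion S) :
    TensorProduct.map (prH E.toChainInclusion S s) (prH E.toChainInclusion S s') (χ.ψH x) =
      TensorProduct.map (toH E.toChainInclusion S) (toH E.toChainInclusion S)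
        (TensorProduct.map (prC E.toChainInclusion S s.letter) (prC E.toChainInclusion S s'.letter)
          (χ.ψ (liftH E.toChainInclusion S x))) := by
  simp only [ψH, LinearMap.comp_apply]
  rw [← LinearMap.comp_apply, ← TensorProduct.map_comp, prH_forgetC, prH_forgetC,
    TensorProduct.map_comp, LinearMap.comp_apply]

theorem toH₂_comp_β_γ (l : Letter S) (x : CharC E.toChainInclusion S) :
    TensorProduct.map (toH E.toChainInclusion S) (toH E.toChainInclusion S)
      (TensorProduct.map (dChar E.toChainInclusion S) LinearMap.id
        (comp E.toChainInclusion S χ.ψ Letter.β Letter.β l x)) =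
      TensorProduct.map (toH E.toChainInclusion S) (toH E.toChainInclusion S)
        (comp E.toChainInclusion S χ.ψ Letter.β Letter.β l x) := by
  have h : prC E.toChainInclusion S Letter.β ∘ₗ prC E.toChainInclusion S Letter.β =
      prC E.toChainInclusion S Letter.β := LinearMap.ext fun y => by
    rw [LinearMap.comp_apply, prC_prC, if_pos rfl]
  rw [comp_apply_eq, TensorProduct.map_map, TensorProduct.map_map, TensorProduct.map_map,
    toH_dChar, LinearMap.comp_id, LinearMap.comp_assoc, h]

/-- Moving the differential past the first factor costs the sign of that factor; `toH₂` carries the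
same sign when the second letter is `β`. -/
theorem toH₂_comp_η_β (x : CharC E.toChainInclusion S) :
    TensorProduct.map (toH E.toChainInclusion S) (toH E.toChainInclusion S)
      (TensorProduct.map (GCh E.toChainInclusion S).sgn (dChar E.toChainInclusion S)
        (comp E.toChainInclusion S χ.ψ Letter.β Letter.η Letter.β x)) =
      toH₂ E.toChainInclusion Letter.β
        (comp E.toChainInclusion S χ.ψ Letter.β Letter.η Letter.β x) := by
  have h : prC E.toChainInclusion S Letter.β ∘ₗ prC E.toChainInclusion S Letter.β =
      prC E.toChainInclusion S Letter.β := LinearMap.ext fun y => by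
    rw [LinearMap.comp_apply, prC_prC, if_pos rfl]
  rw [comp_apply_eq, toH₂, if_pos rfl, TensorProduct.map_map, TensorProduct.map_map,
    TensorProduct.map_map, toH_dChar, LinearMap.comp_assoc, toH_sgn_η, LinearMap.comp_assoc, h,
    LinearMap.comp_assoc]

/-- On `ker θ` the coproduct `ψ(ϑ)` is evaluated at `z + z̄`. Index pairs that involve `ker θ`
receive a contribution from `z` only, the other pairs from `z̄` only. Components of `β` with a
factor `β` are matched with those of `γ` by `comp_γγ`, `comp_γη` and `comp_ηγ`, so one component of
`ψ(ϑ)` represents both. -/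
theorem map_prH_ψH_eq {l l' l'' : Letter S} (h : Letter.Allowed l l' l'') (n : ℤ)
    (x : CharGrp E.toChainInclusion l.idx n) :
    TensorProduct.map (prH E.toChainInclusion S l'.idx) (prH E.toChainInclusion S l''.idx)
      (χ.ψH (inH E.toChainInclusion S l.idx n x)) =
      toH₂ E.toChainInclusion l'' (comp E.toChainInclusion S χ.ψ l l' l''
        (inC E.toChainInclusion S l n x)) := by
  have hγ : ∀ (l₁ l₂ : Letter S) (n : ℤ) (x : CharGrp E.toChainInclusion (Letter.γ (S := S)).idx n),
      ¬ Letter.Allowed Letter.β l₁ l₂ → TensorProduct.map (prC E.toChainInclusion S l₁)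
        (prC E.toChainInclusion S l₂) (χ.ψ (inC E.toChainInclusion S Letter.γ n x +
          inC E.toChainInclusion S Letter.β n x)) = comp E.toChainInclusion S χ.ψ Letter.γ l₁ l₂
            (inC E.toChainInclusion S Letter.γ n x) := by
    intro l₁ l₂ n x h
    rw [map_add, map_add, comp_inC]
    exact (congrArg _ (χ.map_prC_ψ_eq_zero (l := Letter.β) h n x)).trans (add_zero _)
  have hβ : ∀ (l₁ l₂ : Letter S) (n : ℤ) (x : CharGrp E.toChainInclusion (Letter.β (S := S)).idx n),
      ¬ Letter.Allowed Letter.γ l₁ l₂ → TensorProduct.map (prC E.toChainInclusion S l₁)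
        (prC E.toChainInclusion S l₂) (χ.ψ (inC E.toChainInclusion S Letter.γ n x +
          inC E.toChainInclusion S Letter.β n x)) = comp E.toChainInclusion S χ.ψ Letter.β l₁ l₂
            (inC E.toChainInclusion S Letter.β n x) := by
    intro l₁ l₂ n x h
    rw [map_add, map_add, comp_inC]
    exact (congrArg (· + _) (χ.map_prC_ψ_eq_zero (l := Letter.γ) h n x)).trans (zero_add _)
  have ne : ∀ {l₁ : Letter S} (hl : l₁ ≠ Letter.β) z, TensorProduct.map (toH E.toChainInclusion S)
      (toH E.toChainInclusion S) z = toH₂ E.toChainInclusion l₁ z := fun hl z => by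
    rw [toH₂_of_ne hl]
  have neγ : (Letter.γ : Letter S) ≠ Letter.β := by simp
  have neη : (Letter.η : Letter S) ≠ Letter.β := by simp
  have neα : ∀ h, (Letter.α h : Letter S) ≠ Letter.β := by simp
  rw [map_prH_ψH]
  cases l with
  | α hα =>
    rw [liftH_sig, comp_inC]
    cases l' <;> cases l'' <;> first | exact h.elim | (rw [toH₂_of_ne (by simp)]; rfl)
  | η =>
    rw [liftH_emp, comp_inC]
    cases l' <;> cases l'' <;> first | exact h.elim | (rw [toH₂_of_ne (by simp)]; rfl)
  | γ =>
    refine (congrArg (fun z => TensorProduct.map (toH E.toChainInclusion S)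
      (toH E.toChainInclusion S) (TensorProduct.map (prC E.toChainInclusion S _)
        (prC E.toChainInclusion S _) (χ.ψ z))) (liftH_omg n x)).trans ?_
    cases l' <;> cases l'' <;> first
      | exact h.elim
      | exact (ne neγ _).trans (congrArg _ (hγ _ _ n x fun h => h))
  | β =>
    refine (congrArg (fun z => TensorProduct.map (toH E.toChainInclusion S)
      (toH E.toChainInclusion S) (TensorProduct.map (prC E.toChainInclusion S _)
        (prC E.toChainInclusion S _) (χ.ψ z))) (liftH_omg n x)).trans ?_
    have hd : ∀ l₁ l₂ : Letter S, comp E.toChainInclusion S χ.ψ Letter.γ l₁ l₂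
        (inC E.toChainInclusion S Letter.γ n x) = comp E.toChainInclusion S χ.ψ Letter.γ l₁ l₂
          (dChar E.toChainInclusion S (inC E.toChainInclusion S Letter.β n x)) := fun _ _ =>
      congrArg _ (dChar_β n x).symm
    cases l' <;> cases l'' <;> first | exact h.elim | skip
    · exact (congrArg _ (hβ (Letter.α _) (Letter.α _) n x fun h => h)).trans (ne (neα _) _)
    · exact (congrArg _ (hβ (Letter.α _) Letter.η n x fun h => h)).trans (ne neη _)
    · exact (congrArg _ ((hγ Letter.γ Letter.γ n x fun h => h).trans ((hd _ _).trans
        (χ.comp_γγ _)))).trans ((χ.toH₂_comp_β_γ _ _).trans (ne neγ _))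
    · exact (congrArg _ ((hγ Letter.γ Letter.η n x fun h => h).trans ((hd _ _).trans
        (χ.comp_γη _)))).trans ((χ.toH₂_comp_β_γ _ _).trans (ne neη _))
    · exact (congrArg _ (hβ Letter.η (Letter.α _) n x fun h => h)).trans (ne (neα _) _)
    · exact (congrArg _ ((hγ Letter.η Letter.γ n x fun h => h).trans ((hd _ _).trans
        (χ.comp_ηγ _)))).trans (χ.toH₂_comp_η_β _)
    · exact (congrArg _ (hβ Letter.η Letter.η n x fun h => h)).trans (ne neη _)

end CharData

theorem GrData.isBdd_ofSum {I : Type*} [DecidableEq I] {X : I → Type u} [∀ i, AddCommGroup (X i)]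
    [∀ i, Module ℤ (X i)] {deg : I → ℤ} {N : Type*} [AddCommGroup N] [Module ℤ N] {H : GrData N}
    {f : (⨁ i, X i) →ₗ[ℤ] N} (F : Finset ℤ)
    (h : ∀ i (x : X i), f (DirectSum.lof ℤ I X i x) ∈ ⨆ j ∈ F, H.gr (deg i + j)) :
    IsBdd (ofSum X deg) H f := by
  refine ⟨F, fun n x hx => ?_⟩
  induction hx using Submodule.span_induction with
  | mem x hx => obtain ⟨i, rfl, x, rfl⟩ := hx; exact h i x
  | zero => rw [map_zero]; exact Submodule.zero_mem _
  | add x y _ _ hx hy => rw [map_add]; exact Submodule.add_mem _ hx hy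
  | smul c x _ hx => rw [map_smul]; exact Submodule.smul_mem _ c hx

/-! ### The index coalgebra complex of one pair -/

section IndexComplex

variable {S : Kind}

theorem GT_lawful : (GT S).Lawful := GrData.ofSum_lawful _ _

theorem gen_mem_gr (l : Letter S) : gen S l ∈ (GT S).gr l.deg :=
  GrData.lof_mem_ofSum (X := fun _ : Letter S => ℤ) (deg := Letter.deg) l 1

theorem TCx.lift_gen {M : Type u} [AddCommGroup M] [Module ℤ M] (f : Letter S → M) (l : Letter S) :
    TCx.lift S f (gen S l) = f l :=
  (DirectSum.toModule_lof ℤ (φ := fun l => LinearMap.toSpanSingleton ℤ M (f l)) l (1 : ℤ)).trans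
    (one_smul ℤ (f l))

theorem lof_eq_smul_gen (l : Letter S) (c : ℤ) :
    DirectSum.lof ℤ (Letter S) (fun _ => ℤ) l c = c • gen S l := by
  rw [gen, ← map_smul]
  congr 1
  exact (mul_one c).symm

theorem span_gen : Submodule.span ℤ (Set.range (gen S)) = ⊤ := by
  refine top_unique (DirectSum.span_lof_eq_top (fun _ : Letter S => ℤ) ▸ Submodule.span_le.2 ?_)
  rintro _ ⟨l, c, rfl⟩
  rw [lof_eq_smul_gen]
  exact Submodule.smul_mem _ c (Submodule.subset_span ⟨l, rfl⟩)

theorem TCx.ext_gen {M : Type*} [AddCommGroup M] [Module ℤ M] {f g : TCx S →ₗ[ℤ] M}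
    (h : ∀ l, f (gen S l) = g (gen S l)) : f = g :=
  LinearMap.ext_on span_gen (by rintro _ ⟨l, rfl⟩; exact h l)

theorem gen_hom (l : Letter S) : (GT S).par l.deg (gen S l) = gen S l := by
  rw [GT_lawful.par_gr _ _ _ (gen_mem_gr l), if_pos rfl]

theorem prT_gen (s : Idx S) (l : Letter S) :
    prT S s (gen S l) = if l.idx = s then gen S l else 0 :=
  projOn_lof (fun _ : Letter S => ℤ) (fun l => l.idx = s) l 1

theorem dT_gen (l : Letter S) : dT S (gen S l) = if l = Letter.β then gen S Letter.γ else 0 := by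
  refine (TCx.lift_gen _ l).trans ?_
  cases l <;> rfl

theorem isDeg_T {N : Type*} [AddCommGroup N] [Module ℤ N] {H : GrData N} {f : TCx S →ₗ[ℤ] N} {k : ℤ}
    (h : ∀ l, f (gen S l) ∈ H.gr (l.deg + k)) : GrData.IsDeg (GT S) H f k :=
  GrData.isDeg_ofSum (X := fun _ : Letter S => ℤ) (deg := Letter.deg) (f := f) fun l c => by
    rw [lof_eq_smul_gen, map_smul]
    exact Submodule.smul_mem _ c (h l)

theorem dT_deg : GrData.IsDeg (GT S) (GT S) (dT S) (-1) := isDeg_T fun l => by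
  rw [dT_gen]
  split_ifs with h
  · subst h
    exact gen_mem_gr Letter.γ
  · exact Submodule.zero_mem _

theorem prT_deg (s : Idx S) : GrData.IsDeg (GT S) (GT S) (prT S s) 0 := isDeg_T fun l => by
  rw [prT_gen, add_zero]
  split_ifs with h
  · exact gen_mem_gr l
  · exact Submodule.zero_mem _

theorem gen_mem_lowT {l : Letter S} (h : l = Letter.γ ∨ l = Letter.η) : gen S l ∈ lowT S := by
  refine Submodule.subset_span ?_
  obtain rfl | rfl := h <;> simp

theorem lowT_le {Q : Submodule ℤ (TCx S)} (hγ : gen S Letter.γ ∈ Q) (hη : gen S Letter.η ∈ Q) :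
    lowT S ≤ Q := Submodule.span_le.2 (Set.insert_subset hγ (Set.singleton_subset_iff.2 hη))

theorem dT_lowT {x : TCx S} (hx : x ∈ lowT S) : dT S x = 0 := by
  refine lowT_le (Q := LinearMap.ker (dT S)) ?_ ?_ hx <;> exact (dT_gen _).trans (if_neg (by simp))

theorem par_lowT (e : ZMod 2) {x : TCx S} (hx : x ∈ lowT S) : (GT S).par e x ∈ lowT S := by
  refine lowT_le (Q := (lowT S).comap ((GT S).par e)) ?_ ?_ hx <;>
  · rw [Submodule.mem_comap, GT_lawful.par_gr _ _ _ (gen_mem_gr _)]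
    split_ifs
    · exact gen_mem_lowT (by simp)
    · exact Submodule.zero_mem _

theorem prT_lowT (s : Idx S) {x : TCx S} (hx : x ∈ lowT S) : prT S s x ∈ lowT S := by
  refine lowT_le (Q := (lowT S).comap (prT S s)) ?_ ?_ hx <;>
  · rw [Submodule.mem_comap, prT_gen]
    split_ifs
    · exact gen_mem_lowT (by simp)
    · exact Submodule.zero_mem _

theorem prT_dT (s : Idx S) : prT S s ∘ₗ dT S = dT S ∘ₗ prT S s := TCx.ext_gen fun l => by
  rw [LinearMap.comp_apply, LinearMap.comp_apply, prT_gen, dT_gen]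
  by_cases h : l = Letter.β
  · subst h
    rw [if_pos rfl, prT_gen]
    refine ((apply_ite (dT S) _ _ _).trans ?_).symm
    rw [dT_gen, if_pos rfl, map_zero]
    rfl
  · rw [if_neg h, map_zero]
    split_ifs
    · rw [dT_gen, if_neg h]
    · rw [map_zero]

end IndexComplex

namespace CharData

variable {E : SplitCoalgInclusion.{u}} {S : Kind} (χ : CharData E S)

open Classical in
/-- The component of `ψT` from the generator `l` to `l' ⊗ l''`. -/
def ψTcomp (l l' l'' : Letter S) : TCx S ⊗[ℤ] TCx S :=
  if comp E.toChainInclusion S χ.ψ l l' l'' = 0 then 0 else gen S l' ⊗ₜ[ℤ] gen S l''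

theorem ψT_gen (l : Letter S) : χ.ψT (gen S l) = ∑ l', ∑ l'', χ.ψTcomp l l' l'' :=
  TCx.lift_gen _ l

theorem ψTcomp_eq_zero {l l' l'' : Letter S} (h : ¬ Letter.Allowed l l' l'') :
    χ.ψTcomp l l' l'' = 0 := if_pos (χ.ψ_allowed l l' l'' h)

theorem ψTcomp_mem (l l' l'' : Letter S) :
    χ.ψTcomp l l' l'' ∈ Submodule.span ℤ {gen S l' ⊗ₜ[ℤ] gen S l''} := by
  unfold ψTcomp
  split_ifs
  · exact Submodule.zero_mem _
  · exact Submodule.mem_span_singleton_self _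

theorem ψTcomp_map {l₁ l₁' l₁'' l₂ l₂' l₂'' : Letter S} (f g : TCx S →ₗ[ℤ] TCx S)
    (h : comp E.toChainInclusion S χ.ψ l₂ l₂' l₂'' = 0 ↔
      comp E.toChainInclusion S χ.ψ l₁ l₁' l₁'' = 0)
    (hf : f (gen S l₁') = gen S l₂') (hg : g (gen S l₁'') = gen S l₂'') :
    TensorProduct.map f g (χ.ψTcomp l₁ l₁' l₁'') = χ.ψTcomp l₂ l₂' l₂'' := by
  unfold ψTcomp
  by_cases h0 : comp E.toChainInclusion S χ.ψ l₁ l₁' l₁'' = 0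
  · rw [if_pos h0, if_pos (h.2 h0), map_zero]
  · rw [if_neg h0, if_neg (fun h1 => h0 (h.1 h1)), TensorProduct.map_tmul, hf, hg]

theorem map_ψTcomp_eq_zero {l l' l'' : Letter S} (f g : TCx S →ₗ[ℤ] TCx S)
    (h : ¬ Letter.Allowed l l' l'' ∨ f (gen S l') = 0 ∨ g (gen S l'') = 0) :
    TensorProduct.map f g (χ.ψTcomp l l' l'') = 0 := by
  obtain h | h := h
  · rw [χ.ψTcomp_eq_zero h, map_zero]
  · unfold ψTcomp
    split_ifs
    · exact map_zero _
    · rw [TensorProduct.map_tmul]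
      obtain h | h := h
      · rw [h, TensorProduct.zero_tmul]
      · rw [h, TensorProduct.tmul_zero]

/-- For `β`, the terms of its coproduct with a factor `β` are carried by the differential
bijectively to the terms of the coproduct of `γ`, by the equivalences of vanishing. The coproducts
of the other generators contain no `β`, so both sides are zero. -/
theorem ψT_chain (x : TCx S) : χ.ψT (dT S x) = tensorD (GT S) (dT S) (dT S) (χ.ψT x) := by
  suffices h : χ.ψT ∘ₗ dT S = tensorD (GT S) (dT S) (dT S) ∘ₗ χ.ψT from LinearMap.congr_fun h x
  refine TCx.ext_gen fun l => ?_
  rw [LinearMap.comp_apply, LinearMap.comp_apply, dT_gen, ψT_gen, tensorD, LinearMap.add_apply]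
  simp only [map_sum]
  have hd : ∀ l : Letter S, l ≠ Letter.β → dT S (gen S l) = 0 := fun l h => by
    rw [dT_gen, if_neg h]
  by_cases h : l = Letter.β
  · subst h
    rw [if_pos rfl, ψT_gen,
      Fintype.sum_eq_add (f := fun l' => ∑ l'', χ.ψTcomp Letter.γ l' l'') Letter.γ Letter.η (by simp)
      (fun l' hl' => Finset.sum_eq_zero fun l'' _ => χ.ψTcomp_eq_zero (by
        cases l' <;> cases l'' <;> simp_all [Letter.Allowed]))]
    congr 1
    · rw [Fintype.sum_eq_single Letter.β (fun l' hl' => Finset.sum_eq_zero fun l'' _ =>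
        χ.map_ψTcomp_eq_zero _ _ (Or.inr (Or.inl (hd l' hl'))))]
      refine Finset.sum_congr rfl fun l'' _ => ?_
      cases l'' with
      | γ => exact (χ.ψTcomp_map _ _ χ.comp_γγ_eq_zero_iff ((dT_gen _).trans (if_pos rfl)) rfl).symm
      | η => exact (χ.ψTcomp_map _ _ χ.comp_γη_eq_zero_iff ((dT_gen _).trans (if_pos rfl)) rfl).symm
      | α => rw [χ.ψTcomp_eq_zero (by simp [Letter.Allowed]),
          χ.map_ψTcomp_eq_zero _ _ (Or.inl (by simp [Letter.Allowed]))]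
      | β => rw [χ.ψTcomp_eq_zero (by simp [Letter.Allowed]),
          χ.map_ψTcomp_eq_zero _ _ (Or.inl (by simp [Letter.Allowed]))]
    · rw [Fintype.sum_eq_single Letter.γ (fun l'' hl' => χ.ψTcomp_eq_zero (by
        cases l'' <;> simp_all [Letter.Allowed])),
        Fintype.sum_eq_single Letter.η (fun l' hl' => Finset.sum_eq_zero fun l'' _ => ?_),
        Fintype.sum_eq_single Letter.β (fun l'' hl' => 
          χ.map_ψTcomp_eq_zero _ _ (Or.inr (Or.inr (hd l'' hl'))))]
      · refine (χ.ψTcomp_map _ _ χ.comp_ηγ_eq_zero_iff ?_ ((dT_gen _).trans (if_pos rfl))).symm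
        rw [GT_lawful.sgn_hom (gen_hom _)]
        exact one_smul ℤ _
      · by_cases hl : l'' = Letter.β
        · subst hl
          exact χ.map_ψTcomp_eq_zero _ _ (Or.inl (by cases l' <;> simp_all [Letter.Allowed]))
        · exact χ.map_ψTcomp_eq_zero _ _ (Or.inr (Or.inr (hd l'' hl)))
  · rw [if_neg h, map_zero]
    have key : ∀ l' l'', ¬ Letter.Allowed l l' l'' ∨ l' ≠ Letter.β ∧ l'' ≠ Letter.β := by
      intro l' l''
      cases l <;> cases l' <;> cases l'' <;> simp_all [Letter.Allowed]
    refine ((congrArg₂ (· + ·) ?_ ?_).trans (add_zero 0)).symm <;>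
      refine Finset.sum_eq_zero fun l' _ => Finset.sum_eq_zero fun l'' _ =>
        χ.map_ψTcomp_eq_zero _ _ ?_
    · exact (key l' l'').imp_right fun h => Or.inl (hd _ h.1)
    · exact (key l' l'').imp_right fun h => Or.inr (hd _ h.2)

theorem ψT_mem {x : TCx S} (hx : x ∈ lowT S) : χ.ψT x ∈ tensorSub (lowT S) (lowT S) := by
  have key : ∀ l l' l'' : Letter S, l = Letter.γ ∨ l = Letter.η →
      χ.ψTcomp l l' l'' ∈ tensorSub (lowT S) (lowT S) := by
    intro l l' l'' hl
    by_cases h : Letter.Allowed l l' l''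
    · refine (Submodule.span_singleton_le_iff_mem _ _).2 ?_ (χ.ψTcomp_mem l l' l'')
      refine Submodule.apply_mem_map₂ _ (gen_mem_lowT ?_) (gen_mem_lowT ?_) <;>
      · obtain rfl | rfl := hl <;> cases l' <;> cases l'' <;> simp_all [Letter.Allowed]
    · rw [χ.ψTcomp_eq_zero h]; exact Submodule.zero_mem _
  refine lowT_le (Q := (tensorSub (lowT S) (lowT S)).comap χ.ψT) ?_ ?_ hx <;>
  · rw [Submodule.mem_comap, ψT_gen]
    exact Submodule.sum_mem _ fun l' _ => Submodule.sum_mem _ fun l'' _ => key _ l' l'' (by simp)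

theorem ψT_bdd : GrData.IsBdd (GT S) ((GT S).prod (GT S)) χ.ψT := by
  refine GrData.isBdd_ofSum (X := fun _ : Letter S => ℤ) (deg := Letter.deg) (f := χ.ψT)
    ((Finset.univ : Finset (Letter S × Letter S × Letter S)).image fun p =>
      p.2.1.deg + p.2.2.deg - p.1.deg) fun l c => ?_
  rw [lof_eq_smul_gen, map_smul, ψT_gen]
  refine Submodule.smul_mem _ c (Submodule.sum_mem _ fun l' _ => Submodule.sum_mem _ fun l'' _ => ?_)
  refine (Submodule.span_singleton_le_iff_mem _ _).2 ?_ (χ.ψTcomp_mem l l' l'')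
  refine Submodule.mem_iSup_of_mem (l'.deg + l''.deg - l.deg) (Submodule.mem_iSup_of_mem ?_ ?_)
  · exact Finset.mem_image.2 ⟨(l, l', l''), Finset.mem_univ _, rfl⟩
  · rw [add_sub_cancel]
    exact GrData.tmul_mem_prod (gen_mem_gr l') (gen_mem_gr l'') rfl

theorem forgetC_bdd : GrData.IsBdd (GCh E.toChainInclusion S) (GH E.toChainInclusion S)
    (forgetC E.toChainInclusion S) := by
  refine GrData.IsDeg.bdd (k := 0) (isDeg_charC fun l n x => ?_)
  have h : forgetC E.toChainInclusion S (inC E.toChainInclusion S l n x) =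
      if l = Letter.β then 0 else inH E.toChainInclusion S l.idx n x := by
    refine (toModule_inC _ l n x).trans ?_
    cases l <;> rfl
  rw [h]
  split_ifs with hl
  · exact Submodule.zero_mem _
  · have h0 : l.deg = 0 := by cases l <;> simp_all [Letter.deg]
    rw [h0, add_zero, add_zero]
    exact inH_mem_gr _ n x

theorem liftH_bdd : GrData.IsBdd (GH E.toChainInclusion S) (GCh E.toChainInclusion S)
    (liftH E.toChainInclusion S) := by
  have h0 : ∀ (n k : ℤ) (x : CharC E.toChainInclusion S), k = 0 ∨ k = 1 →
      x ∈ (GCh E.toChainInclusion S).gr (n + k) →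
      x ∈ ⨆ j ∈ ({0, 1} : Finset ℤ), (GCh E.toChainInclusion S).gr (n + j) := fun n k x hk hx =>
    Submodule.mem_iSup_of_mem k (Submodule.mem_iSup_of_mem (by simpa using hk) hx)
  refine GrData.isBdd_ofSum (X := HPiece E.toChainInclusion S) (deg := fun p => p.2)
    (f := liftH E.toChainInclusion S) {0, 1} ?_
  rintro ⟨s, n⟩ x
  cases s with
  | sig h =>
    refine h0 n 0 _ (Or.inl rfl) ?_
    exact Eq.mpr (congrArg (· ∈ _) (liftH_sig h n x)) (inC_mem_gr (Letter.α h) n x)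
  | omg =>
    refine Eq.mpr (congrArg (· ∈ _) (liftH_omg n x)) (Submodule.add_mem _ ?_ ?_)
    · exact h0 n 0 _ (Or.inl rfl) (inC_mem_gr Letter.γ n x)
    · exact h0 n 1 _ (Or.inr rfl) (inC_mem_gr Letter.β n x)
  | emp =>
    refine h0 n 0 _ (Or.inl rfl) ?_
    exact Eq.mpr (congrArg (· ∈ _) (liftH_emp n x)) (inC_mem_gr Letter.η n x)

theorem ψH_bdd : GrData.IsBdd (GH E.toChainInclusion S)
    ((GH E.toChainInclusion S).prod (GH E.toChainInclusion S)) χ.ψH :=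
  (forgetC_bdd.tmap forgetC_bdd).comp
    ((GrData.IsDeg.of_zero χ.ψ_coproduct.deg).bdd.comp liftH_bdd)

/-- The character coproduct has degree 0. The resulting relation between internal degrees and letter
degrees is the input for the comparison of signs. -/
theorem comp_inC_mem (l l' l'' : Letter S) (n : ℤ) (x : CharGrp E.toChainInclusion l.idx n) :
    comp E.toChainInclusion S χ.ψ l l' l'' (inC E.toChainInclusion S l n x) ∈ Submodule.span ℤ
      {z | ∃ (n' n'' : ℤ) (a : CharGrp E.toChainInclusion l'.idx n')
        (b : CharGrp E.toChainInclusion l''.idx n''), n' + l'.deg + (n'' + l''.deg) = n + l.deg ∧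
          z = inC E.toChainInclusion S l' n' a ⊗ₜ[ℤ] inC E.toChainInclusion S l'' n'' b} := by
  rw [comp_inC]
  rw [← Submodule.mem_comap]
  refine GrData.prod_gr_le (fun a b hab y hy z hz => ?_)
    (χ.ψ_coproduct.deg _ _ (inC_mem_gr l n x))
  rw [Submodule.mem_comap, TensorProduct.map_tmul]
  obtain ⟨y', hy'⟩ := exists_prC_eq l' hy
  obtain ⟨z', hz'⟩ := exists_prC_eq l'' hz
  rw [hy', hz']
  exact Submodule.subset_span ⟨_, _, y', z', by rw [sub_add_cancel, sub_add_cancel, hab], rfl⟩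

end CharData

/-! ### Tensor products of maps that do not preserve degrees -/

section Koszul

variable {m : ℕ} {A : Fin m → Type u} [∀ k, AddCommGroup (A k)] [∀ k, Module ℤ (A k)]
  {B : Fin m → Type v} [∀ k, AddCommGroup (B k)] [∀ k, Module ℤ (B k)]
  {GA : ∀ k, GrData (A k)} {GB : ∀ k, GrData (B k)}

/-- The operator on a tensor product that multiplies the part of parities `e` by `c e`. -/
def parScale (GB : ∀ k, GrData (B k)) (c : (Fin m → ZMod 2) → ℤ) :
    (⨂[ℤ] k, B k) →ₗ[ℤ] ⨂[ℤ] k, B k :=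
  ∑ e : Fin m → ZMod 2, c e • PiTensorProduct.map (fun k => (GB k).par (e k))

theorem parScale_tprod (hB : ∀ k, (GB k).Lawful) (c : (Fin m → ZMod 2) → ℤ) {e : Fin m → ZMod 2}
    {x : ∀ k, B k} (hx : ∀ k, (GB k).par (e k) (x k) = x k) :
    parScale GB c (PiTensorProduct.tprod ℤ x) = c e • PiTensorProduct.tprod ℤ x := by
  simp only [parScale, LinearMap.sum_apply, LinearMap.smul_apply, PiTensorProduct.map_tprod,
    par_map_tprod hB hx]
  rw [Finset.sum_eq_single e]
  · rw [if_pos rfl]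
  · intro e' _ he; rw [if_neg (Ne.symm he), smul_zero]
  · simp

theorem parScale_map {f : ∀ k, A k →ₗ[ℤ] B k} (hf : ∀ k, GrData.IsPar (GA k) (GB k) (f k) 0)
    (c : (Fin m → ZMod 2) → ℤ) (x : ⨂[ℤ] k, A k) :
    parScale GB c (PiTensorProduct.map f x) = PiTensorProduct.map f (parScale GA c x) := by
  simp only [parScale, LinearMap.sum_apply, LinearMap.smul_apply, map_sum, map_smul]
  refine Finset.sum_congr rfl fun e _ => ?_
  rw [← LinearMap.comp_apply, ← LinearMap.comp_apply, ← PiTensorProduct.map_comp,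
    ← PiTensorProduct.map_comp]
  congr 3
  funext k
  refine LinearMap.ext fun y => ?_
  simpa using hf k (e k) y

/-- Once the source parities are fixed, the Koszul sign depends on the target parities only and
becomes an operator on the target. -/
theorem koszulL_tprod (hA : ∀ k, (GA k).Lawful) (f : ∀ k, A k →ₗ[ℤ] B k) {e : Fin m → ZMod 2}
    {x : ∀ k, A k} (hx : ∀ k, (GA k).par (e k) (x k) = x k) :
    koszulL GA GB f (PiTensorProduct.tprod ℤ x) =
      parScale GB (fun e' => sg (pairSum e (e + e'))) (PiTensorProduct.tprod ℤ fun k => f k (x k)) := by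
  simp only [koszulL, parScale, LinearMap.sum_apply, LinearMap.smul_apply,
    PiTensorProduct.map_tprod, LinearMap.comp_apply]
  rw [Finset.sum_eq_single e]
  · simp only [hx]
  · intro e₁ _ he
    obtain ⟨k, hk⟩ := Function.ne_iff.1 (Ne.symm he)
    refine Finset.sum_eq_zero fun e' _ => ?_
    rw [MultilinearMap.map_coord_zero _ k, smul_zero]
    rw [(hA k).par_hom (hx k), if_neg hk, map_zero, map_zero]
  · simp

theorem koszulR_tprod (hA : ∀ k, (GA k).Lawful) (f : ∀ k, A k →ₗ[ℤ] B k) {e : Fin m → ZMod 2}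
    {x : ∀ k, A k} (hx : ∀ k, (GA k).par (e k) (x k) = x k) :
    koszulR GA GB f (PiTensorProduct.tprod ℤ x) =
      parScale GB (fun e' => sg (pairSum (e + e') e')) (PiTensorProduct.tprod ℤ fun k => f k (x k)) := by
  simp only [koszulR, parScale, LinearMap.sum_apply, LinearMap.smul_apply,
    PiTensorProduct.map_tprod, LinearMap.comp_apply]
  rw [Finset.sum_eq_single e]
  · simp only [hx]
  · intro e₁ _ he
    obtain ⟨k, hk⟩ := Function.ne_iff.1 (Ne.symm he)
    refine Finset.sum_eq_zero fun e' _ => ?_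
    rw [MultilinearMap.map_coord_zero _ k, smul_zero]
    rw [(hA k).par_hom (hx k), if_neg hk, map_zero, map_zero]
  · simp

theorem koszulL_bdd (hA : ∀ k, (GA k).Lawful) (hB : ∀ k, (GB k).Lawful)
    {f : ∀ k, A k →ₗ[ℤ] B k} (hf : ∀ k, GrData.IsBdd (GA k) (GB k) (f k)) :
    GrData.IsBdd (GrData.pi GA) (GrData.pi GB) (koszulL GA GB f) :=
  GrData.IsBdd.sum fun _ _ => GrData.IsBdd.sum fun _ _ => GrData.IsBdd.smul _
    (GrData.IsBdd.piMap fun k => ((hB k).par_deg _).bdd.comp ((hf k).comp ((hA k).par_deg _).bdd))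

theorem koszulR_bdd (hA : ∀ k, (GA k).Lawful) (hB : ∀ k, (GB k).Lawful)
    {f : ∀ k, A k →ₗ[ℤ] B k} (hf : ∀ k, GrData.IsBdd (GA k) (GB k) (f k)) :
    GrData.IsBdd (GrData.pi GA) (GrData.pi GB) (koszulR GA GB f) :=
  GrData.IsBdd.sum fun _ _ => GrData.IsBdd.sum fun _ _ => GrData.IsBdd.smul _
    (GrData.IsBdd.piMap fun k => ((hB k).par_deg _).bdd.comp ((hf k).comp ((hA k).par_deg _).bdd))

theorem koszulR_mem_poly {K : LowerSet (Finset (Fin m))} {L : ∀ k, Submodule ℤ (A k)}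
    {L' : ∀ k, Submodule ℤ (B k)} {f : ∀ k, A k →ₗ[ℤ] B k}
    (hL : ∀ k e, ∀ x ∈ L k, (GA k).par e x ∈ L k) (hL' : ∀ k e, ∀ x ∈ L' k, (GB k).par e x ∈ L' k)
    (hf : ∀ k, ∀ x ∈ L k, f k x ∈ L' k) {x : ⨂[ℤ] k, A k} (hx : x ∈ poly K L) :
    koszulR GA GB f x ∈ poly K L' := by
  simp only [koszulR, LinearMap.sum_apply, LinearMap.smul_apply]
  exact Submodule.sum_mem _ fun e _ => Submodule.sum_mem _ fun e' _ => Submodule.smul_mem _ _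
    (map_mem_poly (f := fun k => (GB k).par (e' k) ∘ₗ f k ∘ₗ (GA k).par (e k))
      (fun k y hy => hL' k _ _ (hf k _ (hL k _ _ hy))) hx)

theorem map_tprod_single (d : ∀ k, A k →ₗ[ℤ] A k) (x : ∀ k, A k) (k : Fin m) :
    PiTensorProduct.map (fun i => if i = k then d i else LinearMap.id) (PiTensorProduct.tprod ℤ x) =
      PiTensorProduct.tprod ℤ (Function.update x k (d k (x k))) := by
  rw [PiTensorProduct.map_tprod]
  congr 1
  funext i
  by_cases h : i = k
  · subst h; simp
  · simp [h]

/-- The tensor product of chain maps that need not preserve degrees is a chain map. -/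
theorem koszulR_piD (hA : ∀ k, (GA k).Lawful) (hB : ∀ k, (GB k).Lawful)
    {d : ∀ k, A k →ₗ[ℤ] A k} {d' : ∀ k, B k →ₗ[ℤ] B k} {f : ∀ k, A k →ₗ[ℤ] B k}
    (hd : ∀ k, GrData.IsPar (GA k) (GA k) (d k) 1) (hd' : ∀ k, GrData.IsPar (GB k) (GB k) (d' k) 1)
    (hf : ∀ k x, f k (d k x) = d' k (f k x)) :
    koszulR GA GB f ∘ₗ piD GA d = piD GB d' ∘ₗ koszulR GA GB f := by
  refine PiTensorProduct.ext_span (fun k => {x | ∃ e, (GA k).par e x = x})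
    (fun k => (hA k).span_par) fun x hx => ?_
  choose e he using hx
  rw [LinearMap.comp_apply, LinearMap.comp_apply, piD_tprod hA he, map_sum, koszulR_tprod hA f he]
  simp only [map_smul]
  have h1 : ∀ k, koszulR GA GB f (PiTensorProduct.tprod ℤ (Function.update x k (d k (x k)))) =
      parScale GB (fun e' => sg (pairSum (e + Pi.single k 1 + e') e'))
        (PiTensorProduct.tprod ℤ (Function.update (fun i => f i (x i)) k (d' k (f k (x k))))) := by
    intro k
    rw [koszulR_tprod hA f (update_hom hd he k)]
    congr 2
    funext i
    by_cases h : i = k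
    · subst h; simp [hf]
    · simp [h]
  simp only [h1]
  -- A differential at `k` raises the source and the target parity there, so `e + a` does not
  -- change. The change of the second argument of `pairSum` turns the sign of the source
  -- differential into that of the target differential.
  have h2 : ∑ k, sg (sumBefore e k) • (parScale GB (fun e' =>
      sg (pairSum (e + Pi.single k 1 + e') e')) ∘ₗ PiTensorProduct.map fun i =>
        if i = k then d' i else LinearMap.id) =
      piD GB d' ∘ₗ parScale GB fun e' => sg (pairSum (e + e') e') := by
    refine PiTensorProduct.ext_span (fun k => {x | ∃ e, (GB k).par e x = x})
      (fun k => (hB k).span_par) fun y hy => ?_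
    choose a ha using hy
    rw [LinearMap.comp_apply, parScale_tprod hB _ ha, map_smul, piD_tprod hB ha, Finset.smul_sum,
      LinearMap.sum_apply]
    refine Finset.sum_congr rfl fun k _ => ?_
    rw [LinearMap.smul_apply, LinearMap.comp_apply, map_tprod_single,
      parScale_tprod hB _ (update_hom hd' ha k), smul_smul, smul_smul, ← sg_add, ← sg_add]
    have h3 : e + Pi.single k 1 + (a + Pi.single k 1) = e + a := by
      funext i
      simp only [Pi.add_apply]
      linear_combination zmod_two_add_self ((Pi.single k 1 : Fin m → ZMod 2) i)
    rw [h3, pairSum_add_right, pairSum_single_right, sumBefore_add]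
    congr 2
    linear_combination zmod_two_add_self (sumBefore e k)
  have h4 := LinearMap.congr_fun h2 (PiTensorProduct.tprod ℤ fun k => f k (x k))
  simp only [LinearMap.sum_apply, LinearMap.smul_apply, LinearMap.comp_apply,
    map_tprod_single] at h4
  exact h4

end Koszul

/-! ### The total complex and the character coalgebra as indexed algebras. -/

section Indexed

variable {m : ℕ} (K : LowerSet (Finset (Fin m))) {E : Fin m → SplitCoalgInclusion.{u}} {S : Kind}
  (χ : ∀ k, CharData (E k) S)

theorem totalCx_isDGC : (totalCx K χ).IsDGC where
  lawful := GrData.Lawful.pi fun _ => GT_lawful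
  d_deg := piD_deg (fun _ => GT_lawful) fun _ => dT_deg
  d_mem x hx := piD_mem_poly (fun _ x hx => by rw [dT_lowT hx]; exact Submodule.zero_mem _)
    (fun _ e _ hx => par_lowT e hx) hx
  par_mem e x hx := pi_par_mem_poly (fun _ e _ hx => par_lowT e hx) e hx
  Ψ_bdd := (shuffle_deg (fun _ => GT_lawful) fun _ => GT_lawful).bdd.comp
    (koszulR_bdd (fun _ => GT_lawful) (fun _ => GT_lawful.prod GT_lawful) fun k => (χ k).ψT_bdd)
  Ψ_mem x hx := by
    refine shuffle_mem_poly (fun _ => GT_lawful) (fun _ => GT_lawful) (fun _ e _ hx => par_lowT e hx)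
      (fun _ e _ hx => par_lowT e hx) (koszulR_mem_poly (fun _ e _ hx => par_lowT e hx)
        (fun _ e z hz => ?_) (fun k _ hx => (χ k).ψT_mem hx) hx)
    rw [GrData.prod, LinearMap.sum_apply]
    exact Submodule.sum_mem _ fun a _ => tensorSub_map (fun _ => par_lowT _) (fun _ => par_lowT _) hz
  Ψ_d x _ := by
    have hd : GrData.IsPar (GT S) (GT S) (dT S) 1 := by
      simpa using dT_deg.par GT_lawful GT_lawful
    have hd' : GrData.IsPar ((GT S).prod (GT S)) ((GT S).prod (GT S))
        (tensorD (GT S) (dT S) (dT S)) 1 := by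
      simpa using (tensorD_deg GT_lawful dT_deg).par (GT_lawful.prod GT_lawful)
        (GT_lawful.prod GT_lawful)
    have h1 := koszulR_piD (fun _ : Fin m => GT_lawful) (fun _ => GT_lawful.prod GT_lawful)
      (fun _ => hd) (fun _ => hd') (fun k => (χ k).ψT_chain)
    have h2 := shuffle_piD (fun _ : Fin m => GT_lawful) (fun _ => GT_lawful) (fun _ => hd)
      (fun _ => hd)
    exact (congrArg (shuffle (fun _ => GT S) fun _ => GT S) (LinearMap.congr_fun h1 x)).trans
      (LinearMap.congr_fun h2 _)

theorem charCoalg_isDGC : (charCoalg χ).IsDGC where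
  lawful := GrData.Lawful.pi fun _ => GH_lawful
  d_deg := GrData.IsDeg.zero
  d_mem _ _ := trivial
  par_mem _ _ _ := trivial
  Ψ_bdd := (shuffle_deg (fun _ => GH_lawful) fun _ => GH_lawful).bdd.comp
    (koszulL_bdd (fun _ => GH_lawful) (fun _ => GH_lawful.prod GH_lawful) fun k => (χ k).ψH_bdd)
  Ψ_mem x _ := by
    have h := TensorProduct.map₂_mk_top_top_eq_top (R := ℤ) (M := (charCoalg χ).M)
      (N := (charCoalg χ).M)
    exact (h.symm ▸ Submodule.mem_top :)
  Ψ_d x _ := by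
    change (charCoalg χ).Ψ 0 = tensorD (charCoalg χ).G 0 0 _
    rw [map_zero, tensorD, TensorProduct.map_zero_left, TensorProduct.map_zero_right, add_zero,
      LinearMap.zero_apply]

theorem totalIdx_isChainMap (s : Fin m → Idx S) :
    CoalgData.IsChainMap (totalCx K χ) (totalCx K χ) (totalIdx K χ s) where
  deg _ _ hx := (GrData.IsDeg.piMap_zero fun k => prT_deg (s k)).zero_mem hx
  sub _ hx := map_mem_poly (fun k _ => prT_lowT (s k)) hx
  comm x _ := (LinearMap.congr_fun (piD_comm
    (fun k => (prT_deg (s k)).sgn_comm GT_lawful GT_lawful) fun k => (prT_dT (s k)).symm) x).symm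

theorem charIdx_isChainMap (s : Fin m → Idx S) :
    CoalgData.IsChainMap (charCoalg χ) (charCoalg χ) (charIdx χ s) where
  deg _ _ hx := (GrData.IsDeg.piMap_zero fun k => prH_deg (s k)).zero_mem hx
  sub _ _ := trivial
  comm _ _ := map_zero _

theorem totalCx_indexedOK : CoalgData.IndexedOK (totalCx K χ) (totalIdx K χ) where
  mul := (totalCx_isDGC K χ).mulOK
  par := (totalCx_isDGC K χ).pullOK_par
  idx s := (totalIdx_isChainMap K χ s).pullOK

theorem charCoalg_indexedOK : CoalgData.IndexedOK (charCoalg χ) (charIdx χ) where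
  mul := (charCoalg_isDGC χ).mulOK
  par := (charCoalg_isDGC χ).pullOK_par
  idx s := (charIdx_isChainMap χ s).pullOK

end Indexed

/-- Two linear maps agree on `⨂ x_k` if they agree on the tensor products of elements of sets whose
spans contain the `x_k`. -/
theorem PiTensorProduct.eq_of_span {ι N : Type*} {M : ι → Type*} [Fintype ι]
    [∀ i, AddCommGroup (M i)] [∀ i, Module ℤ (M i)] [AddCommMonoid N] [Module ℤ N]
    {f g : PiTensorProduct ℤ M →ₗ[ℤ] N} (S : ∀ i, Set (M i))
    (h : ∀ x, (∀ i, x i ∈ S i) → f (PiTensorProduct.tprod ℤ x) = g (PiTensorProduct.tprod ℤ x))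
    (x : ∀ i, M i) (hx : ∀ i, x i ∈ Submodule.span ℤ (S i)) :
    f (PiTensorProduct.tprod ℤ x) = g (PiTensorProduct.tprod ℤ x) := by
  let _ : AddCommGroup N := Module.addCommMonoidToAddCommGroup ℤ
  exact MultilinearMap.eq_of_span (f.compMultilinearMap (PiTensorProduct.tprod ℤ))
    (g.compMultilinearMap (PiTensorProduct.tprod ℤ)) S h x hx

theorem PiTensorProduct.ext_of_span {ι N : Type*} {M : ι → Type*} [Fintype ι]
    [∀ i, AddCommGroup (M i)] [∀ i, Module ℤ (M i)] [AddCommMonoid N] [Module ℤ N]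
    {f g : PiTensorProduct ℤ M →ₗ[ℤ] N} (S : ∀ i, Set (M i)) (hS : ∀ i, Submodule.span ℤ (S i) = ⊤)
    (h : ∀ x, (∀ i, x i ∈ S i) → f (PiTensorProduct.tprod ℤ x) = g (PiTensorProduct.tprod ℤ x)) :
    f = g :=
  PiTensorProduct.ext (MultilinearMap.ext fun x =>
    PiTensorProduct.eq_of_span S h x fun i => by rw [hS]; trivial)

/-! ### The coproduct of the diagonal tensor product -/

namespace GrData

variable {M : Type u} {N : Type v} [AddCommGroup M] [Module ℤ M] [AddCommGroup N] [Module ℤ N]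

/-- `(x' ⊗ x'') ⊗ (y' ⊗ y'') ↦ (-1)^{|x''| |y'|} (x' ⊗ y') ⊗ (x'' ⊗ y'')`. -/
def interchange (G : GrData M) (H : GrData N) :
    (M ⊗[ℤ] M) ⊗[ℤ] (N ⊗[ℤ] N) →ₗ[ℤ] (M ⊗[ℤ] N) ⊗[ℤ] (M ⊗[ℤ] N) :=
  ∑ e : ZMod 2, ∑ e' : ZMod 2, sg (e * e') •
    ((TensorProduct.tensorTensorTensorComm ℤ M M N N).toLinearMap ∘ₗ
      TensorProduct.map (TensorProduct.map LinearMap.id (G.par e))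
        (TensorProduct.map (H.par e') LinearMap.id))

variable {G : GrData M} {H : GrData N}

theorem interchange_tmul (hG : G.Lawful) (hH : H.Lawful) {e e' : ZMod 2} (x' : M) {x'' : M} {y' : N}
    (y'' : N) (hx : G.par e x'' = x'') (hy : H.par e' y' = y') :
    interchange G H ((x' ⊗ₜ x'') ⊗ₜ (y' ⊗ₜ y'')) =
      sg (e * e') • ((x' ⊗ₜ y') ⊗ₜ[ℤ] (x'' ⊗ₜ y'')) := by
  simp only [interchange, LinearMap.sum_apply]
  rw [Finset.sum_eq_single e, Finset.sum_eq_single e']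
  · simp [hx, hy]
  · intro c _ hc
    simp [hH.par_hom hy, Ne.symm hc]
  · simp
  · intro c _ hc
    refine Finset.sum_eq_zero fun c' _ => ?_
    simp [hG.par_hom hx, Ne.symm hc]
  · simp

end GrData

/-! ### Signs in the comparison of coproducts. -/

section DiagMap

variable {m : ℕ} {E : Fin m → ChainInclusion.{u}} {S : Kind}

/-- The tensor product of the maps `φ₁`, followed by the shuffle. -/
def diagMap (E : Fin m → ChainInclusion.{u}) (S : Kind) :
    (⨂[ℤ] k, CharC (E k) S) →ₗ[ℤ] (⨂[ℤ] _k : Fin m, TCx S) ⊗[ℤ] (⨂[ℤ] k, CharH (E k) S) :=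
  shuffle (fun _ => GT S) (fun k => GH (E k) S) ∘ₗ PiTensorProduct.map (fun k => φ₁ (E k) S)

theorem inH_hom {E : ChainInclusion.{u}} (s : Idx S) (n : ℤ) (x : CharGrp E s n) :
    (GH E S).par n (inH E S s n x) = inH E S s n x := by
  rw [GH_lawful.par_gr _ _ _ (inH_mem_gr s n x), if_pos rfl]

theorem inC_hom {E : ChainInclusion.{u}} (l : Letter S) (n : ℤ) (x : CharGrp E l.idx n) :
    (GCh E S).par (l.deg + n) (inC E S l n x) = inC E S l n x := by
  rw [GCh_lawful.par_gr _ _ _ (inC_mem_gr l n x), if_pos (by push_cast; ring)]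

theorem toH₂_inC {E : ChainInclusion.{u}} {l l' l'' : Letter S} {n' n'' : ℤ}
    (a : CharGrp E l.idx n') (b : CharGrp E l'.idx n'') :
    CharData.toH₂ E l'' (inC E S l n' a ⊗ₜ inC E S l' n'' b) =
      sg (l''.deg * n') • (inH E S l.idx n' a ⊗ₜ inH E S l'.idx n'' b) := by
  rw [CharData.toH₂, TensorProduct.map_tmul, toH_inC, LinearMap.comp_apply, toH_inC]
  split_ifs with h
  · subst h
    rw [GH_lawful.sgn_hom (inH_hom _ _ _), TensorProduct.smul_tmul']
    simp [Letter.deg]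
  · have h0 : l''.deg = 0 := by cases l'' <;> simp_all [Letter.deg]
    simp [h0, sg_zero]

theorem diagMap_tprod (l : Fin m → Letter S) (n : Fin m → ℤ) (x : ∀ k, CharGrp (E k) (l k).idx (n k)) :
    diagMap E S (PiTensorProduct.tprod ℤ fun k => inC (E k) S (l k) (n k) (x k)) =
      sg (pairSum (fun k => (n k : ZMod 2)) fun k => ((l k).deg : ZMod 2)) •
        ((PiTensorProduct.tprod ℤ fun k => gen S (l k)) ⊗ₜ[ℤ]
          PiTensorProduct.tprod ℤ fun k => inH (E k) S (l k).idx (n k) (x k)) := by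
  rw [diagMap, LinearMap.comp_apply, PiTensorProduct.map_tprod]
  simp only [φ₁_inC]
  exact shuffle_tprod (fun _ => GT_lawful) (fun _ => GH_lawful) (fun k => gen_hom (l k))
    fun k => inH_hom (l k).idx (n k) (x k)

/-- The double sum is split into its parts above, below and on the diagonal. -/
theorem sum_mul_sum_eq (a b : Fin m → ZMod 2) :
    (∑ k, a k) * ∑ k, b k = pairSum a b + pairSum b a + ∑ k, a k * b k := by
  have h : ∀ i, a i * b i = ∑ j, if i = j then a i * b j else 0 := fun i => by simp
  have h2 : pairSum b a = ∑ i, ∑ j, if j < i then a i * b j else 0 := by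
    rw [pairSum_eq, Finset.sum_comm]
    simp only [mul_comm]
  rw [Finset.sum_mul_sum, h2, pairSum_eq]
  simp only [h, ← Finset.sum_add_distrib]
  refine Finset.sum_congr rfl fun i _ => Finset.sum_congr rfl fun j _ => ?_
  rcases lt_trichotomy i j with h | h | h
  · simp [h, h.ne, h.le]
  · simp [h]
  · simp [h, h.ne', h.le]

theorem sg_sum {ι : Type*} (s : Finset ι) (a : ι → ZMod 2) : sg (∑ i ∈ s, a i) = ∏ i ∈ s, sg (a i) := by
  classical
  induction s using Finset.induction_on with
  | empty => simp [sg_zero]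
  | insert i s hi ih => rw [Finset.sum_insert hi, Finset.prod_insert hi, sg_add, ih]

/-- Here `N`, `N'`, `N''` stand for the parities of the homology parts of an element and of its two
cofactors, `L'`, `L''` for those of the letters of the cofactors. The parity of the letter of the
element is `N' + L' + N'' + L'' + N`, because the coproduct has degree 0. The term `s`, the sign of
`toH₂`, cancels the diagonal part of the interchange sign, and everything else cancels modulo 2. -/
theorem diagMap_sign (N N' N'' L' L'' : Fin m → ZMod 2) (s : ZMod 2) :
    pairSum (L'' + N'') (L' + N') + (pairSum N'' L'' + pairSum N' L') =
      pairSum N (N' + L' + (N'' + L'') + N) +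
        pairSum ((N' + L' + (N'' + L'') + N) + (L' + L'')) (L' + L'') +
        (s + (pairSum N (N + (N' + N'')) + pairSum N'' N') + pairSum L'' L') +
        (pairSum L'' N' + pairSum N' L'' + s) := by
  have h2 : (2 : ZMod 2) = 0 := rfl
  simp only [pairSum_add_left, pairSum_add_right]
  linear_combination -(pairSum N N' + pairSum N L' + pairSum N N'' + pairSum N L'' + pairSum N N + s +
    pairSum N' L'' + pairSum L' L' + pairSum L' L'' + pairSum L'' L' + pairSum L'' L'') * h2

/-- The comparison of the coproducts on one component. -/
theorem diagMap_shuffle (l l' l'' : Fin m → Letter S) (n : Fin m → ℤ)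
    (c : ∀ k, CharC (E k) S ⊗[ℤ] CharC (E k) S)
    (hc : ∀ k, c k ∈ Submodule.span ℤ
      {z | ∃ (n' n'' : ℤ) (a : CharGrp (E k) (l' k).idx n')
        (b : CharGrp (E k) (l'' k).idx n''), n' + (l' k).deg + (n'' + (l'' k).deg) = n k + (l k).deg ∧
          z = inC (E k) S (l' k) n' a ⊗ₜ[ℤ] inC (E k) S (l'' k) n'' b}) :
    TensorProduct.map (diagMap E S) (diagMap E S)
        (shuffle (fun k => GCh (E k) S) (fun k => GCh (E k) S) (PiTensorProduct.tprod ℤ c)) =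
      (sg (pairSum (fun k => (n k : ZMod 2)) fun k => ((l k).deg : ZMod 2)) *
        sg (pairSum ((fun k => ((l k).deg : ZMod 2)) + fun k => ((l' k).deg : ZMod 2) + (l'' k).deg)
          fun k => ((l' k).deg : ZMod 2) + (l'' k).deg)) •
        GrData.interchange (GrData.pi fun _ => GT S) (GrData.pi fun k => GH (E k) S)
          (shuffle (fun _ => GT S) (fun _ => GT S)
            (PiTensorProduct.tprod ℤ fun k => gen S (l' k) ⊗ₜ gen S (l'' k)) ⊗ₜ
          shuffle (fun k => GH (E k) S) (fun k => GH (E k) S)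
            (parScale (fun k => (GH (E k) S).prod (GH (E k) S))
              (fun e => sg (pairSum (fun k => (n k : ZMod 2)) ((fun k => (n k : ZMod 2)) + e)))
              (PiTensorProduct.tprod ℤ fun k => CharData.toH₂ (E k) (l'' k) (c k)))) := by
  have h := PiTensorProduct.eq_of_span
    (f := TensorProduct.map (diagMap E S) (diagMap E S) ∘ₗ
      shuffle (fun k => GCh (E k) S) (fun k => GCh (E k) S))
    (g := (sg (pairSum (fun k => (n k : ZMod 2)) fun k => ((l k).deg : ZMod 2)) *
        sg (pairSum ((fun k => ((l k).deg : ZMod 2)) + fun k => ((l' k).deg : ZMod 2) + (l'' k).deg)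
          fun k => ((l' k).deg : ZMod 2) + (l'' k).deg)) •
      (GrData.interchange (GrData.pi fun _ => GT S) (GrData.pi fun k => GH (E k) S) ∘ₗ
        TensorProduct.mk ℤ _ _ (shuffle (fun _ => GT S) (fun _ => GT S)
            (PiTensorProduct.tprod ℤ fun k => gen S (l' k) ⊗ₜ gen S (l'' k))) ∘ₗ
        shuffle (fun k => GH (E k) S) (fun k => GH (E k) S) ∘ₗ
        parScale (fun k => (GH (E k) S).prod (GH (E k) S))
          (fun e => sg (pairSum (fun k => (n k : ZMod 2)) ((fun k => (n k : ZMod 2)) + e))) ∘ₗ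
        PiTensorProduct.map fun k => CharData.toH₂ (E k) (l'' k))) _ ?_ c hc
  · simpa only [LinearMap.comp_apply, LinearMap.smul_apply, TensorProduct.mk_apply,
      PiTensorProduct.map_tprod] using h
  clear hc c
  intro c hc
  choose n' n'' a b hn hc using hc
  obtain rfl : c = _ := funext hc
  simp only [LinearMap.comp_apply, LinearMap.smul_apply, TensorProduct.mk_apply,
    PiTensorProduct.map_tprod]
  rw [shuffle_tprod (fun _ => GCh_lawful) (fun _ => GCh_lawful)
    (fun k => inC_hom (l' k) (n' k) (a k)) (fun k => inC_hom (l'' k) (n'' k) (b k)), map_smul,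
    TensorProduct.map_tmul, diagMap_tprod, diagMap_tprod,
    shuffle_tprod (fun _ => GT_lawful) (fun _ => GT_lawful) (fun k => gen_hom (l' k))
      (fun k => gen_hom (l'' k))]
  simp only [toH₂_inC]
  rw [MultilinearMap.map_smul_univ, map_smul,
    parScale_tprod (fun _ => GH_lawful.prod GH_lawful) _ (fun k => GrData.prod_hom GH_lawful GH_lawful
      (inH_hom (l' k).idx (n' k) (a k)) (inH_hom (l'' k).idx (n'' k) (b k))), map_smul, map_smul,
    shuffle_tprod (fun _ => GH_lawful) (fun _ => GH_lawful)
      (fun k => inH_hom (l' k).idx (n' k) (a k)) (fun k => inH_hom (l'' k).idx (n'' k) (b k)),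
    ← sg_sum]
  simp only [← TensorProduct.smul_tmul', TensorProduct.tmul_smul, map_smul, smul_smul]
  rw [GrData.interchange_tmul (GrData.Lawful.pi fun _ => GT_lawful)
    (GrData.Lawful.pi fun _ => GH_lawful) _ _ (GrData.pi_hom (fun _ => GT_lawful)
      fun k => gen_hom (l'' k)) (GrData.pi_hom (fun _ => GH_lawful)
        fun k => inH_hom (l' k).idx (n' k) (a k)), smul_smul]
  simp only [← sg_add]
  congr 2
  -- Degree 0 of the coproduct eliminates the parity of `l` from the sign identity.
  have hl : (fun k => ((l k).deg : ZMod 2)) = fun k =>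
      (n' k + (l' k).deg + (n'' k + (l'' k).deg) + n k : ZMod 2) := funext fun k => by
    have h := congrArg (Int.cast : ℤ → ZMod 2) (hn k)
    push_cast at h
    linear_combination (-1) * h - zmod_two_add_self (n k : ZMod 2)
  rw [hl, sum_mul_sum_eq]
  exact diagMap_sign _ _ _ _ _ _

/-- The projection of `T ⊗ H(θ)` onto the diagonal. -/
def diagTensorProj (E : Fin m → ChainInclusion.{u}) (S : Kind) :
    (⨂[ℤ] _k : Fin m, TCx S) ⊗[ℤ] (⨂[ℤ] k, CharH (E k) S) →ₗ[ℤ]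
      (⨂[ℤ] _k : Fin m, TCx S) ⊗[ℤ] (⨂[ℤ] k, CharH (E k) S) :=
  ∑ s : Fin m → Idx S, TensorProduct.map (PiTensorProduct.map fun k => prT S (s k))
    (PiTensorProduct.map fun k => prH (E k) S (s k))

theorem map_prT_tprod (s : Fin m → Idx S) (l : Fin m → Letter S) :
    PiTensorProduct.map (fun k => prT S (s k)) (PiTensorProduct.tprod ℤ fun k => gen S (l k)) =
      if (fun k => (l k).idx) = s then PiTensorProduct.tprod ℤ fun k => gen S (l k) else 0 := by
  rw [PiTensorProduct.map_tprod]
  split_ifs with h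
  · subst h
    simp only [prT_gen, if_pos]
  · obtain ⟨k, hk⟩ := Function.ne_iff.1 h
    exact MultilinearMap.map_coord_zero _ k ((prT_gen _ _).trans (if_neg hk))

theorem diagTensorProj_tmul (l : Fin m → Letter S) (x : ⨂[ℤ] k, CharH (E k) S) :
    diagTensorProj E S ((PiTensorProduct.tprod ℤ fun k => gen S (l k)) ⊗ₜ x) =
      (PiTensorProduct.tprod ℤ fun k => gen S (l k)) ⊗ₜ
        PiTensorProduct.map (fun k => prH (E k) S (l k).idx) x := by
  rw [diagTensorProj, LinearMap.sum_apply, Finset.sum_eq_single fun k => (l k).idx]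
  · rw [TensorProduct.map_tmul, map_prT_tprod, if_pos rfl]
  · intro s _ hs
    rw [TensorProduct.map_tmul, map_prT_tprod, if_neg (Ne.symm hs), TensorProduct.zero_tmul]
  · simp

theorem prH_par {E : ChainInclusion.{u}} (s : Idx S) :
    GrData.IsPar (GH E S) (GH E S) (prH E S s) 0 := by
  simpa using (prH_deg s).par GH_lawful GH_lawful

/-- A tensor of generators has one definite index, so projecting to the diagonal amounts to
projecting the character factors to the indices of `l'` and `l''`. -/
theorem diagTensorProj_interchange (l' l'' : Fin m → Letter S)
    (w : ⨂[ℤ] k, (CharH (E k) S ⊗[ℤ] CharH (E k) S)) :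
    TensorProduct.map (diagTensorProj E S) (diagTensorProj E S)
      (GrData.interchange (GrData.pi fun _ => GT S) (GrData.pi fun k => GH (E k) S)
        (shuffle (fun _ => GT S) (fun _ => GT S)
          (PiTensorProduct.tprod ℤ fun k => gen S (l' k) ⊗ₜ gen S (l'' k)) ⊗ₜ
        shuffle (fun k => GH (E k) S) (fun k => GH (E k) S) w)) =
      GrData.interchange (GrData.pi fun _ => GT S) (GrData.pi fun k => GH (E k) S)
        (shuffle (fun _ => GT S) (fun _ => GT S)
          (PiTensorProduct.tprod ℤ fun k => gen S (l' k) ⊗ₜ gen S (l'' k)) ⊗ₜ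
        shuffle (fun k => GH (E k) S) (fun k => GH (E k) S)
          (PiTensorProduct.map (fun k => TensorProduct.map (prH (E k) S (l' k).idx)
            (prH (E k) S (l'' k).idx)) w)) := by
  have hG := GrData.Lawful.pi fun _ : Fin m => GT_lawful (S := S)
  have hH := GrData.Lawful.pi fun k => GH_lawful (E := E k) (S := S)
  have hp : GrData.IsPar (GrData.pi fun k => GH (E k) S) (GrData.pi fun k => GH (E k) S)
      (PiTensorProduct.map fun k => prH (E k) S (l' k).idx) 0 := by
    simpa using (GrData.IsDeg.piMap_zero fun k => prH_deg (E := E k) (l' k).idx).par hH hH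
  have key : ∀ v, TensorProduct.map (diagTensorProj E S) (diagTensorProj E S)
      (GrData.interchange (GrData.pi fun _ => GT S) (GrData.pi fun k => GH (E k) S)
        (((PiTensorProduct.tprod ℤ fun k => gen S (l' k)) ⊗ₜ
          (PiTensorProduct.tprod ℤ fun k => gen S (l'' k))) ⊗ₜ v)) =
      GrData.interchange (GrData.pi fun _ => GT S) (GrData.pi fun k => GH (E k) S)
        (((PiTensorProduct.tprod ℤ fun k => gen S (l' k)) ⊗ₜ
          (PiTensorProduct.tprod ℤ fun k => gen S (l'' k))) ⊗ₜ
        TensorProduct.map (PiTensorProduct.map fun k => prH (E k) S (l' k).idx)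
          (PiTensorProduct.map fun k => prH (E k) S (l'' k).idx) v) := by
    intro v
    induction v using TensorProduct.induction_on with
    | zero => simp only [map_zero, TensorProduct.tmul_zero]
    | add v v' h h' => simp only [map_add, TensorProduct.tmul_add, h, h']
    | tmul y y' =>
      rw [← hH.sum_par_apply y, TensorProduct.sum_tmul]
      simp only [map_sum, TensorProduct.tmul_sum]
      refine Finset.sum_congr rfl fun e _ => ?_
      have hy := hH.par_par_self e y
      have hg := GrData.pi_hom (fun _ : Fin m => GT_lawful) fun k => gen_hom (l'' k)
      rw [TensorProduct.map_tmul, GrData.interchange_tmul hG hH _ _ hg hy,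
        GrData.interchange_tmul hG hH _ _ hg (by simpa using hp.hom hy), map_smul,
        TensorProduct.map_tmul, diagTensorProj_tmul, diagTensorProj_tmul]
  rw [shuffle_tprod (fun _ => GT_lawful) (fun _ => GT_lawful) (fun k => gen_hom (l' k))
      (fun k => gen_hom (l'' k)), ← TensorProduct.smul_tmul', map_smul, map_smul, key, ← TensorProduct.smul_tmul', map_smul]
  refine congrArg (fun v => _ • GrData.interchange _ _ (_ ⊗ₜ v)) ?_
  exact (LinearMap.congr_fun (shuffle_map (fun _ => GH_lawful) (fun _ => GH_lawful)
    (fun _ => GH_lawful) (fun _ => GH_lawful) (fun k => prH_par _) fun k => prH_par _) w).symm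

end DiagMap

/-! ### Equality of the coproducts. -/

section Comult

variable {m : ℕ} {E : Fin m → SplitCoalgInclusion.{u}} {S : Kind} (χ : ∀ k, CharData (E k) S)

theorem sum_prC {E : ChainInclusion.{u}} : ∑ l, prC E S l = LinearMap.id := by
  refine charC_ext fun l n x => ?_
  simp only [LinearMap.sum_apply, prC_inC, Finset.sum_ite_eq, Finset.mem_univ, if_true,
    LinearMap.id_apply]

theorem CharData.ψ_eq_sum {E : SplitCoalgInclusion.{u}} (χ : CharData E S) (l : Letter S) (n : ℤ)
    (x : CharGrp E.toChainInclusion l.idx n) :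
    χ.ψ (inC E.toChainInclusion S l n x) = ∑ p : Letter S × Letter S,
      comp E.toChainInclusion S χ.ψ l p.1 p.2 (inC E.toChainInclusion S l n x) := by
  simp only [χ.comp_inC, Fintype.sum_prod_type]
  have h := sum_prC (E := E.toChainInclusion) (S := S)
  have h2 : TensorProduct.map (∑ l, prC E.toChainInclusion S l) (∑ l, prC E.toChainInclusion S l) =
      ∑ l, ∑ l', TensorProduct.map (prC E.toChainInclusion S l) (prC E.toChainInclusion S l') := by
    refine TensorProduct.ext' fun y z => ?_
    simp only [TensorProduct.map_tmul, LinearMap.sum_apply, TensorProduct.sum_tmul,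
      TensorProduct.tmul_sum]
    exact Finset.sum_comm
  rw [h, TensorProduct.map_id] at h2
  have h3 := LinearMap.congr_fun h2 (χ.ψ (inC E.toChainInclusion S l n x))
  simpa only [LinearMap.sum_apply, LinearMap.id_apply] using h3

/-- Both sides are expanded over the choices of components `l → l' ⊗ l''` in all factors. A
vanishing component contributes nothing to either side, so coefficients 0 and 1 suffice in the
coproduct of `T`. For a nonvanishing choice the projection to the diagonal extracts the component
from `ψ(ϑ)` by `CharData.map_prH_ψH_eq`, and `diagMap_shuffle` settles the signs. -/
theorem diagMap_comult (x : ⨂[ℤ] k, CharC (E k).toChainInclusion S) :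
    TensorProduct.map (diagMap (fun k => (E k).toChainInclusion) S)
        (diagMap (fun k => (E k).toChainInclusion) S)
        (shuffle (fun k => GCh (E k).toChainInclusion S) (fun k => GCh (E k).toChainInclusion S)
          (PiTensorProduct.map (fun k => (χ k).ψ) x)) =
      TensorProduct.map (diagTensorProj (fun k => (E k).toChainInclusion) S)
        (diagTensorProj (fun k => (E k).toChainInclusion) S)
        (GrData.interchange (GrData.pi fun _ => GT S)
          (GrData.pi fun k => GH (E k).toChainInclusion S)
          (TensorProduct.map
            (shuffle (fun _ => GT S) (fun _ => GT S) ∘ₗ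
              koszulR (fun _ => GT S) (fun _ => (GT S).prod (GT S)) fun k => (χ k).ψT)
            (shuffle (fun k => GH (E k).toChainInclusion S)
                (fun k => GH (E k).toChainInclusion S) ∘ₗ
              koszulL (fun k => GH (E k).toChainInclusion S)
                (fun k => (GH (E k).toChainInclusion S).prod (GH (E k).toChainInclusion S))
                fun k => (χ k).ψH)
            (diagMap (fun k => (E k).toChainInclusion) S x))) := by
  suffices h : TensorProduct.map (diagMap (fun k => (E k).toChainInclusion) S)
        (diagMap (fun k => (E k).toChainInclusion) S) ∘ₗ
        shuffle (fun k => GCh (E k).toChainInclusion S) (fun k => GCh (E k).toChainInclusion S) ∘ₗ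
          PiTensorProduct.map (fun k => (χ k).ψ) =
      TensorProduct.map (diagTensorProj (fun k => (E k).toChainInclusion) S)
        (diagTensorProj (fun k => (E k).toChainInclusion) S) ∘ₗ
        GrData.interchange (GrData.pi fun _ => GT S)
          (GrData.pi fun k => GH (E k).toChainInclusion S) ∘ₗ
          TensorProduct.map
            (shuffle (fun _ => GT S) (fun _ => GT S) ∘ₗ
              koszulR (fun _ => GT S) (fun _ => (GT S).prod (GT S)) fun k => (χ k).ψT)
            (shuffle (fun k => GH (E k).toChainInclusion S)
                (fun k => GH (E k).toChainInclusion S) ∘ₗ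
              koszulL (fun k => GH (E k).toChainInclusion S)
                (fun k => (GH (E k).toChainInclusion S).prod (GH (E k).toChainInclusion S))
                fun k => (χ k).ψH) ∘ₗ
            diagMap (fun k => (E k).toChainInclusion) S from LinearMap.congr_fun h x
  refine PiTensorProduct.ext_of_span
    (fun k => {y | ∃ l n z, y = inC (E k).toChainInclusion S l n z}) (fun k => ?_) fun y hy => ?_
  · refine top_unique (DirectSum.span_lof_eq_top (CPiece (E k).toChainInclusion S) ▸
      Submodule.span_mono ?_)
    rintro _ ⟨⟨l, n⟩, z, rfl⟩
    exact ⟨l, n, z, rfl⟩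
  choose l n z hy using hy
  obtain rfl : y = _ := funext hy
  have hT : ∀ k, (χ k).ψT (gen S (l k)) =
      ∑ p : Letter S × Letter S, (χ k).ψTcomp (l k) p.1 p.2 := fun k => by
    rw [(χ k).ψT_gen, Fintype.sum_prod_type]
  simp only [LinearMap.comp_apply]
  rw [PiTensorProduct.map_tprod, diagMap_tprod, map_smul, map_smul, map_smul, TensorProduct.map_tmul,
    LinearMap.comp_apply, LinearMap.comp_apply,
    koszulR_tprod (fun _ => GT_lawful) _ (fun k => gen_hom (l k)),
    koszulL_tprod (fun _ => GH_lawful) _ (fun k => inH_hom (l k).idx (n k) (z k))]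
  simp only [CharData.ψ_eq_sum, hT]
  rw [MultilinearMap.map_sum, MultilinearMap.map_sum]
  simp only [map_sum, TensorProduct.sum_tmul, Finset.smul_sum]
  refine Finset.sum_congr rfl fun p _ => ?_
  by_cases hp : ∃ k, comp (E k).toChainInclusion S (χ k).ψ (l k) (p k).1 (p k).2 = 0
  · obtain ⟨k, hk⟩ := hp
    rw [MultilinearMap.map_coord_zero _ k (by rw [hk, LinearMap.zero_apply]),
      MultilinearMap.map_coord_zero (PiTensorProduct.tprod ℤ) k (if_pos hk)]
    simp only [map_zero, TensorProduct.zero_tmul, smul_zero]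
  · rw [not_exists] at hp
    have hg : ∀ k, (χ k).ψTcomp (l k) (p k).1 (p k).2 = gen S (p k).1 ⊗ₜ gen S (p k).2 := fun k =>
      if_neg (hp k)
    have ha : ∀ k, Letter.Allowed (l k) (p k).1 (p k).2 := fun k => by
      by_contra h
      exact hp k ((χ k).ψ_allowed _ _ _ h)
    simp only [hg]
    rw [parScale_tprod (fun _ => GT_lawful.prod GT_lawful) _ (fun k => GrData.prod_hom GT_lawful
      GT_lawful (gen_hom (p k).1) (gen_hom (p k).2)), map_smul, ← TensorProduct.smul_tmul', map_smul,
      map_smul, diagTensorProj_interchange (fun k => (p k).1) (fun k => (p k).2), ← parScale_map,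
      PiTensorProduct.map_tprod]
    · simp only [(χ _).map_prH_ψH_eq (ha _)]
      rw [smul_smul]
      exact diagMap_shuffle l (fun k => (p k).1) (fun k => (p k).2) n _ fun k =>
        (χ k).comp_inC_mem _ _ _ _ _
    · intro k
      have h := (GrData.IsDeg.tmap (prH_deg (E := (E k).toChainInclusion) (p k).1.idx)
        (prH_deg (E := (E k).toChainInclusion) (p k).2.idx)).par (GH_lawful.prod GH_lawful)
          (GH_lawful.prod GH_lawful)
      simpa using h

end Comult

/-! ### The diagonal tensor product as a complex with a coproduct -/

section Interchange

variable {M : Type u} {N : Type v} [AddCommGroup M] [Module ℤ M] [AddCommGroup N] [Module ℤ N]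
  {G : GrData M} {H : GrData N}

theorem GrData.tensorTensorTensorComm_deg : IsDeg ((G.prod G).prod (H.prod H))
    ((G.prod H).prod (G.prod H))
    (TensorProduct.tensorTensorTensorComm ℤ M M N N).toLinearMap 0 := by
  refine IsDeg.of_zero fun n z hz => ?_
  refine prod_gr_le (Q := (((G.prod H).prod (G.prod H)).gr n).comap
    (TensorProduct.tensorTensorTensorComm ℤ M M N N).toLinearMap) (fun a b hab x hx y hy => ?_) hz
  change x ∈ (((G.prod H).prod (G.prod H)).gr n).comap
    ((TensorProduct.tensorTensorTensorComm ℤ M M N N).toLinearMap ∘ₗ (TensorProduct.mk ℤ _ _).flip y)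
  refine prod_gr_le (fun p q hpq x hx x' hx' => ?_) hx
  change y ∈ (((G.prod H).prod (G.prod H)).gr n).comap
    ((TensorProduct.tensorTensorTensorComm ℤ M M N N).toLinearMap ∘ₗ
      TensorProduct.mk ℤ _ _ (x ⊗ₜ x'))
  refine prod_gr_le (fun p' q' hpq' y hy y' hy' => ?_) hy
  change (x ⊗ₜ[ℤ] y) ⊗ₜ[ℤ] (x' ⊗ₜ[ℤ] y') ∈ ((G.prod H).prod (G.prod H)).gr n
  exact tmul_mem_prod (tmul_mem_prod hx hy rfl) (tmul_mem_prod hx' hy' rfl) (by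
    rw [← hab, ← hpq, ← hpq']; ring)

theorem GrData.interchange_deg (hG : G.Lawful) (hH : H.Lawful) :
    IsDeg ((G.prod G).prod (H.prod H)) ((G.prod H).prod (G.prod H)) (interchange G H) 0 := by
  refine IsDeg.sum fun e _ => IsDeg.sum fun e' _ => IsDeg.smul _ ?_
  exact tensorTensorTensorComm_deg.comp' ((IsDeg.id.tmap (hG.par_deg e)).tmap
    ((hH.par_deg e').tmap IsDeg.id)) (by simp)

end Interchange

namespace CoalgData

/-- A complex with a coproduct that is the image of another one. -/
theorem IsDGC.of_map {X : CoalgData.{u}} {Y : CoalgData.{v}} (hX : X.IsDGC) (p : X.M →ₗ[ℤ] Y.M)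
    (lawful : Y.G.Lawful) (d_deg : GrData.IsDeg Y.G Y.G Y.d (-1))
    (Ψ_bdd : GrData.IsBdd Y.G (Y.G.prod Y.G) Y.Ψ) (hp : GrData.IsDeg X.G Y.G p 0)
    (hd : ∀ x, p (X.d x) = Y.d (p x)) (hΨ : ∀ x, TensorProduct.map p p (X.Ψ x) = Y.Ψ (p x))
    (hN : ∀ y ∈ Y.N, ∃ x ∈ X.N, p x = y) (hN' : ∀ x ∈ X.N, p x ∈ Y.N) : Y.IsDGC where
  lawful := lawful
  d_deg := d_deg
  d_mem y hy := by
    obtain ⟨x, hx, rfl⟩ := hN y hy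
    rw [← hd]
    exact hN' _ (hX.d_mem x hx)
  par_mem e y hy := by
    obtain ⟨x, hx, rfl⟩ := hN y hy
    have h : GrData.IsPar X.G Y.G p 0 := by simpa using hp.par hX.lawful lawful
    have h2 := h e x
    rw [add_zero] at h2
    rw [h2]
    exact hN' _ (hX.par_mem e x hx)
  Ψ_bdd := Ψ_bdd
  Ψ_mem y hy := by
    obtain ⟨x, hx, rfl⟩ := hN y hy
    rw [← hΨ]
    exact tensorSub_map hN' hN' (hX.Ψ_mem x hx)
  Ψ_d y hy := by
    obtain ⟨x, hx, rfl⟩ := hN y hy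
    rw [← hd, ← hΨ, ← hΨ, hX.Ψ_d x hx, tensorD, tensorD]
    simp only [LinearMap.add_apply, map_add, TensorProduct.map_map]
    have h1 : p ∘ₗ X.d = Y.d ∘ₗ p := LinearMap.ext hd
    rw [h1, ← hp.sgn_comm hX.lawful lawful]
    rfl

end CoalgData

section Poly

variable {m : ℕ} {A : Fin m → Type u} [∀ k, AddCommGroup (A k)] [∀ k, Module ℤ (A k)]

theorem poly_le_of_span {K : LowerSet (Finset (Fin m))} {L : ∀ k, Submodule ℤ (A k)}
    {Q : Submodule ℤ (⨂[ℤ] k, A k)} (S P : ∀ k, Set (A k)) (hS : ∀ k, Submodule.span ℤ (S k) = ⊤)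
    (hP : ∀ k, L k ≤ Submodule.span ℤ (S k ∩ P k))
    (h : ∀ τ ∈ K, ∀ x : ∀ k, A k, (∀ k, x k ∈ S k) → (∀ k, k ∉ τ → x k ∈ P k) →
      PiTensorProduct.tprod ℤ x ∈ Q) : poly K L ≤ Q := by
  refine poly_le fun τ hτ x hx => ?_
  refine PiTensorProduct.tprod_mem_of_span (fun k => {z | z ∈ S k ∧ (k ∉ τ → z ∈ P k)}) _
    (fun x hx => h τ hτ x (fun k => (hx k).1) fun k => (hx k).2) x fun k => ?_
  by_cases hk : k ∈ τ
  · have : x k ∈ Submodule.span ℤ (S k) := by rw [hS]; trivial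
    refine Submodule.span_mono ?_ this
    exact fun z hz => ⟨hz, fun h => absurd hk h⟩
  · refine Submodule.span_mono ?_ (hP k (hx k hk))
    exact fun z hz => ⟨hz.1, fun _ => hz.2⟩

end Poly

/-! ### The isomorphism onto the diagonal for one factor. -/

section OneFactor

variable {E : ChainInclusion.{u}} {S : Kind}

theorem φ₁_deg : GrData.IsDeg (GCh E S) ((GT S).prod (GH E S)) (φ₁ E S) 0 :=
  isDeg_charC fun l n x => by
    rw [φ₁_inC, add_zero]
    exact GrData.tmul_mem_prod (gen_mem_gr l) (inH_mem_gr _ n x) (add_comm _ _)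

theorem φ₁_dChar : tensorD (GT S) (dT S) (0 : CharH E S →ₗ[ℤ] CharH E S) ∘ₗ φ₁ E S =
    φ₁ E S ∘ₗ dChar E S := by
  refine charC_ext fun l n x => ?_
  rw [LinearMap.comp_apply, LinearMap.comp_apply, φ₁_inC, tensorD, TensorProduct.map_zero_right,
    add_zero, TensorProduct.map_tmul, dT_gen, LinearMap.id_apply]
  by_cases h : l = Letter.β
  · subst h
    rw [if_pos rfl, dChar_β]
    exact (φ₁_inC Letter.γ n x).symm
  · rw [if_neg h, TensorProduct.zero_tmul]
    have h2 : dChar E S (inC E S l n x) = 0 := by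
      cases l with
      | β => exact absurd rfl h
      | α hα => exact dChar_α hα n x
      | γ => exact dChar_γ n x
      | η => exact dChar_η n x
    rw [h2, map_zero]

/-- The component of the inverse of `φ₁` at the generator `l`. -/
def invφ₁ (E : ChainInclusion.{u}) (l : Letter S) : CharH E S →ₗ[ℤ] CharC E S :=
  DirectSum.toModule ℤ (Idx S × ℤ) (CharC E S) fun p =>
    if h : l.idx = p.1 then (h ▸ inC E S l p.2 : CharGrp E p.1 p.2 →ₗ[ℤ] CharC E S) else 0

/-- `l ⊗ x ↦ x` if `l` and `x` have the same index; other tensors are mapped to zero. -/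
def retrφ₁ (E : ChainInclusion.{u}) (S : Kind) : TCx S ⊗[ℤ] CharH E S →ₗ[ℤ] CharC E S :=
  TensorProduct.lift (TCx.lift S (invφ₁ E))

theorem retrφ₁_eq (l : Letter S) (n : ℤ) (x : CharGrp E l.idx n) :
    retrφ₁ E S (gen S l ⊗ₜ inH E S l.idx n x) = inC E S l n x := by
  rw [retrφ₁, TensorProduct.lift.tmul, TCx.lift_gen]
  refine (toModule_inH _ l.idx n x).trans ?_
  rw [dif_pos rfl]

theorem retrφ₁_ne (l : Letter S) (s : Idx S) (h : l.idx ≠ s) (n : ℤ) (x : CharGrp E s n) :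
    retrφ₁ E S (gen S l ⊗ₜ inH E S s n x) = 0 := by
  rw [retrφ₁, TensorProduct.lift.tmul, TCx.lift_gen]
  refine (toModule_inH _ s n x).trans ?_
  rw [dif_neg h, LinearMap.zero_apply]

theorem retrφ₁_φ₁ : retrφ₁ E S ∘ₗ φ₁ E S = LinearMap.id := charC_ext fun l n x => by
  rw [LinearMap.comp_apply, φ₁_inC, retrφ₁_eq, LinearMap.id_apply]

theorem retrφ₁_deg : GrData.IsDeg ((GT S).prod (GH E S)) (GCh E S) (retrφ₁ E S) 0 := by
  refine GrData.IsDeg.of_zero fun n z hz => ?_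
  refine GrData.prod_gr_le (Q := ((GCh E S).gr n).comap (retrφ₁ E S)) (fun a b hab x hx y hy => ?_) hz
  have key : GrData.IsDeg (GT S) (GCh E S) (retrφ₁ E S ∘ₗ (TensorProduct.mk ℤ _ _).flip y) b := by
    refine isDeg_T fun l => ?_
    change retrφ₁ E S (gen S l ⊗ₜ y) ∈ (GCh E S).gr (l.deg + b)
    have key2 : GrData.IsDeg (GH E S) (GCh E S) (retrφ₁ E S ∘ₗ TensorProduct.mk ℤ _ _ (gen S l))
        l.deg := isDeg_charH fun s j w => by
      change retrφ₁ E S (gen S l ⊗ₜ inH E S s j w) ∈ (GCh E S).gr (j + l.deg)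
      by_cases h : l.idx = s
      · subst h
        rw [retrφ₁_eq]
        exact inC_mem_gr l j w
      · rw [retrφ₁_ne l s h]
        exact Submodule.zero_mem _
    have h := key2 b y hy
    rw [add_comm] at h
    exact h
  have h := key a x hx
  rw [hab] at h
  exact h

/-- An element of `ker θ` is its own preimage under `ϑ'`; a value `θ u`, viewed in `η`, has the
preimage `u - κ u`. -/
theorem inC_mem_range_θ' (κ : ∀ n, E.U n →ₗ[ℤ] LinearMap.ker (E.θ n))
    (hκ : ∀ n (z : LinearMap.ker (E.θ n)), κ n z = z) {l : Letter S}
    (hl : l = Letter.γ ∨ l = Letter.η) (n : ℤ) (x : CharGrp E l.idx n) :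
    inC E S l n x ∈ LinearMap.range (θ' E S κ) := by
  obtain rfl | rfl := hl
  · let z : LinearMap.ker (E.θ n) := x
    refine ⟨DirectSum.lof ℤ ℤ E.U n z, ?_⟩
    rw [θ'_lof, hκ]
    have h : (E.θ n).rangeRestrict z = 0 := Subtype.ext z.2
    rw [h]
    exact (congrArg _ (map_zero _)).trans (add_zero _)
  · obtain ⟨u, hu⟩ := (x : LinearMap.range (E.θ n)).2
    refine ⟨DirectSum.lof ℤ ℤ E.U n (u - κ n u), ?_⟩
    rw [θ'_lof, map_sub, hκ, sub_self]
    have h : (E.θ n).rangeRestrict (u - κ n u) = (x : LinearMap.range (E.θ n)) := by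
      refine Subtype.ext ?_
      rw [← hu]
      exact (map_sub (E.θ n) _ _).trans ((congrArg _ (κ n u).2).trans (sub_zero _))
    rw [h]
    exact (congrArg (· + _) (map_zero _)).trans (zero_add _)

theorem range_θ'_le (κ : ∀ n, E.U n →ₗ[ℤ] LinearMap.ker (E.θ n)) :
    LinearMap.range (θ' E S κ) ≤ Submodule.span ℤ
      ({y | ∃ l n x, y = inC E S l n x} ∩
        {y | ∃ l n x, (l = Letter.γ ∨ l = Letter.η) ∧ y = inC E S l n x}) := by
  rintro _ ⟨u, rfl⟩
  induction u using DirectSum.induction_on with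
  | zero => rw [map_zero]; exact Submodule.zero_mem _
  | add u v hu hv => rw [map_add]; exact Submodule.add_mem _ hu hv
  | of n u =>
    rw [show DirectSum.of E.U n u = DirectSum.lof ℤ ℤ E.U n u from rfl, θ'_lof]
    exact Submodule.add_mem _
      (Submodule.subset_span ⟨⟨_, _, _, rfl⟩, Letter.γ, n, _, Or.inl rfl, rfl⟩)
      (Submodule.subset_span ⟨⟨_, _, _, rfl⟩, Letter.η, n, _, Or.inr rfl, rfl⟩)

theorem span_inC : Submodule.span ℤ {y | ∃ l n x, y = inC E S l n x} = ⊤ := by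
  refine top_unique (DirectSum.span_lof_eq_top (CPiece E S) ▸ Submodule.span_mono ?_)
  rintro _ ⟨⟨l, n⟩, z, rfl⟩
  exact ⟨l, n, z, rfl⟩

theorem span_inH : Submodule.span ℤ {y | ∃ s n x, y = inH E S s n x} = ⊤ := by
  refine top_unique (DirectSum.span_lof_eq_top (HPiece E S) ▸ Submodule.span_mono ?_)
  rintro _ ⟨⟨s, n⟩, z, rfl⟩
  exact ⟨s, n, z, rfl⟩

end OneFactor

/-! ### The comparison map for several factors. -/

section Diagonal

variable {m : ℕ} {E : Fin m → ChainInclusion.{u}} {S : Kind}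

theorem diagMap_deg : GrData.IsDeg (GrData.pi fun k => GCh (E k) S)
    ((GrData.pi fun _ => GT S).prod (GrData.pi fun k => GH (E k) S)) (diagMap E S) 0 :=
  (shuffle_deg (fun _ => GT_lawful) fun _ => GH_lawful).comp'
    (GrData.IsDeg.piMap_zero fun _ => φ₁_deg) (add_zero 0)

/-- The left inverse of `diagMap`. -/
def diagInv (E : Fin m → ChainInclusion.{u}) (S : Kind) :
    (⨂[ℤ] _k : Fin m, TCx S) ⊗[ℤ] (⨂[ℤ] k, CharH (E k) S) →ₗ[ℤ] (⨂[ℤ] k, CharC (E k) S) :=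
  PiTensorProduct.map (fun k => retrφ₁ (E k) S) ∘ₗ unshuffle (fun _ => GT S) (fun k => GH (E k) S)

theorem diagInv_deg : GrData.IsDeg ((GrData.pi fun _ => GT S).prod (GrData.pi fun k => GH (E k) S))
    (GrData.pi fun k => GCh (E k) S) (diagInv E S) 0 :=
  (GrData.IsDeg.piMap_zero fun _ => retrφ₁_deg).comp'
    (unshuffle_deg (fun _ => GT_lawful) fun _ => GH_lawful) (add_zero 0)

theorem diagInv_diagMap (x : ⨂[ℤ] k, CharC (E k) S) : diagInv E S (diagMap E S x) = x := by
  have h1 := unshuffle_shuffle (fun _ : Fin m => GT_lawful (S := S))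
    (fun k => GH_lawful (E := E k) (S := S))
  have h2 := LinearMap.congr_fun h1 (PiTensorProduct.map (fun k => φ₁ (E k) S) x)
  refine (congrArg (PiTensorProduct.map fun k => retrφ₁ (E k) S) h2).trans ?_
  rw [LinearMap.id_apply, ← LinearMap.comp_apply, ← PiTensorProduct.map_comp]
  simp only [retrφ₁_φ₁, PiTensorProduct.map_id, LinearMap.id_apply]

theorem piD_zero {A : Fin m → Type*} [∀ k, AddCommGroup (A k)] [∀ k, Module ℤ (A k)]
    (G : ∀ k, GrData (A k)) : piD G (fun k => (0 : A k →ₗ[ℤ] A k)) = 0 := by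
  refine Finset.sum_eq_zero fun k _ => PiTensorProduct.ext (MultilinearMap.ext fun x => ?_)
  simp only [LinearMap.compMultilinearMap_apply, PiTensorProduct.map_tprod]
  exact MultilinearMap.map_coord_zero _ k (by simp)

theorem diagMap_piD (x : ⨂[ℤ] k, CharC (E k) S) :
    diagMap E S (piD (fun k => GCh (E k) S) (fun k => dChar (E k) S) x) =
      tensorD (GrData.pi fun _ => GT S) (piD (fun _ => GT S) fun _ => dT S) 0 (diagMap E S x) := by
  have hd : GrData.IsPar (GT S) (GT S) (dT S) 1 := by
    simpa using dT_deg.par GT_lawful GT_lawful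
  have h1 := piD_comm (GA := fun k => GCh (E k) S) (GB := fun k => (GT S).prod (GH (E k) S))
    (fun k => φ₁_deg.sgn_comm GCh_lawful (GT_lawful.prod GH_lawful)) fun k => φ₁_dChar (E := E k)
  have h2 := shuffle_piD (GA := fun _ : Fin m => GT S) (GB := fun k => GH (E k) S)
    (d' := fun k => 0) (fun _ => GT_lawful) (fun _ => GH_lawful) (fun _ => hd)
    fun k e x => by simp
  rw [piD_zero] at h2
  exact (congrArg (shuffle _ _) (LinearMap.congr_fun h1 x).symm).trans
    (LinearMap.congr_fun h2 _)

end Diagonal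

/-! ### Identification of the character complex with the diagonal tensor product. -/

section DiagonalComplex

variable {m : ℕ} (K : LowerSet (Finset (Fin m))) {E : Fin m → SplitCoalgInclusion.{u}} {S : Kind}
  (χ : ∀ k, CharData (E k) S)

theorem tmul_mem_diagCx {s : Fin m → Idx S} {x : (totalCx K χ).M} {y : (charCoalg χ).M}
    (hx : x ∈ (totalCx K χ).N) (hs : totalIdx K χ s x = x) (hs' : charIdx χ s y = y) :
    (x ⊗ₜ[ℤ] y : (totalCx K χ).M ⊗[ℤ] (charCoalg χ).M) ∈ (diagCx K χ).N :=
  (Submodule.subset_span ⟨s, x, hx, y, trivial, hs, hs', rfl⟩ :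
    x ⊗ₜ[ℤ] y ∈ Submodule.span ℤ {z : (totalCx K χ).M ⊗[ℤ] (charCoalg χ).M |
      ∃ s, ∃ x ∈ (totalCx K χ).N, ∃ y ∈ (charCoalg χ).N, totalIdx K χ s x = x ∧
        charIdx χ s y = y ∧ z = x ⊗ₜ[ℤ] y})

theorem φchar_mem {x : (charCx K χ).M} (hx : x ∈ (charCx K χ).N) :
    φchar K χ x ∈ (diagCx K χ).N := by
  suffices h : (charCx K χ).N ≤ (diagCx K χ).N.comap (φchar K χ) from h hx
  refine poly_le_of_span (fun k => {y | ∃ l n x, y = inC (E k).toChainInclusion S l n x})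
    (fun k => {y | ∃ l n x, (l = Letter.γ ∨ l = Letter.η) ∧ y = inC (E k).toChainInclusion S l n x})
    (fun k => span_inC) (fun k => range_θ'_le _) fun τ hτ y hy hy' => ?_
  have hy2 : ∀ k, ∃ l n x, (k ∉ τ → l = Letter.γ ∨ l = Letter.η) ∧
      y k = inC (E k).toChainInclusion S l n x := fun k => by
    by_cases hk : k ∈ τ
    · obtain ⟨l, n, x, h⟩ := hy k
      exact ⟨l, n, x, fun h => absurd hk h, h⟩
    · obtain ⟨l, n, x, h, h'⟩ := hy' k hk
      exact ⟨l, n, x, fun _ => h, h'⟩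
  choose l n z hl hz using hy2
  obtain rfl : y = _ := funext hz
  have h := diagMap_tprod (E := fun k => (E k).toChainInclusion) l n z
  change φchar K χ (PiTensorProduct.tprod ℤ fun k => inC (E k).toChainInclusion S (l k) (n k) (z k))
    ∈ (diagCx K χ).N
  have aux : ∀ (c : ℤ) (v : (charCx K χ).M) (w : (diagCx K χ).M), w ∈ (diagCx K χ).N →
      φchar K χ v = c • w → φchar K χ v ∈ (diagCx K χ).N := fun c v w hw hv => by
    rw [hv]
    exact Submodule.smul_mem _ _ hw
  refine aux _ _ _ (tmul_mem_diagCx K χ (s := fun k => (l k).idx)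
    (tprod_mem_poly hτ fun k hk => gen_mem_lowT (hl k hk)) ?_ ?_) h
  · exact (map_prT_tprod _ l).trans (if_pos rfl)
  · refine (PiTensorProduct.map_tprod _ _).trans (congrArg _ (funext fun k => ?_))
    exact (prH_inH _ _ _ _).trans (if_pos rfl)

/-- The diagonal is spanned by tensors of generators with homology pieces, projected to a common
index. If the indices match, such a tensor is up to sign the image of a tensor of pieces; otherwise
one of the projections kills it. -/
theorem exists_φchar_eq {y : (diagCx K χ).M} (hy : y ∈ (diagCx K χ).N) :
    ∃ x ∈ (charCx K χ).N, φchar K χ x = y := by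
  suffices h : (diagCx K χ).N ≤ (charCx K χ).N.map (φchar K χ) from h hy
  refine Submodule.span_le.2 ?_
  rintro _ ⟨s, x, hx, y, -, hx', hy', rfl⟩
  have key : ∀ x ∈ (totalCx K χ).N, ∀ y : (charCoalg χ).M, (totalIdx K χ s x ⊗ₜ[ℤ] charIdx χ s y :
      (diagCx K χ).M) ∈ (charCx K χ).N.map (φchar K χ) := by
    clear hx hy' hx' x y
    intro x hx y
    have hx0 : (totalCx K χ).N ≤ ((charCx K χ).N.map (φchar K χ)).comap
        ((TensorProduct.mk ℤ (totalCx K χ).M (charCoalg χ).M).flip (charIdx χ s y) ∘ₗ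
          totalIdx K χ s) := by
      refine poly_le_of_span (fun k => Set.range (gen S)) (fun k => {gen S Letter.γ, gen S Letter.η})
        (fun k => span_gen) (fun k => Submodule.span_mono ?_) fun τ hτ x hx hx' => ?_
      · rintro _ (rfl | rfl)
        · exact ⟨⟨_, rfl⟩, Or.inl rfl⟩
        · exact ⟨⟨_, rfl⟩, Or.inr rfl⟩
      have hx2 : ∀ k, ∃ l, (k ∉ τ → l = Letter.γ ∨ l = Letter.η) ∧ x k = gen S l := fun k => by
        by_cases hk : k ∈ τ
        · obtain ⟨l, h⟩ := hx k
          exact ⟨l, fun h => absurd hk h, h.symm⟩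
        · obtain h | h := hx' k hk
          · exact ⟨Letter.γ, fun _ => Or.inl rfl, h⟩
          · exact ⟨Letter.η, fun _ => Or.inr rfl, h⟩
      choose l hl hx2 using hx2
      obtain rfl : x = _ := funext hx2
      have hy0 : (⊤ : Submodule ℤ (⨂[ℤ] k, CharH (E k).toChainInclusion S)) ≤
          ((charCx K χ).N.map (φchar K χ)).comap
            (TensorProduct.mk ℤ (totalCx K χ).M (charCoalg χ).M
              (totalIdx K χ s (PiTensorProduct.tprod ℤ fun k => gen S (l k))) ∘ₗ charIdx χ s) := by
        rw [← PiTensorProduct.span_tprod_eq_top]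
        refine Submodule.span_le.2 ?_
        rintro _ ⟨y, rfl⟩
        refine PiTensorProduct.tprod_mem_of_span
          (fun k => {y | ∃ s n x, y = inH (E k).toChainInclusion S s n x}) _ (fun y hy => ?_) y
          fun k => by rw [span_inH]; trivial
        choose s' n z hz using hy
        obtain rfl : y = _ := funext hz
        change TensorProduct.mk ℤ (totalCx K χ).M (charCoalg χ).M
          (PiTensorProduct.map (fun k => prT S (s k)) (PiTensorProduct.tprod ℤ fun k => gen S (l k)))
          (PiTensorProduct.map (fun k => prH (E k).toChainInclusion S (s k))
            (PiTensorProduct.tprod ℤ fun k => inH (E k).toChainInclusion S (s' k) (n k) (z k))) ∈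
            (charCx K χ).N.map (φchar K χ)
        rw [map_prT_tprod]
        by_cases h1 : (fun k => (l k).idx) = s
        · rw [if_pos h1]
          by_cases h2 : s' = s
          · subst h2
            subst h1
            have h3 : PiTensorProduct.map (fun k => prH (E k).toChainInclusion S (l k).idx)
                (PiTensorProduct.tprod ℤ fun k =>
                  inH (E k).toChainInclusion S (l k).idx (n k) (z k)) =
                PiTensorProduct.tprod ℤ fun k =>
                  inH (E k).toChainInclusion S (l k).idx (n k) (z k) :=
              (PiTensorProduct.map_tprod _ _).trans (congrArg _ (funext fun k =>
                (prH_inH _ _ _ _).trans (if_pos rfl)))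
            have h4 := diagMap_tprod (E := fun k => (E k).toChainInclusion) l n z
            have h5 := congrArg (sg (pairSum (fun k => (n k : ZMod 2)) fun k =>
              ((l k).deg : ZMod 2)) • ·) h4
            simp only [smul_smul, sg_mul_self, one_smul] at h5
            refine ⟨sg (pairSum (fun k => (n k : ZMod 2)) fun k => ((l k).deg : ZMod 2)) •
              PiTensorProduct.tprod ℤ fun k => inC (E k).toChainInclusion S (l k) (n k) (z k),
              Submodule.smul_mem _ _ (tprod_mem_poly hτ fun k hk =>
                inC_mem_range_θ' _ (χ k).κ_ker (hl k hk) _ _), ?_⟩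
            refine (map_smul (φchar K χ) _ _).trans (h5.trans ?_)
            exact congrArg (TensorProduct.mk ℤ (totalCx K χ).M (charCoalg χ).M _) h3.symm
          · obtain ⟨k, hk⟩ := Function.ne_iff.1 h2
            have h3 : PiTensorProduct.map (fun k => prH (E k).toChainInclusion S (s k))
                (PiTensorProduct.tprod ℤ fun k =>
                  inH (E k).toChainInclusion S (s' k) (n k) (z k)) = 0 :=
              (PiTensorProduct.map_tprod _ _).trans (MultilinearMap.map_coord_zero _ k
                ((prH_inH _ _ _ _).trans (if_neg hk)))
            refine Eq.mpr (congrArg (· ∈ _) ((congrArg (TensorProduct.mk ℤ (totalCx K χ).M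
              (charCoalg χ).M _) h3).trans (map_zero _))) (Submodule.zero_mem _)
        · rw [if_neg h1]
          exact Eq.mpr (congrArg (· ∈ _) (LinearMap.map_zero₂ (TensorProduct.mk ℤ (totalCx K χ).M
              (charCoalg χ).M) _)) (Submodule.zero_mem _)
      exact hy0 (x := y) trivial
    exact hx0 hx
  have h := key x hx y
  rw [hx', hy'] at h
  exact h

theorem φchar_isChainMap : CoalgData.IsChainMap (charCx K χ) (diagCx K χ) (φchar K χ) where
  deg _ _ hx := diagMap_deg.zero_mem hx
  sub _ hx := φchar_mem K χ hx
  comm x _ := diagMap_piD x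

theorem diagTensorProj_deg {E : Fin m → ChainInclusion.{u}} :
    GrData.IsDeg ((GrData.pi fun _ => GT S).prod (GrData.pi fun k => GH (E k) S))
      ((GrData.pi fun _ => GT S).prod (GrData.pi fun k => GH (E k) S)) (diagTensorProj E S) 0 :=
  GrData.IsDeg.sum fun s _ => by
    have h := (GrData.IsDeg.piMap_zero (GA := fun _ => GT S) (GB := fun _ => GT S)
      fun k : Fin m => prT_deg (s k)).tmap (GrData.IsDeg.piMap_zero
        (GA := fun k => GH (E k) S) (GB := fun k => GH (E k) S) fun k => prH_deg (s k))
    rw [add_zero] at h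
    exact h

theorem φchar_comult (x : (charCx K χ).M) :
    TensorProduct.map (φchar K χ) (φchar K χ) ((charCx K χ).Ψ x) = (diagCx K χ).Ψ (φchar K χ x) :=
  diagMap_comult χ x

/-- The structure is inherited from the isomorphic character complex, rather than derived from the
two tensor factors, whose coproducts need not preserve degrees. -/
theorem diagCx_isDGC : (diagCx K χ).IsDGC := by
  have hT := totalCx_isDGC K χ
  have hH := charCoalg_isDGC χ
  refine (charCx_isDGC K χ).of_map (φchar K χ) (hT.lawful.prod hH.lawful) ?_ ?_
    (GrData.IsDeg.of_zero (φchar_isChainMap K χ).deg) diagMap_piD (φchar_comult K χ)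
    (fun y hy => exists_φchar_eq K χ hy) fun x hx => φchar_mem K χ hx
  · have h1 := hT.d_deg.tmap (GrData.IsDeg.id (G := (charCoalg χ).G))
    have h2 := hT.lawful.sgn_deg.tmap hH.d_deg
    rw [add_zero] at h1
    rw [zero_add] at h2
    exact h1.add h2
  · have h1 := diagTensorProj_deg (S := S) (E := fun k => (E k).toChainInclusion)
    have h1 : GrData.IsDeg (diagCx K χ).G (diagCx K χ).G (CoalgData.diagProj₀ (totalCx K χ)
      (charCoalg χ) (totalIdx K χ) (charIdx χ)) 0 := h1
    exact (h1.tmap h1).bdd.comp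
      ((GrData.interchange_deg hT.lawful hH.lawful).bdd.comp (hT.Ψ_bdd.tmap hH.Ψ_bdd))

/-- The map has a left inverse and is onto the diagonal subcomplex, so the homotopy can be taken to
be zero. -/
theorem φchar_bijective : Function.Bijective (CoalgData.pull (φchar_isChainMap K χ).pullOK) := by
  let r : (diagCx K χ).M →ₗ[ℤ] (charCx K χ).M := diagInv (fun k => (E k).toChainInclusion) S
  have hinv : ∀ x : (charCx K χ).M, r (φchar K χ x) = x := diagInv_diagMap
  refine CoalgData.pull_bijective (φchar_isChainMap K χ) r 0 diagInv_deg.bdd (GrData.IsDeg.zero (k := 0)).bdd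
    (fun y hy => ?_) (fun y hy => ?_) (fun _ _ => Submodule.zero_mem _) (fun x _ => ?_) fun y hy => ?_
  · obtain ⟨x, hx, rfl⟩ := exists_φchar_eq K χ hy
    rw [hinv]
    exact hx
  · obtain ⟨x, hx, rfl⟩ := exists_φchar_eq K χ hy
    rw [← (φchar_isChainMap K χ).comm x hx, hinv, hinv]
  · rw [hinv, sub_self, LinearMap.zero_apply, LinearMap.zero_apply, map_zero, add_zero]
  · obtain ⟨x, hx, rfl⟩ := exists_φchar_eq K χ hy
    rw [hinv]

theorem φchar_mul (a b : (diagCx K χ).Coh) :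
    CoalgData.pull (φchar_isChainMap K χ).pullOK ((diagCx K χ).mul (diagCx_isDGC K χ).mulOK a b) =
      (charCx K χ).mul (charCx_isDGC K χ).mulOK (CoalgData.pull (φchar_isChainMap K χ).pullOK a)
        (CoalgData.pull (φchar_isChainMap K χ).pullOK b) := by
  refine CoalgData.pull_mul (φchar_isChainMap K χ) _ _ 0 (GrData.IsDeg.zero (k := 0)).bdd
    (fun _ _ => Submodule.zero_mem _) (fun x _ => ?_) a b
  rw [φchar_comult, sub_self, LinearMap.zero_apply, LinearMap.zero_apply, map_zero, add_zero]

end DiagonalComplex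

/-! ### The cross product of the cohomology of a diagonal tensor product -/

namespace CoalgData

/-- The cochain `f` represents the cohomology class `c`. -/
def Rep (X : CoalgData.{u}) (f : Module.Dual ℤ X.M) (c : X.Coh) : Prop :=
  ∃ hf : f ∈ X.cocycles, X.cls ⟨f, hf⟩ = c

theorem Rep.unique {X : CoalgData.{u}} {f : Module.Dual ℤ X.M} {c c' : X.Coh} (h : X.Rep f c)
    (h' : X.Rep f c') : c = c' := by
  obtain ⟨hf, rfl⟩ := h
  obtain ⟨hf', rfl⟩ := h'
  rfl

theorem Rep.add {X : CoalgData.{u}} {f g : Module.Dual ℤ X.M} {c c' : X.Coh} (h : X.Rep f c)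
    (h' : X.Rep g c') : X.Rep (f + g) (c + c') := by
  obtain ⟨hf, rfl⟩ := h
  obtain ⟨hg, rfl⟩ := h'
  exact ⟨add_mem hf hg, map_add X.cls ⟨f, hf⟩ ⟨g, hg⟩⟩

theorem Rep.smul {X : CoalgData.{u}} {f : Module.Dual ℤ X.M} {c : X.Coh} (r : ℤ) (h : X.Rep f c) :
    X.Rep (r • f) (r • c) := by
  obtain ⟨hf, rfl⟩ := h
  exact ⟨Submodule.smul_mem _ _ hf, map_smul X.cls r ⟨f, hf⟩⟩

theorem Rep.zero (X : CoalgData.{u}) : X.Rep 0 0 := ⟨Submodule.zero_mem _, map_zero X.cls⟩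

theorem Rep.sum {X : CoalgData.{u}} {ι : Type*} {s : Finset ι} {f : ι → Module.Dual ℤ X.M}
    {c : ι → X.Coh} (h : ∀ i ∈ s, X.Rep (f i) (c i)) : X.Rep (∑ i ∈ s, f i) (∑ i ∈ s, c i) := by
  classical
  induction s using Finset.induction_on with
  | empty => simpa using Rep.zero X
  | insert i s hi ih =>
    rw [Finset.sum_insert hi, Finset.sum_insert hi]
    exact (h i (Finset.mem_insert_self _ _)).add (ih fun j hj => h j (Finset.mem_insert_of_mem hj))

/-- The difference vanishes on `N`, hence is a coboundary with primitive 0. -/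
theorem Rep.congr {X : CoalgData.{u}} {f g : Module.Dual ℤ X.M} {c : X.Coh} (h : X.Rep f c)
    (hg : g ∈ X.gdual) (hfg : ∀ x ∈ X.N, g x = f x) (hd : ∀ x ∈ X.N, X.d x ∈ X.N) : X.Rep g c := by
  obtain ⟨hf, rfl⟩ := h
  have hg' : g ∈ X.cocycles := ⟨hg, fun x hx => by rw [hfg _ (hd x hx), hf.2 x hx]⟩
  refine ⟨hg', cls_eq.2 ⟨(sub_mem hg' hf).1, 0, X.gdual_zero, fun x hx => ?_⟩⟩
  rw [LinearMap.sub_apply, hfg x hx, sub_self, LinearMap.zero_apply]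

section Cross

variable {I : Type w} [Fintype I]

/-- The conditions under which the cohomology of the diagonal tensor product of `X` and `Y` is the
diagonal tensor product of the cohomology groups. -/
structure CrossOK (X : CoalgData.{u}) (Y : CoalgData.{v}) (π : I → X.M →ₗ[ℤ] X.M)
    (ρ : I → Y.M →ₗ[ℤ] Y.M) : Prop where
  lawful : X.G.Lawful
  gdual : ∀ f, f ∈ X.gdual
  finite : Module.Finite ℤ X.M
  free : Module.Free ℤ X.M
  d_mem : ∀ x ∈ X.N, X.d x ∈ X.N
  π_chain : ∀ s, IsChainMap X X (π s)
  ρ_chain : ∀ s, IsChainMap Y Y (ρ s)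
  π_idem : ∀ s x, π s (π s x) = π s x
  ρ_idem : ∀ s y, ρ s (ρ s y) = ρ s y
  π_orth : ∀ s t, s ≠ t → ∀ x, π s (π t x) = 0
  d_eq : Y.d = 0
  N_eq : Y.N = ⊤

variable {X : CoalgData.{u}} {Y : CoalgData.{v}} {π : I → X.M →ₗ[ℤ] X.M}
  {ρ : I → Y.M →ₗ[ℤ] Y.M}

theorem mem_gdual_diag {f : Module.Dual ℤ (X.M ⊗[ℤ] Y.M)} {F : Finset ℤ}
    (hf : ∀ p q, p + q ∉ F → ∀ x ∈ X.G.gr p, ∀ y ∈ Y.G.gr q, f (x ⊗ₜ y) = 0) :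
    f ∈ (diag X Y π ρ).gdual := by
  refine ⟨F, fun n hn z hz => ?_⟩
  have h : (X.G.prod Y.G).gr n ≤ LinearMap.ker f :=
    fun z hz => GrData.prod_gr_le (fun p q hpq x hx y hy => LinearMap.mem_ker.2
      (hf p q (hpq ▸ hn) x hx y hy)) hz
  exact h hz

theorem diag_N_eqOn {L : Type*} [AddCommGroup L] [Module ℤ L] {f g : X.M ⊗[ℤ] Y.M →ₗ[ℤ] L}
    (h : ∀ s, ∀ x ∈ X.N, ∀ y, π s x = x → ρ s y = y → f (x ⊗ₜ y) = g (x ⊗ₜ y))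
    {z : X.M ⊗[ℤ] Y.M} (hz : z ∈ (diag X Y π ρ).N) : f z = g z := by
  have h1 : (diag X Y π ρ).N ≤ LinearMap.eqLocus f g := by
    refine Submodule.span_le.2 ?_
    rintro _ ⟨s, x, hx, y, -, hs, hs', rfl⟩
    exact h s x hx y hs hs'
  exact h1 hz

theorem tmul_mem_diag {s : I} {x : X.M} {y : Y.M} (hx : x ∈ X.N) (hy : y ∈ Y.N) (hs : π s x = x)
    (hs' : ρ s y = y) : (x ⊗ₜ[ℤ] y : X.M ⊗[ℤ] Y.M) ∈ (diag X Y π ρ).N :=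
  (Submodule.subset_span ⟨s, x, hx, y, hy, hs, hs', rfl⟩ :
    x ⊗ₜ[ℤ] y ∈ Submodule.span ℤ {z : X.M ⊗[ℤ] Y.M |
      ∃ s, ∃ x ∈ X.N, ∃ y ∈ Y.N, π s x = x ∧ ρ s y = y ∧ z = x ⊗ₜ[ℤ] y})

theorem dualDistrib_mem_gdual {a : Module.Dual ℤ X.M} {b : Module.Dual ℤ Y.M} (ha : a ∈ X.gdual)
    (hb : b ∈ Y.gdual) :
    (TensorProduct.dualDistrib ℤ X.M Y.M (a ⊗ₜ[ℤ] b) : Module.Dual ℤ (diag X Y π ρ).M) ∈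
      (diag X Y π ρ).gdual := by
  obtain ⟨F, hF⟩ := ha
  obtain ⟨F', hF'⟩ := hb
  classical
  refine mem_gdual_diag (F := (F ×ˢ F').image fun p => p.1 + p.2) fun p q hpq x hx y hy => ?_
  rw [TensorProduct.dualDistrib_apply]
  by_cases h : p ∈ F
  · by_cases h' : q ∈ F'
    · exact absurd (Finset.mem_image.2 ⟨(p, q), Finset.mem_product.2 ⟨h, h'⟩, rfl⟩) hpq
    · rw [hF' q h' y hy, mul_zero]
  · rw [hF p h x hx, zero_mul]

theorem dualDistrib_map_subtype_apply (u : X.cocycles ⊗[ℤ] Y.cocycles)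
    (f : X.cocycles ⊗[ℤ] Y.cocycles →ₗ[ℤ] ℤ) (x : X.M) (y : Y.M)
    (hf : ∀ a b, f (a ⊗ₜ b) = a.1 x * b.1 y) :
    TensorProduct.dualDistrib ℤ X.M Y.M
      (TensorProduct.map X.cocycles.subtype Y.cocycles.subtype u) (x ⊗ₜ y) = f u := by
  induction u with
  | zero => rw [map_zero, map_zero, map_zero, LinearMap.zero_apply]
  | add u v hu hv => rw [map_add, map_add, map_add, LinearMap.add_apply, hu, hv]
  | tmul a b =>
    rw [hf, TensorProduct.map_tmul, TensorProduct.dualDistrib_apply]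
    rfl

/-- A map with values in a torsion-free group whose source is finitely generated is a sum of
functionals times elements. -/
theorem _root_.LinearMap.exists_eq_sum_smul {M F : Type*} [AddCommGroup M] [Module ℤ M]
    [AddCommGroup F] [Module ℤ F] [Module.Finite ℤ M] [Module.IsTorsionFree ℤ F] (f : M →ₗ[ℤ] F) :
    ∃ (n : ℕ) (a : Fin n → Module.Dual ℤ M) (b : Fin n → F),
      (∀ i x, f x = 0 → a i x = 0) ∧ ∀ x, f x = ∑ i, a i x • b i := by
  have : Module.Finite ℤ (LinearMap.range f) := Module.Finite.range f
  have : Module.Free ℤ (LinearMap.range f) := Module.free_of_finite_type_torsion_free'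
  let B := Module.finBasis ℤ (LinearMap.range f)
  refine ⟨_, fun i => B.coord i ∘ₗ f.rangeRestrict, fun i => (B i).1, fun i x hx => ?_, fun x => ?_⟩
  · have h0 : f.rangeRestrict x = 0 := Subtype.ext hx
    rw [LinearMap.comp_apply, h0, map_zero]
  · have h0 := congrArg Subtype.val (B.sum_repr (f.rangeRestrict x))
    rw [Submodule.coe_sum] at h0
    exact h0.symm

namespace CrossOK

theorem dualDistrib_mem (h : CrossOK X Y π ρ) {a : Module.Dual ℤ X.M} {b : Module.Dual ℤ Y.M}
    (ha : a ∈ X.cocycles) (hb : b ∈ Y.cocycles) :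
    (TensorProduct.dualDistrib ℤ X.M Y.M (a ⊗ₜ[ℤ] b) : Module.Dual ℤ (diag X Y π ρ).M) ∈
      (diag X Y π ρ).cocycles := by
  refine ⟨dualDistrib_mem_gdual ha.1 hb.1, fun z hz => ?_⟩
  exact diag_N_eqOn (f := TensorProduct.dualDistrib ℤ X.M Y.M (a ⊗ₜ[ℤ] b) ∘ₗ tensorD X.G X.d Y.d)
    (g := 0) (fun s x hx y _ _ => by simp [tensorD, h.d_eq, ha.2 x hx]) hz

theorem dualDistrib_mem_coboundaries_left (h : CrossOK X Y π ρ) {a : Module.Dual ℤ X.M}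
    {b : Module.Dual ℤ Y.M} (ha : a ∈ X.coboundaries) (hb : b ∈ Y.cocycles) :
    (TensorProduct.dualDistrib ℤ X.M Y.M (a ⊗ₜ[ℤ] b) : Module.Dual ℤ (diag X Y π ρ).M) ∈
      (diag X Y π ρ).coboundaries := by
  obtain ⟨ha, g, hg, hag⟩ := ha
  refine ⟨dualDistrib_mem_gdual ha hb.1, _, dualDistrib_mem_gdual hg hb.1, fun z hz => ?_⟩
  exact diag_N_eqOn (f := TensorProduct.dualDistrib ℤ X.M Y.M (a ⊗ₜ[ℤ] b))
    (g := TensorProduct.dualDistrib ℤ X.M Y.M (g ⊗ₜ[ℤ] b) ∘ₗ tensorD X.G X.d Y.d)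
    (fun s x hx y _ _ => by simp [tensorD, h.d_eq, hag x hx]) hz

/-- With zero differential and `N` everything, a class of `Y` has only one representing cochain. -/
theorem eq_zero_of_mem_coboundaries (h : CrossOK X Y π ρ) {b : Module.Dual ℤ Y.M}
    (hb : b ∈ Y.coboundaries) : b = 0 := by
  obtain ⟨hb, g, hg, hbg⟩ := hb
  refine LinearMap.ext fun y => ?_
  rw [hbg y (h.N_eq ▸ Submodule.mem_top), h.d_eq, LinearMap.zero_apply, map_zero,
    LinearMap.zero_apply]

theorem dualDistrib_map_mem (h : CrossOK X Y π ρ) (u : X.cocycles ⊗[ℤ] Y.cocycles) :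
    (TensorProduct.dualDistrib ℤ X.M Y.M
      (TensorProduct.map X.cocycles.subtype Y.cocycles.subtype u) :
        Module.Dual ℤ (diag X Y π ρ).M) ∈ (diag X Y π ρ).cocycles := by
  induction u with
  | zero =>
    rw [map_zero, map_zero]
    exact Submodule.zero_mem (diag X Y π ρ).cocycles
  | add u v hu hv =>
    rw [map_add, map_add]
    exact Submodule.add_mem (diag X Y π ρ).cocycles hu hv
  | tmul a b => exact h.dualDistrib_mem a.2 b.2

/-- The cross product `[a] ⊗ [b] ↦ [a ⊗ b]`. -/
def cross (h : CrossOK X Y π ρ) : X.Coh ⊗[ℤ] Y.Coh →ₗ[ℤ] (diag X Y π ρ).Coh :=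
  let b : X.cocycles →ₗ[ℤ] Y.cocycles →ₗ[ℤ] (diag X Y π ρ).Coh := LinearMap.mk₂ ℤ
    (fun f g => (diag X Y π ρ).cls ⟨_, h.dualDistrib_mem f.2 g.2⟩)
    (fun f f' g => by
      rw [← map_add]; congr 1; ext1
      exact congrArg _ (TensorProduct.add_tmul _ _ _) |>.trans (map_add _ _ _))
    (fun c f g => by
      rw [← map_smul]; congr 1; ext1
      exact congrArg _ (TensorProduct.smul_tmul' _ _ _).symm |>.trans (map_smul _ _ _))
    (fun f g g' => by
      rw [← map_add]; congr 1; ext1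
      exact congrArg _ (TensorProduct.tmul_add _ _ _) |>.trans (map_add _ _ _))
    (fun c f g => by
      rw [← map_smul]; congr 1; ext1
      exact congrArg _ (TensorProduct.tmul_smul _ _ _) |>.trans (map_smul _ _ _))
  let b₁ : X.Coh →ₗ[ℤ] Y.cocycles →ₗ[ℤ] (diag X Y π ρ).Coh := Submodule.liftQ _ b (fun f hf => by
    rw [LinearMap.mem_ker]
    ext1 g
    exact (Submodule.Quotient.mk_eq_zero _).2 (h.dualDistrib_mem_coboundaries_left hf g.2))
  TensorProduct.lift (Submodule.liftQ _ b₁.flip (fun g hg => by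
    rw [LinearMap.mem_ker]
    obtain rfl : g = 0 := Subtype.ext (h.eq_zero_of_mem_coboundaries hg)
    exact map_zero _)).flip

theorem cross_cls (h : CrossOK X Y π ρ) (a : X.cocycles) (b : Y.cocycles) :
    h.cross (X.cls a ⊗ₜ Y.cls b) = (diag X Y π ρ).cls ⟨_, h.dualDistrib_mem a.2 b.2⟩ := rfl

theorem rep_cross (h : CrossOK X Y π ρ) (u : X.cocycles ⊗[ℤ] Y.cocycles) :
    (diag X Y π ρ).Rep (TensorProduct.dualDistrib ℤ X.M Y.M
      (TensorProduct.map X.cocycles.subtype Y.cocycles.subtype u))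
        (h.cross (TensorProduct.map X.cls Y.cls u)) := by
  induction u with
  | zero =>
    rw [map_zero, map_zero, map_zero, map_zero]
    exact Rep.zero (diag X Y π ρ)
  | add u v hu hv =>
    rw [map_add, map_add, map_add, map_add]
    exact Rep.add hu hv
  | tmul a b => exact ⟨_, h.cross_cls a b⟩

end CrossOK

end Cross

end CoalgData

/-! ### The Künneth theorem for diagonal tensor products -/

namespace CoalgData

section Kunneth

variable {I : Type w} [Fintype I] {X : CoalgData.{u}} {Y : CoalgData.{v}} {π : I → X.M →ₗ[ℤ] X.M}
  {ρ : I → Y.M →ₗ[ℤ] Y.M}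

/-- The restriction of cocycles to `N`. -/
def resN (X : CoalgData.{u}) : X.cocycles →ₗ[ℤ] Module.Dual ℤ X.N :=
  LinearMap.lcomp ℤ ℤ X.N.subtype ∘ₗ X.cocycles.subtype

/-- A cocycle that vanishes on `N` is a coboundary, so a class depends only on the restriction to
`N`. -/
theorem exists_factor_resN (X : CoalgData.{u}) :
    ∃ s : LinearMap.range X.resN →ₗ[ℤ] X.Coh, ∀ a, s (X.resN.rangeRestrict a) = X.cls a := by
  have hk : LinearMap.ker X.resN ≤ LinearMap.ker X.cls := fun a ha => by
    refine LinearMap.mem_ker.2 (cls_eq_zero.2 ⟨a.2.1, 0, X.gdual_zero, fun x hx => ?_⟩)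
    exact LinearMap.congr_fun (LinearMap.mem_ker.1 ha) ⟨x, hx⟩
  refine ⟨(LinearMap.ker X.resN).liftQ X.cls hk ∘ₗ X.resN.quotKerEquivRange.symm.toLinearMap,
    fun a => ?_⟩
  have h0 : X.resN.quotKerEquivRange.symm (X.resN.rangeRestrict a) =
      (LinearMap.ker X.resN).mkQ a := by
    rw [LinearEquiv.symm_apply_eq]
    rfl
  rw [LinearMap.comp_apply, LinearEquiv.coe_coe, h0]
  rfl

/-- Elements `r ⊗ b` of `R ⊗ F`, with `R` free and `F` a group of functionals, are detected by the
values of the functionals. -/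
theorem _root_.TensorProduct.eq_zero_of_forall_eval {R M : Type*} [AddCommGroup R] [Module ℤ R]
    [AddCommGroup M] [Module ℤ M] [Module.Free ℤ R] (F : Submodule ℤ (Module.Dual ℤ M))
    (t : R ⊗[ℤ] F) (ht : ∀ y, TensorProduct.rid ℤ R (TensorProduct.map LinearMap.id
      (Module.Dual.eval ℤ M y ∘ₗ F.subtype) t) = 0) : t = 0 := by
  let B := Module.Free.chooseBasis ℤ R
  refine (TensorProduct.equivFinsuppOfBasisLeft B).injective ?_
  rw [map_zero]
  ext i y
  have key : ∀ t : R ⊗[ℤ] F, (TensorProduct.equivFinsuppOfBasisLeft B t i).1 y =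
      B.repr (TensorProduct.rid ℤ R (TensorProduct.map LinearMap.id
        (Module.Dual.eval ℤ M y ∘ₗ F.subtype) t)) i := by
    intro t
    induction t with
    | zero => simp
    | add u v hu hv => simp only [map_add, Finsupp.add_apply, Submodule.coe_add,
        LinearMap.add_apply, hu, hv]
    | tmul r b => simp [TensorProduct.equivFinsuppOfBasisLeft_apply_tmul, mul_comm]
  rw [key, ht]
  simp

namespace CrossOK

/-- Classes of `X` factor through restrictions to `N`, and these restrictions form a free group
because `X.M` is free of finite rank. A tensor over a free group is detected by evaluating its
second factor at all elements of `Y`. -/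
theorem map_cls_eq_zero (h : CrossOK X Y π ρ) (u : X.cocycles ⊗[ℤ] Y.cocycles)
    (hu : ∀ x ∈ X.N, ∀ y, TensorProduct.dualDistrib ℤ X.M Y.M
      (TensorProduct.map X.cocycles.subtype Y.cocycles.subtype u) (x ⊗ₜ y) = 0) :
    TensorProduct.map X.cls Y.cls u = 0 := by
  have := h.finite
  have := h.free
  obtain ⟨s, hs⟩ := X.exists_factor_resN
  have : Module.Free ℤ (LinearMap.range X.resN) := inferInstance
  have h0 : TensorProduct.map X.resN.rangeRestrict LinearMap.id u = 0 := by
    refine TensorProduct.eq_zero_of_forall_eval _ _ fun y => Subtype.ext (LinearMap.ext fun x => ?_)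
    refine Eq.trans ?_ (hu x.1 x.2 y)
    symm
    refine dualDistrib_map_subtype_apply u (Module.Dual.eval ℤ X.N x ∘ₗ
      (LinearMap.range X.resN).subtype ∘ₗ (TensorProduct.rid ℤ _).toLinearMap ∘ₗ
      TensorProduct.map LinearMap.id (Module.Dual.eval ℤ Y.M y ∘ₗ Y.cocycles.subtype) ∘ₗ
      TensorProduct.map X.resN.rangeRestrict LinearMap.id) x.1 y fun a b => ?_
    simp only [LinearMap.comp_apply, TensorProduct.map_tmul, LinearEquiv.coe_coe,
      TensorProduct.rid_tmul]
    exact mul_comm _ _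
  have h1 : TensorProduct.map X.cls Y.cls u =
      TensorProduct.map s Y.cls (TensorProduct.map X.resN.rangeRestrict LinearMap.id u) := by
    rw [← LinearMap.comp_apply, ← TensorProduct.map_comp, LinearMap.comp_id]
    congr 2
    exact LinearMap.ext fun a => (hs a).symm
  rw [h1, h0, map_zero]

/-- For homogeneous `x` the degrees in which `f (x ⊗ -)` is nonzero lie in a shift of the finite set
belonging to `f`; a general `x` is a finite sum of homogeneous ones. -/
theorem curry_mem (h : CrossOK X Y π ρ) {f : Module.Dual ℤ (X.M ⊗[ℤ] Y.M)}
    (hf : f ∈ (diag X Y π ρ).gdual) (x : X.M) : TensorProduct.curry f x ∈ Y.cocycles := by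
  have h1 : (⊤ : Submodule ℤ X.M) ≤ Y.cocycles.comap (TensorProduct.curry f) := by
    rw [← h.lawful.span]
    refine Submodule.span_le.2 ?_
    rintro x ⟨p, hx⟩
    obtain ⟨F, hF⟩ := hf
    refine ⟨⟨F.image fun n => n - p, fun q hq y hy => ?_⟩, fun y _ => ?_⟩
    · refine hF (p + q) (fun h => hq (Finset.mem_image.2 ⟨_, h, by ring⟩)) _ ?_
      exact GrData.tmul_mem_prod hx hy rfl
    · rw [h.d_eq, LinearMap.zero_apply, map_zero]
  exact h1 (x := x) trivial

/-- The curried functional maps the finitely generated group `X.M` to a torsion-free group of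
cochains, so its image is free of finite rank, and a basis of the image gives the `b i`. The `a i`
vanish wherever `f (x ⊗ -)` does; this will make them cocycles when `f` is one. -/
theorem exists_eq_sum (h : CrossOK X Y π ρ) {f : Module.Dual ℤ (X.M ⊗[ℤ] Y.M)}
    (hf : f ∈ (diag X Y π ρ).gdual) :
    ∃ (n : ℕ) (a : Fin n → Module.Dual ℤ X.M) (b : Fin n → Y.cocycles),
      (∀ i x, (∀ y, f (x ⊗ₜ y) = 0) → a i x = 0) ∧
        ∀ x y, f (x ⊗ₜ y) = ∑ i, a i x * (b i).1 y := by
  have := h.finite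
  let g : X.M →ₗ[ℤ] Y.cocycles := (TensorProduct.curry f).codRestrict Y.cocycles (h.curry_mem hf)
  have : Module.IsTorsionFree ℤ Y.cocycles := inferInstance
  obtain ⟨n, a, b, h1, h2⟩ := g.exists_eq_sum_smul
  refine ⟨n, a, b, fun i x hx => h1 i x (Subtype.ext (LinearMap.ext hx)), fun x y => ?_⟩
  have h3 := LinearMap.congr_fun (congrArg Subtype.val (h2 x)) y
  refine h3.trans ?_
  rw [Submodule.coe_sum, LinearMap.sum_apply]
  rfl

theorem diagProj₀_deg (h : CrossOK X Y π ρ) :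
    GrData.IsDeg (X.G.prod Y.G) (X.G.prod Y.G) (diagProj₀ X Y π ρ) 0 :=
  GrData.IsDeg.sum fun s _ => by
    have h1 := (GrData.IsDeg.of_zero (h.π_chain s).deg).tmap (GrData.IsDeg.of_zero (h.ρ_chain s).deg)
    rw [add_zero] at h1
    exact h1

theorem comp_diagProj₀_mem (h : CrossOK X Y π ρ) {f : Module.Dual ℤ (X.M ⊗[ℤ] Y.M)}
    (hf : f ∈ (diag X Y π ρ).gdual) :
    (f ∘ₗ diagProj₀ X Y π ρ : Module.Dual ℤ (X.M ⊗[ℤ] Y.M)) ∈ (diag X Y π ρ).gdual := by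
  obtain ⟨F, hF⟩ := hf
  exact ⟨F, fun n hn z hz => hF n hn _ (h.diagProj₀_deg.zero_mem hz)⟩

theorem diagProj₀_eq (h : CrossOK X Y π ρ) {z : X.M ⊗[ℤ] Y.M} (hz : z ∈ (diag X Y π ρ).N) :
    diagProj₀ X Y π ρ z = z := by
  refine diag_N_eqOn (f := diagProj₀ X Y π ρ) (g := LinearMap.id) (fun s x _ y hs hs' => ?_) hz
  rw [diagProj₀, LinearMap.sum_apply, Finset.sum_eq_single s, TensorProduct.map_tmul, hs, hs']
  · rfl
  · intro t _ ht
    rw [TensorProduct.map_tmul, ← hs, h.π_orth t s ht, TensorProduct.zero_tmul]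
  · exact fun hs => absurd (Finset.mem_univ _) hs

theorem diag_d_mem (h : CrossOK X Y π ρ) {z : X.M ⊗[ℤ] Y.M} (hz : z ∈ (diag X Y π ρ).N) :
    tensorD X.G X.d Y.d z ∈ (diag X Y π ρ).N := by
  have h1 : (diag X Y π ρ).N ≤ (diag X Y π ρ).N.comap (tensorD X.G X.d Y.d) := by
    refine Submodule.span_le.2 ?_
    rintro _ ⟨s, x, hx, y, hy, hs, hs', rfl⟩
    have h2 : tensorD X.G X.d Y.d (x ⊗ₜ[ℤ] y) = X.d x ⊗ₜ y := by simp [tensorD, h.d_eq]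
    refine Eq.mpr (congrArg (· ∈ (diag X Y π ρ).N) h2) (tmul_mem_diag (s := s) (h.d_mem x hx) hy ?_ hs')
    rw [(h.π_chain s).comm x hx, hs]
  exact h1 hz

/-- Evaluation of a functional on `diagProj₀ (d x ⊗ y)`. -/
theorem diagProj₀_d_tmul (h : CrossOK X Y π ρ) {x : X.M} (hx : x ∈ X.N) (y : Y.M) :
    diagProj₀ X Y π ρ (X.d x ⊗ₜ y) = tensorD X.G X.d Y.d (diagProj₀ X Y π ρ (x ⊗ₜ y)) := by
  simp only [diagProj₀, LinearMap.sum_apply, map_sum, TensorProduct.map_tmul]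
  refine Finset.sum_congr rfl fun s _ => ?_
  rw [(h.π_chain s).comm x hx]
  simp [tensorD, h.d_eq]

theorem diagProj₀_mem (h : CrossOK X Y π ρ) {x : X.M} (hx : x ∈ X.N) (y : Y.M) :
    diagProj₀ X Y π ρ (x ⊗ₜ y) ∈ (diag X Y π ρ).N := by
  rw [diagProj₀, LinearMap.sum_apply]
  exact Submodule.sum_mem (diag X Y π ρ).N fun s _ => tmul_mem_diag (s := s)
    ((h.π_chain s).sub x hx) (h.N_eq ▸ Submodule.mem_top) (h.π_idem s x) (h.ρ_idem s y)

/-- Composition with the projection to the diagonal changes `f` only off the diagonal. The resulting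
functional is a finite sum of products, and its first factors are cocycles because `f` kills
boundaries of the diagonal complex. -/
theorem exists_cross_eq (h : CrossOK X Y π ρ) (f : Module.Dual ℤ (X.M ⊗[ℤ] Y.M))
    (hf : f ∈ (diag X Y π ρ).cocycles) : ∃ z, (diag X Y π ρ).Rep f (h.cross z) := by
  obtain ⟨n, a, b, h1, h2⟩ := h.exists_eq_sum (h.comp_diagProj₀_mem hf.1)
  have ha : ∀ i, a i ∈ X.cocycles := fun i => by
    refine ⟨h.gdual _, fun x hx => h1 i _ fun y => ?_⟩
    rw [LinearMap.comp_apply, h.diagProj₀_d_tmul hx]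
    exact hf.2 _ (h.diagProj₀_mem hx y)
  let u : X.cocycles ⊗[ℤ] Y.cocycles := ∑ i, (⟨a i, ha i⟩ : X.cocycles) ⊗ₜ b i
  refine ⟨TensorProduct.map X.cls Y.cls u, (h.rep_cross u).congr hf.1 (fun z hz => ?_) fun z hz =>
    h.diag_d_mem hz⟩
  have h3 : TensorProduct.dualDistrib ℤ X.M Y.M
      (TensorProduct.map X.cocycles.subtype Y.cocycles.subtype u) = f ∘ₗ diagProj₀ X Y π ρ := by
    refine TensorProduct.ext' fun x y => ?_
    rw [h2]
    simp [u, TensorProduct.map_tmul]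
  exact (Eq.trans (LinearMap.congr_fun h3 z) (congrArg f (h.diagProj₀_eq hz))).symm

theorem cross_surjective (h : CrossOK X Y π ρ) : Function.Surjective h.cross := by
  intro c
  obtain ⟨⟨f, hf⟩, rfl⟩ := cls_surjective _ c
  obtain ⟨z, hz⟩ := h.exists_cross_eq f hf
  exact ⟨z, hz.unique ⟨hf, rfl⟩⟩

variable (hX : IndexedOK X π) (hY : IndexedOK Y ρ)

/-- `diagProj` on the level of cocycles. -/
def diagCocycles (hX : IndexedOK X π) (hY : IndexedOK Y ρ) :
    X.cocycles ⊗[ℤ] Y.cocycles →ₗ[ℤ] X.cocycles ⊗[ℤ] Y.cocycles :=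
  ∑ s, TensorProduct.map ((LinearMap.lcomp ℤ ℤ (π s)).restrict (hX.idx s).cocycle)
    ((LinearMap.lcomp ℤ ℤ (ρ s)).restrict (hY.idx s).cocycle)

theorem map_cls_diagCocycles (u : X.cocycles ⊗[ℤ] Y.cocycles) :
    TensorProduct.map X.cls Y.cls (diagCocycles hX hY u) =
      diagProj hX hY (TensorProduct.map X.cls Y.cls u) := by
  induction u with
  | zero => simp only [map_zero]
  | add u v hu hv => simp only [map_add, hu, hv]
  | tmul a b =>
    simp only [diagCocycles, diagProj, LinearMap.sum_apply, map_sum, TensorProduct.map_tmul]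
    rfl

theorem dualDistrib_diagCocycles (u : X.cocycles ⊗[ℤ] Y.cocycles) :
    TensorProduct.dualDistrib ℤ X.M Y.M (TensorProduct.map X.cocycles.subtype Y.cocycles.subtype
      (diagCocycles hX hY u)) = TensorProduct.dualDistrib ℤ X.M Y.M
        (TensorProduct.map X.cocycles.subtype Y.cocycles.subtype u) ∘ₗ diagProj₀ X Y π ρ := by
  induction u with
  | zero => simp only [map_zero, LinearMap.zero_comp]
  | add u v hu hv => simp only [map_add, hu, hv, LinearMap.add_comp]
  | tmul a b =>
    refine TensorProduct.ext' fun x y => ?_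
    simp only [diagCocycles, diagProj₀, LinearMap.sum_apply, map_sum, TensorProduct.map_tmul,
      LinearMap.comp_apply, TensorProduct.dualDistrib_apply]
    rfl

theorem diagProj_diagProj (h : CrossOK X Y π ρ) (z : X.Coh ⊗[ℤ] Y.Coh) :
    diagProj hX hY (diagProj hX hY z) = diagProj hX hY z := by
  induction z with
  | zero => simp only [map_zero]
  | add u v hu hv => simp only [map_add, hu, hv]
  | tmul a b =>
    obtain ⟨a, rfl⟩ := cls_surjective _ a
    obtain ⟨b, rfl⟩ := cls_surjective _ b
    simp only [diagProj, LinearMap.sum_apply, map_sum, TensorProduct.map_tmul]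
    refine Finset.sum_congr rfl fun s _ => ?_
    rw [Finset.sum_eq_single s]
    · have h1 : pull (hX.idx s) (pull (hX.idx s) (X.cls a)) = pull (hX.idx s) (X.cls a) :=
        congrArg X.cls (Subtype.ext (LinearMap.ext fun x => congrArg a.1 (h.π_idem s x)))
      have h2 : pull (hY.idx s) (pull (hY.idx s) (Y.cls b)) = pull (hY.idx s) (Y.cls b) :=
        congrArg Y.cls (Subtype.ext (LinearMap.ext fun x => congrArg b.1 (h.ρ_idem s x)))
      rw [h1, h2]
    · intro t _ ht
      have h0 : ∀ s t, s ≠ t → pull (hX.idx s) (pull (hX.idx t) (X.cls a)) = 0 := fun s t hst => by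
        rw [pull_cls, pull_cls, ← map_zero X.cls]
        refine congrArg _ (Subtype.ext (LinearMap.ext fun x => ?_))
        refine (congrArg a.1 (h.π_orth t s hst.symm x)).trans ?_
        rw [map_zero]
        rfl
      first
      | rw [h0 s t ht.symm, TensorProduct.zero_tmul]
      | rw [h0 t s ht, TensorProduct.zero_tmul]
    · exact fun hs => absurd (Finset.mem_univ _) hs

theorem cross_diagProj (h : CrossOK X Y π ρ) (z : X.Coh ⊗[ℤ] Y.Coh) :
    h.cross (diagProj hX hY z) = h.cross z := by
  obtain ⟨u, rfl⟩ := TensorProduct.map_surjective (cls_surjective X) (cls_surjective Y) z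
  have h1 := h.rep_cross (diagCocycles hX hY u)
  rw [map_cls_diagCocycles] at h1
  refine h1.unique ((h.rep_cross u).congr (h.dualDistrib_map_mem _).1 (fun z hz => ?_)
    fun z hz => h.diag_d_mem hz)
  exact (LinearMap.congr_fun (dualDistrib_diagCocycles hX hY u) z).trans
    (congrArg (TensorProduct.dualDistrib ℤ X.M Y.M _) (h.diagProj₀_eq hz))

/-- If the cross product is the coboundary of `g`, the diagonal part of `g` is a finite sum of
products `a i ⊗ b i`. As `Y` has no differential, the diagonal part of the given tensor agrees on
`N` with the sum of the `(a i ∘ d) ⊗ b i`, and each `a i ∘ d` is a coboundary. -/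
theorem diagProj_eq_zero (h : CrossOK X Y π ρ) (hd : ∀ x ∈ X.N, X.d (X.d x) = 0)
    {z : X.Coh ⊗[ℤ] Y.Coh} (hz : h.cross z = 0) : diagProj hX hY z = 0 := by
  obtain ⟨u, rfl⟩ := TensorProduct.map_surjective (cls_surjective X) (cls_surjective Y) z
  obtain ⟨hu, hu'⟩ := h.rep_cross u
  rw [hz] at hu'
  obtain ⟨-, g, hg, hug⟩ := cls_eq_zero.1 hu'
  obtain ⟨n, a, b, -, h2⟩ := h.exists_eq_sum (h.comp_diagProj₀_mem hg)
  have ha : ∀ i, a i ∘ₗ X.d ∈ X.cocycles := fun i =>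
    ⟨h.gdual _, fun x hx => by rw [LinearMap.comp_apply, hd x hx, map_zero]⟩
  have ha' : ∀ i, X.cls ⟨_, ha i⟩ = 0 := fun i =>
    cls_eq_zero.2 ⟨h.gdual _, a i, h.gdual _, fun x _ => rfl⟩
  have h3 := h.map_cls_eq_zero (diagCocycles hX hY u -
    ∑ i, (⟨_, ha i⟩ : X.cocycles) ⊗ₜ[ℤ] b i) fun x hx y => ?_
  · rw [map_sub, map_sum, map_cls_diagCocycles] at h3
    have h4 : ∑ i, TensorProduct.map X.cls Y.cls ((⟨_, ha i⟩ : X.cocycles) ⊗ₜ[ℤ] b i) = 0 :=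
      Finset.sum_eq_zero fun i _ => by rw [TensorProduct.map_tmul, ha', TensorProduct.zero_tmul]
    rw [h4, sub_zero] at h3
    exact h3
  · rw [map_sub, map_sub, LinearMap.sub_apply, dualDistrib_diagCocycles, LinearMap.comp_apply,
      sub_eq_zero]
    refine (hug _ (h.diagProj₀_mem hx y)).trans ?_
    refine (congrArg g (h.diagProj₀_d_tmul hx y).symm).trans ?_
    refine (h2 (X.d x) y).trans ?_
    simp [TensorProduct.map_tmul]

/-- The cross product restricts to an isomorphism from the diagonal tensor product of the
cohomology groups to the cohomology of the diagonal tensor product. -/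
def crossEquiv (h : CrossOK X Y π ρ) (hd : ∀ x ∈ X.N, X.d (X.d x) = 0) :
    DiagTensor hX hY ≃ₗ[ℤ] (diag X Y π ρ).Coh :=
  LinearEquiv.ofBijective (h.cross ∘ₗ (DiagTensor hX hY).subtype) (by
    constructor
    · rw [injective_iff_map_eq_zero]
      rintro ⟨_, z, rfl⟩ hz
      refine Subtype.ext ?_
      exact (h.diagProj_diagProj hX hY z).symm.trans (h.diagProj_eq_zero hX hY hd hz)
    · intro c
      obtain ⟨z, rfl⟩ := h.cross_surjective c
      exact ⟨(diagProj hX hY).rangeRestrict z, h.cross_diagProj hX hY z⟩)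

theorem crossEquiv_apply (h : CrossOK X Y π ρ) (hd : ∀ x ∈ X.N, X.d (X.d x) = 0)
    (z : DiagTensor hX hY) : h.crossEquiv hX hY hd z = h.cross z.1 := rfl

theorem crossEquiv_rangeRestrict (h : CrossOK X Y π ρ) (hd : ∀ x ∈ X.N, X.d (X.d x) = 0)
    (z : X.Coh ⊗[ℤ] Y.Coh) :
    h.crossEquiv hX hY hd ((diagProj hX hY).rangeRestrict z) = h.cross z :=
  h.cross_diagProj hX hY z

end CrossOK

end Kunneth

end CoalgData

/-! ### Multiplicativity of the cross product -/

theorem GrData.interchange_tmul_eq_sum {M : Type u} {N : Type v} [AddCommGroup M] [Module ℤ M]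
    [AddCommGroup N] [Module ℤ N] {G : GrData M} {H : GrData N} (x x' : M) (y y' : N) :
    interchange G H ((x ⊗ₜ x') ⊗ₜ (y ⊗ₜ y')) = ∑ e : ZMod 2, ∑ e' : ZMod 2, sg (e * e') •
      ((x ⊗ₜ[ℤ] H.par e' y) ⊗ₜ[ℤ] (G.par e x' ⊗ₜ[ℤ] y')) := by
  simp only [interchange, LinearMap.sum_apply]
  simp

/-- Dualizing moves the parity projections from the elements to the functionals `a'` and `b`, so the
sign of the interchange becomes the sign `(-1)^{|b| |a'|}` of the product. -/
theorem GrData.dualDistrib_interchange {M : Type u} {N : Type v} [AddCommGroup M] [Module ℤ M]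
    [AddCommGroup N] [Module ℤ N] {G : GrData M} {H : GrData N} (a a' : Module.Dual ℤ M)
    (b b' : Module.Dual ℤ N) (u : M ⊗[ℤ] M) (v : N ⊗[ℤ] N) :
    TensorProduct.dualDistrib ℤ (M ⊗[ℤ] N) (M ⊗[ℤ] N)
      (TensorProduct.dualDistrib ℤ M N (a ⊗ₜ b) ⊗ₜ TensorProduct.dualDistrib ℤ M N (a' ⊗ₜ b'))
        (interchange G H (u ⊗ₜ v)) =
      ∑ e : ZMod 2, ∑ e' : ZMod 2, sg (e * e') *
        (TensorProduct.dualDistrib ℤ M M (a ⊗ₜ[ℤ] (a' ∘ₗ G.par e')) u *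
          TensorProduct.dualDistrib ℤ N N ((b ∘ₗ H.par e) ⊗ₜ[ℤ] b') v) := by
  induction u with
  | zero => simp
  | add u u' hu hu' =>
    simp only [TensorProduct.add_tmul, map_add, hu, hu', add_mul, mul_add, Finset.sum_add_distrib]
  | tmul x x' =>
    induction v with
    | zero => simp
    | add v v' hv hv' =>
      simp only [TensorProduct.tmul_add, map_add, hv, hv', mul_add, Finset.sum_add_distrib]
    | tmul y y' =>
      rw [Finset.sum_comm, interchange_tmul_eq_sum]
      simp only [map_sum, map_smul]
      refine Finset.sum_congr rfl fun e _ => Finset.sum_congr rfl fun e' _ => ?_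
      simp only [TensorProduct.dualDistrib_apply, LinearMap.comp_apply, smul_eq_mul, mul_comm e' e]
      ring

namespace CoalgData

section CrossMul

variable {I : Type w} [Fintype I] {X : CoalgData.{u}} {Y : CoalgData.{v}} {π : I → X.M →ₗ[ℤ] X.M}
  {ρ : I → Y.M →ₗ[ℤ] Y.M}

/-- The product of the cochains `a ⊗ b` and `a' ⊗ b'` of the tensor product of `X` and `Y`. -/
def tensorCup (X : CoalgData.{u}) (Y : CoalgData.{v}) (a a' : Module.Dual ℤ X.M)
    (b b' : Module.Dual ℤ Y.M) : Module.Dual ℤ (X.M ⊗[ℤ] Y.M) :=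
  ∑ e : ZMod 2, ∑ e' : ZMod 2, sg (e * e') • TensorProduct.dualDistrib ℤ X.M Y.M
    (X.cup a (a' ∘ₗ X.G.par e') ⊗ₜ[ℤ] Y.cup (b ∘ₗ Y.G.par e) b')

/-- The two formulas differ only in the integer action through which the sign operates. -/
theorem shuffle₂_eq (X : CoalgData.{u}) (Y : CoalgData.{v}) :
    shuffle₂ X Y = GrData.interchange X.G Y.G := by
  unfold shuffle₂ GrData.interchange
  refine Finset.sum_congr rfl fun e _ => Finset.sum_congr rfl fun e' _ => ?_
  exact (Int.cast_smul_eq_zsmul ℤ _ _).symm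

theorem tensorCup_tmul (a a' : Module.Dual ℤ X.M) (b b' : Module.Dual ℤ Y.M) (x : X.M) (y : Y.M) :
    tensorCup X Y a a' b b' (x ⊗ₜ y) = TensorProduct.dualDistrib ℤ (X.M ⊗[ℤ] Y.M) (X.M ⊗[ℤ] Y.M)
      (TensorProduct.dualDistrib ℤ X.M Y.M (a ⊗ₜ b) ⊗ₜ TensorProduct.dualDistrib ℤ X.M Y.M (a' ⊗ₜ b'))
        (shuffle₂ X Y (X.Ψ x ⊗ₜ Y.Ψ y)) := by
  rw [shuffle₂_eq]
  refine Eq.trans ?_ (GrData.dualDistrib_interchange (G := X.G) (H := Y.G) a a' b b' (X.Ψ x)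
    (Y.Ψ y)).symm
  simp only [tensorCup, LinearMap.sum_apply, LinearMap.smul_apply, TensorProduct.dualDistrib_apply,
    cup_apply, smul_eq_mul]

theorem dualDistrib_map_diagProj₀ (f g : Module.Dual ℤ (X.M ⊗[ℤ] Y.M))
    (z : (X.M ⊗[ℤ] Y.M) ⊗[ℤ] (X.M ⊗[ℤ] Y.M)) :
    TensorProduct.dualDistrib ℤ (X.M ⊗[ℤ] Y.M) (X.M ⊗[ℤ] Y.M) (f ⊗ₜ[ℤ] g)
      (TensorProduct.map (diagProj₀ X Y π ρ) (diagProj₀ X Y π ρ) z) =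
    TensorProduct.dualDistrib ℤ (X.M ⊗[ℤ] Y.M) (X.M ⊗[ℤ] Y.M)
      ((f ∘ₗ diagProj₀ X Y π ρ) ⊗ₜ[ℤ] (g ∘ₗ diagProj₀ X Y π ρ)) z := by
  induction z with
  | zero => rw [map_zero, map_zero, map_zero]
  | add u v hu hv => rw [map_add, map_add, map_add, hu, hv]
  | tmul x y => rfl

theorem dualDistrib_comp_diagProj₀ (a : Module.Dual ℤ X.M) (b : Module.Dual ℤ Y.M) :
    TensorProduct.dualDistrib ℤ X.M Y.M (a ⊗ₜ[ℤ] b) ∘ₗ diagProj₀ X Y π ρ =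
      ∑ s, TensorProduct.dualDistrib ℤ X.M Y.M ((a ∘ₗ π s) ⊗ₜ[ℤ] (b ∘ₗ ρ s)) := by
  refine TensorProduct.ext' fun x y => ?_
  simp [diagProj₀, LinearMap.sum_apply]

theorem cup_diag (a a' : Module.Dual ℤ X.M) (b b' : Module.Dual ℤ Y.M) :
    (diag X Y π ρ).cup (TensorProduct.dualDistrib ℤ X.M Y.M (a ⊗ₜ[ℤ] b))
      (TensorProduct.dualDistrib ℤ X.M Y.M (a' ⊗ₜ[ℤ] b')) =
      ∑ s, ∑ t, tensorCup X Y (a ∘ₗ π s) (a' ∘ₗ π t) (b ∘ₗ ρ s) (b' ∘ₗ ρ t) := by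
  refine TensorProduct.ext' fun x y => ?_
  refine (dualDistrib_map_diagProj₀ (π := π) (ρ := ρ) _ _
    (shuffle₂ X Y (X.Ψ x ⊗ₜ Y.Ψ y))).trans ?_
  rw [dualDistrib_comp_diagProj₀, dualDistrib_comp_diagProj₀, TensorProduct.sum_tmul]
  simp only [TensorProduct.tmul_sum, map_sum, LinearMap.sum_apply, tensorCup_tmul]

namespace CrossOK

variable (hX : IndexedOK X π) (hY : IndexedOK Y ρ)

theorem tensorMul_cls (a a' : X.cocycles) (b b' : Y.cocycles) :
    tensorMul hX hY (X.cls a ⊗ₜ Y.cls b) (X.cls a' ⊗ₜ Y.cls b') =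
      ∑ e : ZMod 2, ∑ e' : ZMod 2, sg (e * e') •
        (X.cls ⟨_, hX.mul.mul_mem _ a.2 _ ((hX.par e').cocycle _ a'.2)⟩ ⊗ₜ[ℤ]
          Y.cls ⟨_, hY.mul.mul_mem _ ((hY.par e).cocycle _ b.2) _ b'.2⟩) := by
  simp only [tensorMul, LinearMap.sum_apply]
  rfl

theorem rep_cross_tmul (h : CrossOK X Y π ρ) (a : X.cocycles) (b : Y.cocycles) :
    (diag X Y π ρ).Rep (TensorProduct.dualDistrib ℤ X.M Y.M (a.1 ⊗ₜ[ℤ] b.1))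
      (h.cross (X.cls a ⊗ₜ Y.cls b)) :=
  ⟨_, h.cross_cls a b⟩

theorem rep_tensorMul (h : CrossOK X Y π ρ) (a a' : X.cocycles) (b b' : Y.cocycles) :
    (diag X Y π ρ).Rep (tensorCup X Y a.1 a'.1 b.1 b'.1)
      (h.cross (tensorMul hX hY (X.cls a ⊗ₜ Y.cls b) (X.cls a' ⊗ₜ Y.cls b'))) := by
  rw [tensorMul_cls, map_sum]
  simp only [map_sum, map_smul]
  exact Rep.sum fun e _ => Rep.sum fun e' _ => Rep.smul _ (h.rep_cross_tmul
    ⟨_, hX.mul.mul_mem _ a.2 _ ((hX.par e').cocycle _ a'.2)⟩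
    ⟨_, hY.mul.mul_mem _ ((hY.par e).cocycle _ b.2) _ b'.2⟩)

/-- The coproduct of the diagonal complex projects both cofactors to the diagonal. Dually, both
arguments of the product are replaced by their diagonal parts, and the claim reduces to single
tensors of cocycles. -/
theorem cross_tensorMul (h : CrossOK X Y π ρ) (hD : (diag X Y π ρ).MulOK) (z z' : X.Coh ⊗[ℤ] Y.Coh) :
    h.cross (tensorMul hX hY (diagProj hX hY z) (diagProj hX hY z')) =
      (diag X Y π ρ).mul hD (h.cross z) (h.cross z') := by
  induction z with
  | zero => simp only [map_zero, LinearMap.zero_apply]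
  | add u v hu hv => simp only [map_add, LinearMap.add_apply, hu, hv]
  | tmul a b =>
    induction z' with
    | zero => simp only [map_zero]
    | add u v hu hv => simp only [map_add, hu, hv]
    | tmul a' b' =>
      obtain ⟨a, rfl⟩ := cls_surjective _ a
      obtain ⟨b, rfl⟩ := cls_surjective _ b
      obtain ⟨a', rfl⟩ := cls_surjective _ a'
      obtain ⟨b', rfl⟩ := cls_surjective _ b'
      rw [cross_cls, cross_cls, mul_cls]
      have h1 : ∀ (a : X.cocycles) (b : Y.cocycles), diagProj hX hY (X.cls a ⊗ₜ Y.cls b) =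
          ∑ s, X.cls ⟨a.1 ∘ₗ π s, (hX.idx s).cocycle _ a.2⟩ ⊗ₜ[ℤ]
            Y.cls ⟨b.1 ∘ₗ ρ s, (hY.idx s).cocycle _ b.2⟩ := fun a b => by
        simp only [diagProj, LinearMap.sum_apply, TensorProduct.map_tmul, pull_cls]
      rw [h1, h1]
      simp only [map_sum, LinearMap.sum_apply]
      rw [Finset.sum_comm]
      have h2 : (diag X Y π ρ).Rep _ _ := Rep.sum fun s (_ : s ∈ Finset.univ) =>
        Rep.sum fun t (_ : t ∈ Finset.univ) =>
          h.rep_tensorMul hX hY ⟨a.1 ∘ₗ π s, (hX.idx s).cocycle _ a.2⟩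
            ⟨a'.1 ∘ₗ π t, (hX.idx t).cocycle _ a'.2⟩ ⟨b.1 ∘ₗ ρ s, (hY.idx s).cocycle _ b.2⟩
            ⟨b'.1 ∘ₗ ρ t, (hY.idx t).cocycle _ b'.2⟩
      refine h2.unique ⟨?_, ?_⟩
      · exact (congrArg (· ∈ (diag X Y π ρ).cocycles) (cup_diag a.1 a'.1 b.1 b'.1)).mp
          (hD.mul_mem _ (h.dualDistrib_mem a.2 b.2) _ (h.dualDistrib_mem a'.2 b'.2))
      · exact congrArg _ (Subtype.ext (cup_diag _ _ _ _).symm)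

theorem crossEquiv_diagMul (h : CrossOK X Y π ρ) (hd : ∀ x ∈ X.N, X.d (X.d x) = 0)
    (hD : (diag X Y π ρ).MulOK) (z z' : DiagTensor hX hY) :
    h.crossEquiv hX hY hd (diagMul hX hY z z') =
      (diag X Y π ρ).mul hD (h.crossEquiv hX hY hd z) (h.crossEquiv hX hY hd z') := by
  obtain ⟨_, z, rfl⟩ := z
  obtain ⟨_, z', rfl⟩ := z'
  refine (h.crossEquiv_rangeRestrict hX hY hd _).trans ((h.cross_tensorMul hX hY hD z z').trans ?_)
  rw [crossEquiv_apply, crossEquiv_apply]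
  exact congrArg₂ (fun u v => (diag X Y π ρ).mul hD u v) (h.cross_diagProj hX hY z).symm
    (h.cross_diagProj hX hY z').symm

end CrossOK

end CrossMul

end CoalgData

/-! ### The cohomology algebra of the diagonal tensor product of `T(K)` and `H(θ)` -/

section SquareZero

variable {m : ℕ} {A : Fin m → Type u} [∀ k, AddCommGroup (A k)] [∀ k, Module ℤ (A k)]
  {GA : ∀ k, GrData (A k)} {d : ∀ k, A k →ₗ[ℤ] A k}

/-- Terms with two different positions cancel in pairs under the swap, because the sign involution
anticommutes with the differential; terms with equal positions contain `d ∘ d`. -/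
theorem piD_piD (hs : ∀ k, (GA k).sgn ∘ₗ d k = -(d k ∘ₗ (GA k).sgn)) (hd : ∀ k, d k ∘ₗ d k = 0) :
    piD GA d ∘ₗ piD GA d = 0 := by
  let f : Fin m → ∀ i, A i →ₗ[ℤ] A i :=
    fun k i => if i < k then (GA i).sgn else if i = k then d i else LinearMap.id
  have h0 : ∀ g : ∀ i, A i →ₗ[ℤ] A i, ∀ k, g k = 0 → PiTensorProduct.map g = 0 :=
    fun g k hg => (PiTensorProduct.mapMultilinear ℤ A A).map_coord_zero k hg
  have hlt : ∀ k l, k < l → PiTensorProduct.map (fun i => f k i ∘ₗ f l i) +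
      PiTensorProduct.map (fun i => f l i ∘ₗ f k i) = 0 := fun k l hkl => by
    have h1 : (fun i => f l i ∘ₗ f k i) =
        Function.update (fun i => f k i ∘ₗ f l i) k ((-1 : ℤ) • (f k k ∘ₗ f l k)) := by
      funext i
      rcases lt_trichotomy i k with hi | rfl | hi
      · rw [Function.update_of_ne hi.ne]
        simp only [f, if_pos hi, if_pos (hi.trans hkl)]
      · rw [Function.update_self]
        simp only [f, if_pos hkl, lt_irrefl, if_false, if_true, hs, neg_one_smul]
      · rw [Function.update_of_ne hi.ne']
        simp only [f, if_neg hi.not_gt, if_neg hi.ne', LinearMap.id_comp, LinearMap.comp_id]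
    have h2 := (PiTensorProduct.mapMultilinear ℤ A A).map_update_smul
      (fun i => f k i ∘ₗ f l i) k (-1 : ℤ) (f k k ∘ₗ f l k)
    rw [Function.update_eq_self k (fun i => f k i ∘ₗ f l i)] at h2
    rw [h1]
    refine (congrArg (PiTensorProduct.map (fun i => f k i ∘ₗ f l i) + ·) h2).trans ?_
    rw [neg_one_smul]
    exact add_neg_cancel _
  have hall : ∀ k l, PiTensorProduct.map (fun i => f k i ∘ₗ f l i) +
      PiTensorProduct.map (fun i => f l i ∘ₗ f k i) = 0 := fun k l => by
    rcases lt_trichotomy k l with h | rfl | h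
    · exact hlt k l h
    · rw [h0 (fun i => f k i ∘ₗ f k i) k (by simp only [f, lt_irrefl, if_false, if_true, hd]),
        add_zero]
    · rw [add_comm]
      exact hlt l k h
  have h1 : piD GA d ∘ₗ piD GA d =
      ∑ p : Fin m × Fin m, PiTensorProduct.map (fun i => f p.1 i ∘ₗ f p.2 i) := by
    rw [piD, LinearMap.sum_comp_eq, Fintype.sum_prod_type]
    refine Finset.sum_congr rfl fun k _ => ?_
    rw [LinearMap.comp_sum_eq]
    exact Finset.sum_congr rfl fun l _ => (PiTensorProduct.map_comp _ _).symm
  rw [h1]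
  refine Finset.sum_involution (fun p _ => p.swap) (fun p _ => hall p.1 p.2) (fun p _ hp h => hp ?_)
    (fun _ _ => Finset.mem_univ _) fun p _ => p.swap_swap
  have h2 : p.2 = p.1 := congrArg Prod.fst h
  refine h0 _ p.1 ?_
  rw [h2]
  simp only [f, lt_irrefl, if_false, if_true, hd]

end SquareZero

/-! ### Finiteness and index projections of the total complex. -/

section Main

variable {m : ℕ} (K : LowerSet (Finset (Fin m))) {E : Fin m → SplitCoalgInclusion.{u}} {S : Kind}
  (χ : ∀ k, CharData (E k) S)

theorem dT_dT : dT S ∘ₗ dT S = 0 := TCx.ext_gen fun l => by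
  rw [LinearMap.comp_apply, dT_gen]
  split_ifs
  · rw [dT_gen, if_neg (by simp)]
    rfl
  · rw [map_zero]
    rfl

theorem totalCx_d_d (x : (totalCx K χ).M) : (totalCx K χ).d ((totalCx K χ).d x) = 0 :=
  LinearMap.congr_fun (piD_piD (fun _ => dT_deg.sgn_anticomm GT_lawful GT_lawful (by decide))
    fun _ => dT_dT) x

theorem GT_gr_eq_zero {n : ℤ} (hn : n ∉ Finset.Icc 0 1) {x : TCx S} (hx : x ∈ (GT S).gr n) :
    x = 0 := by
  have h : (GT S).gr n ≤ ⊥ := by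
    refine Submodule.span_le.2 ?_
    rintro _ ⟨l, rfl, x, rfl⟩
    refine absurd ?_ hn
    cases l <;> simp [Letter.deg]
  exact (Submodule.mem_bot ℤ).1 (h hx)

/-- `T` lives in degrees 0 and 1, so its `m`-fold tensor power lives in degrees 0 to `m`, and the
finiteness condition on functionals is automatic. -/
theorem mem_gdual_totalCx (f : Module.Dual ℤ (totalCx K χ).M) : f ∈ (totalCx K χ).gdual := by
  refine ⟨Finset.Icc 0 (m : ℤ), fun n hn x hx => ?_⟩
  have h : (GrData.pi fun _ : Fin m => GT S).gr n ≤ LinearMap.ker f := by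
    refine GrData.pi_gr_le fun a ha x hx => ?_
    by_cases h : ∀ k, a k ∈ Finset.Icc 0 1
    · refine absurd (Finset.mem_Icc.2 ?_) hn
      rw [← ha]
      refine ⟨Finset.sum_nonneg fun k _ => (Finset.mem_Icc.1 (h k)).1, ?_⟩
      have := Finset.sum_le_sum fun k (_ : k ∈ Finset.univ) => (Finset.mem_Icc.1 (h k)).2
      simpa using this
    · obtain ⟨k, hk⟩ := not_forall.1 h
      have h1 : PiTensorProduct.tprod ℤ x = 0 :=
        MultilinearMap.map_coord_zero _ k (GT_gr_eq_zero hk (hx k))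
      rw [h1]
      exact Submodule.zero_mem _
  exact h hx

theorem crossOK : CoalgData.CrossOK (totalCx K χ) (charCoalg χ) (totalIdx K χ) (charIdx χ) where
  lawful := (totalCx_isDGC K χ).lawful
  gdual := mem_gdual_totalCx K χ
  finite := inferInstanceAs (Module.Finite ℤ (⨂[ℤ] _ : Fin m, TCx S))
  free := Module.Free.of_basis (Basis.piTensorProduct fun _ : Fin m =>
    Module.Free.chooseBasis ℤ (TCx S))
  d_mem := (totalCx_isDGC K χ).d_mem
  π_chain := totalIdx_isChainMap K χ
  ρ_chain := charIdx_isChainMap χ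
  π_idem s x := by
    have h : PiTensorProduct.map (fun k => prT S (s k)) ∘ₗ PiTensorProduct.map (fun k => prT S (s k)) =
        PiTensorProduct.map (fun k => prT S (s k)) := by
      rw [← PiTensorProduct.map_comp]
      exact congrArg _ (funext fun k => TCx.ext_gen fun l => by
        rw [LinearMap.comp_apply, prT_gen]; split_ifs with h <;> simp [prT_gen, h])
    exact LinearMap.congr_fun h x
  ρ_idem s x := by
    have h : PiTensorProduct.map (fun k => prH (E k).toChainInclusion S (s k)) ∘ₗ
        PiTensorProduct.map (fun k => prH (E k).toChainInclusion S (s k)) =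
        PiTensorProduct.map (fun k => prH (E k).toChainInclusion S (s k)) := by
      rw [← PiTensorProduct.map_comp]
      refine congrArg _ (funext fun k => LinearMap.ext_on span_inH ?_)
      rintro _ ⟨s', n, x, rfl⟩
      rw [LinearMap.comp_apply, prH_inH]
      split_ifs with h
      · rw [prH_inH, if_pos h]
      · rw [map_zero]
    exact LinearMap.congr_fun h x
  π_orth s t hst x := by
    obtain ⟨k, hk⟩ := Function.ne_iff.1 hst
    have h : PiTensorProduct.map (fun k => prT S (s k)) ∘ₗ PiTensorProduct.map (fun k => prT S (t k)) =
        0 := by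
      rw [← PiTensorProduct.map_comp]
      refine (PiTensorProduct.mapMultilinear ℤ (fun _ : Fin m => TCx S)
        (fun _ => TCx S)).map_coord_zero k (TCx.ext_gen fun l => ?_)
      rw [LinearMap.comp_apply, prT_gen]
      split_ifs with h
      · rw [prT_gen, if_neg (by rw [h]; exact hk.symm)]
        rfl
      · rw [map_zero]
        rfl
    exact LinearMap.congr_fun h x
  d_eq := rfl
  N_eq := rfl

end Main

end

theorem theorem4p7 (m : ℕ) (K : LowerSet (Finset (Fin m)))
    (E : Fin m → SplitCoalgInclusion.{u}) (S : Kind)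
    (hS : S = Kind.R → ∀ k n, Function.Surjective ((E k).θ n)) :
    (∀ k, Nonempty (CharData (E k) S)) ∧
    ∀ χ : ∀ k, CharData (E k) S,
      ∃ (h₁ : CoalgData.IsChainMap (inclCx K E) (charCx K χ) (φincl K χ))
        (h₂ : CoalgData.IsChainMap (charCx K χ) (diagCx K χ) (φchar K χ))
        (m₁ : (inclCx K E).MulOK) (m₂ : (charCx K χ).MulOK) (m₃ : (diagCx K χ).MulOK)
        (hT : CoalgData.IndexedOK (totalCx K χ) (totalIdx K χ))
        (hH : CoalgData.IndexedOK (charCoalg χ) (charIdx χ)),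
        CoalgData.InducesAlgIso h₁ m₁ m₂ ∧
        CoalgData.InducesAlgIso h₂ m₂ m₃ ∧
        ∃ Φ : CoalgData.DiagTensor hT hH ≃ₗ[ℤ] (inclCx K E).Coh,
          (∀ x y, Φ (CoalgData.diagMul hT hH x y) = (inclCx K E).mul m₁ (Φ x) (Φ y)) ∧
          ∀ (a : (totalCx K χ).cocycles) (b : (charCoalg χ).cocycles),
            ∃ hab : (TensorProduct.dualDistrib ℤ (totalCx K χ).M (charCoalg χ).M
                (a.1 ⊗ₜ[ℤ] b.1) : Module.Dual ℤ (diagCx K χ).M) ∈ (diagCx K χ).cocycles,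
              Φ ((CoalgData.diagProj hT hH).rangeRestrict
                  ((totalCx K χ).cls a ⊗ₜ[ℤ] (charCoalg χ).cls b)) =
                CoalgData.pull h₁.pullOK (CoalgData.pull h₂.pullOK
                  ((diagCx K χ).cls ⟨_, hab⟩)) := by
  refine ⟨fun k => CharData.nonempty (E k) S fun h n => hS h k n, fun χ => ?_⟩
  have h₁ := φincl_isChainMap K χ
  have h₂ := φchar_isChainMap K χ
  have m₁ := (inclCx_isDGC K E).mulOK
  have m₃ := (diagCx_isDGC K χ).mulOK
  have hT := totalCx_indexedOK K χ
  have hH := charCoalg_indexedOK χ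
  have i₁ : CoalgData.InducesAlgIso h₁ m₁ (charCx_isDGC K χ).mulOK :=
    ⟨φincl_bijective K χ hS, φincl_mul K χ⟩
  have i₂ : CoalgData.InducesAlgIso h₂ (charCx_isDGC K χ).mulOK m₃ :=
    ⟨φchar_bijective K χ, φchar_mul K χ⟩
  have hc := crossOK K χ
  have hd : ∀ x ∈ (totalCx K χ).N, (totalCx K χ).d ((totalCx K χ).d x) = 0 :=
    fun x _ => totalCx_d_d K χ x
  -- The isomorphism is the cross product followed by the two pullbacks, so its value on the
  -- diagonal part of `[a] ⊗ [b]` comes from the definition of the cross product.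
  refine ⟨h₁, h₂, m₁, _, m₃, hT, hH, i₁, i₂, (hc.crossEquiv hT hH hd).trans
    ((LinearEquiv.ofBijective _ i₂.1).trans (LinearEquiv.ofBijective _ i₁.1)), fun x y => ?_,
    fun a b => ⟨hc.dualDistrib_mem a.2 b.2, ?_⟩⟩
  · refine (congrArg (fun c => CoalgData.pull h₁.pullOK (CoalgData.pull h₂.pullOK c))
      (hc.crossEquiv_diagMul hT hH hd m₃ x y)).trans ?_
    exact (congrArg (CoalgData.pull h₁.pullOK) (i₂.2 _ _)).trans (i₁.2 _ _)
  · exact congrArg (fun c => CoalgData.pull h₁.pullOK (CoalgData.pull h₂.pullOK c))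
      ((hc.crossEquiv_rangeRestrict hT hH hd _).trans (hc.cross_cls a b))
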